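/- Let $f:\mathbb{R}^n\times[0,\infty)\to\mathbb{R}^n$ and $B:\mathbb{R}^n\times[0,\infty)\to\mathbb{R}^{n\times m}$ be smooth, let $b_1,\dots,b_m$ be the columns of $B$, and consider the system $\dot x=f(x,t)+B(x,t)u$. Put $A(x,u,t)=\frac{\partial f}{\partial x}+\sum_{i=1}^m\frac{\partial b_i}{\partial x}u_i$. Let $M(x,t)$ be a smooth symmetric $n\times n$ matrix function with $\alpha_1I\le M(x,t)\le\alpha_2I$ for constants $\alpha_1,\alpha_2>0$, let $\lambda>0$, and suppose that for all $t\ge0$, $x$, $u$ and $\delta\ne0$ $$\delta'MB=0\ \Longrightarrow\ \delta'\big(\dot M+A'M+MA+2\lambda M\big)\delta<0,$$ where $\dot M=\frac{\partial M}{\partial t}+\partial_{f+Bu}M$ and $\partial_v$ is the directional derivative in $x$. Let $H_i=\partial_{b_i}M+\frac{\partial b_i}{\partial x}'M+M\frac{\partial b_i}{\partial x}$ and $Q=MBB'M$, and suppose in addition that there is a continuous $\psi:\mathbb{R}^n\times\mathbb{R}^n\times[0,\infty)\to[0,\infty)$ with $|\delta'H_i(x,t)\delta|\le\psi(x,\delta,t)\,\delta'Q(x,t)\delta$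 for all $i$, $x$, $\delta$, $t$. Put $R=\sqrt{\alpha_2/\alpha_1}$. Then for every target trajectory $(x^*,u^*)$, that is, every solution on $[0,\infty)$ with piecewise continuous input $u^*$, the following hold, where $(\ast)$ is the bound $|x(t)-x^*(t)|\le R\,e^{-\lambda t}\,|x(0)-x^*(0)|$. 1. (Universal exponential open-loop controllability.) For every $x_0$ there is a piecewise continuous input $u$ whose solution with $x(0)=x_0$ exists on $[0,\infty)$ and satisfies $(\ast)$ for all $t\ge0$. 2. (Universal exponential stabilisability by sampled-data feedback with arbitrary sample times.) There is a law $\kappa(s,\xi,t)$, piecewise continuous in $t\in[s,\infty)$ for all $s\ge 0$ and $\xi\in\mathbb{R}^n$, such that for all sample times $0=\tau_0<\tau_1<\dots\to\infty$ and all $x_0$, the closed loop with $u(t)=\kappa(\tau_i,x(\tau_i),t)$ for $t\in[\tau_i,\tau_{i+1})$ has a solution on $[0,\infty)$ with $x(0)=x_0$, and every such solution satisfies $(\ast)$ for all $t\ge0$. 3. (Universal exponential stabilisability by continuous feedback defined almost everywhere, and everywhere in a neighbourhood of the target.) There are a relatively open $D\subseteq\mathbb{R}^n\times[0,\infty)$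 that contains $(x^*(t),t)$ for all $t\ge0$ and whose slice $\{x:(x,t)\in D\}$ has a complement of Lebesgue measure zero for each $t\ge 0$, and a law $u=K(x,t,u^*(t))$ with $K$ continuous on $D\times\mathbb{R}^m$, such that (a) from every $x_0$ the closed loop has a solution on $[0,\infty)$, in the sense of Filippov (for almost every $t$ the input $u(t)$ lies in the set $\bigcap_{\varepsilon>0}\overline{\mathrm{co}}\{K(y,t,u^*(t)):|y-x(t)|<\varepsilon,\ (y,t)\in D\}$, which is the single value of the law where $(x(t),t)\in D$), that satisfies $(\ast)$ for all $t\ge0$; and (b) $(\ast)$ holds on $[0,T]$ for every $T\ge 0$ and every Carathéodory solution on $[0,T]$ whose input $u(t)$, for almost every $t$, is the value of the law at $(x(t),t)$ if $(x(t),t)\in D$, and otherwise a limit of values $K(y_j,t,u^*(t))$ with $y_j\to x(t)$, $(y_j,t)\in D$. -/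

import Mathlib

open Set Filter Topology MeasureTheory
open scoped ContDiff InnerProductSpace

namespace CCM

/-- The state space `ℝⁿ` with its Euclidean norm (and likewise the input space `ℝᵐ`). -/
abbrev Vec (n : ℕ) : Type := EuclideanSpace ℝ (Fin n)

noncomputable section

/-- `F(x, t)` is a smooth function on `ℝⁿ × [0, ∞)`. -/
def Smooth {n : ℕ} {G : Type*} [NormedAddCommGroup G] [NormedSpace ℝ G]
    (F : Vec n → ℝ → G) : Prop :=
  ContDiffOn ℝ ∞ (fun p : Vec n × ℝ => F p.1 p.2) (univ ×ˢ Ici 0)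

/-- The `i`-th column `b_i(x, t)` of the input matrix. -/
def col {n m : ℕ} (B : Vec n → ℝ → Vec m →L[ℝ] Vec n) (i : Fin m) (x : Vec n) (t : ℝ) : Vec n :=
  B x t (EuclideanSpace.single i 1)

/-- The Jacobian `A(x, u, t) = ∂f/∂x + ∑ i, u_i ∂b_i/∂x` of the differential dynamics. -/
def jac {n m : ℕ} (f : Vec n → ℝ → Vec n) (B : Vec n → ℝ → Vec m →L[ℝ] Vec n)
    (x : Vec n) (u : Vec m) (t : ℝ) : Vec n →L[ℝ] Vec n :=
  fderiv ℝ (fun y => f y t) x + ∑ i, u i • fderiv ℝ (fun y => col B i y t) x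

/-- The derivative `Ṁ = ∂M/∂t + ∂_{f + B u} M` of `M` along the system
(the time derivative is one-sided at `t = 0`). -/
def metricDot {n m : ℕ} (f : Vec n → ℝ → Vec n) (B : Vec n → ℝ → Vec m →L[ℝ] Vec n)
    (M : Vec n → ℝ → Vec n →L[ℝ] Vec n) (x : Vec n) (u : Vec m) (t : ℝ) : Vec n →L[ℝ] Vec n :=
  derivWithin (fun s => M x s) (Ici 0) t + fderiv ℝ (fun y => M y t) x (f x t + B x t u)

/-- `M(x, t)` is a Riemannian metric: smooth, symmetric, with `α₁ I ≤ M ≤ α₂ I`, where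
`α₁, α₂ > 0`. -/
structure IsUniformlyBoundedMetric {n : ℕ} (M : Vec n → ℝ → Vec n →L[ℝ] Vec n)
    (α₁ α₂ : ℝ) : Prop where
  smooth : Smooth M
  symm : ∀ x t, 0 ≤ t → ∀ v w, ⟪M x t v, w⟫_ℝ = ⟪v, M x t w⟫_ℝ
  pos_lower : 0 < α₁
  pos_upper : 0 < α₂
  lower : ∀ x t, 0 ≤ t → ∀ δ, α₁ * ‖δ‖ ^ 2 ≤ ⟪δ, M x t δ⟫_ℝ
  upper : ∀ x t, 0 ≤ t → ∀ δ, ⟪δ, M x t δ⟫_ℝ ≤ α₂ * ‖δ‖ ^ 2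

/-- `δ' M B = 0 ⟹ δ' (Ṁ + A' M + M A + 2 λ M) δ < 0`, for all `t ≥ 0`, `x`, `u`, `δ ≠ 0`. -/
def ContractionCondition {n m : ℕ} (f : Vec n → ℝ → Vec n) (B : Vec n → ℝ → Vec m →L[ℝ] Vec n)
    (M : Vec n → ℝ → Vec n →L[ℝ] Vec n) (lam : ℝ) : Prop :=
  ∀ (t : ℝ), 0 ≤ t → ∀ (x : Vec n) (u : Vec m) (δ : Vec n), δ ≠ 0 →
    (∀ v : Vec m, ⟪δ, M x t (B x t v)⟫_ℝ = 0) →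
    ⟪δ, (metricDot f B M x u t + (jac f B x u t).adjoint ∘L M x t + M x t ∘L jac f B x u t
      + (2 * lam) • M x t) δ⟫_ℝ < 0

/-- `H_i = ∂_{b_i} M + (∂b_i/∂x)' M + M (∂b_i/∂x)`. -/
def hMat {n m : ℕ} (B : Vec n → ℝ → Vec m →L[ℝ] Vec n) (M : Vec n → ℝ → Vec n →L[ℝ] Vec n)
    (i : Fin m) (x : Vec n) (t : ℝ) : Vec n →L[ℝ] Vec n :=
  fderiv ℝ (fun y => M y t) x (col B i x t)
    + (fderiv ℝ (fun y => col B i y t) x).adjoint ∘L M x t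
    + M x t ∘L fderiv ℝ (fun y => col B i y t) x

/-- `Q = M B B' M`. -/
def qMat {n m : ℕ} (B : Vec n → ℝ → Vec m →L[ℝ] Vec n) (M : Vec n → ℝ → Vec n →L[ℝ] Vec n)
    (x : Vec n) (t : ℝ) : Vec n →L[ℝ] Vec n :=
  M x t ∘L B x t ∘L (B x t).adjoint ∘L M x t

/-- There is a continuous `ψ : ℝⁿ × ℝⁿ × [0, ∞) → [0, ∞)` with
`|δ' H_i δ| ≤ ψ(x, δ, t) δ' Q δ` for all `i`, `x`, `δ`, `t`. -/
def InputGrowthCondition {n m : ℕ} (B : Vec n → ℝ → Vec m →L[ℝ] Vec n)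
    (M : Vec n → ℝ → Vec n →L[ℝ] Vec n) : Prop :=
  ∃ ψ : Vec n × Vec n × ℝ → ℝ,
    ContinuousOn ψ (univ ×ˢ univ ×ˢ Ici 0) ∧
    (∀ x δ t, 0 ≤ t → 0 ≤ ψ (x, δ, t)) ∧
    ∀ (i : Fin m) (x δ : Vec n) (t : ℝ), 0 ≤ t →
      |⟪δ, hMat B M i x t δ⟫_ℝ| ≤ ψ (x, δ, t) * ⟪δ, qMat B M x t δ⟫_ℝ

/-- `u` is piecewise continuous on `[a, ∞)`: discontinuities only on a set that is finite in each
bounded interval, and finite one-sided limits everywhere. -/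
def PiecewiseContinuousFrom {m : ℕ} (a : ℝ) (u : ℝ → Vec m) : Prop :=
  (∃ S : Set ℝ, (∀ T, (S ∩ Icc a T).Finite) ∧
    ∀ t, a ≤ t → t ∉ S → ContinuousWithinAt u (Ici a) t) ∧
  (∀ t, a ≤ t → ∃ l, Tendsto u (𝓝[>] t) (𝓝 l)) ∧
  ∀ t, a < t → ∃ l, Tendsto u (𝓝[<] t) (𝓝 l)

/-- `x` solves `ẋ = f(x, t) + B(x, t) u(t)` on `[0, T]` (in the sense of Carathéodory). -/
structure IsTrajectoryOn {n m : ℕ} (f : Vec n → ℝ → Vec n) (B : Vec n → ℝ → Vec m →L[ℝ] Vec n)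
    (x : ℝ → Vec n) (u : ℝ → Vec m) (T : ℝ) : Prop where
  continuousOn : ContinuousOn x (Icc 0 T)
  integrable : IntegrableOn u (Icc 0 T)
  eq_integral : ∀ t ∈ Icc 0 T, x t = x 0 + ∫ s in (0 : ℝ)..t, (f (x s) s + B (x s) s (u s))

/-- `x` solves `ẋ = f(x, t) + B(x, t) u(t)` on `[0, ∞)`. -/
def IsTrajectory {n m : ℕ} (f : Vec n → ℝ → Vec n) (B : Vec n → ℝ → Vec m →L[ℝ] Vec n)
    (x : ℝ → Vec n) (u : ℝ → Vec m) : Prop :=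
  ∀ T, 0 ≤ T → IsTrajectoryOn f B x u T

/-- A target trajectory: a forward-complete solution with piecewise continuous input. -/
def IsTarget {n m : ℕ} (f : Vec n → ℝ → Vec n) (B : Vec n → ℝ → Vec m →L[ℝ] Vec n)
    (xs : ℝ → Vec n) (us : ℝ → Vec m) : Prop :=
  PiecewiseContinuousFrom 0 us ∧ IsTrajectory f B xs us

/-- `|x(t) - x*(t)| ≤ R e^{-λ t} |x(0) - x*(0)|` for all `t ∈ I`. -/
def ExpBoundOn {n : ℕ} (lam R : ℝ) (xs x : ℝ → Vec n) (I : Set ℝ) : Prop :=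
  ∀ t ∈ I, ‖x t - xs t‖ ≤ R * Real.exp (-lam * t) * ‖x 0 - xs 0‖

/-- Universal exponential open-loop controllability with rate `lam` and overshoot `R`. -/
def UnivExpOpenLoopControllable {n m : ℕ} (f : Vec n → ℝ → Vec n)
    (B : Vec n → ℝ → Vec m →L[ℝ] Vec n) (lam R : ℝ) : Prop :=
  ∀ xs us, IsTarget f B xs us → ∀ x₀ : Vec n, ∃ (u : ℝ → Vec m) (x : ℝ → Vec n),
    PiecewiseContinuousFrom 0 u ∧ IsTrajectory f B x u ∧ x 0 = x₀ ∧
    ExpBoundOn lam R xs x (Ici 0)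

/-- Sample times `0 = τ₀ < τ₁ < ⋯ → ∞`. -/
def IsSampling (τ : ℕ → ℝ) : Prop :=
  τ 0 = 0 ∧ StrictMono τ ∧ Tendsto τ atTop atTop

/-- `x` is a closed-loop solution under the sampled-data law
`u(t) = κ(τ_i, x(τ_i), t)` for `t ∈ [τ_i, τ_{i+1})`. -/
def IsSampledSolution {n m : ℕ} (f : Vec n → ℝ → Vec n) (B : Vec n → ℝ → Vec m →L[ℝ] Vec n)
    (κ : ℝ → Vec n → ℝ → Vec m) (τ : ℕ → ℝ) (x : ℝ → Vec n) : Prop :=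
  ∃ u : ℝ → Vec m, IsTrajectory f B x u ∧
    ∀ (i : ℕ), ∀ t ∈ Ico (τ i) (τ (i + 1)), u t = κ (τ i) (x (τ i)) t

/-- Universal exponential stabilisability by sampled-data feedback with arbitrary sample times:
each target has one law `κ` that works for all sampling sequences and all initial states. -/
def UnivExpStabSampledData {n m : ℕ} (f : Vec n → ℝ → Vec n)
    (B : Vec n → ℝ → Vec m →L[ℝ] Vec n) (lam R : ℝ) : Prop :=
  ∀ xs us, IsTarget f B xs us → ∃ κ : ℝ → Vec n → ℝ → Vec m,
    (∀ s, 0 ≤ s → ∀ ξ, PiecewiseContinuousFrom s (κ s ξ)) ∧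
    ∀ τ, IsSampling τ → ∀ x₀ : Vec n,
      (∃ x, IsSampledSolution f B κ τ x ∧ x 0 = x₀) ∧
      ∀ x, IsSampledSolution f B κ τ x → x 0 = x₀ → ExpBoundOn lam R xs x (Ici 0)

/-- The values at `(x, t)` of a feedback law with domain `D`, including its limit values
`lim k(y, t)`, `y → x`, `(y, t) ∈ D`. It is `{k(x, t)}` where `(x, t) ∈ D` and `k(·, t)` is
continuous on the slice of `D`. -/
def limitValues {n m : ℕ} (D : Set (Vec n × ℝ)) (k : Vec n → ℝ → Vec m)
    (x : Vec n) (t : ℝ) : Set (Vec m) :=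
  ⋂ ε ∈ Ioi (0 : ℝ), closure ((fun y => k y t) '' {y | y ∈ Metric.ball x ε ∧ (y, t) ∈ D})

/-- The Filippov regularisation at `(x, t)` of a feedback law with domain `D`. (When the slices
of `D` have full measure and `k(·, t)` is continuous on them, discarding further null sets changes
nothing. It is again `{k(x, t)}` where `(x, t) ∈ D`.) -/
def filippovValues {n m : ℕ} (D : Set (Vec n × ℝ)) (k : Vec n → ℝ → Vec m)
    (x : Vec n) (t : ℝ) : Set (Vec m) :=
  ⋂ ε ∈ Ioi (0 : ℝ),
    closure (convexHull ℝ ((fun y => k y t) '' {y | y ∈ Metric.ball x ε ∧ (y, t) ∈ D}))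

/-- Universal exponential stabilisability by continuous feedback defined almost everywhere, and
everywhere near the target: the law `u = K(x, t, u*(t))` is continuous on a relatively open domain
`D ⊆ ℝⁿ × [0, ∞)` that contains the target and has slices of full measure. From each initial state
there is a global closed-loop (Filippov) solution with the exponential bound, and the bound holds
for every closed-loop solution, on any interval, whose input is at almost every time a value
(off `D`, a limit value) of the law. -/
def UnivExpStabContinuousAE {n m : ℕ} (f : Vec n → ℝ → Vec n)
    (B : Vec n → ℝ → Vec m →L[ℝ] Vec n) (lam R : ℝ) : Prop :=
  ∀ xs us, IsTarget f B xs us →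
    ∃ (D : Set (Vec n × ℝ)) (K : Vec n → ℝ → Vec m → Vec m),
      (∃ O : Set (Vec n × ℝ), IsOpen O ∧ D = O ∩ (univ ×ˢ Ici 0)) ∧
      (∀ t, 0 ≤ t → (xs t, t) ∈ D) ∧
      (∀ t, 0 ≤ t → volume {x : Vec n | (x, t) ∉ D} = 0) ∧
      ContinuousOn (fun q : (Vec n × ℝ) × Vec m => K q.1.1 q.1.2 q.2) (D ×ˢ univ) ∧
      (∀ x₀ : Vec n, ∃ (x : ℝ → Vec n) (u : ℝ → Vec m), IsTrajectory f B x u ∧ x 0 = x₀ ∧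
        (∀ᵐ t ∂(volume.restrict (Ici (0 : ℝ))),
          u t ∈ filippovValues D (fun y s => K y s (us s)) (x t) t) ∧
        ExpBoundOn lam R xs x (Ici 0)) ∧
      ∀ (T : ℝ) (x : ℝ → Vec n) (u : ℝ → Vec m), 0 ≤ T → IsTrajectoryOn f B x u T →
        (∀ᵐ t ∂(volume.restrict (Icc (0 : ℝ) T)),
          u t ∈ limitValues D (fun y s => K y s (us s)) (x t) t) →
        ExpBoundOn lam R xs x (Icc 0 T)

end

end CCM

/-! The argument measures the distance from the target state to the actual state by the Riemannian
metric `M(·, t)` and builds an input under which its square decays like `e^{-2λt}`. Since this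
squared distance lies between `α₁|x - x*|²` and `α₂|x - x*|²`, the Euclidean bound with overshoot
`√(α₂/α₁)` follows (`expBoundOn_of_sqDist_le`).

Contraction. The form `δ'(Ṁ + A'M + MA + 2λM)δ` is affine in `u` with coefficients `δ'H_iδ`. A
compactness version of Finsler's lemma together with the growth condition bounds it on bounded sets
by `(ρ₀ + k|u|)|B'Mδ|² - ε|δ|²` (`contractionForm_le`). So two neighbouring trajectories contract if
their inputs differ by `-½ρB'Mδ` with `ρ ≥ ρ₀ + k|u|`. Along a geodesic from `x*` to `x` these
differences add up to an input offset, and the required `ρ` grows with the accumulated input. The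
choice `ρ = θe^{θr}` at parameter `r` resolves this: the offset is then at most `(β/2)(e^{θr} - 1)`,
and one large `θ` suffices for the whole geodesic (`le_exp_mul_of_affine_le`, `gain`). The strict
margin `ε` also pays for freezing the offset during a short time, so holding the input still gives
the exact rate `λ` (`pairForm_hold`, `exists_hold`).

Distance. Paths are replaced by chains of `N` links with energy `N ∑ |Δ|²_M`. Minimal chains satisfy
a discrete Euler-Lagrange equation and converge to integral curves of the Hamiltonian field of
`½p'M⁻¹p`. Hence chains from `b` to `x` of energy at most `e + C/N` give a cogeodesic of energy at
most `e` (`exists_expMap_of_chains`). This yields existence of minimal geodesics, local Lipschitz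
continuity and semiconcavity of the squared distance, and lets `exists_hold` work link by link: each
link contracts up to `O(N⁻³)`, hence the chain up to `O(1/N)`.

Open-loop and sampled-data control. Offsets and hold times are chosen continuously
(`exists_holdLaw`); restarting from a minimal geodesic after every hold time gives a global solution
(`IsHoldLaw.exists_solution`). The sampled-data law plays the input of that solution until the next
sample.

Continuous feedback. The law is used where the minimal covector is unique and not conjugate. Such
points form a relatively open set containing the target; its slices have full measure by
Rademacher's theorem and the null measure of critical values of the exponential map. Limit values of
the law come from minimal covectors, and at almost every time a solution driven by such values is
tangent to a held solution; this gives the decay (`IsHoldLaw.sqDist_le`). A Filippov solution is a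
limit of sampled solutions with mesh tending to zero: the derivative of the limiting accumulated
offset lies in every closed convex set containing the offsets of all minimal covectors
(`IsSampledLimit.deriv_mem`), and each such offset is a limit value because interior points of
minimal geodesics have a unique minimal covector. -/

namespace CCM

/-! ### Functions that are smooth up to the initial time -/

section SmoothHalf

variable {E G : Type*} [NormedAddCommGroup E] [NormedSpace ℝ E]
  [NormedAddCommGroup G] [NormedSpace ℝ G]

/-- `F(x, t)` is smooth on `E × [0, ∞)`. -/
def SmoothHalf (F : E → ℝ → G) : Prop :=
  ContDiffOn ℝ ∞ (fun p : E × ℝ => F p.1 p.2) (univ ×ˢ Ici 0)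

theorem uniqueDiffOn_half : UniqueDiffOn ℝ ((univ : Set E) ×ˢ Ici (0 : ℝ)) :=
  uniqueDiffOn_univ.prod (uniqueDiffOn_Ici 0)

theorem SmoothHalf.differentiableOn {F : E → ℝ → G} (hF : SmoothHalf F) :
    DifferentiableOn ℝ (fun p : E × ℝ => F p.1 p.2) (univ ×ˢ Ici 0) :=
  ContDiffOn.differentiableOn hF (by simp)

/-- A slice of constant time lies inside the half-space, so the spatial derivative is two-sided even
at time zero; only the time derivative is one-sided there. -/
theorem SmoothHalf.hasFDerivAt_joint {F : E → ℝ → G} (hF : SmoothHalf F) (x : E) {t : ℝ}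
    (ht : 0 ≤ t) : HasFDerivAt (fun y => F y t)
      ((fderivWithin ℝ (fun p : E × ℝ => F p.1 p.2) (univ ×ˢ Ici 0) (x, t)).comp
        (ContinuousLinearMap.inl ℝ E ℝ)) x := by
  have h := (hF.differentiableOn (x, t) ⟨mem_univ _, ht⟩).hasFDerivWithinAt
  have h2 : HasFDerivAt (fun y : E => (y, t)) (ContinuousLinearMap.inl ℝ E ℝ) x :=
    hasFDerivAt_prodMk_left x t
  exact HasFDerivWithinAt.comp_hasFDerivAt (f := fun y : E => (y, t)) x h h2
    (Eventually.of_forall fun y => mk_mem_prod (mem_univ y) ht)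

theorem SmoothHalf.hasDerivWithinAt_joint {F : E → ℝ → G} (hF : SmoothHalf F) (x : E) {t : ℝ}
    (ht : 0 ≤ t) : HasDerivWithinAt (fun s => F x s)
      (fderivWithin ℝ (fun p : E × ℝ => F p.1 p.2) (univ ×ˢ Ici 0) (x, t) (0, 1)) (Ici 0) t := by
  have h := (hF.differentiableOn (x, t) ⟨mem_univ _, ht⟩).hasFDerivWithinAt
  have h2 : HasDerivWithinAt (fun s : ℝ => (x, s)) ((0 : E), (1 : ℝ)) (Ici 0) t :=
    (hasDerivWithinAt_const t (Ici 0) x).prodMk (hasDerivWithinAt_id t (Ici 0))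
  exact h.comp_hasDerivWithinAt t h2 (fun s hs => ⟨mem_univ _, hs⟩)

theorem SmoothHalf.hasFDerivAt {F : E → ℝ → G} (hF : SmoothHalf F) (x : E) {t : ℝ}
    (ht : 0 ≤ t) : HasFDerivAt (fun y => F y t) (fderiv ℝ (fun y => F y t) x) x :=
  (hF.hasFDerivAt_joint x ht).differentiableAt.hasFDerivAt

theorem SmoothHalf.fderiv {F : E → ℝ → G} (hF : SmoothHalf F) :
    SmoothHalf (fun x t => fderiv ℝ (fun y => F y t) x) := by
  have h1 : ContDiffOn ℝ ∞ (fderivWithin ℝ (fun p : E × ℝ => F p.1 p.2) (univ ×ˢ Ici 0))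
      (univ ×ˢ Ici 0) := ContDiffOn.fderivWithin hF uniqueDiffOn_half (by simp)
  have h2 := h1.clm_comp (contDiffOn_const (c := ContinuousLinearMap.inl ℝ E ℝ))
  refine ContDiffOn.congr h2 ?_
  rintro ⟨x, t⟩ ⟨-, ht⟩
  exact (hF.hasFDerivAt_joint x ht).fderiv

theorem SmoothHalf.derivWithin {F : E → ℝ → G} (hF : SmoothHalf F) :
    SmoothHalf (fun x t => derivWithin (fun s => F x s) (Ici 0) t) := by
  have h1 : ContDiffOn ℝ ∞ (fderivWithin ℝ (fun p : E × ℝ => F p.1 p.2) (univ ×ˢ Ici 0))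
      (univ ×ˢ Ici 0) := ContDiffOn.fderivWithin hF uniqueDiffOn_half (by simp)
  have h2 := h1.clm_apply (contDiffOn_const (c := ((0 : E), (1 : ℝ))))
  refine ContDiffOn.congr h2 ?_
  rintro ⟨x, t⟩ ⟨-, ht⟩
  exact (hF.hasDerivWithinAt_joint x ht).derivWithin (uniqueDiffOn_Ici 0 t ht)

/-- The chain rule along a curve at a positive time. -/
theorem SmoothHalf.hasDerivAt_comp {F : E → ℝ → G} (hF : SmoothHalf F) {y : ℝ → E} {y' : E}
    {t : ℝ} (ht : 0 < t) (hy : HasDerivAt y y' t) :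
    HasDerivAt (fun s => F (y s) s)
      (_root_.fderiv ℝ (fun x => F x t) (y t) y' +
        _root_.derivWithin (fun s => F (y t) s) (Ici 0) t) t := by
  have h := (hF.differentiableOn (y t, t) ⟨mem_univ _, ht.le⟩).hasFDerivWithinAt
  have h2 : HasDerivAt (fun s : ℝ => (y s, s)) (y', (1 : ℝ)) t := hy.prodMk (hasDerivAt_id t)
  have h3 := (h.hasFDerivAt (prod_mem_nhds univ_mem (Ici_mem_nhds ht)))
  have h4 := HasFDerivAt.comp_hasDerivAt (f := fun s => (y s, s)) t h3 h2
  refine h4.congr_deriv ?_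
  rw [(hF.hasFDerivAt_joint (y t) ht.le).fderiv,
    (hF.hasDerivWithinAt_joint (y t) ht.le).derivWithin (uniqueDiffOn_Ici 0 t ht.le)]
  simp only [ContinuousLinearMap.comp_apply, ContinuousLinearMap.inl_apply, ← map_add]
  simp

theorem SmoothHalf.continuousOn {F : E → ℝ → G} (hF : SmoothHalf F) :
    ContinuousOn (fun p : E × ℝ => F p.1 p.2) (univ ×ˢ Ici 0) := ContDiffOn.continuousOn hF

theorem SmoothHalf.continuousOn_comp {F : E → ℝ → G} (hF : SmoothHalf F) {y : ℝ → E} {s : Set ℝ}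
    (hy : ContinuousOn y s) (hs : ∀ t ∈ s, 0 ≤ t) : ContinuousOn (fun t => F (y t) t) s :=
  hF.continuousOn.comp (hy.prodMk continuousOn_id) (fun t ht => ⟨mem_univ _, hs t ht⟩)

theorem SmoothHalf.continuous_slice {F : E → ℝ → G} (hF : SmoothHalf F) {t : ℝ} (ht : 0 ≤ t) :
    Continuous (fun x => F x t) :=
  continuous_iff_continuousAt.2 fun x => (hF.hasFDerivAt x ht).continuousAt

/-- A smooth function is bounded and Lipschitz on bounded sets. -/
theorem SmoothHalf.bounded_lipschitz [FiniteDimensional ℝ E] {F : E → ℝ → G} (hF : SmoothHalf F)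
    (R : ℝ) : ∃ C, 0 < C ∧ ∀ x y t s, ‖x‖ ≤ R → ‖y‖ ≤ R → 0 ≤ t → t ≤ R → 0 ≤ s → s ≤ R →
      ‖F x t‖ ≤ C ∧ ‖F x t - F y s‖ ≤ C * (‖x - y‖ + |t - s|) := by
  have hK : IsCompact (Metric.closedBall (0 : E) R ×ˢ Icc (0 : ℝ) R) :=
    (isCompact_closedBall 0 R).prod isCompact_Icc
  have hsub : Metric.closedBall (0 : E) R ×ˢ Icc (0 : ℝ) R ⊆ univ ×ˢ Ici 0 :=
    prod_mono (subset_univ _) Icc_subset_Ici_self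
  obtain ⟨C1, h1⟩ := hK.exists_bound_of_continuousOn (hF.continuousOn.mono hsub)
  obtain ⟨C2, h2⟩ := (ContDiffOn.mono hF hsub).exists_lipschitzOnWith (by simp)
    ((convex_closedBall _ _).prod (convex_Icc _ _)) hK
  refine ⟨|C1| + C2 + 1, by positivity, fun x y t s hx hy ht htR hs hsR => ?_⟩
  have hxm : (x, t) ∈ Metric.closedBall (0 : E) R ×ˢ Icc (0 : ℝ) R := ⟨by simpa using hx, ht, htR⟩
  have hym : (y, s) ∈ Metric.closedBall (0 : E) R ×ˢ Icc (0 : ℝ) R := ⟨by simpa using hy, hs, hsR⟩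
  constructor
  · have := h1 _ hxm
    have := le_abs_self C1
    have := C2.2
    simp only [NNReal.val_eq_coe] at this
    linarith
  · have h := h2.dist_le_mul _ hxm _ hym
    rw [dist_eq_norm, dist_eq_norm] at h
    refine h.trans ?_
    have h3 : ‖(x, t) - (y, s)‖ ≤ ‖x - y‖ + |t - s| := by
      rw [Prod.mk_sub_mk, Prod.norm_mk, Real.norm_eq_abs]
      exact max_le (by linarith [abs_nonneg (t - s)]) (by linarith [norm_nonneg (x - y)])
    have h4 : (C2 : ℝ) ≤ |C1| + C2 + 1 := by linarith [abs_nonneg C1]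
    exact mul_le_mul h4 h3 (norm_nonneg _) (by positivity)

/-- First order Taylor expansion in space with a uniform quadratic remainder on bounded sets. -/
theorem SmoothHalf.taylor [FiniteDimensional ℝ E] {F : E → ℝ → G} (hF : SmoothHalf F)
    (R : ℝ) : ∃ C, 0 < C ∧ ∀ x y t, ‖x‖ ≤ R → ‖y‖ ≤ R → 0 ≤ t → t ≤ R →
      ‖F y t - F x t - _root_.fderiv ℝ (fun z => F z t) x (y - x)‖ ≤ C * ‖y - x‖ ^ 2 := by
  obtain ⟨C, hC, h⟩ := hF.fderiv.bounded_lipschitz R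
  refine ⟨C, hC, fun x y t hx hy ht htR => ?_⟩
  have hseg : ∀ z ∈ segment ℝ x y, ‖z‖ ≤ R ∧ ‖z - x‖ ≤ ‖y - x‖ := by
    intro z hz
    constructor
    · have := (convex_closedBall (0 : E) R).segment_subset (x := x) (y := y)
        (by simpa using hx) (by simpa using hy) hz
      simpa using this
    · obtain ⟨a, b, ha, hb, hab, rfl⟩ := hz
      have : a • x + b • y - x = b • (y - x) := by
        rw [← eq_sub_iff_add_eq] at hab; subst hab; module
      rw [this, norm_smul, Real.norm_of_nonneg hb]
      exact mul_le_of_le_one_left (norm_nonneg _) (by linarith)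
  have := (convex_segment x y).norm_image_sub_le_of_norm_hasFDerivWithin_le'
    (f := fun z => F z t) (f' := fun z => _root_.fderiv ℝ (fun w => F w t) z)
    (φ := _root_.fderiv ℝ (fun w => F w t) x) (C := C * ‖y - x‖)
    (fun z hz => (hF.hasFDerivAt z ht).hasFDerivWithinAt)
    (fun z hz => by
      refine ((h z x t t (hseg z hz).1 hx ht htR ht htR).2).trans ?_
      simp only [sub_self, abs_zero, add_zero]
      exact mul_le_mul_of_nonneg_left (hseg z hz).2 hC.le)
    (left_mem_segment ℝ x y) (right_mem_segment ℝ x y)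
  refine this.trans (le_of_eq (by ring))

end SmoothHalf

/-! ### Grönwall and decay estimates -/

/-- The function `φ` is only continuous, so the differential Grönwall inequality is applied to its
majorant `A + L∫φ`, which has a right derivative. -/
theorem gronwall_integral {φ : ℝ → ℝ} {a b A L : ℝ} (hL : 0 ≤ L)
    (hφ : ContinuousOn φ (Icc a b)) (h : ∀ t ∈ Icc a b, φ t ≤ A + L * ∫ s in a..t, φ s) :
    ∀ t ∈ Icc a b, φ t ≤ A * Real.exp (L * (t - a)) := by
  intro t ht
  have hab : a ≤ b := ht.1.trans ht.2
  have hint : ∀ c ∈ Icc a b, IntervalIntegrable φ volume a c := fun c hc =>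
    (hφ.mono (by rw [uIcc_of_le hc.1]; exact Icc_subset_Icc_right hc.2)).intervalIntegrable
  have hder : ∀ s ∈ Ico a b, HasDerivWithinAt (fun t => A + L * ∫ s in a..t, φ s) (L * φ s)
      (Ici s) s := by
    intro s hs
    refine HasDerivWithinAt.const_add _ (HasDerivWithinAt.const_mul _ ?_)
    refine intervalIntegral.integral_hasDerivWithinAt_right (hint s ⟨hs.1, hs.2.le⟩)
      (t := Ioi s) ?_ ?_
    · refine ⟨Icc a b, ?_, hφ.aestronglyMeasurable measurableSet_Icc⟩
      exact mem_of_superset (Ioo_mem_nhdsGT hs.2)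
        (fun x hx => ⟨hs.1.trans hx.1.le, hx.2.le⟩)
    · refine ((hφ s ⟨hs.1, hs.2.le⟩).mono_of_mem_nhdsWithin ?_)
      exact mem_of_superset (Ioo_mem_nhdsGT hs.2)
        (fun x hx => ⟨hs.1.trans hx.1.le, hx.2.le⟩)
  have hcont : ContinuousOn (fun t => A + L * ∫ s in a..t, φ s) (Icc a b) := by
    refine continuousOn_const.add (continuousOn_const.mul ?_)
    have := intervalIntegral.continuousOn_primitive_interval
      (f := φ) (μ := volume) (a := a) (b := b) (by
        rw [uIcc_of_le hab]; exact hφ.integrableOn_Icc)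
    rwa [uIcc_of_le hab] at this
  have key := le_gronwallBound_of_liminf_deriv_right_le (f := fun t => A + L * ∫ s in a..t, φ s)
    (f' := fun s => L * φ s) (δ := A) (K := L) (ε := 0) hcont
    (fun s hs r hr => ((hder s hs).liminf_right_slope_le hr))
    (by simp)
    (fun s hs => by
      have := mul_le_mul_of_nonneg_left (h s ⟨hs.1, hs.2.le⟩) hL
      simpa using this) t ht
  rw [gronwallBound_ε0] at key
  exact (h t ht).trans key

/-- A Lipschitz function with `g' ≤ -c g` almost everywhere decays exponentially. -/
theorem exp_decay_of_ae_deriv {g : ℝ → ℝ} {a b c : ℝ} {K : NNReal} (hab : a ≤ b)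
    (hg : LipschitzOnWith K g (Icc a b))
    (hd : ∀ᵐ t, t ∈ Ioo a b → ∀ d, HasDerivAt g d t → d ≤ -c * g t) :
    g b ≤ Real.exp (-c * (b - a)) * g a := by
  -- Lipschitz functions are absolutely continuous, so the product `e^{c(t-a)} g` is the integral of
  -- its almost everywhere derivative, which is nonpositive.
  have hac : AbsolutelyContinuousOnInterval g a b :=
    LipschitzOnWith.absolutelyContinuousOnInterval (by rwa [uIcc_of_le hab])
  have hexp : ContDiff ℝ 1 (fun t : ℝ => Real.exp (c * (t - a))) := by fun_prop
  obtain ⟨K', hK'⟩ := hexp.contDiffOn.exists_lipschitzOnWith (s := Icc a b) (by simp)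
    (convex_Icc a b) isCompact_Icc
  have hac2 : AbsolutelyContinuousOnInterval (fun t : ℝ => Real.exp (c * (t - a))) a b :=
    LipschitzOnWith.absolutelyContinuousOnInterval (by rwa [uIcc_of_le hab])
  have hac3 := hac2.mul hac
  have h1 := hac3.integral_deriv_eq_sub
  have h2 : ∫ x in a..b, deriv ((fun t : ℝ => Real.exp (c * (t - a))) * g) x ≤ 0 := by
    rw [intervalIntegral.integral_of_le hab, integral_Ioc_eq_integral_Ioo]
    refine integral_nonpos_of_ae ?_
    have hdiff := hac.ae_differentiableAt
    rw [Filter.EventuallyLE, ae_restrict_iff' measurableSet_Ioo]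
    filter_upwards [hd, hdiff] with t h3 h4 ht
    have h5 : DifferentiableAt ℝ g t := h4 (by
      rw [uIcc_of_le hab]; exact Ioo_subset_Icc_self ht)
    have h6 : HasDerivAt (fun t : ℝ => Real.exp (c * (t - a))) (Real.exp (c * (t - a)) * c) t := by
      simpa using (((hasDerivAt_id t).sub_const a).const_mul c).exp
    have h7 := h3 ht _ h5.hasDerivAt
    rw [(h6.mul h5.hasDerivAt).deriv]
    have h8 := Real.exp_pos (c * (t - a))
    simp only [Pi.zero_apply]
    nlinarith
  rw [h1] at h2
  simp only [Pi.mul_apply, sub_self, mul_zero, Real.exp_zero, one_mul] at h2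
  have h3 : Real.exp (-c * (b - a)) * Real.exp (c * (b - a)) = 1 := by
    rw [← Real.exp_add]; simp
  have h4 := Real.exp_pos (-c * (b - a))
  calc g b = Real.exp (-c * (b - a)) * (Real.exp (c * (b - a)) * g b) := by
        rw [← mul_assoc, h3, one_mul]
    _ ≤ _ := mul_le_mul_of_nonneg_left (by linarith) h4.le

/-- Existence for Carathéodory equations with a globally Lipschitz right-hand side. -/
theorem caratheodory_exists {E : Type*} [NormedAddCommGroup E] [NormedSpace ℝ E] [CompleteSpace E]
    (g : ℝ → E → E) {a b L : ℝ} (hab : a ≤ b) (hL : 0 ≤ L)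
    (hlip : ∀ s ∈ Icc a b, ∀ x y, ‖g s x - g s y‖ ≤ L * ‖x - y‖)
    (hint : ∀ y : ℝ → E, Continuous y → IntegrableOn (fun s => g s (y s)) (Icc a b)) (x₀ : E) :
    ∃ x : ℝ → E, Continuous x ∧ ∀ t ∈ Icc a b, x t = x₀ + ∫ s in a..t, g s (x s) := by
  set ℓ := L + 1 with hℓ
  have hℓ0 : 0 < ℓ := by positivity
  -- The unknown is `z(s) = e^{-2ℓ(s-a)} x(s)`. With this weight the Picard operator is a
  -- contraction with factor 1/2 on all of `[a, b]`, so no subdivision of the interval is needed.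
  -- Taking `ℓ = L + 1` keeps the weight positive when `L = 0`.
  let ext : C(Icc a b, E) → ℝ → E := fun z s =>
    Real.exp (2 * ℓ * (s - a)) • z (projIcc a b hab s)
  have hext : ∀ z, Continuous (ext z) := fun z => by
    exact (by fun_prop : Continuous fun s : ℝ => Real.exp (2 * ℓ * (s - a))).smul
      (z.continuous.comp continuous_projIcc)
  have hii : ∀ z, ∀ c ∈ Icc a b, ∀ d ∈ Icc a b,
      IntervalIntegrable (fun s => g s (ext z s)) volume c d := by
    intro z c hc d hd
    exact IntegrableOn.intervalIntegrable ((hint _ (hext z)).mono_set (uIcc_subset_Icc hc hd))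
  have hPc : ∀ z, Continuous (fun t : Icc a b => Real.exp (-(2 * ℓ * ((t : ℝ) - a))) •
      (x₀ + ∫ s in a..(t : ℝ), g s (ext z s))) := fun z => by
    have h1 : ContinuousOn (fun t => ∫ s in a..t, g s (ext z s)) (Icc a b) := by
      have := intervalIntegral.continuousOn_primitive_interval
        (f := fun s => g s (ext z s)) (μ := volume) (a := a) (b := b) (by
          rw [uIcc_of_le hab]; exact hint _ (hext z))
      rwa [uIcc_of_le hab] at this
    exact (ContinuousOn.smul (by fun_prop : ContinuousOn (fun t : ℝ =>
      Real.exp (-(2 * ℓ * (t - a)))) (Icc a b)) (continuousOn_const.add h1)).domRestrict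
  let P : C(Icc a b, E) → C(Icc a b, E) := fun z => ⟨_, hPc z⟩
  have hP : ∀ z t (ht : t ∈ Icc a b), P z ⟨t, ht⟩ = Real.exp (-(2 * ℓ * (t - a))) •
      (x₀ + ∫ s in a..t, g s (ext z s)) := fun _ _ _ => rfl
  have hcontr : ContractingWith (1 / 2) P := by
    refine ⟨by norm_num, LipschitzWith.of_dist_le_mul fun z w => ?_⟩
    rw [ContinuousMap.dist_le (by positivity)]
    rintro ⟨t, ht⟩
    have ha : a ∈ Icc a b := ⟨le_rfl, hab⟩
    have e1 : P z ⟨t, ht⟩ - P w ⟨t, ht⟩ = Real.exp (-(2 * ℓ * (t - a))) •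
        ∫ s in a..t, (g s (ext z s) - g s (ext w s)) := by
      rw [intervalIntegral.integral_sub (hii z a ha t ht) (hii w a ha t ht)]
      rw [hP, hP]
      module
    have e2 : ‖∫ s in a..t, (g s (ext z s) - g s (ext w s))‖ ≤
        ∫ s in a..t, ℓ * Real.exp (2 * ℓ * (s - a)) * dist z w := by
      refine intervalIntegral.norm_integral_le_of_norm_le ht.1 (ae_of_all _ fun s hs => ?_)
        (Continuous.intervalIntegrable (by fun_prop) _ _)
      have hs' : s ∈ Icc a b := ⟨hs.1.le, hs.2.trans ht.2⟩
      refine (hlip s hs' _ _).trans ?_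
      have : ext z s - ext w s = Real.exp (2 * ℓ * (s - a)) •
          (z (projIcc a b hab s) - w (projIcc a b hab s)) := by simp only [ext, smul_sub]
      rw [this, norm_smul, Real.norm_of_nonneg (Real.exp_pos _).le, ← dist_eq_norm]
      have h1 := ContinuousMap.dist_apply_le_dist (f := z) (g := w) (projIcc a b hab s)
      have h2 := Real.exp_pos (2 * ℓ * (s - a))
      calc L * (Real.exp (2 * ℓ * (s - a)) * _) ≤ ℓ * (Real.exp (2 * ℓ * (s - a)) * dist z w) :=
            mul_le_mul (by linarith) (mul_le_mul_of_nonneg_left h1 h2.le) (by positivity) hℓ0.le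
        _ = ℓ * Real.exp (2 * ℓ * (s - a)) * dist z w := by ring
    have e3 : ∫ s in a..t, ℓ * Real.exp (2 * ℓ * (s - a)) * dist z w =
        (Real.exp (2 * ℓ * (t - a)) - 1) / 2 * dist z w := by
      have : ∀ s ∈ uIcc a t, HasDerivAt (fun s => Real.exp (2 * ℓ * (s - a)) / 2 * dist z w)
          (ℓ * Real.exp (2 * ℓ * (s - a)) * dist z w) s := by
        intro s _
        have := (((((hasDerivAt_id s).sub_const a).const_mul (2 * ℓ)).exp).div_const 2).mul_const
          (dist z w)
        refine this.congr_deriv ?_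
        simp only [id]; ring
      rw [intervalIntegral.integral_eq_sub_of_hasDerivAt this
        (Continuous.intervalIntegrable (by fun_prop) _ _)]
      simp
      ring
    rw [dist_eq_norm, e1, norm_smul, Real.norm_of_nonneg (Real.exp_pos _).le]
    calc Real.exp (-(2 * ℓ * (t - a))) * ‖∫ s in a..t, (g s (ext z s) - g s (ext w s))‖
        ≤ Real.exp (-(2 * ℓ * (t - a))) * ((Real.exp (2 * ℓ * (t - a)) - 1) / 2 * dist z w) := by
          rw [← e3]; gcongr
      _ ≤ Real.exp (-(2 * ℓ * (t - a))) * (Real.exp (2 * ℓ * (t - a)) / 2 * dist z w) := by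
          gcongr
          linarith
      _ = (Real.exp (-(2 * ℓ * (t - a))) * Real.exp (2 * ℓ * (t - a))) * (dist z w / 2) := by ring
      _ = _ := by
          rw [← Real.exp_add, neg_add_cancel, Real.exp_zero]
          simp; ring
  have : Nonempty C(Icc a b, E) := ⟨0⟩
  have hfix := hcontr.fixedPoint_isFixedPt
  set z := ContractingWith.fixedPoint P hcontr with hz
  refine ⟨ext z, hext z, fun t ht => ?_⟩
  have h1 : z ⟨t, ht⟩ = P z ⟨t, ht⟩ := by
    conv_lhs => rw [← hfix.eq]
  have h2 : ext z t = Real.exp (2 * ℓ * (t - a)) • z ⟨t, ht⟩ := by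
    simp only [ext, projIcc_of_mem hab ht]
  rw [h2, h1, hP, smul_smul, ← Real.exp_add]
  simp

end CCM

/-! ### Cutting off vector fields; the Hamiltonian of the metric. -/

namespace CCM

/-- A vector field cut off outside a ball. -/
noncomputable def cutoff {E : Type*} [NormedAddCommGroup E] (R : ℝ) (x : E) : ℝ :=
  max (min (R + 1 - ‖x‖) 1) 0

section Cutoff

variable {E G : Type*} [NormedAddCommGroup E] [NormedAddCommGroup G] [NormedSpace ℝ G]

theorem cutoff_nonneg (R : ℝ) (x : E) : 0 ≤ cutoff R x := le_max_right _ _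

theorem cutoff_le_one (R : ℝ) (x : E) : cutoff R x ≤ 1 :=
  max_le (min_le_right _ _) zero_le_one

theorem cutoff_eq_one {R : ℝ} {x : E} (h : ‖x‖ ≤ R) : cutoff R x = 1 := by
  unfold cutoff
  rw [min_eq_right (by linarith), max_eq_left zero_le_one]

theorem cutoff_eq_zero {R : ℝ} {x : E} (h : R + 1 ≤ ‖x‖) : cutoff R x = 0 := by
  unfold cutoff
  exact max_eq_right ((min_le_left _ _).trans (by linarith))

theorem continuous_cutoff (R : ℝ) : Continuous (cutoff R : E → ℝ) := by
  unfold cutoff; fun_prop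

theorem abs_cutoff_sub_le (R : ℝ) (x y : E) : |cutoff R x - cutoff R y| ≤ ‖x - y‖ := by
  unfold cutoff
  refine (abs_max_sub_max_le_abs _ _ _).trans ((abs_inf_sub_inf_le_abs _ _ _).trans ?_)
  have : R + 1 - ‖x‖ - (R + 1 - ‖y‖) = ‖y‖ - ‖x‖ := by ring
  rw [this, norm_sub_rev]
  exact abs_norm_sub_norm_le y x

/-- By symmetry one of the points may be taken in the ball of radius `R + 1`. The splitting then
compares values of `F` only when both points are in that ball; otherwise the factor in front
vanishes. This turns locally Lipschitz fields into globally Lipschitz ones to which Picard iteration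
applies. -/
theorem cutoff_smul_lipschitz {F : E → G} {R C : ℝ}
    (hF : ∀ x y, ‖x‖ ≤ R + 1 → ‖y‖ ≤ R + 1 → ‖F x‖ ≤ C ∧ ‖F x - F y‖ ≤ C * ‖x - y‖) (hC : 0 ≤ C)
    (x y : E) : ‖cutoff R x • F x - cutoff R y • F y‖ ≤ 2 * C * ‖x - y‖ := by
  have key : ∀ x y : E, ‖x‖ ≤ R + 1 →
      ‖cutoff R x • F x - cutoff R y • F y‖ ≤ 2 * C * ‖x - y‖ := by
    intro x y hx
    have h1 : |cutoff R x - cutoff R y| * ‖F x‖ ≤ C * ‖x - y‖ := by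
      rw [mul_comm]
      exact mul_le_mul (hF x x hx hx).1 (abs_cutoff_sub_le R x y) (abs_nonneg _) hC
    have h2 : ‖cutoff R y • (F x - F y)‖ ≤ C * ‖x - y‖ := by
      by_cases hy : ‖y‖ ≤ R + 1
      · rw [norm_smul, Real.norm_of_nonneg (cutoff_nonneg R y)]
        exact (mul_le_of_le_one_left (norm_nonneg _) (cutoff_le_one R y)).trans (hF x y hx hy).2
      · rw [cutoff_eq_zero (not_le.1 hy).le]
        simp only [zero_smul, norm_zero]
        positivity
    have h3 : cutoff R x • F x - cutoff R y • F y =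
        (cutoff R x - cutoff R y) • F x + cutoff R y • (F x - F y) := by module
    rw [h3]
    refine (norm_add_le _ _).trans ?_
    rw [norm_smul, Real.norm_eq_abs]
    linarith
  by_cases hx : ‖x‖ ≤ R + 1
  · exact key x y hx
  by_cases hy : ‖y‖ ≤ R + 1
  · rw [norm_sub_rev, norm_sub_rev x]
    exact key y x hy
  · rw [cutoff_eq_zero (not_le.1 hx).le, cutoff_eq_zero (not_le.1 hy).le]
    simp only [zero_smul, sub_self, norm_zero]
    positivity

end Cutoff

/-! ### The Hamiltonian of a metric -/

noncomputable section

variable {n : ℕ} {M : Vec n → ℝ → Vec n →L[ℝ] Vec n} {α₁ α₂ : ℝ}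

/-- The inverse (dual) metric. -/
def dualMetric (M : Vec n → ℝ → Vec n →L[ℝ] Vec n) (x : Vec n) (t : ℝ) : Vec n →L[ℝ] Vec n :=
  (M x t).inverse

theorem IsUniformlyBoundedMetric.isInvertible (hM : IsUniformlyBoundedMetric M α₁ α₂) (x : Vec n)
    {t : ℝ} (ht : 0 ≤ t) : (M x t).IsInvertible := by
  have hinj : Function.Injective (M x t : Vec n →ₗ[ℝ] Vec n) := by
    rw [← LinearMap.ker_eq_bot, LinearMap.ker_eq_bot']
    intro v hv
    have h := hM.lower x t ht v
    have hv' : M x t v = 0 := hv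
    rw [hv', inner_zero_right] at h
    have := hM.pos_lower
    have h2 : ‖v‖ ^ 2 ≤ 0 := by
      by_contra h3
      push Not at h3
      have := mul_pos this h3
      linarith
    have h3 : ‖v‖ = 0 := by nlinarith [norm_nonneg v]
    exact norm_eq_zero.1 h3
  refine ⟨(LinearEquiv.ofInjectiveEndo _ hinj).toContinuousLinearEquiv, ?_⟩
  ext v
  rfl

theorem metric_dualMetric (hM : IsUniformlyBoundedMetric M α₁ α₂) (x : Vec n)
    {t : ℝ} (ht : 0 ≤ t) (p : Vec n) : M x t (dualMetric M x t p) = p :=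
  (hM.isInvertible x ht).self_apply_inverse p

theorem dualMetric_metric (hM : IsUniformlyBoundedMetric M α₁ α₂) (x : Vec n)
    {t : ℝ} (ht : 0 ≤ t) (v : Vec n) : dualMetric M x t (M x t v) = v :=
  (hM.isInvertible x ht).inverse_apply_self v

theorem dualMetric_symm (hM : IsUniformlyBoundedMetric M α₁ α₂) (x : Vec n)
    {t : ℝ} (ht : 0 ≤ t) (p q : Vec n) :
    ⟪dualMetric M x t p, q⟫_ℝ = ⟪p, dualMetric M x t q⟫_ℝ := by
  conv_lhs => rw [← metric_dualMetric hM x ht q]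
  conv_rhs => rw [← metric_dualMetric hM x ht p]
  rw [hM.symm x t ht]

theorem smoothHalf_dualMetric (hM : IsUniformlyBoundedMetric M α₁ α₂) :
    SmoothHalf (dualMetric M) := by
  rintro ⟨x, t⟩ ⟨-, ht⟩
  have h := (hM.isInvertible x ht).contDiffAt_map_inverse (n := ∞)
  exact h.comp_contDiffWithinAt (x, t) (hM.smooth (x, t) ⟨mem_univ _, ht⟩)

/-- The kinetic energy `p' M⁻¹ p` of the phase point `(x, p)`. -/
def energy (M : Vec n → ℝ → Vec n →L[ℝ] Vec n) (Y : Vec n × Vec n) (t : ℝ) : ℝ :=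
  ⟪Y.2, dualMetric M Y.1 t Y.2⟫_ℝ

theorem norm_dualMetric_le (hM : IsUniformlyBoundedMetric M α₁ α₂) (x : Vec n)
    {t : ℝ} (ht : 0 ≤ t) (p : Vec n) : ‖dualMetric M x t p‖ ≤ ‖p‖ / α₁ := by
  have h := hM.lower x t ht (dualMetric M x t p)
  rw [metric_dualMetric hM x ht] at h
  have h2 := real_inner_le_norm (dualMetric M x t p) p
  have hα := hM.pos_lower
  rw [le_div_iff₀ hα]
  by_contra h3
  push Not at h3
  have h4 : 0 < ‖dualMetric M x t p‖ := by
    by_contra h5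
    have : ‖dualMetric M x t p‖ = 0 := le_antisymm (not_lt.1 h5) (norm_nonneg _)
    rw [this] at h3
    linarith [norm_nonneg p, zero_mul α₁]
  nlinarith

theorem energy_le (hM : IsUniformlyBoundedMetric M α₁ α₂) (Y : Vec n × Vec n)
    {t : ℝ} (ht : 0 ≤ t) : energy M Y t ≤ ‖Y.2‖ ^ 2 / α₁ := by
  refine (real_inner_le_norm _ _).trans ?_
  have := mul_le_mul_of_nonneg_left (norm_dualMetric_le hM Y.1 ht Y.2) (norm_nonneg Y.2)
  refine this.trans (le_of_eq (by ring))

theorem le_energy (hM : IsUniformlyBoundedMetric M α₁ α₂) (Y : Vec n × Vec n)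
    {t : ℝ} (ht : 0 ≤ t) : ‖Y.2‖ ^ 2 / α₂ ≤ energy M Y t := by
  obtain ⟨x, p⟩ := Y
  simp only [energy]
  set v := dualMetric M x t p with hv
  have hp : M x t v = p := metric_dualMetric hM x ht p
  have hα := hM.pos_upper
  -- Completing the square: expanding the form at `p/α₂ - M⁻¹p` and using `M ≤ α₂` gives the lower
  -- bound for `p'M⁻¹p`.
  have h0 : 0 ≤ ⟪(1 / α₂) • p - v, M x t ((1 / α₂) • p - v)⟫_ℝ :=
    le_trans (by have := hM.pos_lower; positivity) (hM.lower x t ht _)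
  have h1 := hM.upper x t ht p
  have h2 : ⟪v, M x t p⟫_ℝ = ‖p‖ ^ 2 := by
    rw [← hM.symm x t ht, hp, real_inner_self_eq_norm_sq]
  rw [map_sub, map_smul, hp, inner_sub_left, inner_sub_right, inner_sub_right, inner_smul_left,
    inner_smul_left, inner_smul_right, inner_smul_right, h2, real_inner_self_eq_norm_sq,
    real_inner_comm] at h0
  simp only [conj_trivial] at h0
  have h3 : 1 / α₂ * (1 / α₂ * ⟪M x t p, p⟫_ℝ) ≤ 1 / α₂ * ‖p‖ ^ 2 := by
    rw [real_inner_comm]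
    have : 1 / α₂ * ⟪p, M x t p⟫_ℝ ≤ ‖p‖ ^ 2 := by
      rw [one_div, inv_mul_le_iff₀ hα]; exact h1
    exact mul_le_mul_of_nonneg_left this (by positivity)
  rw [real_inner_comm v p]
  have : ‖p‖ ^ 2 / α₂ = 1 / α₂ * ‖p‖ ^ 2 := by ring
  linarith

theorem energy_nonneg (hM : IsUniformlyBoundedMetric M α₁ α₂) (Y : Vec n × Vec n)
    {t : ℝ} (ht : 0 ≤ t) : 0 ≤ energy M Y t :=
  le_trans (by have := hM.pos_upper; positivity) (le_energy hM Y ht)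

theorem norm_metric_le (hM : IsUniformlyBoundedMetric M α₁ α₂) (x : Vec n)
    {t : ℝ} (ht : 0 ≤ t) (v : Vec n) : ‖M x t v‖ ≤ α₂ * ‖v‖ := by
  have h := le_energy hM (x, M x t v) ht
  simp only [energy, dualMetric_metric hM x ht] at h
  have h2 := real_inner_le_norm (M x t v) v
  have hα := hM.pos_upper
  rw [div_le_iff₀ hα] at h
  by_contra h3
  push Not at h3
  have h4 : 0 < ‖M x t v‖ := lt_of_le_of_lt (by positivity) h3
  nlinarith

/-- Half the spatial gradient of `v' M(x, t) v`. -/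
def metricForce (M : Vec n → ℝ → Vec n →L[ℝ] Vec n) (x v : Vec n) (t : ℝ) : Vec n :=
  ∑ i, ((1 / 2 : ℝ) * ⟪v, fderiv ℝ (fun y => M y t) x (EuclideanSpace.single i 1) v⟫_ℝ) •
    EuclideanSpace.single i (1 : ℝ)

theorem inner_metricForce (x v ξ : Vec n) (t : ℝ) :
    ⟪metricForce M x v t, ξ⟫_ℝ = (1 / 2) * ⟪v, fderiv ℝ (fun y => M y t) x ξ v⟫_ℝ := by
  have hξ : ξ = ∑ i, ξ i • EuclideanSpace.single i (1 : ℝ) := by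
    have := (EuclideanSpace.basisFun (Fin n) ℝ).sum_repr ξ
    simpa using this.symm
  conv_rhs => rw [hξ]
  simp only [metricForce, sum_inner, inner_smul_left, map_sum, map_smul,
    _root_.sum_apply, _root_.smul_apply, inner_sum, inner_smul_right,
    Finset.mul_sum, conj_trivial]
  refine Finset.sum_congr rfl fun i _ => ?_
  rw [EuclideanSpace.inner_single_left]
  simp
  ring

theorem metricForce_smul (x v : Vec n) (t c : ℝ) :
    metricForce M x (c • v) t = c ^ 2 • metricForce M x v t := by
  simp only [metricForce, Finset.smul_sum]
  refine Finset.sum_congr rfl fun i _ => ?_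
  rw [smul_smul, map_smul, inner_smul_left, inner_smul_right]
  simp only [conj_trivial]
  congr 1
  ring

/-- The Hamiltonian vector field of `½ p' M⁻¹ p`, whose integral curves are the cogeodesics. -/
def hamField (M : Vec n → ℝ → Vec n →L[ℝ] Vec n) (Y : Vec n × Vec n) (t : ℝ) : Vec n × Vec n :=
  (dualMetric M Y.1 t Y.2, metricForce M Y.1 (dualMetric M Y.1 t Y.2) t)

theorem SmoothHalf.comp_fst {G : Type*} [NormedAddCommGroup G] [NormedSpace ℝ G]
    {F : Vec n → ℝ → G} (hF : SmoothHalf F) :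
    SmoothHalf (fun (Y : Vec n × Vec n) t => F Y.1 t) := by
  have h1 : ContDiff ℝ ∞ (fun p : (Vec n × Vec n) × ℝ => (p.1.1, p.2)) := by fun_prop
  exact ContDiffOn.comp (t := univ ×ˢ Ici 0) hF h1.contDiffOn
    (fun p hp => ⟨mem_univ _, hp.2⟩)

theorem smoothHalf_hamField (hM : IsUniformlyBoundedMetric M α₁ α₂) :
    SmoothHalf (hamField M) := by
  have h1 := (smoothHalf_dualMetric hM).comp_fst
  have h2 := (SmoothHalf.fderiv (F := M) hM.smooth).comp_fst
  have hsnd : ContDiffOn ℝ ∞ (fun p : (Vec n × Vec n) × ℝ => p.1.2) (univ ×ˢ Ici 0) := by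
    fun_prop
  have hv := ContDiffOn.clm_apply h1 hsnd
  refine ContDiffOn.prodMk hv ?_
  refine ContDiffOn.sum fun i _ => ContDiffOn.fun_smul (contDiffOn_const.mul ?_)
    contDiffOn_const
  exact ContDiffOn.inner ℝ hv ((ContDiffOn.clm_apply h2 contDiffOn_const).clm_apply hv)

theorem smoothHalf_energy (hM : IsUniformlyBoundedMetric M α₁ α₂) :
    SmoothHalf (energy M) := by
  have h1 := (smoothHalf_dualMetric hM).comp_fst
  have hsnd : ContDiffOn ℝ ∞ (fun p : (Vec n × Vec n) × ℝ => p.1.2) (univ ×ˢ Ici 0) := by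
    fun_prop
  exact ContDiffOn.inner ℝ hsnd (ContDiffOn.clm_apply h1 hsnd)

/-- The derivative of the dual metric in terms of that of the metric. -/
theorem inner_fderiv_dualMetric (hM : IsUniformlyBoundedMetric M α₁ α₂) (x ξ p : Vec n)
    {t : ℝ} (ht : 0 ≤ t) :
    ⟪p, fderiv ℝ (fun y => dualMetric M y t) x ξ p⟫_ℝ =
      -⟪dualMetric M x t p, fderiv ℝ (fun y => M y t) x ξ (dualMetric M x t p)⟫_ℝ := by
  have h1 := (smoothHalf_dualMetric hM).hasFDerivAt x ht
  have h2 := SmoothHalf.hasFDerivAt (F := M) hM.smooth x ht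
  have h3 := (h2.clm_apply (h1.clm_apply (hasFDerivAt_const p x)))
  have h4 : (fun y => M y t (dualMetric M y t p)) = fun _ => p := by
    ext1 y; exact metric_dualMetric hM y ht p
  rw [h4] at h3
  have h5 := h3.unique (hasFDerivAt_const p x)
  have h6 := congrArg (fun L => L ξ) h5
  simp only [_root_.add_apply, ContinuousLinearMap.comp_apply,
    ContinuousLinearMap.flip_apply, _root_.zero_apply, map_zero, zero_add] at h6
  have h7 : ⟪p, fderiv ℝ (fun y => dualMetric M y t) x ξ p⟫_ℝ =
      ⟪dualMetric M x t p, M x t (fderiv ℝ (fun y => dualMetric M y t) x ξ p)⟫_ℝ := by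
    rw [← hM.symm x t ht, metric_dualMetric hM x ht]
  rw [h7, eq_neg_iff_add_eq_zero, ← inner_add_right, h6, inner_zero_right]

/-- Conservation of energy for the frozen metric. With `v = M⁻¹p`, the motion of the base point
contributes `-v'(∂_v M)v` through the derivative of `M⁻¹`, and the force, half the gradient,
contributes `2 · ½ v'(∂_v M)v`. -/
theorem fderiv_energy_hamField (hM : IsUniformlyBoundedMetric M α₁ α₂) (Y : Vec n × Vec n)
    {t : ℝ} (ht : 0 ≤ t) :
    fderiv ℝ (fun Z => energy M Z t) Y (hamField M Y t) = 0 := by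
  have h1 := ((smoothHalf_dualMetric hM).hasFDerivAt Y.1 ht).comp Y
    (hasFDerivAt_fst (𝕜 := ℝ) (E := Vec n) (F := Vec n))
  have h2 := (hasFDerivAt_snd (𝕜 := ℝ) (E := Vec n) (F := Vec n) (p := Y))
  have h3 := h2.inner ℝ (h1.clm_apply h2)
  have h4 : fderiv ℝ (fun Z => energy M Z t) Y = _ := h3.fderiv
  rw [h4]
  simp only [Function.comp_apply, ContinuousLinearMap.comp_apply, ContinuousLinearMap.prod_apply,
    fderivInnerCLM_apply, _root_.add_apply, ContinuousLinearMap.flip_apply,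
    ContinuousLinearMap.coe_fst', ContinuousLinearMap.coe_snd', inner_add_right]
  have e1 : (hamField M Y t).2 = metricForce M Y.1 (dualMetric M Y.1 t Y.2) t := rfl
  have e2 : (hamField M Y t).1 = dualMetric M Y.1 t Y.2 := rfl
  rw [e1, e2, inner_fderiv_dualMetric hM _ _ _ ht, ← dualMetric_symm hM Y.1 ht, inner_metricForce,
    real_inner_comm (metricForce M Y.1 (dualMetric M Y.1 t Y.2) t), inner_metricForce]
  ring

end

end CCM

namespace CCM

noncomputable section

variable {n : ℕ} {M : Vec n → ℝ → Vec n →L[ℝ] Vec n} {α₁ α₂ : ℝ}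

/-! ### Cogeodesics -/

/-- `Y = (x, p)` is an integral curve on `[0, 1]` of the Hamiltonian field of the metric frozen at
time `t`. -/
def IsCogeodesic (M : Vec n → ℝ → Vec n →L[ℝ] Vec n) (t : ℝ) (Y : ℝ → Vec n × Vec n) : Prop :=
  ∀ s ∈ Icc (0 : ℝ) 1, HasDerivWithinAt Y (hamField M (Y s) t) (Icc 0 1) s

/-- The factor `χ` only changes the speed along orbits and so preserves the energy. It is allowed
because global existence is proved first for the cut-off Hamiltonian field. -/
theorem energy_eq_of_slowed (hM : IsUniformlyBoundedMetric M α₁ α₂) {t : ℝ} (ht : 0 ≤ t)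
    {Y : ℝ → Vec n × Vec n} {χ : ℝ → ℝ}
    (hY : ∀ s ∈ Icc (0 : ℝ) 1, HasDerivWithinAt Y (χ s • hamField M (Y s) t) (Icc 0 1) s)
    {s : ℝ} (hs : s ∈ Icc (0 : ℝ) 1) : energy M (Y s) t = energy M (Y 0) t := by
  have h := norm_image_sub_le_of_norm_deriv_le_segment' (f := fun s => energy M (Y s) t)
    (f' := fun _ => 0) (C := 0) (a := 0) (b := 1) (fun s hs => by
      have := ((smoothHalf_energy hM).hasFDerivAt (Y s) ht).comp_hasDerivWithinAt s (hY s hs)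
      rwa [map_smul, fderiv_energy_hamField hM _ ht, smul_zero] at this) (by simp) s hs
  rw [zero_mul] at h
  exact sub_eq_zero.1 (norm_le_zero_iff.1 h)

theorem norm_snd_le_of_energy_eq (hM : IsUniformlyBoundedMetric M α₁ α₂) {t : ℝ} (ht : 0 ≤ t)
    {Y Z : Vec n × Vec n} (h : energy M Y t = energy M Z t) :
    ‖Y.2‖ ≤ √(α₂ / α₁) * ‖Z.2‖ := by
  have h1 := le_energy hM Y ht
  have h2 := energy_le hM Z ht
  have := hM.pos_lower
  have := hM.pos_upper
  rw [h] at h1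
  have h3 : ‖Y.2‖ ^ 2 ≤ α₂ / α₁ * ‖Z.2‖ ^ 2 := by
    have h4 := h1.trans h2
    rw [div_le_iff₀ (by positivity)] at h4
    refine h4.trans (le_of_eq (by ring))
  rw [← Real.sqrt_sq (norm_nonneg Y.2), ← Real.sqrt_sq (norm_nonneg Z.2),
    ← Real.sqrt_mul (by positivity)]
  exact Real.sqrt_le_sqrt h3

theorem norm_snd_le_of_slowed (hM : IsUniformlyBoundedMetric M α₁ α₂) {t : ℝ} (ht : 0 ≤ t)
    {Y : ℝ → Vec n × Vec n} {χ : ℝ → ℝ}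
    (hY : ∀ s ∈ Icc (0 : ℝ) 1, HasDerivWithinAt Y (χ s • hamField M (Y s) t) (Icc 0 1) s)
    {s : ℝ} (hs : s ∈ Icc (0 : ℝ) 1) : ‖(Y s).2‖ ≤ √(α₂ / α₁) * ‖(Y 0).2‖ :=
  norm_snd_le_of_energy_eq hM ht (energy_eq_of_slowed hM ht hY hs)

theorem norm_fst_sub_le_of_slowed (hM : IsUniformlyBoundedMetric M α₁ α₂) {t : ℝ} (ht : 0 ≤ t)
    {Y : ℝ → Vec n × Vec n} {χ : ℝ → ℝ} (hχ : ∀ s, |χ s| ≤ 1)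
    (hY : ∀ s ∈ Icc (0 : ℝ) 1, HasDerivWithinAt Y (χ s • hamField M (Y s) t) (Icc 0 1) s)
    {s : ℝ} (hs : s ∈ Icc (0 : ℝ) 1) :
    ‖(Y s).1 - (Y 0).1‖ ≤ √(α₂ / α₁) / α₁ * ‖(Y 0).2‖ := by
  have hα := hM.pos_lower
  have h := norm_image_sub_le_of_norm_deriv_le_segment' (f := fun s => (Y s).1)
    (f' := fun s => χ s • dualMetric M (Y s).1 t (Y s).2) (C := √(α₂ / α₁) / α₁ * ‖(Y 0).2‖)
    (a := 0) (b := 1) (fun s hs => (hY s hs).fst) (fun s hs => by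
      have hs' : s ∈ Icc (0 : ℝ) 1 := Ico_subset_Icc_self hs
      rw [norm_smul, Real.norm_eq_abs]
      refine (mul_le_of_le_one_left (norm_nonneg _) (hχ s)).trans ?_
      refine (norm_dualMetric_le hM _ ht _).trans ?_
      rw [div_mul_eq_mul_div]
      exact div_le_div_of_nonneg_right (norm_snd_le_of_slowed hM ht hY hs') hα.le) s hs
  refine h.trans ?_
  rw [sub_zero]
  exact mul_le_of_le_one_right (by positivity) hs.2

theorem IsCogeodesic.slowed {t : ℝ} {Y : ℝ → Vec n × Vec n} (hY : IsCogeodesic M t Y) :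
    ∀ s ∈ Icc (0 : ℝ) 1, HasDerivWithinAt Y ((1 : ℝ) • hamField M (Y s) t) (Icc 0 1) s :=
  fun s hs => by rw [one_smul]; exact hY s hs

theorem IsCogeodesic.continuousOn {t : ℝ} {Y : ℝ → Vec n × Vec n} (hY : IsCogeodesic M t Y) :
    ContinuousOn Y (Icc 0 1) := fun s hs => (hY s hs).continuousWithinAt

theorem IsCogeodesic.energy_eq (hM : IsUniformlyBoundedMetric M α₁ α₂) {t : ℝ} (ht : 0 ≤ t)
    {Y : ℝ → Vec n × Vec n} (hY : IsCogeodesic M t Y) {s : ℝ} (hs : s ∈ Icc (0 : ℝ) 1) :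
    energy M (Y s) t = energy M (Y 0) t :=
  energy_eq_of_slowed hM ht (χ := fun _ => 1) hY.slowed hs

theorem IsCogeodesic.norm_snd_le (hM : IsUniformlyBoundedMetric M α₁ α₂) {t : ℝ} (ht : 0 ≤ t)
    {Y : ℝ → Vec n × Vec n} (hY : IsCogeodesic M t Y) {s : ℝ} (hs : s ∈ Icc (0 : ℝ) 1) :
    ‖(Y s).2‖ ≤ √(α₂ / α₁) * ‖(Y 0).2‖ :=
  norm_snd_le_of_energy_eq hM ht (hY.energy_eq hM ht hs)

theorem IsCogeodesic.norm_fst_sub_le (hM : IsUniformlyBoundedMetric M α₁ α₂) {t : ℝ} (ht : 0 ≤ t)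
    {Y : ℝ → Vec n × Vec n} (hY : IsCogeodesic M t Y) {s : ℝ} (hs : s ∈ Icc (0 : ℝ) 1) :
    ‖(Y s).1 - (Y 0).1‖ ≤ √(α₂ / α₁) / α₁ * ‖(Y 0).2‖ :=
  norm_fst_sub_le_of_slowed hM ht (χ := fun _ => 1) (by simp) hY.slowed hs

/-- Cogeodesics starting in a bounded set stay in a bounded set. -/
theorem IsCogeodesic.exists_bound (hM : IsUniformlyBoundedMetric M α₁ α₂) (R : ℝ) :
    ∃ R', R ≤ R' ∧ ∀ t, 0 ≤ t → ∀ Y, IsCogeodesic M t Y → ‖Y 0‖ ≤ R →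
      ∀ s ∈ Icc (0 : ℝ) 1, ‖Y s‖ ≤ R' := by
  have := hM.pos_lower
  refine ⟨max R (max (√(α₂ / α₁) * R) (R + √(α₂ / α₁) / α₁ * R)), le_max_left _ _,
    fun t ht Y hY h0 s hs => le_max_of_le_right ?_⟩
  have h1 := _root_.norm_fst_le (Y 0)
  have h2 := _root_.norm_snd_le (Y 0)
  rw [Prod.norm_def]
  refine max_le (le_max_of_le_right ?_) (le_max_of_le_left ?_)
  · have h3 := hY.norm_fst_sub_le hM ht hs
    have h4 : ‖(Y s).1‖ ≤ ‖(Y s).1 - (Y 0).1‖ + ‖(Y 0).1‖ := by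
      simpa using norm_add_le ((Y s).1 - (Y 0).1) (Y 0).1
    have h5 : √(α₂ / α₁) / α₁ * ‖(Y 0).2‖ ≤ √(α₂ / α₁) / α₁ * R := by
      gcongr; exact h2.trans h0
    linarith
  · refine (hY.norm_snd_le hM ht hs).trans ?_
    gcongr; exact h2.trans h0

theorem hasDerivWithinAt_fst {E G : Type*} [NormedAddCommGroup E] [NormedSpace ℝ E]
    [NormedAddCommGroup G] [NormedSpace ℝ G] {f : ℝ → E × G} {f' : E × G} {S : Set ℝ} {s : ℝ}
    (h : HasDerivWithinAt f f' S s) : HasDerivWithinAt (fun r => (f r).1) f'.1 S s := by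
  simpa using (HasFDerivWithinAt.fst h.hasFDerivWithinAt).hasDerivWithinAt

theorem hasDerivWithinAt_snd {E G : Type*} [NormedAddCommGroup E] [NormedSpace ℝ E]
    [NormedAddCommGroup G] [NormedSpace ℝ G] {f : ℝ → E × G} {f' : E × G} {S : Set ℝ} {s : ℝ}
    (h : HasDerivWithinAt f f' S s) : HasDerivWithinAt (fun r => (f r).2) f'.2 S s := by
  simpa using (HasFDerivWithinAt.snd h.hasFDerivWithinAt).hasDerivWithinAt

theorem hasDerivWithinAt_Ici_of_Icc {E : Type*} [NormedAddCommGroup E] [NormedSpace ℝ E]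
    {f : ℝ → E} {f' : E} {a b s : ℝ} (hs : s ∈ Ico a b) (h : HasDerivWithinAt f f' (Icc a b) s) :
    HasDerivWithinAt f f' (Ici s) s :=
  h.mono_of_mem_nhdsWithin (Icc_mem_nhdsGE_of_mem hs)

/-- Lipschitz dependence of cogeodesics on the initial point and on the frozen time. -/
theorem IsCogeodesic.exists_lipschitz (hM : IsUniformlyBoundedMetric M α₁ α₂) (R : ℝ) :
    ∃ C, 0 < C ∧ ∀ t t', 0 ≤ t → t ≤ R → 0 ≤ t' → t' ≤ R → ∀ Y Y', IsCogeodesic M t Y →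
      IsCogeodesic M t' Y' → ‖Y 0‖ ≤ R → ‖Y' 0‖ ≤ R →
      ∀ s ∈ Icc (0 : ℝ) 1, ‖Y s - Y' s‖ ≤ C * (‖Y 0 - Y' 0‖ + |t - t'|) := by
  obtain ⟨R', hRR', hR'⟩ := IsCogeodesic.exists_bound hM R
  obtain ⟨L, hL, hlip⟩ := (smoothHalf_hamField hM).bounded_lipschitz R'
  refine ⟨Real.exp L, Real.exp_pos L, fun t t' ht htR ht' htR' Y Y' hY hY' h0 h0' s hs => ?_⟩
  have h := norm_le_gronwallBound_of_norm_deriv_right_le (f := fun s => Y s - Y' s)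
    (f' := fun s => hamField M (Y s) t - hamField M (Y' s) t') (δ := ‖Y 0 - Y' 0‖) (K := L)
    (ε := L * |t - t'|) (a := 0) (b := 1) (hY.continuousOn.sub hY'.continuousOn)
    (fun s hs => hasDerivWithinAt_Ici_of_Icc hs
      ((hY s (Ico_subset_Icc_self hs)).sub (hY' s (Ico_subset_Icc_self hs)))) le_rfl
    (fun s hs => by
      have hs' := Ico_subset_Icc_self hs
      have := (hlip (Y s) (Y' s) t t' (hR' t ht Y hY h0 s hs') (hR' t' ht' Y' hY' h0' s hs') ht
        (htR.trans hRR') ht' (htR'.trans hRR')).2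
      linarith) s hs
  refine h.trans ?_
  rw [gronwallBound_of_K_ne_0 hL.ne', sub_zero, mul_div_cancel_left₀ _ hL.ne']
  have h1 : Real.exp (L * s) ≤ Real.exp L :=
    Real.exp_le_exp.2 (mul_le_of_le_one_right hL.le hs.2)
  have h2 := mul_le_mul_of_nonneg_left h1 (norm_nonneg (Y 0 - Y' 0))
  have h3 := mul_le_mul_of_nonneg_left h1 (abs_nonneg (t - t'))
  have h4 := abs_nonneg (t - t')
  nlinarith

theorem IsCogeodesic.eqOn (hM : IsUniformlyBoundedMetric M α₁ α₂) {t : ℝ} (ht : 0 ≤ t)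
    {Y Y' : ℝ → Vec n × Vec n} (hY : IsCogeodesic M t Y) (hY' : IsCogeodesic M t Y')
    (h0 : Y 0 = Y' 0) : EqOn Y Y' (Icc 0 1) := by
  obtain ⟨C, -, h⟩ := IsCogeodesic.exists_lipschitz hM (max t ‖Y 0‖)
  intro s hs
  have := h t t ht (le_max_left _ _) ht (le_max_left _ _) Y Y' hY hY' (le_max_right _ _)
    (by rw [← h0]; exact le_max_right _ _) s hs
  rw [h0, sub_self, norm_zero, sub_self, abs_zero, add_zero, mul_zero] at this
  exact sub_eq_zero.1 (norm_le_zero_iff.1 this)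

theorem hamField_neg (x p : Vec n) (t : ℝ) :
    hamField M (x, -p) t = (-(hamField M (x, p) t).1, (hamField M (x, p) t).2) := by
  have := metricForce_smul (M := M) x (dualMetric M x t p) t (-1)
  simp only [hamField, map_neg]
  congr 1
  simpa using this

/-- The velocity is odd and the force even in the covector. Reversal transfers uniqueness from the
initial to the terminal phase point. -/
theorem IsCogeodesic.reverse {t : ℝ} {Y : ℝ → Vec n × Vec n} (hY : IsCogeodesic M t Y) :
    IsCogeodesic M t (fun s => ((Y (1 - s)).1, -(Y (1 - s)).2)) := by
  intro s hs
  have hs' : 1 - s ∈ Icc (0 : ℝ) 1 := ⟨by linarith [hs.2], by linarith [hs.1]⟩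
  have h1 : HasDerivWithinAt (fun s : ℝ => 1 - s) (-1) (Icc 0 1) s := by
    simpa using (hasDerivWithinAt_id s (Icc (0 : ℝ) 1)).const_sub 1
  have h2 := HasDerivWithinAt.scomp s (hY (1 - s) hs') h1
    (fun r hr => ⟨by linarith [hr.2], by linarith [hr.1]⟩)
  have e1 : HasDerivWithinAt (fun s => (Y (1 - s)).1) _ (Icc 0 1) s := hasDerivWithinAt_fst h2
  have e2 : HasDerivWithinAt (fun s => (Y (1 - s)).2) _ (Icc 0 1) s := hasDerivWithinAt_snd h2
  have h3 := HasDerivWithinAt.prodMk e1 e2.fun_neg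
  rw [hamField_neg]
  refine h3.congr_deriv ?_
  simp

theorem IsCogeodesic.eqOn_of_eq_end (hM : IsUniformlyBoundedMetric M α₁ α₂) {t : ℝ} (ht : 0 ≤ t)
    {Y Y' : ℝ → Vec n × Vec n} (hY : IsCogeodesic M t Y) (hY' : IsCogeodesic M t Y')
    (h1 : Y 1 = Y' 1) : EqOn Y Y' (Icc 0 1) := by
  have h := hY.reverse.eqOn hM ht hY'.reverse (by simp [h1])
  intro s hs
  have h2 := h (x := 1 - s) ⟨by linarith [hs.2], by linarith [hs.1]⟩
  simp only [sub_sub_cancel, Prod.mk.injEq, neg_inj] at h2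
  exact Prod.ext h2.1 h2.2

theorem hamField_smul (x p : Vec n) (t c : ℝ) :
    hamField M (x, c • p) t = (c • (hamField M (x, p) t).1, c ^ 2 • (hamField M (x, p) t).2) := by
  simp only [hamField, map_smul, metricForce_smul]

/-- A subarc of a cogeodesic, reparametrised by `[0, 1]`. -/
theorem IsCogeodesic.scale {t : ℝ} {Y : ℝ → Vec n × Vec n} (hY : IsCogeodesic M t Y) {a c : ℝ}
    (ha : 0 ≤ a) (hc : 0 ≤ c) (hac : a + c ≤ 1) :
    IsCogeodesic M t (fun s => ((Y (a + c * s)).1, c • (Y (a + c * s)).2)) := by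
  have hmem : ∀ s ∈ Icc (0 : ℝ) 1, a + c * s ∈ Icc (0 : ℝ) 1 := fun s hs =>
    ⟨by have := mul_nonneg hc hs.1; linarith, by
      have := mul_le_of_le_one_right hc hs.2; linarith⟩
  intro s hs
  have h1 : HasDerivWithinAt (fun s : ℝ => a + c * s) c (Icc 0 1) s := by
    simpa using ((hasDerivWithinAt_id s (Icc (0 : ℝ) 1)).const_mul c).const_add a
  have h2 := HasDerivWithinAt.scomp s (hY _ (hmem s hs)) h1 hmem
  have e1 : HasDerivWithinAt (fun s => (Y (a + c * s)).1) _ (Icc 0 1) s :=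
    hasDerivWithinAt_fst h2
  have e2 : HasDerivWithinAt (fun s => (Y (a + c * s)).2) _ (Icc 0 1) s :=
    hasDerivWithinAt_snd h2
  have h3 := HasDerivWithinAt.prodMk e1 (e2.fun_const_smul c)
  rw [hamField_smul]
  refine h3.congr_deriv ?_
  simp [smul_smul, sq]

/-- Cogeodesics exist on `[0, 1]` because the energy is conserved. -/
theorem exists_isCogeodesic (hM : IsUniformlyBoundedMetric M α₁ α₂) {t : ℝ} (ht : 0 ≤ t)
    (Y₀ : Vec n × Vec n) : ∃ Y, Y 0 = Y₀ ∧ IsCogeodesic M t Y := by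
  have hα := hM.pos_lower
  -- Energy conservation holds for the cut-off equation too and confines its solution to the ball of
  -- this radius. There the cutoff equals 1, so the solution is a genuine cogeodesic.
  set R := max (‖Y₀.1‖ + √(α₂ / α₁) / α₁ * ‖Y₀.2‖) (√(α₂ / α₁) * ‖Y₀.2‖) with hR
  obtain ⟨C, hC, hlip⟩ := (smoothHalf_hamField hM).bounded_lipschitz (max t (R + 1))
  have hcut := cutoff_smul_lipschitz (F := fun Y => hamField M Y t) (R := R) (C := C)
    (fun x y hx hy => by
      have := hlip x y t t (hx.trans (le_max_right _ _)) (hy.trans (le_max_right _ _)) ht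
        (le_max_left _ _) ht (le_max_left _ _)
      simpa using this) hC.le
  have hcont : Continuous fun Y : Vec n × Vec n => cutoff R Y • hamField M Y t :=
    (continuous_cutoff R).smul ((smoothHalf_hamField hM).continuous_slice ht)
  obtain ⟨Y, hYc, hY⟩ := caratheodory_exists (fun _ Y => cutoff R Y • hamField M Y t)
    (zero_le_one' ℝ) (L := 2 * C) (by positivity) (fun _ _ => hcut)
    (fun y hy => (hcont.comp hy).continuousOn.integrableOn_Icc) Y₀
  have hY0 : Y 0 = Y₀ := by simpa using hY 0 (by simp)
  have hd : ∀ s ∈ Icc (0 : ℝ) 1,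
      HasDerivWithinAt Y (cutoff R (Y s) • hamField M (Y s) t) (Icc 0 1) s := by
    intro s hs
    have h1 : HasDerivAt (fun u => Y₀ + ∫ r in (0 : ℝ)..u, cutoff R (Y r) • hamField M (Y r) t)
        (cutoff R (Y s) • hamField M (Y s) t) s :=
      ((hcont.comp hYc).integral_hasStrictDerivAt 0 s).hasDerivAt.const_add Y₀
    exact h1.hasDerivWithinAt.congr hY (hY s hs)
  refine ⟨Y, hY0, fun s hs => ?_⟩
  have h1 := norm_fst_sub_le_of_slowed hM ht (fun s => by
    rw [abs_of_nonneg (cutoff_nonneg R (Y s))]; exact cutoff_le_one R (Y s)) hd hs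
  have h2 := norm_snd_le_of_slowed hM ht hd hs
  rw [hY0] at h1 h2
  have h3 : ‖Y s‖ ≤ R := by
    rw [Prod.norm_def]
    refine max_le (le_max_of_le_left ?_) (le_max_of_le_right h2)
    have h4 : ‖(Y s).1‖ ≤ ‖(Y s).1 - Y₀.1‖ + ‖Y₀.1‖ := by
      simpa using norm_add_le ((Y s).1 - Y₀.1) Y₀.1
    linarith
  have h4 := hd s hs
  rwa [cutoff_eq_one h3, one_smul] at h4

/-- The cogeodesic with initial point `b` and initial covector `p`. -/
def cogeod (M : Vec n → ℝ → Vec n →L[ℝ] Vec n) (t : ℝ) (b p : Vec n) : ℝ → Vec n × Vec n :=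
  Classical.epsilon fun Y => Y 0 = (b, p) ∧ IsCogeodesic M t Y

theorem cogeod_spec (hM : IsUniformlyBoundedMetric M α₁ α₂) {t : ℝ} (ht : 0 ≤ t) (b p : Vec n) :
    cogeod M t b p 0 = (b, p) ∧ IsCogeodesic M t (cogeod M t b p) :=
  Classical.epsilon_spec (exists_isCogeodesic hM ht (b, p))

theorem cogeod_zero (hM : IsUniformlyBoundedMetric M α₁ α₂) {t : ℝ} (ht : 0 ≤ t) (b p : Vec n) :
    cogeod M t b p 0 = (b, p) := (cogeod_spec hM ht b p).1

theorem isCogeodesic_cogeod (hM : IsUniformlyBoundedMetric M α₁ α₂) {t : ℝ} (ht : 0 ≤ t)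
    (b p : Vec n) : IsCogeodesic M t (cogeod M t b p) := (cogeod_spec hM ht b p).2

theorem IsCogeodesic.eq_cogeod (hM : IsUniformlyBoundedMetric M α₁ α₂) {t : ℝ} (ht : 0 ≤ t)
    {Y : ℝ → Vec n × Vec n} (hY : IsCogeodesic M t Y) {s : ℝ} (hs : s ∈ Icc (0 : ℝ) 1) :
    cogeod M t (Y 0).1 (Y 0).2 s = Y s :=
  (isCogeodesic_cogeod hM ht _ _).eqOn hM ht hY (cogeod_zero hM ht _ _) hs

theorem cogeod_smul (hM : IsUniformlyBoundedMetric M α₁ α₂) {t : ℝ} (ht : 0 ≤ t) (b p : Vec n)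
    {c s : ℝ} (hc : c ∈ Icc (0 : ℝ) 1) (hs : s ∈ Icc (0 : ℝ) 1) :
    cogeod M t b (c • p) s = ((cogeod M t b p (c * s)).1, c • (cogeod M t b p (c * s)).2) := by
  have h := ((isCogeodesic_cogeod hM ht b p).scale le_rfl hc.1 (by linarith [hc.2])).eq_cogeod
    hM ht hs
  simp only [zero_add, mul_zero, cogeod_zero hM ht] at h
  exact h

/-- The exponential map of the metric frozen at time `t`, on covectors. -/
def expMap (M : Vec n → ℝ → Vec n →L[ℝ] Vec n) (t : ℝ) (b p : Vec n) : Vec n :=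
  (cogeod M t b p 1).1

end

end CCM

namespace CCM

noncomputable section

variable {n : ℕ} {M : Vec n → ℝ → Vec n →L[ℝ] Vec n} {α₁ α₂ : ℝ}

/-! ### Discrete energies of chains -/

/-- The discrete energy of the chain `y 0, …, y N`. -/
def chainEnergy (M : Vec n → ℝ → Vec n →L[ℝ] Vec n) (t : ℝ) (N : ℕ) (y : ℕ → Vec n) : ℝ :=
  N * ∑ i ∈ Finset.range N, ⟪y (i + 1) - y i, M (y i) t (y (i + 1) - y i)⟫_ℝ

/-- Euler step estimates along a cogeodesic. -/
theorem IsCogeodesic.exists_step (hM : IsUniformlyBoundedMetric M α₁ α₂) (R : ℝ) :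
    ∃ C, 0 < C ∧ ∀ t, 0 ≤ t → t ≤ R → ∀ Y, IsCogeodesic M t Y → ‖Y 0‖ ≤ R →
      ∀ s δ, 0 ≤ s → 0 ≤ δ → s + δ ≤ 1 →
        ‖Y s‖ ≤ C ∧ ‖hamField M (Y s) t‖ ≤ C ∧ ‖Y (s + δ) - Y s‖ ≤ C * δ ∧
        ‖Y (s + δ) - Y s - δ • hamField M (Y s) t‖ ≤ C * δ ^ 2 := by
  obtain ⟨R', hRR', hR'⟩ := IsCogeodesic.exists_bound hM R
  obtain ⟨L, hL, hlip⟩ := (smoothHalf_hamField hM).bounded_lipschitz R'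
  refine ⟨max (L * L) (max L R'), by positivity, fun t ht htR Y hY h0 s δ hs hδ hsδ => ?_⟩
  have hb : ∀ r ∈ Icc (0 : ℝ) 1, ‖Y r‖ ≤ R' := hR' t ht Y hY h0
  have hX : ∀ r ∈ Icc (0 : ℝ) 1, ‖hamField M (Y r) t‖ ≤ L := fun r hr =>
    (hlip _ _ t t (hb r hr) (hb r hr) ht (htR.trans hRR') ht (htR.trans hRR')).1
  have hsub : Icc s (s + δ) ⊆ Icc (0 : ℝ) 1 := Icc_subset_Icc hs hsδ
  have hs1 : s ∈ Icc (0 : ℝ) 1 := ⟨hs, by linarith⟩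
  have h1 : ∀ r ∈ Icc s (s + δ), ‖Y r - Y s‖ ≤ L * (r - s) :=
    norm_image_sub_le_of_norm_deriv_le_segment' (fun r hr => (hY r (hsub hr)).mono hsub)
      (fun r hr => hX r (hsub (Ico_subset_Icc_self hr)))
  have h2 := norm_image_sub_le_of_norm_deriv_le_segment' (a := s) (b := s + δ)
    (f := fun r => Y r - (r - s) • hamField M (Y s) t)
    (f' := fun r => hamField M (Y r) t - hamField M (Y s) t) (C := L * L * δ)
    (fun r hr => by
      have e1 := (hY r (hsub hr)).mono hsub
      have e2 := ((hasDerivWithinAt_id r (Icc s (s + δ))).sub_const s).smul_const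
        (hamField M (Y s) t)
      simpa using e1.fun_sub e2)
    (fun r hr => by
      have hr' := Ico_subset_Icc_self hr
      have e1 := (hlip (Y r) (Y s) t t (hb r (hsub hr')) (hb s hs1) ht (htR.trans hRR') ht
        (htR.trans hRR')).2
      rw [sub_self, abs_zero, add_zero] at e1
      refine e1.trans ?_
      have e2 := h1 r hr'
      have e3 : L * (r - s) ≤ L * δ := mul_le_mul_of_nonneg_left (by linarith [hr.2]) hL.le
      have e4 := mul_le_mul_of_nonneg_left (e2.trans e3) hL.le
      linarith) (s + δ) ⟨by linarith, le_rfl⟩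
  refine ⟨(hb s hs1).trans ((le_max_right _ _).trans (le_max_right _ _)),
    (hX s hs1).trans ((le_max_left _ _).trans (le_max_right _ _)), ?_, ?_⟩
  · refine (h1 (s + δ) ⟨by linarith, le_rfl⟩).trans ?_
    rw [add_sub_cancel_left]
    exact mul_le_mul_of_nonneg_right ((le_max_left _ _).trans (le_max_right _ _)) hδ
  · simp only [add_sub_cancel_left, sub_self, zero_smul, sub_zero] at h2
    rw [sub_right_comm]
    refine h2.trans ?_
    have : L * L * δ * δ = L * L * δ ^ 2 := by ring
    rw [this]
    exact mul_le_mul_of_nonneg_right (le_max_left _ _) (by positivity)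

theorem norm_fst_le_norm {E G : Type*} [NormedAddCommGroup E] [NormedAddCommGroup G] (Y : E × G) :
    ‖Y.1‖ ≤ ‖Y‖ := _root_.norm_fst_le Y

theorem norm_snd_le_norm {E G : Type*} [NormedAddCommGroup E] [NormedAddCommGroup G] (Y : E × G) :
    ‖Y.2‖ ≤ ‖Y‖ := _root_.norm_snd_le Y

theorem abs_inner_apply_le {E : Type*} [NormedAddCommGroup E] [InnerProductSpace ℝ E] (v w : E)
    (L : E →L[ℝ] E) : |⟪v, L w⟫_ℝ| ≤ ‖L‖ * ‖v‖ * ‖w‖ := by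
  refine (abs_real_inner_le_norm _ _).trans ?_
  have := mul_le_mul_of_nonneg_left (L.le_opNorm w) (norm_nonneg v)
  linarith

/-- Perturbation of a quadratic form, with explicit error. -/
theorem abs_quadratic_sub_le {E : Type*} [NormedAddCommGroup E] [InnerProductSpace ℝ E] (v w : E)
    (L : E →L[ℝ] E) : |⟪w, L w⟫_ℝ - ⟪v, L v⟫_ℝ| ≤ ‖L‖ * (‖v‖ + ‖w‖) * ‖w - v‖ := by
  have h : ⟪w, L w⟫_ℝ - ⟪v, L v⟫_ℝ = ⟪w - v, L w⟫_ℝ + ⟪v, L (w - v)⟫_ℝ := by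
    rw [map_sub, inner_sub_left, inner_sub_right]; ring
  rw [h]
  refine (abs_add_le _ _).trans ?_
  have h1 := abs_inner_apply_le (w - v) w L
  have h2 := abs_inner_apply_le v (w - v) L
  linarith

/-- Expansion of a perturbed quadratic form at a perturbed vector. -/
theorem quadratic_expansion_le {E : Type*} [NormedAddCommGroup E] [InnerProductSpace ℝ E]
    (L₀ L₁ D : E →L[ℝ] E) (v ξ : E) {s h K C₂ C₃ C₄ : ℝ} (hh : 0 ≤ h) (hC₂ : 0 ≤ C₂)
    (hC₃ : 0 ≤ C₃) (hC₄ : 0 ≤ C₄) (hK : 0 ≤ K) (h₁ : ‖L₁‖ ≤ C₂)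
    (h₂ : ‖L₁ - L₀ - (s * h) • D‖ ≤ C₃ * (K * h) ^ 2) (h₃ : ‖L₁ - L₀‖ ≤ C₄ * K * h)
    (hv : ‖v‖ ≤ K) (hξ : ‖ξ‖ ≤ K) :
    ⟪v + h • ξ, L₁ (v + h • ξ)⟫_ℝ ≤ ⟪v, L₀ v⟫_ℝ + s * h * ⟪v, D v⟫_ℝ +
      h * (⟪ξ, L₀ v⟫_ℝ + ⟪v, L₀ ξ⟫_ℝ) + (C₃ * K ^ 4 + 2 * C₄ * K ^ 3 + C₂ * K ^ 2) * h ^ 2 := by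
  have g1 : ⟪v, (L₁ - L₀ - (s * h) • D) v⟫_ℝ ≤ C₃ * (K * h) ^ 2 * K * K :=
    (le_abs_self _).trans ((abs_inner_apply_le v v _).trans (by gcongr))
  have g6 : ⟪ξ, L₁ ξ⟫_ℝ ≤ C₂ * K * K :=
    (le_abs_self _).trans ((abs_inner_apply_le ξ ξ L₁).trans (by gcongr))
  have g7 : ⟪ξ, (L₁ - L₀) v⟫_ℝ ≤ C₄ * K * h * K * K :=
    (le_abs_self _).trans ((abs_inner_apply_le ξ v _).trans (by gcongr))
  have g8 : ⟪v, (L₁ - L₀) ξ⟫_ℝ ≤ C₄ * K * h * K * K :=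
    (le_abs_self _).trans ((abs_inner_apply_le v ξ _).trans (by gcongr))
  have m1 := mul_le_mul_of_nonneg_left (add_le_add g7 g8) hh
  have m2 := mul_le_mul_of_nonneg_left g6 (sq_nonneg h)
  simp only [map_add, map_smul, inner_add_left, inner_add_right, inner_smul_left,
    inner_smul_right, _root_.sub_apply, inner_sub_right, conj_trivial, _root_.smul_apply]
    at g1 m1 m2 ⊢
  linarith

set_option maxHeartbeats 1600000 in
/-- The energy of a sheared cogeodesic, sampled at `N` equal steps. -/
theorem chainEnergy_sheared_le (hM : IsUniformlyBoundedMetric M α₁ α₂) (R : ℝ) :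
    ∃ C, 0 < C ∧ ∀ t, 0 ≤ t → t ≤ R → ∀ Y, IsCogeodesic M t Y → ‖Y 0‖ ≤ R →
      ∀ ξ, ‖ξ‖ ≤ R → ∀ h, 0 ≤ h → h ≤ 1 → ∀ N : ℕ, 0 < N →
        chainEnergy M t N (fun i => (Y (i / N)).1 + ((i / N : ℝ) * h) • ξ) ≤
          energy M (Y 0) t + 2 * h * ⟪(Y 1).2, ξ⟫_ℝ + C * h ^ 2 + C / N := by
  obtain ⟨C₁, hC₁, hstep⟩ := IsCogeodesic.exists_step hM R
  obtain ⟨C₂, hC₂, hMb⟩ := SmoothHalf.bounded_lipschitz (F := M) hM.smooth (C₁ + |R| + 1)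
  obtain ⟨C₃, hC₃, hMt⟩ := SmoothHalf.taylor (F := M) hM.smooth (C₁ + |R| + 1)
  obtain ⟨C₄, hC₄, hMd⟩ := (SmoothHalf.fderiv (F := M) hM.smooth).bounded_lipschitz (C₁ + |R| + 1)
  -- constants for the two error terms
  set K := C₁ + |R| with hK
  have hK0 : 0 < K := by positivity
  set Ch := C₃ * K ^ 4 + 2 * C₄ * K ^ 3 + C₂ * K ^ 2 with hCh
  set Cd := 4 * C₁ * K + C₂ * (2 * K + (2 * K + C₁)) * C₁ with hCd
  refine ⟨Ch + Cd, by positivity, fun t ht htR Y hY h0 ξ hξ h hh hh1 N hN => ?_⟩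
  have hR0 : 0 ≤ R := ht.trans htR
  have htR' : t ≤ C₁ + |R| + 1 := by linarith [le_abs_self R]
  have hN' : (0 : ℝ) < N := by exact_mod_cast hN
  have hξK : ‖ξ‖ ≤ K := hξ.trans (by linarith [le_abs_self R])
  set δ : ℝ := 1 / N with hδ
  have hδ0 : 0 < δ := by positivity
  have hδ1 : δ ≤ 1 := by
    rw [hδ, div_le_one hN']; exact_mod_cast hN
  -- the telescoping quantity
  let g : ℕ → ℝ := fun i => (i / N : ℝ) * ⟪(Y (i / N)).2, ξ⟫_ℝ
  -- The term of first order in `h` is `2h(⟨p, ξ⟩ + s⟨q, ξ⟩)` with `q` the force. By Hamilton's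
  -- equation for `p` this is the derivative of `2hs⟨p, ξ⟩`, so the increments of `g` sum to the
  -- boundary value at `s = 1`. The error `Ch` is of second order in the shear; the error `Cd` comes
  -- from Euler steps.
  have key : ∀ i ∈ Finset.range N,
      ⟪(Y ((i + 1 : ℕ) / N)).1 + (((i + 1 : ℕ) / N : ℝ) * h) • ξ -
          ((Y (i / N)).1 + ((i / N : ℝ) * h) • ξ),
        M ((Y (i / N)).1 + ((i / N : ℝ) * h) • ξ) t
          ((Y ((i + 1 : ℕ) / N)).1 + (((i + 1 : ℕ) / N : ℝ) * h) • ξ -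
            ((Y (i / N)).1 + ((i / N : ℝ) * h) • ξ))⟫_ℝ ≤
        δ ^ 2 * energy M (Y 0) t + 2 * h * δ * (g (i + 1) - g i) + Ch * δ ^ 2 * h ^ 2
          + Cd * δ ^ 3 := by
    intro i hi
    have hiN : (i : ℝ) + 1 ≤ N := by exact_mod_cast Finset.mem_range.1 hi
    set s : ℝ := i / N with hs
    have hs0 : 0 ≤ s := by positivity
    have hsd : ((i + 1 : ℕ) / N : ℝ) = s + δ := by rw [hs, hδ]; push_cast; ring
    have hs1 : s + δ ≤ 1 := by
      rw [hs, hδ, ← add_div, div_le_one hN']; exact hiN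
    obtain ⟨hb, hXb, hd1, hd2⟩ := hstep t ht htR Y hY h0 s δ hs0 hδ0.le hs1
    obtain ⟨hb', -, -, -⟩ := hstep t ht htR Y hY h0 (s + δ) 0 (by linarith) le_rfl (by linarith)
    have hE : energy M (Y s) t = energy M (Y 0) t := hY.energy_eq hM ht ⟨hs0, by linarith⟩
    simp only [g, hsd, ← hs]
    set x := (Y s).1 with hx
    set p := (Y s).2 with hp
    set v := dualMetric M x t p with hv
    set q := metricForce M x v t with hq
    have hX : hamField M (Y s) t = (v, q) := rfl
    rw [hX] at hXb hd2
    have hxb : ‖x‖ ≤ C₁ := (norm_fst_le_norm _).trans hb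
    have hpb : ‖p‖ ≤ C₁ := (norm_snd_le_norm _).trans hb
    have hvb : ‖v‖ ≤ C₁ := (norm_fst_le_norm (v, q)).trans hXb
    have hvK : ‖v‖ ≤ K := by linarith [abs_nonneg R]
    have he1 : ‖(Y (s + δ)).1 - x - δ • v‖ ≤ C₁ * δ ^ 2 :=
      (norm_fst_le_norm (Y (s + δ) - Y s - δ • (v, q))).trans hd2
    have he2 : ‖(Y (s + δ)).2 - p - δ • q‖ ≤ C₁ * δ ^ 2 :=
      (norm_snd_le_norm (Y (s + δ) - Y s - δ • (v, q))).trans hd2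
    have hd1' : ‖(Y (s + δ)).2 - p‖ ≤ C₁ * δ := (norm_snd_le_norm (Y (s + δ) - Y s)).trans hd1
    set x' := x + (s * h) • ξ with hx'
    set w := v + h • ξ with hw
    have hsh : 0 ≤ s * h := by positivity
    have hsh1 : s * h ≤ 1 := mul_le_one₀ (by linarith) hh hh1
    have hx'b : ‖x'‖ ≤ C₁ + |R| + 1 := by
      refine (norm_add_le _ _).trans ?_
      rw [norm_smul, Real.norm_of_nonneg hsh]
      have := mul_le_of_le_one_left (norm_nonneg ξ) hsh1
      linarith [le_abs_self R]
    have hxb' : ‖x‖ ≤ C₁ + |R| + 1 := by linarith [abs_nonneg R]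
    have hM' : ‖M x' t‖ ≤ C₂ := (hMb x' x' t t hx'b hx'b ht htR' ht htR').1
    have hM0 : ‖M x t‖ ≤ C₂ := (hMb x x t t hxb' hxb' ht htR' ht htR').1
    have hD0 : ‖fderiv ℝ (fun y => M y t) x‖ ≤ C₄ := (hMd x x t t hxb' hxb' ht htR' ht htR').1
    -- replace the increment by its linear part
    set Δ := (Y (s + δ)).1 + ((s + δ) * h) • ξ - x' with hΔ
    have hΔw : ‖Δ - δ • w‖ ≤ C₁ * δ ^ 2 := by
      have : Δ - δ • w = (Y (s + δ)).1 - x - δ • v := by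
        rw [hΔ, hx', hw]; module
      rw [this]; exact he1
    have hwb : ‖w‖ ≤ 2 * K := by
      refine (norm_add_le _ _).trans ?_
      rw [norm_smul, Real.norm_of_nonneg hh]
      have := mul_le_of_le_one_left (norm_nonneg ξ) hh1
      linarith
    have hδw : ‖δ • w‖ ≤ δ * (2 * K) := by
      rw [norm_smul, Real.norm_of_nonneg hδ0.le]; gcongr
    have hδ2 : C₁ * δ ^ 2 ≤ C₁ * δ := by
      have : δ ^ 2 ≤ δ := pow_le_of_le_one hδ0.le (by linarith) two_ne_zero
      gcongr
    have hΔb : ‖Δ‖ ≤ δ * (2 * K + C₁) := by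
      have : ‖Δ‖ ≤ ‖Δ - δ • w‖ + ‖δ • w‖ := by simpa using norm_add_le (Δ - δ • w) (δ • w)
      linarith
    have t1 : ⟪Δ, M x' t Δ⟫_ℝ ≤ δ ^ 2 * ⟪w, M x' t w⟫_ℝ +
        C₂ * (2 * K + (2 * K + C₁)) * C₁ * δ ^ 3 := by
      have e1 := (le_abs_self _).trans (abs_quadratic_sub_le (δ • w) Δ (M x' t))
      have e2 : ⟪δ • w, M x' t (δ • w)⟫_ℝ = δ ^ 2 * ⟪w, M x' t w⟫_ℝ := by
        rw [map_smul, inner_smul_left, inner_smul_right]; simp; ring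
      have e3 : ‖M x' t‖ * (‖δ • w‖ + ‖Δ‖) * ‖Δ - δ • w‖ ≤
          C₂ * (δ * (2 * K) + δ * (2 * K + C₁)) * (C₁ * δ ^ 2) := by gcongr
      rw [e2] at e1
      linarith
    -- expand the metric at the sheared point
    have t2 : ⟪w, M x' t w⟫_ℝ ≤ energy M (Y 0) t + 2 * h * (⟪p, ξ⟫_ℝ + s * ⟪q, ξ⟫_ℝ)
        + Ch * h ^ 2 := by
      set D := fderiv ℝ (fun y => M y t) x with hD
      have e : x' - x = (s * h) • ξ := by rw [hx']; abel
      have hshh : s * h ≤ h := mul_le_of_le_one_left hh (by linarith)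
      have ex : ‖x' - x‖ ≤ K * h := by
        rw [e, norm_smul, Real.norm_of_nonneg hsh, mul_comm K]
        gcongr
      have f1 : ‖M x' t - M x t - (s * h) • D ξ‖ ≤ C₃ * (K * h) ^ 2 := by
        have e1 := hMt x x' t hxb' hx'b ht htR'
        rw [← map_smul, ← e]
        exact e1.trans (by gcongr)
      have hMv : M x t v = p := metric_dualMetric hM x ht p
      have g2 : ⟪v, M x t v⟫_ℝ = energy M (Y 0) t := by
        rw [← hE, hMv, energy, real_inner_comm]
      have g3 : ⟪v, D ξ v⟫_ℝ = 2 * ⟪q, ξ⟫_ℝ := by rw [hq, inner_metricForce]; ring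
      have g4 : ⟪ξ, M x t v⟫_ℝ = ⟪p, ξ⟫_ℝ := by rw [hMv, real_inner_comm]
      have g5 : ⟪v, M x t ξ⟫_ℝ = ⟪p, ξ⟫_ℝ := by rw [← hM.symm x t ht, hMv]
      have hdiff' : ‖M x' t - M x t‖ ≤ C₄ * K * h := by
        have : ∀ z ∈ segment ℝ x x', ‖z‖ ≤ C₁ + |R| + 1 := fun z hz => by
          have := (convex_closedBall (0 : Vec n) (C₁ + |R| + 1)).segment_subset (x := x) (y := x')
            (by simpa using hxb') (by simpa using hx'b) hz
          simpa using this
        have := (convex_segment x x').norm_image_sub_le_of_norm_hasFDerivWithin_le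
          (f := fun z => M z t) (f' := fun z => fderiv ℝ (fun y => M y t) z) (C := C₄)
          (fun z _ => (SmoothHalf.hasFDerivAt (F := M) hM.smooth z ht).hasFDerivWithinAt)
          (fun z hz => (hMd z z t t (this z hz) (this z hz) ht htR' ht htR').1)
          (left_mem_segment ℝ x x') (right_mem_segment ℝ x x')
        refine this.trans ?_
        rw [mul_assoc]
        gcongr
      have := quadratic_expansion_le (M x t) (M x' t) (D ξ) v ξ hh hC₂.le hC₃.le hC₄.le hK0.le hM'
        f1 hdiff' hvK hξK
      rw [g2, g3, g4, g5] at this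
      linarith
    -- telescoping
    have t3 : |(s + δ) * ⟪(Y (s + δ)).2, ξ⟫_ℝ - s * ⟪p, ξ⟫_ℝ - δ * (⟪p, ξ⟫_ℝ + s * ⟪q, ξ⟫_ℝ)|
        ≤ 2 * C₁ * K * δ ^ 2 := by
      have e : (s + δ) * ⟪(Y (s + δ)).2, ξ⟫_ℝ - s * ⟪p, ξ⟫_ℝ - δ * (⟪p, ξ⟫_ℝ + s * ⟪q, ξ⟫_ℝ) =
          s * ⟪(Y (s + δ)).2 - p - δ • q, ξ⟫_ℝ + δ * ⟪(Y (s + δ)).2 - p, ξ⟫_ℝ := by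
        simp only [inner_sub_left, inner_smul_left, conj_trivial]; ring
      rw [e]
      refine (abs_add_le _ _).trans ?_
      rw [abs_mul, abs_mul, abs_of_nonneg hs0, abs_of_nonneg hδ0.le]
      have e1 : |⟪(Y (s + δ)).2 - p - δ • q, ξ⟫_ℝ| ≤ C₁ * δ ^ 2 * K :=
        (abs_real_inner_le_norm _ _).trans (by gcongr)
      have e2 : |⟪(Y (s + δ)).2 - p, ξ⟫_ℝ| ≤ C₁ * δ * K :=
        (abs_real_inner_le_norm _ _).trans (by gcongr)
      have e3 : s * |⟪(Y (s + δ)).2 - p - δ • q, ξ⟫_ℝ| ≤ 1 * (C₁ * δ ^ 2 * K) := by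
        gcongr; linarith
      have e4 : δ * |⟪(Y (s + δ)).2 - p, ξ⟫_ℝ| ≤ δ * (C₁ * δ * K) := by gcongr
      linarith
    refine t1.trans ?_
    have m1 := mul_le_mul_of_nonneg_left t2 (sq_nonneg δ)
    have m2 := (abs_le.1 t3).1
    have m3 := mul_le_mul_of_nonneg_left m2 (by positivity : 0 ≤ 2 * h * δ)
    have m4 : h * (C₁ * K * δ ^ 3) ≤ C₁ * K * δ ^ 3 :=
      mul_le_of_le_one_left (by positivity) hh1
    rw [hCd]
    linarith
  have hsum := Finset.sum_le_sum key
  rw [chainEnergy]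
  have hg : ∑ i ∈ Finset.range N, (g (i + 1) - g i) = ⟪(Y 1).2, ξ⟫_ℝ := by
    rw [Finset.sum_range_sub]
    simp [g, hN'.ne']
  have hsum2 := mul_le_mul_of_nonneg_left hsum hN'.le
  refine hsum2.trans ?_
  simp only [Finset.sum_add_distrib, Finset.sum_const, Finset.card_range, nsmul_eq_mul,
    ← Finset.mul_sum, hg]
  have hNδ : (N : ℝ) * δ = 1 := by rw [hδ]; field_simp
  have e : (N : ℝ) * (N * (δ ^ 2 * energy M (Y 0) t) + 2 * h * δ * ⟪(Y 1).2, ξ⟫_ℝ +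
      N * (Ch * δ ^ 2 * h ^ 2) + N * (Cd * δ ^ 3)) =
      (N * δ) ^ 2 * energy M (Y 0) t + 2 * h * (N * δ) * ⟪(Y 1).2, ξ⟫_ℝ +
        (N * δ) ^ 2 * Ch * h ^ 2 + (N * δ) ^ 2 * Cd * δ := by ring
  rw [e, hNδ]
  have hCd0 : 0 ≤ Cd * h ^ 2 := by positivity
  have hCh0 : 0 ≤ Ch * δ := by positivity
  have e3 : (Ch + Cd) / N = Ch * δ + Cd * δ := by rw [hδ]; ring
  rw [e3]
  linarith

end

end CCM

namespace CCM

noncomputable section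

variable {n : ℕ} {M : Vec n → ℝ → Vec n →L[ℝ] Vec n} {α₁ α₂ : ℝ}

/-! ### Minimal chains -/

theorem sum_sq_le_chainEnergy (hM : IsUniformlyBoundedMetric M α₁ α₂) {t : ℝ} (ht : 0 ≤ t) (N : ℕ)
    (y : ℕ → Vec n) :
    α₁ * (N * ∑ i ∈ Finset.range N, ‖y (i + 1) - y i‖ ^ 2) ≤ chainEnergy M t N y := by
  rw [chainEnergy, mul_left_comm, Finset.mul_sum]
  gcongr
  exact hM.lower _ t ht _

/-- Triangle inequality and Cauchy-Schwarz. The bound is independent of `N` and confines chains of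
bounded energy to a ball. -/
theorem norm_chain_sub_sq_le (hM : IsUniformlyBoundedMetric M α₁ α₂) {t : ℝ} (ht : 0 ≤ t) {N i : ℕ}
    (hi : i ≤ N) (y : ℕ → Vec n) : α₁ * ‖y i - y 0‖ ^ 2 ≤ chainEnergy M t N y := by
  refine le_trans (mul_le_mul_of_nonneg_left ?_ hM.pos_lower.le) (sum_sq_le_chainEnergy hM ht N y)
  have h1 : ‖y i - y 0‖ ≤ ∑ j ∈ Finset.range N, ‖y (j + 1) - y j‖ := by
    rw [← Finset.sum_range_sub]
    exact (norm_sum_le _ _).trans (Finset.sum_le_sum_of_subset_of_nonneg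
      (Finset.range_subset_range.2 hi) fun _ _ _ => norm_nonneg _)
  have h2 := sq_sum_le_card_mul_sum_sq (s := Finset.range N) (f := fun j => ‖y (j + 1) - y j‖)
  rw [Finset.card_range] at h2
  exact (pow_le_pow_left₀ (norm_nonneg _) h1 2).trans h2

theorem chainEnergy_straight_le (hM : IsUniformlyBoundedMetric M α₁ α₂) {t : ℝ} (ht : 0 ≤ t)
    {N : ℕ} (hN : 0 < N) (b x : Vec n) :
    chainEnergy M t N (fun i => b + (i / N : ℝ) • (x - b)) ≤ α₂ * ‖x - b‖ ^ 2 := by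
  have hN' : (0 : ℝ) < N := by exact_mod_cast hN
  have h : ∀ i ∈ Finset.range N,
      ⟪b + ((i + 1 : ℕ) / N : ℝ) • (x - b) - (b + (i / N : ℝ) • (x - b)),
        M (b + (i / N : ℝ) • (x - b)) t
          (b + ((i + 1 : ℕ) / N : ℝ) • (x - b) - (b + (i / N : ℝ) • (x - b)))⟫_ℝ
      ≤ (1 / N) ^ 2 * (α₂ * ‖x - b‖ ^ 2) := by
    intro i _
    have e : b + ((i + 1 : ℕ) / N : ℝ) • (x - b) - (b + (i / N : ℝ) • (x - b)) =
        (1 / N : ℝ) • (x - b) := by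
      push_cast
      rw [add_sub_add_left_eq_sub, ← sub_smul]
      congr 1
      field_simp
      ring
    rw [e, map_smul, inner_smul_left, inner_smul_right, ← mul_assoc]
    have := hM.upper (b + (i / N : ℝ) • (x - b)) t ht (x - b)
    simp only [conj_trivial, sq]
    simp only [sq] at this
    gcongr
  refine (mul_le_mul_of_nonneg_left (Finset.sum_le_sum h) hN'.le).trans (le_of_eq ?_)
  simp only [Finset.sum_const, Finset.card_range, nsmul_eq_mul]
  field_simp

theorem continuous_chainEnergy (hM : IsUniformlyBoundedMetric M α₁ α₂) {t : ℝ} (ht : 0 ≤ t)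
    (N : ℕ) : Continuous (chainEnergy M t N) := by
  have hc : Continuous fun x => M x t := SmoothHalf.continuous_slice (F := M) hM.smooth ht
  refine continuous_const.mul (continuous_finsetSum _ fun i _ => ?_)
  have h1 : Continuous fun y : ℕ → Vec n => y (i + 1) - y i := by fun_prop
  exact h1.inner ((hc.comp (continuous_apply i)).clm_apply h1)

/-- Among the chains with given end points there is one of minimal energy. -/
theorem exists_min_chain (hM : IsUniformlyBoundedMetric M α₁ α₂) {t : ℝ} (ht : 0 ≤ t)
    {N : ℕ} (hN : 0 < N) (b x : Vec n) :
    ∃ y : ℕ → Vec n, y 0 = b ∧ y N = x ∧ chainEnergy M t N y ≤ α₂ * ‖x - b‖ ^ 2 ∧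
      ∀ w : ℕ → Vec n, w 0 = b → w N = x → chainEnergy M t N y ≤ chainEnergy M t N w := by
  have hα₁ := hM.pos_lower
  have hα₂ := hM.pos_upper
  set ρ := √(α₂ / α₁) * ‖x - b‖ with hρ
  -- The energy ignores entries beyond `N`, and the intermediate points of a competitive chain lie
  -- in a fixed ball. The search can therefore be restricted to a compact product of fixed end
  -- points and balls.
  let S : ℕ → Set (Vec n) := fun i =>
    if i = 0 then {b} else if i = N then {x} else Metric.closedBall b ρ
  have hS : IsCompact (Set.pi univ S) := isCompact_univ_pi fun i => by
    simp only [S]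
    split_ifs
    · exact isCompact_singleton
    · exact isCompact_singleton
    · exact isCompact_closedBall _ _
  -- every chain of small energy can be moved into the compact set
  have hmove : ∀ w : ℕ → Vec n, w 0 = b → w N = x → chainEnergy M t N w ≤ α₂ * ‖x - b‖ ^ 2 →
      ∃ w' ∈ Set.pi univ S, chainEnergy M t N w' = chainEnergy M t N w := by
    intro w h0 hNx hw
    refine ⟨fun i => if i ≤ N then w i else b, fun i _ => ?_, ?_⟩
    · simp only [S]
      by_cases h1 : i = 0
      · simp [h1, h0]
      by_cases h3 : i = N
      · simp [h3, hN.ne', hNx]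
      rw [if_neg h1, if_neg h3]
      by_cases h2 : i ≤ N
      · rw [if_pos h2]
        have h7 := norm_chain_sub_sq_le hM ht h2 w
        rw [mem_closedBall_iff_norm, ← h0, hρ, ← Real.sqrt_sq (norm_nonneg (w i - w 0)),
          ← Real.sqrt_sq (norm_nonneg (x - b)), ← Real.sqrt_mul (by positivity)]
        refine Real.sqrt_le_sqrt ?_
        rw [div_mul_eq_mul_div, le_div_iff₀ hα₁]
        linarith
      · rw [if_neg h2, Metric.mem_closedBall, dist_self]
        positivity
    · simp only [chainEnergy]
      congr 1
      refine Finset.sum_congr rfl fun i hi => ?_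
      have := Finset.mem_range.1 hi
      rw [if_pos (by omega), if_pos (by omega)]
  set st : ℕ → Vec n := fun i => b + (i / N : ℝ) • (x - b) with hst
  have hst0 : st 0 = b := by simp [hst]
  have hstN : st N = x := by
    have : (N : ℝ) ≠ 0 := by exact_mod_cast hN.ne'
    simp [hst, this]
  have hstE := chainEnergy_straight_le hM ht hN b x
  obtain ⟨w₀, hw₀, hw₀E⟩ := hmove st hst0 hstN hstE
  obtain ⟨y, hy, hmin⟩ := hS.exists_isMinOn ⟨w₀, hw₀⟩ (continuous_chainEnergy hM ht N).continuousOn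
  have hy0 : y 0 = b := by simpa [S] using hy 0 (mem_univ _)
  have hyN : y N = x := by simpa [S, hN.ne'] using hy N (mem_univ _)
  have hyE : chainEnergy M t N y ≤ α₂ * ‖x - b‖ ^ 2 := (hmin hw₀).trans (hw₀E.trans_le hstE)
  refine ⟨y, hy0, hyN, hyE, fun w h0 hNx => ?_⟩
  by_cases hw : chainEnergy M t N w ≤ α₂ * ‖x - b‖ ^ 2
  · obtain ⟨w', hw', hE⟩ := hmove w h0 hNx hw
    rw [← hE]; exact hmin hw'
  · exact hyE.trans (not_le.1 hw).le

/-- The discrete Euler–Lagrange equation of a minimal chain. -/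
theorem discrete_euler_lagrange (hM : IsUniformlyBoundedMetric M α₁ α₂) {t : ℝ} (ht : 0 ≤ t)
    {N : ℕ} {y : ℕ → Vec n}
    (hmin : ∀ w : ℕ → Vec n, w 0 = y 0 → w N = y N → chainEnergy M t N y ≤ chainEnergy M t N w)
    {k : ℕ} (hk : k + 1 < N) :
    (N : ℝ) • M (y (k + 1)) t (y (k + 2) - y (k + 1)) =
      (N : ℝ) • M (y k) t (y (k + 1) - y k) +
        (N : ℝ) • metricForce M (y (k + 1)) (y (k + 2) - y (k + 1)) t := by
  have hN : (0 : ℝ) < N := by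
    have : 0 < N := by omega
    exact_mod_cast this
  rw [← smul_add]
  congr 1
  refine ext_inner_right ℝ fun ξ => ?_
  let G : ℝ → ℝ := fun ε => ⟪y (k + 1) + ε • ξ - y k, M (y k) t (y (k + 1) + ε • ξ - y k)⟫_ℝ +
    ⟪y (k + 2) - (y (k + 1) + ε • ξ),
      M (y (k + 1) + ε • ξ) t (y (k + 2) - (y (k + 1) + ε • ξ))⟫_ℝ
  have hG : ∀ ε, G 0 ≤ G ε := by
    intro ε
    -- Only one inner vertex is moved, so only the two links meeting at it change; `G` is their
    -- contribution to the energy without the factor `N`.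
    set w := Function.update y (k + 1) (y (k + 1) + ε • ξ) with hw
    have hwk : w k = y k := Function.update_of_ne (by omega) _ _
    have hwk1 : w (k + 1) = y (k + 1) + ε • ξ := Function.update_self _ _ _
    have hwk2 : w (k + 2) = y (k + 2) := Function.update_of_ne (by omega) _ _
    have h1 := hmin w (Function.update_of_ne (by omega) _ _) (Function.update_of_ne (by omega) _ _)
    have h2 := le_of_mul_le_mul_left h1 hN
    rw [← sub_nonneg, ← Finset.sum_sub_distrib] at h2
    rw [← Finset.sum_subset (s₁ := {k, k + 1}) (fun i hi => by
      simp only [Finset.mem_insert, Finset.mem_singleton] at hi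
      rw [Finset.mem_range]; omega) (fun i _ hi => by
      simp only [Finset.mem_insert, Finset.mem_singleton, not_or] at hi
      have e1 : w i = y i := Function.update_of_ne (by omega) _ _
      have e2 : w (i + 1) = y (i + 1) := Function.update_of_ne (by omega) _ _
      rw [e1, e2, sub_self]), Finset.sum_pair (by omega)] at h2
    simp only [add_assoc, Nat.reduceAdd, hwk, hwk1, hwk2] at h2
    simp only [G, zero_smul, add_zero]
    linarith
  have hloc : IsLocalMin G 0 := Filter.Eventually.of_forall hG
  -- derivative of `G`
  have hline : HasDerivAt (fun ε : ℝ => y (k + 1) + ε • ξ) ξ 0 := by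
    simpa using ((hasDerivAt_id (0 : ℝ)).smul_const ξ).const_add (y (k + 1))
  have hD := SmoothHalf.hasFDerivAt (F := M) hM.smooth (y (k + 1)) ht
  have hMl : HasDerivAt (fun ε : ℝ => M (y (k + 1) + ε • ξ) t)
      (fderiv ℝ (fun z => M z t) (y (k + 1)) ξ) 0 := by
    refine HasFDerivAt.comp_hasDerivAt (0 : ℝ) (f := fun ε : ℝ => y (k + 1) + ε • ξ)
      (l := fun z => M z t) ?_ hline
    simpa using hD
  have h1 : HasDerivAt (fun ε : ℝ => y (k + 1) + ε • ξ - y k) ξ 0 := hline.sub_const _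
  have h2 : HasDerivAt (fun ε : ℝ => y (k + 2) - (y (k + 1) + ε • ξ)) (-ξ) 0 := by
    simpa using hline.const_sub (y (k + 2))
  have h3 := h1.inner ℝ ((hasDerivAt_const (0 : ℝ) (M (y k) t)).clm_apply h1)
  have h4 := h2.inner ℝ (hMl.clm_apply h2)
  have h5 := hloc.hasDerivAt_eq_zero (h3.add h4)
  simp only [zero_smul, add_zero, _root_.zero_apply, zero_add, map_neg, inner_neg_left,
    inner_neg_right, inner_add_right] at h5
  have e1 : ⟪y (k + 1) - y k, M (y k) t ξ⟫_ℝ = ⟪M (y k) t (y (k + 1) - y k), ξ⟫_ℝ :=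
    (hM.symm _ t ht _ _).symm
  have e2 : ⟪y (k + 2) - y (k + 1), M (y (k + 1)) t ξ⟫_ℝ =
    ⟪M (y (k + 1)) t (y (k + 2) - y (k + 1)), ξ⟫_ℝ := (hM.symm _ t ht _ _).symm
  rw [e1, e2, real_inner_comm (M (y k) t (y (k + 1) - y k)),
    real_inner_comm (M (y (k + 1)) t (y (k + 2) - y (k + 1)))] at h5
  rw [inner_add_left, inner_metricForce]
  linarith

end

end CCM

namespace CCM

noncomputable section

variable {n : ℕ} {M : Vec n → ℝ → Vec n →L[ℝ] Vec n} {α₁ α₂ : ℝ}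

/-! ### Minimal chains approximate cogeodesics -/

/-- Discrete Grönwall estimate for two approximate Euler orbits: each step adds at most `2a` to the
distance and multiplies what was there by at most `1 + hL`. -/
theorem discrete_compare {E : Type*} [NormedAddCommGroup E] [NormedSpace ℝ E] {X : E → E}
    {Y Z : ℕ → E} {K : ℕ} {h L a : ℝ} (hh : 0 ≤ h) (hL : 0 ≤ L) (ha : 0 ≤ a) (h0 : Y 0 = Z 0)
    (hlip : ∀ k < K, ‖X (Y k) - X (Z k)‖ ≤ L * ‖Y k - Z k‖)
    (hY : ∀ k < K, ‖Y (k + 1) - Y k - h • X (Y k)‖ ≤ a)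
    (hZ : ∀ k < K, ‖Z (k + 1) - Z k - h • X (Z k)‖ ≤ a) :
    ∀ k ≤ K, ‖Y k - Z k‖ ≤ k * (2 * a) * (1 + h * L) ^ k := by
  intro k
  induction k with
  | zero => intro _; simp [h0]
  | succ k ih =>
    intro hk
    have hk' : k < K := hk
    have ihk := ih hk'.le
    have hhL : 0 ≤ h * L := mul_nonneg hh hL
    have e : Y (k + 1) - Z (k + 1) = (Y (k + 1) - Y k - h • X (Y k)) -
        (Z (k + 1) - Z k - h • X (Z k)) + ((Y k - Z k) + h • (X (Y k) - X (Z k))) := by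
      rw [smul_sub]; abel
    have h1 : ‖h • (X (Y k) - X (Z k))‖ ≤ h * (L * ‖Y k - Z k‖) := by
      rw [norm_smul, Real.norm_of_nonneg hh]
      exact mul_le_mul_of_nonneg_left (hlip k hk') hh
    have h2 : ‖Y (k + 1) - Z (k + 1)‖ ≤ 2 * a + (1 + h * L) * ‖Y k - Z k‖ := by
      rw [e]
      have n1 := norm_add_le ((Y (k + 1) - Y k - h • X (Y k)) - (Z (k + 1) - Z k - h • X (Z k)))
        ((Y k - Z k) + h • (X (Y k) - X (Z k)))
      have n2 := norm_sub_le (Y (k + 1) - Y k - h • X (Y k)) (Z (k + 1) - Z k - h • X (Z k))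
      have n3 := norm_add_le (Y k - Z k) (h • (X (Y k) - X (Z k)))
      have n4 := hY k hk'
      have n5 := hZ k hk'
      linarith
    have h3 : 1 ≤ (1 + h * L) ^ (k + 1) := one_le_pow₀ (by linarith)
    have h4 : (1 + h * L) * ‖Y k - Z k‖ ≤ (1 + h * L) * (k * (2 * a) * (1 + h * L) ^ k) :=
      mul_le_mul_of_nonneg_left ihk (by linarith)
    have h5 : 2 * a ≤ 2 * a * (1 + h * L) ^ (k + 1) := le_mul_of_one_le_right (by linarith) h3
    refine h2.trans ?_
    have e2 : ((k + 1 : ℕ) : ℝ) * (2 * a) * (1 + h * L) ^ (k + 1) =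
      (1 + h * L) * (k * (2 * a) * (1 + h * L) ^ k) + 2 * a * (1 + h * L) ^ (k + 1) := by
      push_cast; ring
    rw [e2]; linarith

theorem norm_metricForce_le (x v : Vec n) (t : ℝ) :
    ‖metricForce M x v t‖ ≤ 1 / 2 * ‖fderiv ℝ (fun y => M y t) x‖ * ‖v‖ ^ 2 := by
  set q := metricForce M x v t
  rcases (norm_nonneg q).eq_or_lt with h | h
  · rw [← h]; positivity
  have h1 := inner_metricForce (M := M) x v q t
  rw [real_inner_self_eq_norm_sq] at h1
  have h2 := (le_abs_self _).trans (abs_inner_apply_le v v (fderiv ℝ (fun y => M y t) x q))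
  have h3 := (fderiv ℝ (fun y => M y t) x).le_opNorm q
  have h4 : ‖fderiv ℝ (fun y => M y t) x q‖ * ‖v‖ * ‖v‖ ≤
      ‖fderiv ℝ (fun y => M y t) x‖ * ‖q‖ * ‖v‖ * ‖v‖ := by gcongr
  have h5 : ‖q‖ * ‖q‖ ≤ 1 / 2 * ‖fderiv ℝ (fun y => M y t) x‖ * ‖v‖ ^ 2 * ‖q‖ := by
    change ‖q‖ ^ 2 = _ at h1
    linarith
  exact le_of_mul_le_mul_right h5 h

set_option maxHeartbeats 1600000 in
/-- A minimal chain is close to a cogeodesic. -/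
theorem exists_cogeod_near_min_chain (hM : IsUniformlyBoundedMetric M α₁ α₂) (R : ℝ) :
    ∃ C, 0 < C ∧ ∀ t, 0 ≤ t → t ≤ R → ∀ b x : Vec n, ‖b‖ ≤ R → ‖x‖ ≤ R → ∀ (N : ℕ), 0 < N →
      ∀ y : ℕ → Vec n, y 0 = b → y N = x → chainEnergy M t N y ≤ α₂ * ‖x - b‖ ^ 2 →
      (∀ w : ℕ → Vec n, w 0 = b → w N = x → chainEnergy M t N y ≤ chainEnergy M t N w) →
      ∃ p, ‖p‖ ≤ C ∧ ‖x - expMap M t b p‖ ≤ C / N ∧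
        energy M (b, p) t ≤ chainEnergy M t N y + C / N := by
  have hα₁ := hM.pos_lower
  have hα₂ := hM.pos_upper
  set E₀ := α₂ * (2 * R) ^ 2 with hE₀
  have hE₀0 : 0 ≤ E₀ := by positivity
  set R₁ := |R| + √(E₀ / α₁) with hR₁
  have hRR₁ : R ≤ R₁ := (le_abs_self R).trans (by simp [hR₁])
  obtain ⟨D, hD, hDb⟩ := (SmoothHalf.fderiv (F := M) hM.smooth).bounded_lipschitz R₁
  set P := √(α₂ * E₀) + 1 / 2 * D * (E₀ / α₁) with hP
  have hP0 : 0 ≤ P := by positivity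
  set R₂ := R₁ + P with hR₂
  obtain ⟨C₁, hC₁, hstep⟩ := IsCogeodesic.exists_step hM R₂
  set R₃ := R₂ + C₁ with hR₃
  obtain ⟨L, hL, hlip⟩ := (smoothHalf_hamField hM).bounded_lipschitz R₃
  obtain ⟨Le, hLe, hlipe⟩ := (smoothHalf_energy hM).bounded_lipschitz R₃
  have hR₁0 : 0 ≤ R₁ := by positivity
  set a₀ := L * L + C₁ with ha₀
  set C₃ := 2 * a₀ * Real.exp L with hC₃
  refine ⟨P + (C₃ + L + C₁) + Le * C₃, by positivity,
    fun t ht htR b x hb hx N hN y hy0 hyN hyE hmin => ?_⟩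
  have hN' : (0 : ℝ) < N := by exact_mod_cast hN
  have hxb : ‖x - b‖ ≤ 2 * R := (norm_sub_le _ _).trans (by linarith)
  have hyE' : chainEnergy M t N y ≤ E₀ := hyE.trans (by rw [hE₀]; gcongr)
  set v : ℕ → Vec n := fun k => (N : ℝ) • (y (k + 1) - y k) with hv
  set p : ℕ → Vec n := fun k => M (y k) t (v k) with hp
  have hsum := (sum_sq_le_chainEnergy hM ht N y).trans hyE'
  have hypos : ∀ k ≤ N, ‖y k‖ ≤ R₁ := by
    intro k hk
    have h1 := (norm_chain_sub_sq_le hM ht hk y).trans hyE'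
    have h2 : ‖y k - y 0‖ ≤ √(E₀ / α₁) := by
      rw [← Real.sqrt_sq (norm_nonneg (y k - y 0))]
      exact Real.sqrt_le_sqrt (by rw [le_div_iff₀ hα₁]; linarith)
    have h3 := norm_add_le (y k - y 0) (y 0)
    rw [sub_add_cancel] at h3
    have : ‖y 0‖ ≤ |R| := by rw [hy0]; exact hb.trans (le_abs_self R)
    linarith
  have hen : ∀ k, energy M (y k, p k) t =
      N * (N * ⟪y (k + 1) - y k, M (y k) t (y (k + 1) - y k)⟫_ℝ) := by
    intro k
    simp only [energy, hp, hv, dualMetric_metric hM _ ht, map_smul, inner_smul_left,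
      inner_smul_right, conj_trivial]
    rw [hM.symm _ t ht]
  -- an index of at most average energy
  obtain ⟨j, hjN, hj⟩ : ∃ j ∈ Finset.range N, energy M (y j, p j) t ≤ chainEnergy M t N y := by
    refine Finset.exists_le_of_sum_le (s := Finset.range N) ⟨0, Finset.mem_range.2 hN⟩ ?_
    simp only [hen, Finset.sum_const, Finset.card_range, nsmul_eq_mul, chainEnergy]
    rw [← Finset.mul_sum, ← Finset.mul_sum]
  have hjN' := Finset.mem_range.1 hjN
  have hpj : ‖p j‖ ≤ √(α₂ * E₀) := by
    have h1 := le_energy hM (y j, p j) ht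
    rw [div_le_iff₀ hα₂] at h1
    rw [← Real.sqrt_sq (norm_nonneg (p j))]
    refine Real.sqrt_le_sqrt (h1.trans ?_)
    rw [mul_comm]
    gcongr
    exact hj.trans hyE'
  -- In the covectors `p k = M(y k) v k` the discrete Euler-Lagrange equation is an Euler step for
  -- the momentum whose force is evaluated at the next vertex.
  have hdp : ∀ k, k + 1 < N → p (k + 1) - p k =
      (1 / N : ℝ) • metricForce M (y (k + 1)) (v (k + 1)) t := by
    intro k hk
    have h1 := discrete_euler_lagrange hM ht (y := y) (by rwa [hy0, hyN]) hk
    simp only [hp, hv, map_smul, metricForce_smul] at h1 ⊢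
    rw [show k + 1 + 1 = k + 2 from rfl, h1, add_sub_cancel_left, smul_smul]
    congr 1
    field_simp
  have hdpn : ∀ k, k + 1 < N → ‖p (k + 1) - p k‖ ≤
      1 / 2 * D * (N * ‖y (k + 2) - y (k + 1)‖ ^ 2) := by
    intro k hk
    rw [hdp k hk, norm_smul, Real.norm_of_nonneg (by positivity)]
    have h1 := norm_metricForce_le (M := M) (y (k + 1)) (v (k + 1)) t
    have h2 : ‖fderiv ℝ (fun y => M y t) (y (k + 1))‖ ≤ D :=
      (hDb _ 0 t t (hypos _ hk.le) (by simpa using hR₁0) ht (htR.trans hRR₁) ht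
        (htR.trans hRR₁)).1
    have h3 : ‖v (k + 1)‖ = N * ‖y (k + 2) - y (k + 1)‖ := by
      simp only [hv]; rw [norm_smul, Real.norm_of_nonneg hN'.le]
    rw [h3] at h1
    calc 1 / (N : ℝ) * ‖metricForce M (y (k + 1)) (v (k + 1)) t‖
        ≤ 1 / N * (1 / 2 * D * (N * ‖y (k + 2) - y (k + 1)‖) ^ 2) := by
          gcongr; exact h1.trans (by gcongr)
      _ = _ := by field_simp
  -- One momentum, at an index of at most average energy, is bounded. The force is quadratic in the
  -- velocity, so the total variation of the momenta is controlled by the total energy, and hence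
  -- all of them are bounded uniformly in `N`.
  have hpb : ∀ k < N, ‖p k‖ ≤ P := by
    have key : ∀ i k, i ≤ k → k < N → ‖p k - p i‖ ≤ 1 / 2 * D * (E₀ / α₁) := by
      intro i k hik hk
      have h1 : ‖p k - p i‖ ≤ ∑ l ∈ Finset.Ico i k, ‖p (l + 1) - p l‖ := by
        rw [← Finset.sum_Ico_sub _ hik]; exact norm_sum_le _ _
      have h2 : ∑ l ∈ Finset.Ico i k, ‖p (l + 1) - p l‖ ≤
          ∑ l ∈ Finset.Ico i k, 1 / 2 * D * (N * ‖y (l + 2) - y (l + 1)‖ ^ 2) :=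
        Finset.sum_le_sum fun l hl => hdpn l (by have := (Finset.mem_Ico.1 hl).2; omega)
      have h3 : ∑ l ∈ Finset.Ico i k, ‖y (l + 2) - y (l + 1)‖ ^ 2 ≤
          ∑ l ∈ Finset.range N, ‖y (l + 1) - y l‖ ^ 2 := by
        rw [Finset.sum_Ico_add' (fun l => ‖y (l + 1) - y l‖ ^ 2) i k 1]
        refine Finset.sum_le_sum_of_subset_of_nonneg ?_ fun _ _ _ => by positivity
        intro l hl
        rw [Finset.mem_Ico] at hl
        rw [Finset.mem_range]; omega
      refine h1.trans (h2.trans ?_)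
      rw [← Finset.mul_sum, ← Finset.mul_sum]
      have h4 : N * ∑ l ∈ Finset.Ico i k, ‖y (l + 2) - y (l + 1)‖ ^ 2 ≤ E₀ / α₁ := by
        rw [le_div_iff₀ hα₁]
        have : N * ∑ l ∈ Finset.Ico i k, ‖y (l + 2) - y (l + 1)‖ ^ 2 ≤
          N * ∑ l ∈ Finset.range N, ‖y (l + 1) - y l‖ ^ 2 := by gcongr
        linarith [mul_le_mul_of_nonneg_right this hα₁.le]
      gcongr
    intro k hk
    have h1 : ‖p k - p j‖ ≤ 1 / 2 * D * (E₀ / α₁) := by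
      rcases le_total j k with h | h
      · exact key j k h hk
      · rw [norm_sub_rev]; exact key k j h hjN'
    have h2 := norm_add_le (p k - p j) (p j)
    rw [sub_add_cancel] at h2
    linarith
  set Y : ℕ → Vec n × Vec n := fun k => (y k, p k) with hY
  have hYb : ∀ k < N, ‖Y k‖ ≤ R₂ := by
    intro k hk
    rw [Prod.norm_def]
    exact max_le ((hypos k hk.le).trans (by linarith)) ((hpb k hk).trans (by linarith))
  have htR₃ : t ≤ R₃ := by linarith
  have hXb : ∀ k < N, ‖hamField M (Y k) t‖ ≤ L := fun k hk =>
    (hlip _ 0 t t ((hYb k hk).trans (by linarith)) (by rw [norm_zero]; linarith) ht htR₃ ht htR₃).1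
  have hΔ : ∀ k, y (k + 1) - y k = (1 / N : ℝ) • (hamField M (Y k) t).1 := by
    intro k
    simp only [hamField, hY, hp, dualMetric_metric hM _ ht, hv]
    rw [smul_smul, one_div_mul_cancel hN'.ne', one_smul]
  have hΔp : ∀ k, k + 1 < N → p (k + 1) - p k = (1 / N : ℝ) • (hamField M (Y (k + 1)) t).2 := by
    intro k hk
    rw [hdp k hk]
    simp only [hamField, hY, hp, dualMetric_metric hM _ ht]
  have hΔn : ∀ k < N, ‖y (k + 1) - y k‖ ≤ L / N := by
    intro k hk
    rw [hΔ, norm_smul, Real.norm_of_nonneg (by positivity), one_div, inv_mul_eq_div]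
    gcongr
    exact (norm_fst_le_norm _).trans (hXb k hk)
  have hΔpn : ∀ k, k + 1 < N → ‖p (k + 1) - p k‖ ≤ L / N := by
    intro k hk
    rw [hΔp k hk, norm_smul, Real.norm_of_nonneg (by positivity), one_div, inv_mul_eq_div]
    gcongr
    exact (norm_snd_le_norm _).trans (hXb _ hk)
  -- The positions satisfy the Euler step exactly. The momentum uses the force at `k + 1`, which
  -- differs from that at `k` by `O(1/N)`.
  have hYstep : ∀ k < N - 1, ‖Y (k + 1) - Y k - (1 / N : ℝ) • hamField M (Y k) t‖ ≤
      a₀ / N ^ 2 := by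
    intro k hk
    have hk' : k + 1 < N := by omega
    have h1 : (Y (k + 1) - Y k - (1 / N : ℝ) • hamField M (Y k) t).1 = 0 := by
      simp only [Prod.fst_sub, Prod.smul_fst]
      exact sub_eq_zero.2 (hΔ k)
    have h2 : (Y (k + 1) - Y k - (1 / N : ℝ) • hamField M (Y k) t).2 =
        (1 / N : ℝ) • (hamField M (Y (k + 1)) t - hamField M (Y k) t).2 := by
      simp only [Prod.snd_sub, Prod.smul_snd, smul_sub]
      rw [← hΔp k hk']
    have h3 := (hlip (Y (k + 1)) (Y k) t t ((hYb _ hk').trans (by linarith))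
      ((hYb k (by omega)).trans (by linarith)) ht htR₃ ht htR₃).2
    rw [sub_self, abs_zero, add_zero] at h3
    have h4 : ‖Y (k + 1) - Y k‖ ≤ L / N := by
      rw [Prod.norm_def]
      exact max_le (hΔn k (by omega)) (hΔpn k hk')
    rw [Prod.norm_def, h1, h2, norm_zero, norm_smul, Real.norm_of_nonneg (by positivity)]
    refine max_le (by positivity) ?_
    have h5 : ‖(hamField M (Y (k + 1)) t - hamField M (Y k) t).2‖ ≤ L * (L / N) :=
      (norm_snd_le_norm _).trans (h3.trans (by gcongr))
    calc 1 / (N : ℝ) * ‖(hamField M (Y (k + 1)) t - hamField M (Y k) t).2‖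
        ≤ 1 / N * (L * (L / N)) := by gcongr
      _ = L * L / N ^ 2 := by field_simp
      _ ≤ a₀ / N ^ 2 := by gcongr; rw [ha₀]; linarith
  set Z := cogeod M t b (p 0) with hZ
  have hZg := isCogeodesic_cogeod hM ht b (p 0)
  have hZ0 : Z 0 = Y 0 := by simp only [hZ, cogeod_zero hM ht, hY, hy0]
  have hZ0n : ‖Z 0‖ ≤ R₂ := by rw [hZ0]; exact hYb 0 hN
  have htR₂ : t ≤ R₂ := by linarith
  have hmem : ∀ k : ℕ, k < N → (k / N : ℝ) + 1 / N ≤ 1 := by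
    intro k hk
    rw [← add_div, div_le_one hN']
    exact_mod_cast hk
  have hZs : ∀ k < N, _ := fun k hk =>
    hstep t ht htR₂ Z hZg hZ0n (k / N) (1 / N) (by positivity) (by positivity) (hmem k hk)
  -- Only `N - 1` steps are compared because the momentum equation holds at inner vertices only; the
  -- last link is estimated directly.
  have hcmp := discrete_compare (X := fun Y => hamField M Y t) (Y := Y)
    (Z := fun k => Z (k / N)) (K := N - 1) (h := 1 / N) (L := L) (a := a₀ / N ^ 2)
    (by positivity) hL.le (by positivity) (by simp [hZ0])
    (fun k hk => by
      have := (hlip (Y k) (Z (k / N)) t t ((hYb k (by omega)).trans (by linarith))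
        ((hZs k (by omega)).1.trans (by linarith)) ht htR₃ ht htR₃).2
      simpa using this) hYstep
    (fun k hk => by
      have := (hZs k (by omega)).2.2.2
      have e : ((k + 1 : ℕ) / N : ℝ) = k / N + 1 / N := by push_cast; ring
      rw [e]
      refine this.trans ?_
      rw [one_div, inv_pow, ← div_eq_mul_inv]
      gcongr
      rw [ha₀]; nlinarith)
  have hclose : ∀ k < N, ‖Y k - Z (k / N)‖ ≤ C₃ / N := by
    intro k hk
    refine (hcmp k (by omega)).trans ?_
    have hkN : (k : ℝ) ≤ N := by exact_mod_cast hk.le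
    have h1 : (1 + 1 / (N : ℝ) * L) ^ k ≤ Real.exp L := by
      have h2 : 1 + 1 / (N : ℝ) * L ≤ Real.exp (1 / N * L) := by
        have := Real.add_one_le_exp (1 / (N : ℝ) * L); linarith
      refine (pow_le_pow_left₀ (by positivity) h2 k).trans ?_
      rw [← Real.exp_nat_mul, Real.exp_le_exp]
      rw [← mul_assoc, mul_one_div]
      exact mul_le_of_le_one_left hL.le (by rw [div_le_one hN']; exact hkN)
    calc (k : ℝ) * (2 * (a₀ / N ^ 2)) * (1 + 1 / N * L) ^ k
        ≤ N * (2 * (a₀ / N ^ 2)) * Real.exp L := by gcongr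
      _ = C₃ / N := by rw [hC₃]; field_simp
  have hC₃0 : 0 ≤ C₃ := by positivity
  refine ⟨p 0, (hpb 0 hN).trans (by
    have : 0 ≤ Le * C₃ := by positivity
    linarith), ?_, ?_⟩
  · have hlast : N - 1 < N := by omega
    have eN : N - 1 + 1 = N := by omega
    have h1 := hclose (N - 1) hlast
    have h2 := hΔn (N - 1) hlast
    have h3 := (hZs (N - 1) hlast).2.2.1
    have e : (((N - 1 : ℕ) : ℝ) / N : ℝ) + 1 / N = 1 := by
      rw [Nat.cast_sub hN]; field_simp; push_cast; ring
    rw [e] at h3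
    rw [eN, hyN] at h2
    have h4 := (norm_fst_le_norm (Y (N - 1) - Z ((N - 1 : ℕ) / N))).trans h1
    have h5 := (norm_fst_le_norm (Z 1 - Z ((N - 1 : ℕ) / N))).trans h3
    have e2 : x - expMap M t b (p 0) = (x - y (N - 1)) + (Y (N - 1) - Z ((N - 1 : ℕ) / N)).1 -
        (Z 1 - Z ((N - 1 : ℕ) / N)).1 := by
      simp only [expMap, hZ, hY, Prod.fst_sub]; abel
    rw [e2]
    have h6 := norm_sub_le ((x - y (N - 1)) + (Y (N - 1) - Z ((N - 1 : ℕ) / N)).1)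
      (Z 1 - Z ((N - 1 : ℕ) / N)).1
    have h7 := norm_add_le (x - y (N - 1)) (Y (N - 1) - Z ((N - 1 : ℕ) / N)).1
    have h8 : L / N + C₃ / N + C₁ * (1 / N) ≤ (P + (C₃ + L + C₁) + Le * C₃) / N := by
      rw [mul_one_div, ← add_div, ← add_div]
      have : 0 ≤ Le * C₃ := by positivity
      exact div_le_div_of_nonneg_right (by linarith) hN'.le
    linarith
  -- The energy is compared at the index of at most average energy and then carried back to
  -- parameter zero by conservation along `Z`.
  · have h1 := hclose j hjN'
    have h2 := (hlipe (Y j) (Z (j / N)) t t ((hYb j hjN').trans (by linarith))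
        ((hZs j hjN').1.trans (by linarith)) ht htR₃ ht htR₃).2
    rw [sub_self, abs_zero, add_zero] at h2
    have h3 := hZg.energy_eq hM ht (s := j / N) ⟨by positivity, by
      have := hmem j hjN'
      have h0 : (0 : ℝ) ≤ 1 / N := by positivity
      linarith⟩
    rw [← hZ] at h3
    have h4 : energy M (Z 0) t = energy M (b, p 0) t := by rw [hZ, cogeod_zero hM ht]
    have h5 : Le * ‖Y j - Z (j / N)‖ ≤ Le * (C₃ / N) := by gcongr
    have h6 := (abs_le.1 (h2.trans h5)).1
    have h7 : Le * (C₃ / N) ≤ (P + (C₃ + L + C₁) + Le * C₃) / N := by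
      rw [← mul_div_assoc]
      gcongr
      linarith
    change energy M (Y j) t ≤ _ at hj
    linarith

theorem expMap_lipschitz (hM : IsUniformlyBoundedMetric M α₁ α₂) (R : ℝ) :
    ∃ C, 0 < C ∧ ∀ t t', 0 ≤ t → t ≤ R → 0 ≤ t' → t' ≤ R → ∀ b b' p p' : Vec n,
      ‖b‖ ≤ R → ‖b'‖ ≤ R → ‖p‖ ≤ R → ‖p'‖ ≤ R →
      ‖expMap M t b p - expMap M t' b' p'‖ ≤ C * (‖b - b'‖ + ‖p - p'‖ + |t - t'|) := by
  obtain ⟨C, hC, h⟩ := IsCogeodesic.exists_lipschitz hM R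
  refine ⟨C, hC, fun t t' ht htR ht' htR' b b' p p' hb hb' hp hp' => ?_⟩
  have h1 := h t t' ht htR ht' htR' _ _ (isCogeodesic_cogeod hM ht b p)
    (isCogeodesic_cogeod hM ht' b' p') (by
      rw [cogeod_zero hM ht, Prod.norm_def]; exact max_le hb hp) (by
      rw [cogeod_zero hM ht', Prod.norm_def]; exact max_le hb' hp') 1 ⟨zero_le_one, le_rfl⟩
  rw [cogeod_zero hM ht, cogeod_zero hM ht'] at h1
  refine ((norm_fst_le_norm (_ - _)).trans h1).trans ?_
  have : ‖((b, p) - (b', p') : Vec n × Vec n)‖ ≤ ‖b - b'‖ + ‖p - p'‖ := by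
    rw [Prod.norm_def]
    exact max_le (by simp) (by simp)
  gcongr

theorem continuous_expMap (hM : IsUniformlyBoundedMetric M α₁ α₂) {t : ℝ} (ht : 0 ≤ t)
    (b : Vec n) : Continuous (expMap M t b) := by
  refine continuous_iff_continuousAt.2 fun p => ?_
  obtain ⟨C, hC, h⟩ := expMap_lipschitz hM (max t (max ‖b‖ (‖p‖ + 1)))
  have h2 : ∀ᶠ p' in 𝓝 p, ‖expMap M t b p' - expMap M t b p‖ ≤ C * ‖p' - p‖ := by
    filter_upwards [Metric.ball_mem_nhds p one_pos] with p' hp'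
    have h3 : ‖p'‖ ≤ ‖p‖ + 1 := by
      have := norm_add_le (p' - p) p
      rw [sub_add_cancel] at this
      have := mem_ball_iff_norm.1 hp'
      linarith
    have := h t t ht (le_max_left _ _) ht (le_max_left _ _) b b p' p (by simp) (by simp)
      (by simp [h3]) (by simp)
    simpa using this
  rw [ContinuousAt, tendsto_iff_norm_sub_tendsto_zero]
  refine squeeze_zero' (Eventually.of_forall fun _ => norm_nonneg _) h2 ?_
  have : Tendsto (fun p' : Vec n => C * ‖p' - p‖) (𝓝 p) (𝓝 (C * ‖p - p‖)) :=
    (by fun_prop : Continuous fun p' : Vec n => C * ‖p' - p‖).tendsto p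
  simpa using this

/-- If chains from `b` to `x` have asymptotic energy at most `e`, then so has some cogeodesic. -/
theorem exists_expMap_of_chains (hM : IsUniformlyBoundedMetric M α₁ α₂) {t : ℝ} (ht : 0 ≤ t)
    {b x : Vec n} {e : ℝ}
    (h : ∀ ε > 0, ∀ N₀ : ℕ, ∃ N ≥ N₀, ∃ y : ℕ → Vec n, y 0 = b ∧ y N = x ∧
      chainEnergy M t N y ≤ e + ε) :
    ∃ p, expMap M t b p = x ∧ energy M (b, p) t ≤ e := by
  obtain ⟨C, hC, hnear⟩ := exists_cogeod_near_min_chain hM (max t (max ‖b‖ ‖x‖))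
  -- A minimal chain has no more energy than the given one and lies near a cogeodesic. The initial
  -- covectors are bounded uniformly in `N`, so a subsequence converges.
  have key : ∀ k : ℕ, ∃ p, p ∈ Metric.closedBall (0 : Vec n) C ∧
      ‖x - expMap M t b p‖ ≤ C * (1 / (k + 1)) ∧
      energy M (b, p) t ≤ e + (1 + C) * (1 / (k + 1)) := by
    intro k
    obtain ⟨N, hN, w, hw0, hwN, hwE⟩ := h (1 / (k + 1)) (by positivity) (k + 1)
    have hN0 : 0 < N := by omega
    obtain ⟨y, hy0, hyN, hyE, hmin⟩ := exists_min_chain hM ht hN0 b x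
    obtain ⟨p, hp, hpx, hpE⟩ := hnear t ht (le_max_left _ _) b x (by simp) (by simp) N hN0 y hy0
      hyN hyE hmin
    have hNk : C / (N : ℝ) ≤ C * (1 / (k + 1)) := by
      rw [mul_one_div]
      gcongr
      exact_mod_cast hN
    have := hmin w hw0 hwN
    exact ⟨p, by simpa using hp, hpx.trans hNk, by linarith⟩
  choose p hpb hpx hpE using key
  obtain ⟨q, -, φ, hφ, hq⟩ := (isCompact_closedBall (0 : Vec n) C).tendsto_subseq hpb
  have hlim : Tendsto (fun k : ℕ => 1 / ((φ k : ℝ) + 1)) atTop (𝓝 0) :=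
    tendsto_one_div_add_atTop_nhds_zero_nat.comp hφ.tendsto_atTop
  refine ⟨q, ?_, ?_⟩
  · have h1 := (((continuous_expMap hM ht b).tendsto q).comp hq).const_sub x |>.norm
    have h2 := le_of_tendsto_of_tendsto' h1 (hlim.const_mul C) (fun k => hpx (φ k))
    rw [mul_zero] at h2
    exact (sub_eq_zero.1 (norm_le_zero_iff.1 h2)).symm
  · have hc : Continuous fun p => energy M (b, p) t :=
      ((smoothHalf_energy hM).continuous_slice ht).comp (by fun_prop)
    have h1 := (hc.tendsto q).comp hq
    have h2 := le_of_tendsto_of_tendsto' h1 ((hlim.const_mul (1 + C)).const_add e)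
      (fun k => hpE (φ k))
    simpa using h2

end

end CCM

namespace CCM

noncomputable section

variable {n : ℕ} {M : Vec n → ℝ → Vec n →L[ℝ] Vec n} {α₁ α₂ : ℝ}

/-! ### The squared Riemannian distance -/

/-- The squared Riemannian distance from `b` to `x` for the metric frozen at time `t`. -/
def sqDist (M : Vec n → ℝ → Vec n →L[ℝ] Vec n) (t : ℝ) (b x : Vec n) : ℝ :=
  sInf {e | ∃ p, expMap M t b p = x ∧ energy M (b, p) t = e}

/-- `p` is the initial covector of a minimal geodesic from `b` to `x`. -/
def IsMinCovector (M : Vec n → ℝ → Vec n →L[ℝ] Vec n) (t : ℝ) (b x p : Vec n) : Prop :=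
  expMap M t b p = x ∧ energy M (b, p) t = sqDist M t b x

theorem chainEnergy_cogeod_le (hM : IsUniformlyBoundedMetric M α₁ α₂) (R : ℝ) :
    ∃ C, 0 < C ∧ ∀ t, 0 ≤ t → t ≤ R → ∀ Y, IsCogeodesic M t Y → ‖Y 0‖ ≤ R → ∀ N : ℕ, 0 < N →
      chainEnergy M t N (fun i => (Y (i / N)).1) ≤ energy M (Y 0) t + C / N := by
  obtain ⟨C, hC, h⟩ := chainEnergy_sheared_le hM R
  refine ⟨C, hC, fun t ht htR Y hY h0 N hN => ?_⟩
  have := h t ht htR Y hY h0 0 (by rw [norm_zero]; exact (norm_nonneg _).trans h0) 0 le_rfl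
    zero_le_one N hN
  simpa using this

theorem sqDist_le_energy (hM : IsUniformlyBoundedMetric M α₁ α₂) {t : ℝ} (ht : 0 ≤ t)
    {b x p : Vec n} (hp : expMap M t b p = x) : sqDist M t b x ≤ energy M (b, p) t :=
  csInf_le ⟨0, by rintro e ⟨q, -, rfl⟩; exact energy_nonneg hM _ ht⟩ ⟨p, hp, rfl⟩

theorem exists_nat_div_le (C : ℝ) {ε : ℝ} (hε : 0 < ε) (N₀ : ℕ) :
    ∃ N : ℕ, N₀ ≤ N ∧ 0 < N ∧ C / N ≤ ε := by
  obtain ⟨N, hN⟩ := exists_nat_gt (C / ε)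
  refine ⟨max N (N₀ + 1), by omega, by omega, ?_⟩
  have h0 : (0 : ℝ) < (max N (N₀ + 1) : ℕ) := by
    have : 0 < max N (N₀ + 1) := by omega
    exact_mod_cast this
  rw [div_le_iff₀ h0, mul_comm, ← div_le_iff₀ hε]
  exact hN.le.trans (by exact_mod_cast le_max_left _ _)

theorem exists_expMap_of_chains' (hM : IsUniformlyBoundedMetric M α₁ α₂) {t : ℝ} (ht : 0 ≤ t)
    {b x : Vec n} {e C : ℝ}
    (h : ∀ N : ℕ, 0 < N → ∃ y : ℕ → Vec n, y 0 = b ∧ y N = x ∧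
      chainEnergy M t N y ≤ e + C / N) :
    ∃ p, expMap M t b p = x ∧ energy M (b, p) t ≤ e := by
  refine exists_expMap_of_chains hM ht fun ε hε N₀ => ?_
  obtain ⟨N, hN, hN0, hNε⟩ := exists_nat_div_le C hε N₀
  obtain ⟨y, h0, h1, hy⟩ := h N hN0
  exact ⟨N, hN, y, h0, h1, hy.trans (by linarith)⟩

/-- The device behind the upper bounds for the distance: it suffices to exhibit chains, which can be
sheared, interpolated, concatenated, or carried along by the control system. -/
theorem sqDist_le_of_chains (hM : IsUniformlyBoundedMetric M α₁ α₂) {t : ℝ} (ht : 0 ≤ t)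
    {b x : Vec n} {e C : ℝ}
    (h : ∀ N : ℕ, 0 < N → ∃ y : ℕ → Vec n, y 0 = b ∧ y N = x ∧
      chainEnergy M t N y ≤ e + C / N) : sqDist M t b x ≤ e := by
  obtain ⟨p, hp, he⟩ := exists_expMap_of_chains' hM ht h
  exact (sqDist_le_energy hM ht hp).trans he

theorem exists_expMap_energy_le (hM : IsUniformlyBoundedMetric M α₁ α₂) {t : ℝ} (ht : 0 ≤ t)
    (b x : Vec n) : ∃ p, expMap M t b p = x ∧ energy M (b, p) t ≤ α₂ * ‖x - b‖ ^ 2 := by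
  refine exists_expMap_of_chains' (C := 0) hM ht fun N hN => ⟨_, ?_, ?_,
    (chainEnergy_straight_le hM ht hN b x).trans (by simp)⟩
  · simp
  · have : (N : ℝ) ≠ 0 := by exact_mod_cast hN.ne'
    simp [this]

/-- A Hopf-Rinow statement. Nearly minimal cogeodesics are sampled to chains, and the limit produced
by `exists_expMap_of_chains` attains the infimum. -/
theorem exists_isMinCovector (hM : IsUniformlyBoundedMetric M α₁ α₂) {t : ℝ} (ht : 0 ≤ t)
    (b x : Vec n) : ∃ p, IsMinCovector M t b x p := by
  obtain ⟨p₀, hp₀, -⟩ := exists_expMap_energy_le hM ht b x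
  obtain ⟨p, hp, he⟩ : ∃ p, expMap M t b p = x ∧ energy M (b, p) t ≤ sqDist M t b x := by
    refine exists_expMap_of_chains hM ht fun ε hε N₀ => ?_
    obtain ⟨e, ⟨p, hp, rfl⟩, he⟩ := exists_lt_of_csInf_lt
      (s := {e | ∃ p, expMap M t b p = x ∧ energy M (b, p) t = e}) ⟨_, p₀, hp₀, rfl⟩
      (show sqDist M t b x < sqDist M t b x + ε / 2 by linarith)
    have hY := isCogeodesic_cogeod hM ht b p
    obtain ⟨C, hC, h⟩ := chainEnergy_cogeod_le hM (max t ‖cogeod M t b p 0‖)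
    obtain ⟨N, hN, hN0, hNε⟩ := exists_nat_div_le C (half_pos hε) N₀
    have hN1 : (N : ℝ) ≠ 0 := by exact_mod_cast hN0.ne'
    refine ⟨N, hN, _, ?_, ?_, (h t ht (le_max_left _ _) _ hY (le_max_right _ _) N hN0).trans ?_⟩
    · simp [cogeod_zero hM ht]
    · simp only [div_self hN1]; exact hp
    · rw [cogeod_zero hM ht]; linarith
  exact ⟨p, hp, le_antisymm he (sqDist_le_energy hM ht hp)⟩

theorem sqDist_le (hM : IsUniformlyBoundedMetric M α₁ α₂) {t : ℝ} (ht : 0 ≤ t)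
    (b x : Vec n) : sqDist M t b x ≤ α₂ * ‖x - b‖ ^ 2 := by
  obtain ⟨p, hp, he⟩ := exists_expMap_energy_le hM ht b x
  exact (sqDist_le_energy hM ht hp).trans he

theorem sqDist_nonneg (hM : IsUniformlyBoundedMetric M α₁ α₂) {t : ℝ} (ht : 0 ≤ t)
    (b x : Vec n) : 0 ≤ sqDist M t b x := by
  obtain ⟨p, hp, he⟩ := exists_isMinCovector hM ht b x
  rw [← he]; exact energy_nonneg hM _ ht

theorem IsMinCovector.norm_le (hM : IsUniformlyBoundedMetric M α₁ α₂) {t : ℝ} (ht : 0 ≤ t)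
    {b x p : Vec n} (hp : IsMinCovector M t b x p) : ‖p‖ ≤ α₂ * ‖x - b‖ := by
  have h1 := le_energy hM (b, p) ht
  rw [hp.2] at h1
  have h2 := h1.trans (sqDist_le hM ht b x)
  have := hM.pos_upper
  rw [div_le_iff₀ this] at h2
  refine le_of_sq_le_sq ?_ (by positivity)
  simp only at h2
  nlinarith

theorem le_sqDist (hM : IsUniformlyBoundedMetric M α₁ α₂) {t : ℝ} (ht : 0 ≤ t)
    (b x : Vec n) : α₁ * ‖x - b‖ ^ 2 ≤ sqDist M t b x := by
  obtain ⟨p, hp, he⟩ := exists_isMinCovector hM ht b x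
  have hY := isCogeodesic_cogeod hM ht b p
  obtain ⟨C, hC, h⟩ := chainEnergy_cogeod_le hM (max t ‖cogeod M t b p 0‖)
  refine le_of_forall_pos_le_add fun ε hε => ?_
  obtain ⟨N, hN, hN0, hNε⟩ := exists_nat_div_le C hε 0
  have hN1 : (N : ℝ) ≠ 0 := by exact_mod_cast hN0.ne'
  have h1 := h t ht (le_max_left _ _) _ hY (le_max_right _ _) N hN0
  have h2 := norm_chain_sub_sq_le hM ht (le_refl N) (fun i => (cogeod M t b p (i / N)).1)
  simp only [div_self hN1, Nat.cast_zero, zero_div, cogeod_zero hM ht] at h2 h1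
  rw [expMap] at hp
  rw [hp] at h2
  linarith

theorem sqDist_self (hM : IsUniformlyBoundedMetric M α₁ α₂) {t : ℝ} (ht : 0 ≤ t)
    (b : Vec n) : sqDist M t b b = 0 :=
  le_antisymm (by simpa using sqDist_le hM ht b b) (sqDist_nonneg hM ht b b)

-- A minimal geodesic for the old data is displaced by the affine interpolation of the two end point
-- displacements. Each link changes by `O((d + |t' - t|)/N²)`, where `d` is the total displacement;
-- `N` links and the factor `N` leave a bound independent of `N`.
set_option maxHeartbeats 800000 in
theorem sqDist_lipschitz (hM : IsUniformlyBoundedMetric M α₁ α₂) (R : ℝ) :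
    ∃ C, 0 < C ∧ ∀ t t', 0 ≤ t → t ≤ R → 0 ≤ t' → t' ≤ R → ∀ b b' x x' : Vec n,
      ‖b‖ ≤ R → ‖b'‖ ≤ R → ‖x‖ ≤ R → ‖x'‖ ≤ R →
      sqDist M t' b' x' ≤ sqDist M t b x + C * (‖b' - b‖ + ‖x' - x‖ + |t' - t|) := by
  have hα₂ := hM.pos_upper
  obtain ⟨C₁, hC₁, hstep⟩ := IsCogeodesic.exists_step hM (max R (α₂ * (2 * R)))
  obtain ⟨C₂, hC₂, hchain⟩ := chainEnergy_cogeod_le hM (max R (α₂ * (2 * R)))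
  obtain ⟨C₃, hC₃, hlip⟩ := SmoothHalf.bounded_lipschitz (F := M) hM.smooth (C₁ + 4 * |R|)
  refine ⟨C₃ * (2 * C₁ + 4 * |R|) + C₃ * C₁ ^ 2, by positivity,
    fun t t' ht htR ht' htR' b b' x x' hb hb' hx hx' => ?_⟩
  obtain ⟨p, hp⟩ := exists_isMinCovector hM ht b x
  have hR : 0 ≤ R := ht.trans htR
  rw [abs_of_nonneg hR] at *
  have hpn : ‖p‖ ≤ α₂ * (2 * R) := (hp.norm_le hM ht).trans (by
    gcongr; exact (norm_sub_le _ _).trans (by linarith))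
  set Y := cogeod M t b p with hYdef
  have hY := isCogeodesic_cogeod hM ht b p
  have hY0 : ‖Y 0‖ ≤ max R (α₂ * (2 * R)) := by
    rw [hYdef, cogeod_zero hM ht, Prod.norm_def]
    exact max_le_max hb hpn
  have htm : t ≤ max R (α₂ * (2 * R)) := htR.trans (le_max_left _ _)
  set d := ‖b' - b‖ + ‖x' - x‖ with hd
  have hd0 : 0 ≤ d := by positivity
  have hdR : d ≤ 4 * R := by
    have := norm_sub_le b' b
    have := norm_sub_le x' x
    linarith
  refine sqDist_le_of_chains (C := C₂) hM ht' fun N hN => ?_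
  have hN' : (0 : ℝ) < N := by exact_mod_cast hN
  let y : ℕ → Vec n := fun i => (Y (i / N)).1
  let y' : ℕ → Vec n := fun i =>
    y i + ((b' - b) + (i / N : ℝ) • ((x' - x) - (b' - b)))
  have hy0 : y 0 = b := by simp [y, hYdef, cogeod_zero hM ht]
  have hyN : y N = x := by
    have := hp.1
    simp only [y, div_self hN'.ne']
    exact this
  refine ⟨y', by simp [y', hy0], by simp [y', hyN, div_self hN'.ne'], ?_⟩
  have hch := hchain t ht htm Y hY hY0 N hN
  have he : energy M (Y 0) t = sqDist M t b x := by
    rw [hYdef, cogeod_zero hM ht]; exact hp.2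
  rw [he] at hch
  have hterm : ∀ i ∈ Finset.range N, ⟪y' (i + 1) - y' i, M (y' i) t' (y' (i + 1) - y' i)⟫_ℝ ≤
      ⟪y (i + 1) - y i, M (y i) t (y (i + 1) - y i)⟫_ℝ +
        (C₃ * (2 * C₁ + 4 * R) + C₃ * C₁ ^ 2) * (d + |t' - t|) / N ^ 2 := by
    intro i hi
    have hiN : i < N := Finset.mem_range.1 hi
    have hi1 : (i / N : ℝ) + 1 / N ≤ 1 := by
      rw [← add_div, div_le_one hN']
      exact_mod_cast hiN
    have hi0 : (0 : ℝ) ≤ i / N := by positivity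
    have hi2 : (i / N : ℝ) ≤ 1 := by
      have : (0 : ℝ) ≤ 1 / N := by positivity
      linarith
    obtain ⟨s1, -, s3, -⟩ := hstep t ht htm Y hY hY0 (i / N) (1 / N) hi0 (by positivity) hi1
    have ei : ((i + 1 : ℕ) / N : ℝ) = i / N + 1 / N := by push_cast; ring
    set Δ := y (i + 1) - y i with hΔ
    have hΔn : ‖Δ‖ ≤ C₁ / N := by
      rw [← mul_one_div]
      simp only [hΔ, y, ei]
      exact (norm_fst_le_norm (_ - _)).trans s3
    set η := (x' - x) - (b' - b) with hη
    have hηn : ‖η‖ ≤ d := (norm_sub_le _ _).trans (by rw [hd]; linarith)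
    have hΔ' : y' (i + 1) - y' i = Δ + (1 / N : ℝ) • η := by
      simp only [y', hΔ, ei, add_smul]; abel
    have hyn : ‖y i‖ ≤ C₁ := (norm_fst_le_norm _).trans s1
    have hyd : ‖y' i - y i‖ ≤ d := by
      have : y' i - y i = (1 - i / N : ℝ) • (b' - b) + (i / N : ℝ) • (x' - x) := by
        simp only [y', add_sub_cancel_left, smul_sub, sub_smul, one_smul]; abel
      rw [this]
      refine (norm_add_le _ _).trans ?_
      rw [norm_smul, norm_smul, Real.norm_of_nonneg hi0, Real.norm_of_nonneg (by linarith)]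
      have := mul_le_of_le_one_left (norm_nonneg (b' - b)) (show 1 - (i / N : ℝ) ≤ 1 by linarith)
      have := mul_le_of_le_one_left (norm_nonneg (x' - x)) hi2
      linarith
    have hyn' : ‖y' i‖ ≤ C₁ + 4 * R := by
      have := norm_add_le (y' i - y i) (y i)
      rw [sub_add_cancel] at this
      linarith
    obtain ⟨l1, l2⟩ := hlip (y' i) (y i) t' t hyn' (by linarith) ht' (by linarith) ht
      (by linarith)
    have q1 := (le_abs_self _).trans (abs_quadratic_sub_le Δ (Δ + (1 / N : ℝ) • η) (M (y' i) t'))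
    have q2 := (le_abs_self _).trans (abs_inner_apply_le Δ Δ (M (y' i) t' - M (y i) t))
    rw [_root_.sub_apply, inner_sub_right] at q2
    have hη2 : ‖(1 / N : ℝ) • η‖ ≤ d / N := by
      rw [norm_smul, Real.norm_of_nonneg (by positivity), one_div, inv_mul_eq_div]
      gcongr
    have hΔη : ‖Δ + (1 / N : ℝ) • η‖ ≤ C₁ / N + 4 * R / N := by
      refine (norm_add_le _ _).trans (add_le_add hΔn (hη2.trans ?_))
      gcongr
    have q3 : ‖M (y' i) t'‖ * (‖Δ‖ + ‖Δ + (1 / N : ℝ) • η‖) * ‖Δ + (1 / N : ℝ) • η - Δ‖ ≤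
        C₃ * (C₁ / N + (C₁ / N + 4 * R / N)) * (d / N) := by
      rw [add_sub_cancel_left]
      gcongr
    have q4 : ‖M (y' i) t' - M (y i) t‖ * ‖Δ‖ * ‖Δ‖ ≤
        C₃ * (d + |t' - t|) * (C₁ / N) * (C₁ / N) := by
      gcongr
      exact l2.trans (by gcongr)
    have q5 : C₃ * (C₁ / N + (C₁ / N + 4 * R / N)) * (d / N) ≤
        C₃ * (2 * C₁ + 4 * R) * (d + |t' - t|) / N ^ 2 := by
      rw [show C₃ * (C₁ / N + (C₁ / N + 4 * R / N)) * (d / N) =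
        C₃ * (2 * C₁ + 4 * R) * d / N ^ 2 by field_simp; ring]
      gcongr
      exact le_add_of_nonneg_right (abs_nonneg _)
    have q6 : C₃ * (d + |t' - t|) * (C₁ / N) * (C₁ / N) = C₃ * C₁ ^ 2 * (d + |t' - t|) / N ^ 2 := by
      field_simp
    have q7 : (C₃ * (2 * C₁ + 4 * R) + C₃ * C₁ ^ 2) * (d + |t' - t|) / N ^ 2 =
      C₃ * (2 * C₁ + 4 * R) * (d + |t' - t|) / N ^ 2 +
        C₃ * C₁ ^ 2 * (d + |t' - t|) / N ^ 2 := by ring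
    rw [hΔ', q7]
    linarith
  have hsum := mul_le_mul_of_nonneg_left (Finset.sum_le_sum hterm) hN'.le
  rw [Finset.sum_add_distrib, mul_add, Finset.sum_const, Finset.card_range, nsmul_eq_mul] at hsum
  have e3 : (N : ℝ) * (N * ((C₃ * (2 * C₁ + 4 * R) + C₃ * C₁ ^ 2) * (d + |t' - t|) / N ^ 2)) =
    (C₃ * (2 * C₁ + 4 * R) + C₃ * C₁ ^ 2) * (d + |t' - t|) := by field_simp
  rw [e3] at hsum
  refine hsum.trans ?_
  change chainEnergy M t N y + _ ≤ _
  have : chainEnergy M t N y ≤ sqDist M t b x + C₂ / N := hch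
  linarith

/-- Semiconcavity of the squared distance. -/
theorem sqDist_semiconcave (hM : IsUniformlyBoundedMetric M α₁ α₂) (R : ℝ) :
    ∃ C, 0 < C ∧ ∀ t, 0 ≤ t → t ≤ R → ∀ b x p ξ : Vec n, ‖b‖ ≤ R → ‖x‖ ≤ R → ‖ξ‖ ≤ R →
      IsMinCovector M t b x p → ∀ h, 0 ≤ h → h ≤ 1 →
      sqDist M t b (x + h • ξ) ≤ sqDist M t b x + 2 * h * ⟪(cogeod M t b p 1).2, ξ⟫_ℝ +
        C * h ^ 2 := by
  have hα₂ := hM.pos_upper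
  obtain ⟨C, hC, hs⟩ := chainEnergy_sheared_le hM (max R (α₂ * (2 * R)))
  refine ⟨C, hC, fun t ht htR b x p ξ hb hx hξ hp h hh0 hh1 => ?_⟩
  -- The shear `s ↦ shξ` fixes the base point and moves the end point by exactly `hξ`.
  refine sqDist_le_of_chains (C := C) hM ht fun N hN => ⟨_, ?_, ?_, (hs t ht
    (htR.trans (le_max_left _ _)) _ (isCogeodesic_cogeod hM ht b p) ?_ ξ
    (hξ.trans (le_max_left _ _)) h hh0 hh1 N hN).trans ?_⟩
  · simp [cogeod_zero hM ht]
  · have : (N : ℝ) ≠ 0 := by exact_mod_cast hN.ne'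
    have h1 := hp.1
    simp only [div_self this, one_mul]
    rw [← h1, expMap]
  · rw [cogeod_zero hM ht, Prod.norm_def]
    exact max_le_max hb ((hp.norm_le hM ht).trans (by
      gcongr; exact (norm_sub_le _ _).trans (by linarith)))
  · rw [cogeod_zero hM ht, hp.2]

theorem SmoothHalf.tendsto_comp {E G : Type*} [NormedAddCommGroup E] [NormedSpace ℝ E]
    [NormedAddCommGroup G] [NormedSpace ℝ G] {F : E → ℝ → G} (hF : SmoothHalf F) {ι : Type*}
    {l : Filter ι} {x : ι → E} {t : ι → ℝ} {x₀ : E} {t₀ : ℝ} (hx : Tendsto x l (𝓝 x₀))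
    (ht₀ : 0 ≤ t₀) (ht : Tendsto t l (𝓝 t₀)) (h : ∀ᶠ i in l, 0 ≤ t i) :
    Tendsto (fun i => F (x i) (t i)) l (𝓝 (F x₀ t₀)) := by
  have hc := hF.continuousOn (x₀, t₀) ⟨mem_univ _, ht₀⟩
  have hi : Tendsto (fun i => (x i, t i)) l (𝓝[univ ×ˢ Ici 0] (x₀, t₀)) :=
    tendsto_nhdsWithin_iff.2 ⟨hx.prodMk_nhds ht, h.mono fun i hi => ⟨mem_univ _, hi⟩⟩
  exact Filter.Tendsto.comp (g := fun p : E × ℝ => F p.1 p.2) hc hi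

set_option maxHeartbeats 800000 in
/-- Limits of minimal covectors are minimal. -/
theorem IsMinCovector.of_tendsto (hM : IsUniformlyBoundedMetric M α₁ α₂) {ι : Type*}
    {l : Filter ι} [l.NeBot] {t : ι → ℝ} {b x p : ι → Vec n} {t₀ : ℝ} {b₀ x₀ p₀ : Vec n}
    (ht₀ : 0 ≤ t₀) (ht : ∀ᶠ i in l, 0 ≤ t i) (htl : Tendsto t l (𝓝 t₀))
    (hb : Tendsto b l (𝓝 b₀)) (hx : Tendsto x l (𝓝 x₀)) (hp : Tendsto p l (𝓝 p₀))
    (hmin : ∀ᶠ i in l, IsMinCovector M (t i) (b i) (x i) (p i)) :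
    IsMinCovector M t₀ b₀ x₀ p₀ := by
  set R := max t₀ (max ‖b₀‖ (max ‖x₀‖ ‖p₀‖)) + 1 with hR
  have hR1 : t₀ < R ∧ ‖b₀‖ < R ∧ ‖x₀‖ < R ∧ ‖p₀‖ < R := by
    refine ⟨?_, ?_, ?_, ?_⟩ <;> simp only [hR] <;>
      refine lt_of_le_of_lt ?_ (lt_add_one _) <;> simp
  have hR0 : t₀ ≤ R ∧ ‖b₀‖ ≤ R ∧ ‖x₀‖ ≤ R ∧ ‖p₀‖ ≤ R :=
    ⟨hR1.1.le, hR1.2.1.le, hR1.2.2.1.le, hR1.2.2.2.le⟩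
  clear_value R
  have h1 : ∀ᶠ i in l, t i ≤ R := htl.eventually (eventually_le_nhds hR1.1)
  have h2 : ∀ᶠ i in l, ‖b i‖ ≤ R := hb.norm.eventually (eventually_le_nhds hR1.2.1)
  have h3 : ∀ᶠ i in l, ‖x i‖ ≤ R := hx.norm.eventually (eventually_le_nhds hR1.2.2.1)
  have h4 : ∀ᶠ i in l, ‖p i‖ ≤ R := hp.norm.eventually (eventually_le_nhds hR1.2.2.2)
  obtain ⟨C₁, hC₁, hexp⟩ := expMap_lipschitz hM R
  obtain ⟨C₂, hC₂, hV⟩ := sqDist_lipschitz hM R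
  have hbn : Tendsto (fun i => ‖b₀ - b i‖) l (𝓝 0) := by simpa using (hb.const_sub b₀).norm
  have hxn : Tendsto (fun i => ‖x₀ - x i‖) l (𝓝 0) := by simpa using (hx.const_sub x₀).norm
  have hpn : Tendsto (fun i => ‖p₀ - p i‖) l (𝓝 0) := by simpa using (hp.const_sub p₀).norm
  have htn : Tendsto (fun i => |t₀ - t i|) l (𝓝 0) := by simpa using (htl.const_sub t₀).abs
  have hexp0 : expMap M t₀ b₀ p₀ = x₀ := by
    have e1 : Tendsto (fun i => C₁ * (‖b₀ - b i‖ + ‖p₀ - p i‖ + |t₀ - t i|) + ‖x₀ - x i‖) l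
        (𝓝 0) := by
      simpa using ((((hbn.add hpn).add htn).const_mul C₁).add hxn)
    have e2 : ∀ᶠ i in l, ‖expMap M t₀ b₀ p₀ - x₀‖ ≤
        C₁ * (‖b₀ - b i‖ + ‖p₀ - p i‖ + |t₀ - t i|) + ‖x₀ - x i‖ := by
      filter_upwards [ht, h1, h2, h4, hmin] with i g0 g1 g2 g4 g5
      have := hexp t₀ (t i) ht₀ hR0.1 g0 g1 b₀ (b i) p₀ (p i) hR0.2.1 g2 hR0.2.2.2 g4
      rw [g5.1] at this
      have h7 := norm_sub_le (expMap M t₀ b₀ p₀ - x i) (x₀ - x i)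
      rw [sub_sub_sub_cancel_right] at h7
      linarith
    have := ge_of_tendsto e1 e2
    exact sub_eq_zero.1 (norm_le_zero_iff.1 this)
  refine ⟨hexp0, le_antisymm ?_ (sqDist_le_energy hM ht₀ hexp0)⟩
  have hE : Tendsto (fun i => energy M (b i, p i) (t i)) l (𝓝 (energy M (b₀, p₀) t₀)) := by
    exact (smoothHalf_energy hM).tendsto_comp (hb.prodMk_nhds hp) ht₀ htl ht
  have e1 : Tendsto (fun i => sqDist M t₀ b₀ x₀ + C₂ * (‖b i - b₀‖ + ‖x i - x₀‖ + |t i - t₀|)) l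
      (𝓝 (sqDist M t₀ b₀ x₀)) := by
    have : Tendsto (fun i => sqDist M t₀ b₀ x₀ + C₂ * (‖b₀ - b i‖ + ‖x₀ - x i‖ + |t₀ - t i|)) l
        (𝓝 (sqDist M t₀ b₀ x₀ + C₂ * (0 + 0 + 0))) :=
      (((hbn.add hxn).add htn).const_mul C₂).const_add _
    simpa [norm_sub_rev, abs_sub_comm] using this
  refine le_of_tendsto_of_tendsto hE e1 ?_
  filter_upwards [ht, h1, h2, h3, hmin] with i g0 g1 g2 g3 g5
  rw [g5.2]
  exact hV t₀ (t i) ht₀ hR0.1 g0 g1 b₀ (b i) x₀ (x i) hR0.2.1 g2 hR0.2.2.1 g3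

end

end CCM

namespace CCM

noncomputable section

variable {n : ℕ} {M : Vec n → ℝ → Vec n →L[ℝ] Vec n} {α₁ α₂ : ℝ}

/-! ### Interior points of minimal geodesics -/

/-- The factors arise because each piece is now traversed in a fraction of the unit parameter
interval. -/
theorem chainEnergy_append (t : ℝ) {N₁ N₂ : ℕ} (h₁ : 0 < N₁) (h₂ : 0 < N₂) {y₁ y₂ : ℕ → Vec n}
    (h : y₁ N₁ = y₂ 0) :
    chainEnergy M t (N₁ + N₂) (fun k => if k ≤ N₁ then y₁ k else y₂ (k - N₁)) =
      (N₁ + N₂) / N₁ * chainEnergy M t N₁ y₁ + (N₁ + N₂) / N₂ * chainEnergy M t N₂ y₂ := by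
  have h₁' : (N₁ : ℝ) ≠ 0 := by exact_mod_cast h₁.ne'
  have h₂' : (N₂ : ℝ) ≠ 0 := by exact_mod_cast h₂.ne'
  set w : ℕ → Vec n := fun k => if k ≤ N₁ then y₁ k else y₂ (k - N₁) with hw
  have w1 : ∀ k ≤ N₁, w k = y₁ k := fun k hk => if_pos hk
  have w2 : ∀ k, w (N₁ + k) = y₂ k := by
    intro k
    rcases Nat.eq_zero_or_pos k with rfl | hk
    · rw [add_zero, w1 _ le_rfl, h]
    · simp only [hw]
      rw [if_neg (by omega), Nat.add_sub_cancel_left]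
  simp only [chainEnergy]
  rw [Finset.sum_range_add]
  have e1 : ∑ i ∈ Finset.range N₁, ⟪w (i + 1) - w i, M (w i) t (w (i + 1) - w i)⟫_ℝ =
      ∑ i ∈ Finset.range N₁, ⟪y₁ (i + 1) - y₁ i, M (y₁ i) t (y₁ (i + 1) - y₁ i)⟫_ℝ :=
    Finset.sum_congr rfl fun i hi => by
      have := Finset.mem_range.1 hi
      rw [w1 i this.le, w1 (i + 1) this]
  have e2 : ∑ i ∈ Finset.range N₂, ⟪w (N₁ + i + 1) - w (N₁ + i),
      M (w (N₁ + i)) t (w (N₁ + i + 1) - w (N₁ + i))⟫_ℝ =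
      ∑ i ∈ Finset.range N₂, ⟪y₂ (i + 1) - y₂ i, M (y₂ i) t (y₂ (i + 1) - y₂ i)⟫_ℝ :=
    Finset.sum_congr rfl fun i _ => by rw [add_assoc, w2, w2]
  rw [e1, e2]
  push_cast
  field_simp

/-- Two geodesics are concatenated with the corner at parameter `i/(i + j)`. The parameter is
rational so that both pieces have whole numbers `ki` and `kj` of links. -/
theorem sqDist_le_split (hM : IsUniformlyBoundedMetric M α₁ α₂) {t : ℝ} (ht : 0 ≤ t)
    (b y x : Vec n) {i j : ℕ} (hi : 0 < i) (hj : 0 < j) :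
    sqDist M t b x ≤ (i + j) / i * sqDist M t b y + (i + j) / j * sqDist M t y x := by
  have chains : ∀ b x : Vec n, ∃ C, 0 < C ∧ ∀ N : ℕ, 0 < N → ∃ y : ℕ → Vec n, y 0 = b ∧ y N = x ∧
      chainEnergy M t N y ≤ sqDist M t b x + C / N := by
    intro b x
    obtain ⟨p, hp⟩ := exists_isMinCovector hM ht b x
    obtain ⟨C, hC, h⟩ := chainEnergy_cogeod_le hM (max t ‖cogeod M t b p 0‖)
    refine ⟨C, hC, fun N hN => ⟨_, ?_, ?_, (h t ht (le_max_left _ _) _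
      (isCogeodesic_cogeod hM ht b p) (le_max_right _ _) N hN).trans ?_⟩⟩
    · simp [cogeod_zero hM ht]
    · have hN1 : (N : ℝ) ≠ 0 := by exact_mod_cast hN.ne'
      simp only [div_self hN1]; exact hp.1
    · rw [cogeod_zero hM ht, hp.2]
  obtain ⟨C₁, hC₁, ch₁⟩ := chains b y
  obtain ⟨C₂, hC₂, ch₂⟩ := chains y x
  have hi' : (0 : ℝ) < i := by exact_mod_cast hi
  have hj' : (0 : ℝ) < j := by exact_mod_cast hj
  obtain ⟨p, hp, he⟩ : ∃ p, expMap M t b p = x ∧ energy M (b, p) t ≤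
      (i + j) / i * sqDist M t b y + (i + j) / j * sqDist M t y x := by
    refine exists_expMap_of_chains hM ht fun ε hε N₀ => ?_
    obtain ⟨k, hk, hk0, hkε⟩ := exists_nat_div_le ((i + j) / i * (C₁ / i) + (i + j) / j * (C₂ / j))
      hε N₀
    have hk' : (0 : ℝ) < k := by exact_mod_cast hk0
    obtain ⟨y₁, a1, a2, a3⟩ := ch₁ (k * i) (Nat.mul_pos hk0 hi)
    obtain ⟨y₂, b1, b2, b3⟩ := ch₂ (k * j) (Nat.mul_pos hk0 hj)
    refine ⟨k * i + k * j, le_trans hk (by nlinarith), _, ?_, ?_,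
      (chainEnergy_append t (Nat.mul_pos hk0 hi) (Nat.mul_pos hk0 hj) (a2.trans b1.symm)).trans_le
        ?_⟩
    · simp [a1]
    · have : ¬ (k * i + k * j ≤ k * i) := by
        have := Nat.mul_pos hk0 hj
        omega
      simp only [this, if_false, Nat.add_sub_cancel_left, b2]
    · push_cast at a3 b3 ⊢
      have e1 : ((k : ℝ) * i + k * j) / (k * i) = (i + j) / i := by field_simp
      have e2 : ((k : ℝ) * i + k * j) / (k * j) = (i + j) / j := by field_simp
      rw [e1, e2]
      have g1 := mul_le_mul_of_nonneg_left a3 (show (0 : ℝ) ≤ (i + j) / i by positivity)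
      have g2 := mul_le_mul_of_nonneg_left b3 (show (0 : ℝ) ≤ (i + j) / j by positivity)
      have e3 : ((i + j) / i * (C₁ / i) + (i + j) / j * (C₂ / j)) / k =
        (i + j) / i * (C₁ / (k * i)) + (i + j) / j * (C₂ / (k * j)) := by field_simp
      rw [e3] at hkε
      linarith
  exact (sqDist_le_energy hM ht hp).trans he

theorem continuous_sqDist (hM : IsUniformlyBoundedMetric M α₁ α₂) {t : ℝ} (ht : 0 ≤ t)
    (b : Vec n) : Continuous (sqDist M t b) := by
  refine continuous_iff_continuousAt.2 fun x => ?_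
  obtain ⟨C, hC, h⟩ := sqDist_lipschitz hM (max t (max ‖b‖ (‖x‖ + 1)))
  have h2 : ∀ᶠ y in 𝓝 x, ‖sqDist M t b y - sqDist M t b x‖ ≤ C * ‖y - x‖ := by
    filter_upwards [Metric.ball_mem_nhds x one_pos] with y hy
    have h3 : ‖y‖ ≤ ‖x‖ + 1 := by
      have := norm_add_le (y - x) x
      rw [sub_add_cancel] at this
      have := mem_ball_iff_norm.1 hy
      linarith
    have h4 := h t t ht (le_max_left _ _) ht (le_max_left _ _) b b x y (by simp) (by simp)
      (by simp) (by simp [h3])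
    have h5 := h t t ht (le_max_left _ _) ht (le_max_left _ _) b b y x (by simp) (by simp)
      (by simp [h3]) (by simp)
    rw [norm_sub_rev x y] at h5
    simp only [sub_self, norm_zero, abs_zero, zero_add, add_zero] at h4 h5
    rw [Real.norm_eq_abs, abs_le]
    constructor <;> linarith
  rw [ContinuousAt, tendsto_iff_norm_sub_tendsto_zero]
  refine squeeze_zero' (Eventually.of_forall fun _ => norm_nonneg _) h2 ?_
  have : Tendsto (fun y : Vec n => C * ‖y - x‖) (𝓝 x) (𝓝 (C * ‖x - x‖)) :=
    (by fun_prop : Continuous fun y : Vec n => C * ‖y - x‖).tendsto x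
  simpa using this

theorem energy_smul (x p : Vec n) (t c : ℝ) : energy M (x, c • p) t = c ^ 2 * energy M (x, p) t := by
  simp only [energy, map_smul, inner_smul_left, inner_smul_right, conj_trivial]
  ring

theorem expMap_smul (hM : IsUniformlyBoundedMetric M α₁ α₂) {t : ℝ} (ht : 0 ≤ t) (b p : Vec n)
    {s : ℝ} (hs : s ∈ Icc (0 : ℝ) 1) : expMap M t b (s • p) = (cogeod M t b p s).1 := by
  rw [expMap, cogeod_smul hM ht b p hs ⟨zero_le_one, le_rfl⟩, mul_one]

theorem sqDist_cogeod_end_le (hM : IsUniformlyBoundedMetric M α₁ α₂) {t : ℝ} (ht : 0 ≤ t)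
    (b p : Vec n) {s : ℝ} (hs : s ∈ Icc (0 : ℝ) 1) :
    sqDist M t (cogeod M t b p s).1 (expMap M t b p) ≤ (1 - s) ^ 2 * energy M (b, p) t := by
  have hY := isCogeodesic_cogeod hM ht b p
  have h := (hY.scale hs.1 (c := 1 - s) (by linarith [hs.2]) (by linarith)).eq_cogeod hM ht
    (s := 1) ⟨zero_le_one, le_rfl⟩
  simp only [mul_zero, add_zero, mul_one, add_sub_cancel] at h
  have h1 : expMap M t (cogeod M t b p s).1 ((1 - s) • (cogeod M t b p s).2) =
      expMap M t b p := by
    rw [expMap, h]; rfl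
  refine (sqDist_le_energy hM ht h1).trans (le_of_eq ?_)
  rw [energy_smul, Prod.mk.eta, hY.energy_eq hM ht hs, cogeod_zero hM ht]

/-- The squared distance along a minimal geodesic. -/
theorem IsMinCovector.sqDist_cogeod (hM : IsUniformlyBoundedMetric M α₁ α₂) {t : ℝ} (ht : 0 ≤ t)
    {b x p : Vec n} (hp : IsMinCovector M t b x p) {s : ℝ} (hs : s ∈ Icc (0 : ℝ) 1) :
    sqDist M t b (cogeod M t b p s).1 = s ^ 2 * sqDist M t b x := by
  have hup : ∀ s ∈ Icc (0 : ℝ) 1, sqDist M t b (cogeod M t b p s).1 ≤ s ^ 2 * sqDist M t b x := by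
    intro s hs
    refine (sqDist_le_energy hM ht (expMap_smul hM ht b p hs)).trans (le_of_eq ?_)
    rw [energy_smul, hp.2]
  refine le_antisymm (hup s hs) ?_
  rcases hs.1.eq_or_lt with h0 | h0
  · rw [← h0, cogeod_zero hM ht, sqDist_self hM ht]; simp
  rcases hs.2.eq_or_lt with h1 | h1
  · have := hp.1
    rw [expMap] at this
    rw [h1, this, one_pow, one_mul]
  by_contra hlt
  have hcont : ContinuousOn (fun r => sqDist M t b (cogeod M t b p r).1 - r ^ 2 * sqDist M t b x)
      (Ioo 0 1) := by
    refine ContinuousOn.sub ?_ (by fun_prop)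
    exact (continuous_sqDist hM ht b).comp_continuousOn
      (((isCogeodesic_cogeod hM ht b p).continuousOn.mono Ioo_subset_Icc_self).fst)
  -- Strict inequality is an open condition on the parameter, so it would hold at some rational `σ`.
  -- The split inequality there would give a squared distance smaller than `σ` plus `1 - σ` times
  -- itself.
  have hU := hcont.isOpen_inter_preimage isOpen_Ioo (isOpen_Iio (a := (0 : ℝ)))
  obtain ⟨q, ⟨hq0, hq1⟩, hq⟩ := Rat.denseRange_cast.exists_mem_open hU
    ⟨s, ⟨h0, h1⟩, by simp only [mem_preimage, mem_Iio]; linarith [not_le.1 hlt]⟩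
  have hq0' : 0 < q := by exact_mod_cast hq0
  have hnum : 0 < q.num := Rat.num_pos.2 hq0'
  obtain ⟨i, hi⟩ := Int.eq_ofNat_of_zero_le hnum.le
  have hqe : (q : ℝ) = i / q.den := by
    rw [Rat.cast_def, hi]; simp
  have hden : (0 : ℝ) < q.den := by exact_mod_cast q.den_pos
  have hi0 : 0 < i := by omega
  have hlt1 : i < q.den := by
    rw [hqe, div_lt_one hden] at hq1
    exact_mod_cast hq1
  obtain ⟨j, hj⟩ := Nat.exists_eq_add_of_lt hlt1
  have hdj : (q.den : ℝ) = i + (j + 1 : ℕ) := by rw [hj]; push_cast; ring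
  have hsplit := sqDist_le_split hM ht b (cogeod M t b p q).1 x hi0 (Nat.succ_pos j)
  have h2 := sqDist_cogeod_end_le hM ht b p (s := q) ⟨hq0.le, hq1.le⟩
  rw [hp.1, hp.2] at h2
  simp only [mem_preimage, mem_Iio, sub_neg] at hq
  have hi' : (0 : ℝ) < i := by exact_mod_cast hi0
  have hj' : (0 : ℝ) < (j + 1 : ℕ) := by positivity
  rw [hdj] at hqe
  set σ := (q : ℝ) with hσ
  rw [show (((j + 1 : ℕ) : ℕ) : ℝ) = ((j.succ : ℕ) : ℝ) from rfl] at *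
  have e1 : ((i : ℝ) + (j.succ : ℕ)) / i = 1 / σ := by rw [hqe, one_div_div]
  have e2 : ((i : ℝ) + (j.succ : ℕ)) / (j.succ : ℕ) = 1 / (1 - σ) := by
    rw [hqe]
    field_simp
    ring
  rw [e1, e2] at hsplit
  have hσ1 : 0 < 1 - σ := by linarith
  have g1 : 1 / σ * sqDist M t b (cogeod M t b p σ).1 < 1 / σ * (σ ^ 2 * sqDist M t b x) :=
    mul_lt_mul_of_pos_left hq (by positivity)
  have g2 : 1 / (1 - σ) * sqDist M t (cogeod M t b p σ).1 x ≤
      1 / (1 - σ) * ((1 - σ) ^ 2 * sqDist M t b x) :=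
    mul_le_mul_of_nonneg_left h2 (by positivity)
  have g3 : 1 / σ * (σ ^ 2 * sqDist M t b x) = σ * sqDist M t b x := by field_simp
  have g4 : 1 / (1 - σ) * ((1 - σ) ^ 2 * sqDist M t b x) = (1 - σ) * sqDist M t b x := by
    field_simp
  rw [g3] at g1
  rw [g4] at g2
  linarith

theorem le_of_forall_small {a b C δ : ℝ} (hδ : 0 < δ) (h : ∀ r, 0 < r → r < δ → a ≤ b + C * r) :
    a ≤ b := by
  have h1 : Tendsto (fun r : ℝ => b + C * r) (𝓝[>] 0) (𝓝 b) := by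
    have : Tendsto (fun r : ℝ => b + C * r) (𝓝 0) (𝓝 (b + C * 0)) :=
      (by fun_prop : Continuous fun r : ℝ => b + C * r).tendsto 0
    rw [mul_zero, add_zero] at this
    exact this.mono_left nhdsWithin_le_nhds
  refine ge_of_tendsto h1 ?_
  filter_upwards [Ioo_mem_nhdsGT hδ] with r hr
  exact h r hr.1 hr.2

/-- Two minimal covectors with the same terminal covector agree. -/
theorem eq_of_end_eq (hM : IsUniformlyBoundedMetric M α₁ α₂) {t : ℝ} (ht : 0 ≤ t)
    {b p q : Vec n} (h : cogeod M t b p 1 = cogeod M t b q 1) : p = q := by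
  have := (isCogeodesic_cogeod hM ht b p).eqOn_of_eq_end hM ht (isCogeodesic_cogeod hM ht b q) h
    (x := 0) ⟨le_rfl, zero_le_one⟩
  rw [cogeod_zero hM ht, cogeod_zero hM ht] at this
  exact (Prod.ext_iff.1 this).2

theorem energy_sub (hM : IsUniformlyBoundedMetric M α₁ α₂) {t : ℝ} (ht : 0 ≤ t) (x p q : Vec n) :
    energy M (x, p - q) t =
      energy M (x, p) t - 2 * ⟪p, dualMetric M x t q⟫_ℝ + energy M (x, q) t := by
  simp only [energy, map_sub, inner_sub_left, inner_sub_right]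
  have h := dualMetric_symm hM x ht q p
  rw [real_inner_comm] at h
  rw [← h]; ring

theorem eq_zero_of_energy_nonpos (hM : IsUniformlyBoundedMetric M α₁ α₂) {t : ℝ} (ht : 0 ≤ t)
    {x p : Vec n} (h : energy M (x, p) t ≤ 0) : p = 0 := by
  have h1 := (le_energy hM (x, p) ht).trans h
  have := hM.pos_upper
  rw [div_le_iff₀ this, zero_mul] at h1
  exact norm_eq_zero.1 (pow_eq_zero_iff two_ne_zero |>.1 (le_antisymm h1 (sq_nonneg _)))

/-- Interior points of a minimal geodesic have only one minimal covector. -/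
theorem IsMinCovector.eq_smul (hM : IsUniformlyBoundedMetric M α₁ α₂) {t : ℝ} (ht : 0 ≤ t)
    {b x p q : Vec n} (hp : IsMinCovector M t b x p) {s : ℝ} (hs : s ∈ Ioo (0 : ℝ) 1)
    (hq : IsMinCovector M t b (cogeod M t b p s).1 q) : q = s • p := by
  have hsI : s ∈ Icc (0 : ℝ) 1 := Ioo_subset_Icc_self hs
  set Y := cogeod M t b p with hYdef
  have hY := isCogeodesic_cogeod hM ht b p
  set w := dualMetric M (Y s).1 t (Y s).2 with hw
  obtain ⟨C₁, hC₁, hstep⟩ := IsCogeodesic.exists_step hM (max t ‖Y 0‖)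
  have hst := fun h (h0 : 0 ≤ h) (h1 : s + h ≤ 1) =>
    hstep t ht (le_max_left _ _) Y hY (le_max_right _ _) s h hs.1.le h0 h1
  obtain ⟨C₂, hC₂, hsemi⟩ := sqDist_semiconcave hM (max t (max ‖b‖ (max ‖(Y s).1‖ ‖w‖)))
  obtain ⟨C₃, hC₃, hlip⟩ := sqDist_lipschitz hM (max t (max ‖b‖ (C₁ + (‖(Y s).1‖ + ‖w‖))))
  set q₁ := (cogeod M t b q 1).2 with hq₁
  set E := sqDist M t b x with hE
  have hE0 : 0 ≤ E := sqDist_nonneg hM ht b x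
  have hVs : sqDist M t b (Y s).1 = s ^ 2 * E := hp.sqDist_cogeod hM ht hsI
  -- Going on along the geodesic from the interior point, the squared distance is exactly `(s +
  -- h)²E`, while semiconcavity for the covector `q` bounds it by `s²E + 2h⟨q₁, w⟩ + O(h²)`. Letting
  -- `h` tend to zero gives the claim.
  have key : s * E ≤ ⟪q₁, w⟫_ℝ := by
    have h2 : 2 * (s * E) ≤ 2 * ⟪q₁, w⟫_ℝ := by
      refine le_of_forall_small (C := C₂ + C₃ * C₁) (δ := 1 - s) (by linarith [hs.2])
        fun h h0 h1 => ?_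
      obtain ⟨s1, -, -, s4⟩ := hst h h0.le (by linarith)
      have g1 := hsemi t ht (le_max_left _ _) b (Y s).1 q w (by simp) (by simp) (by simp) hq h h0.le
        (by linarith [hs.1])
      have hsh : s + h ∈ Icc (0 : ℝ) 1 := ⟨by linarith [hs.1], by linarith⟩
      have n1 : ‖(Y (s + h)).1‖ ≤ C₁ := by
        have := (hstep t ht (le_max_left _ _) Y hY (le_max_right _ _) (s + h) 0 hsh.1 le_rfl
          (by linarith)).1
        exact (norm_fst_le_norm _).trans this
      have n2 : ‖(Y s).1 + h • w‖ ≤ ‖(Y s).1‖ + ‖w‖ := by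
        refine (norm_add_le _ _).trans (add_le_add le_rfl ?_)
        rw [norm_smul, Real.norm_of_nonneg h0.le]
        exact mul_le_of_le_one_left (norm_nonneg _) (by linarith [hs.1])
      have g2 := hlip t t ht (le_max_left _ _) ht (le_max_left _ _) b b ((Y s).1 + h • w)
        (Y (s + h)).1 (by simp) (by simp)
        (n2.trans (le_max_of_le_right (le_max_of_le_right (by linarith))))
        (n1.trans (le_max_of_le_right (le_max_of_le_right (by
          have := norm_nonneg (Y s).1
          have := norm_nonneg w
          linarith))))
      have n3 : ‖(Y (s + h)).1 - ((Y s).1 + h • w)‖ ≤ C₁ * h ^ 2 := by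
        refine le_trans (le_of_eq ?_) ((norm_fst_le_norm _).trans s4)
        rw [← sub_sub]
        rfl
      rw [hp.sqDist_cogeod hM ht hsh] at g2
      simp only [sub_self, norm_zero, abs_zero, zero_add, add_zero] at g2
      have g3 := mul_le_mul_of_nonneg_left n3 hC₃.le
      rw [hVs] at g1
      have g4 : h * (2 * (s * E)) ≤ h * (2 * ⟪q₁, w⟫_ℝ + (C₂ + C₃ * C₁) * h) := by
        have : 0 ≤ h ^ 2 * E := by positivity
        nlinarith
      exact le_of_mul_le_mul_left g4 h0
    linarith
  have hq1e : cogeod M t b q 1 = ((Y s).1, q₁) := Prod.ext hq.1 rfl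
  have hYe : energy M (Y s) t = E := by
    rw [hY.energy_eq hM ht hsI, cogeod_zero hM ht, hp.2]
  have hqe : energy M ((Y s).1, q₁) t = s ^ 2 * E := by
    rw [← hq1e, (isCogeodesic_cogeod hM ht b q).energy_eq hM ht ⟨zero_le_one, le_rfl⟩,
      cogeod_zero hM ht, hq.2, hVs]
  -- The equality case of Cauchy-Schwarz in the dual metric: both covectors have energy `s²E`, and
  -- by `key` the cross term is large enough to make the energy of their difference nonpositive.
  have hz : q₁ - s • (Y s).2 = 0 := by
    refine eq_zero_of_energy_nonpos hM ht (x := (Y s).1) ?_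
    rw [energy_sub hM ht, hqe, energy_smul, Prod.mk.eta, hYe, map_smul, inner_smul_right, ← hw]
    have := mul_le_mul_of_nonneg_left key hs.1.le
    nlinarith
  refine eq_of_end_eq hM ht (b := b) ?_
  rw [hq1e, cogeod_smul hM ht b p hsI ⟨zero_le_one, le_rfl⟩, mul_one, sub_eq_zero.1 hz]

/-- Where the squared distance is differentiable, the minimal covector is unique. -/
theorem IsMinCovector.eq_of_differentiableAt (hM : IsUniformlyBoundedMetric M α₁ α₂) {t : ℝ}
    (ht : 0 ≤ t) {b x p q : Vec n} (hd : DifferentiableAt ℝ (sqDist M t b) x)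
    (hp : IsMinCovector M t b x p) (hq : IsMinCovector M t b x q) : p = q := by
  have key : ∀ p, IsMinCovector M t b x p → ∀ ξ,
      fderiv ℝ (sqDist M t b) x ξ ≤ 2 * ⟪(cogeod M t b p 1).2, ξ⟫_ℝ := by
    intro p hp ξ
    obtain ⟨C, hC, hsemi⟩ := sqDist_semiconcave hM (max t (max ‖b‖ (max ‖x‖ ‖ξ‖)))
    have hline : HasDerivAt (fun h : ℝ => x + h • ξ) ξ 0 := by
      simpa using ((hasDerivAt_id (0 : ℝ)).smul_const ξ).const_add x
    have h1 : HasDerivAt (fun h : ℝ => sqDist M t b (x + h • ξ)) (fderiv ℝ (sqDist M t b) x ξ) 0 := by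
      refine HasFDerivAt.comp_hasDerivAt (0 : ℝ) (f := fun h : ℝ => x + h • ξ)
        (l := sqDist M t b) ?_ hline
      simpa using hd.hasFDerivAt
    have h2 := h1.tendsto_slope_zero_right
    have h3 : Tendsto (fun h : ℝ => 2 * ⟪(cogeod M t b p 1).2, ξ⟫_ℝ + C * h) (𝓝[>] 0)
        (𝓝 (2 * ⟪(cogeod M t b p 1).2, ξ⟫_ℝ)) := by
      have : Tendsto (fun h : ℝ => 2 * ⟪(cogeod M t b p 1).2, ξ⟫_ℝ + C * h) (𝓝 0)
          (𝓝 (2 * ⟪(cogeod M t b p 1).2, ξ⟫_ℝ + C * 0)) :=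
        (by fun_prop : Continuous fun h : ℝ => 2 * ⟪(cogeod M t b p 1).2, ξ⟫_ℝ + C * h).tendsto 0
      rw [mul_zero, add_zero] at this
      exact this.mono_left nhdsWithin_le_nhds
    refine le_of_tendsto_of_tendsto h2 h3 ?_
    filter_upwards [Ioo_mem_nhdsGT (zero_lt_one' ℝ)] with h hh
    have g := hsemi t ht (le_max_left _ _) b x p ξ (by simp) (by simp) (by simp) hp h hh.1.le
      hh.2.le
    simp only [zero_add, zero_smul, add_zero, smul_eq_mul]
    rw [inv_mul_le_iff₀ hh.1]
    nlinarith
  -- Using both `ξ` and `-ξ` turns the one-sided bound into an equality. The terminal covector is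
  -- half the gradient, which does not depend on the chosen geodesic.
  have heq : ∀ p, IsMinCovector M t b x p → ∀ ξ,
      2 * ⟪(cogeod M t b p 1).2, ξ⟫_ℝ = fderiv ℝ (sqDist M t b) x ξ := by
    intro p hp ξ
    have h1 := key p hp ξ
    have h2 := key p hp (-ξ)
    rw [map_neg, inner_neg_right] at h2
    linarith
  refine eq_of_end_eq hM ht (b := b) (Prod.ext (hp.1.trans hq.1.symm) (ext_inner_right ℝ fun ξ => ?_))
  have h1 := heq p hp ξ
  have h2 := heq q hq ξ
  linarith

end

end CCM

namespace CCM

noncomputable section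

variable {n : ℕ} {M : Vec n → ℝ → Vec n →L[ℝ] Vec n} {α₁ α₂ : ℝ}

/-! ### The derivative of the exponential map -/

/-- Solving for the operator itself gives the whole linearised flow at once; it supplies the
derivative of the geodesic flow. -/
theorem linear_ode_exists {E : Type*} [NormedAddCommGroup E] [NormedSpace ℝ E] [CompleteSpace E]
    {A : ℝ → E →L[ℝ] E} (hA : Continuous A) :
    ∃ Z : ℝ → E →L[ℝ] E, Z 0 = ContinuousLinearMap.id ℝ E ∧
      ∀ s ∈ Icc (0 : ℝ) 1, HasDerivWithinAt Z (A s ∘L Z s) (Icc 0 1) s := by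
  obtain ⟨L, hL⟩ := isCompact_Icc.exists_bound_of_continuousOn (hA.continuousOn (s := Icc (0 : ℝ) 1))
  obtain ⟨Z, hZc, hZ⟩ := caratheodory_exists (fun s (Z : E →L[ℝ] E) => A s ∘L Z)
    (zero_le_one' ℝ) (L := max L 0) (le_max_right _ _) (fun s hs x y => by
      rw [← ContinuousLinearMap.comp_sub]
      refine (ContinuousLinearMap.opNorm_comp_le _ _).trans ?_
      gcongr
      exact (hL s hs).trans (le_max_left _ _))
    (fun y hy => (hA.clm_comp hy).continuousOn.integrableOn_Icc) (ContinuousLinearMap.id ℝ E)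
  refine ⟨Z, by simpa using hZ 0 ⟨le_rfl, zero_le_one⟩, fun s hs => ?_⟩
  have hc : Continuous fun s => A s ∘L Z s := hA.clm_comp hZc
  have h1 : HasDerivAt (fun t => ContinuousLinearMap.id ℝ E + ∫ r in (0 : ℝ)..t, A r ∘L Z r)
      (A s ∘L Z s) s :=
    (intervalIntegral.integral_hasDerivAt_right (hc.intervalIntegrable _ _)
      (hc.stronglyMeasurableAtFilter _ _) hc.continuousAt).const_add _
  exact h1.hasDerivWithinAt.congr (fun t ht => hZ t ht) (hZ s hs)

/-- First-order expansion of the geodesic flow, uniformly on bounded sets. -/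
theorem IsCogeodesic.exists_linearization (hM : IsUniformlyBoundedMetric M α₁ α₂) (R : ℝ) :
    ∃ C, 0 < C ∧ ∀ t, 0 ≤ t → t ≤ R → ∀ Y, IsCogeodesic M t Y → ‖Y 0‖ ≤ R →
      ∃ Z : Vec n × Vec n →L[ℝ] Vec n × Vec n, ∀ Y', IsCogeodesic M t Y' → ‖Y' 0‖ ≤ R →
        ‖Y' 1 - Y 1 - Z (Y' 0 - Y 0)‖ ≤ C * ‖Y' 0 - Y 0‖ ^ 2 := by
  obtain ⟨R', hRR', hR'⟩ := IsCogeodesic.exists_bound hM R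
  obtain ⟨L, hL, hlip⟩ := (smoothHalf_hamField hM).fderiv.bounded_lipschitz R'
  obtain ⟨C₁, hC₁, htay⟩ := (smoothHalf_hamField hM).taylor R'
  obtain ⟨C₂, hC₂, hl⟩ := IsCogeodesic.exists_lipschitz hM R
  refine ⟨C₁ * C₂ ^ 2 / L * (Real.exp L), by positivity, fun t ht htR Y hY h0 => ?_⟩
  have hYc : Continuous fun s : ℝ => Y (projIcc (0 : ℝ) 1 zero_le_one s) :=
    (continuousOn_iff_continuous_domRestrict.1 hY.continuousOn).comp continuous_projIcc
  obtain ⟨Z, hZ0, hZ⟩ := linear_ode_exists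
    (A := fun s => fderiv ℝ (fun y => hamField M y t) (Y (projIcc (0 : ℝ) 1 zero_le_one s)))
    (((smoothHalf_hamField hM).fderiv.continuous_slice ht).comp hYc)
  refine ⟨Z 1, fun Y' hY' h0' => ?_⟩
  set η := Y' 0 - Y 0 with hη
  have hb : ∀ s ∈ Icc (0 : ℝ) 1, ‖Y s‖ ≤ R' := hR' t ht Y hY h0
  have hb' : ∀ s ∈ Icc (0 : ℝ) 1, ‖Y' s‖ ≤ R' := hR' t ht Y' hY' h0'
  have hder : ∀ s ∈ Icc (0 : ℝ) 1, HasDerivWithinAt (fun s => Y' s - Y s - Z s η)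
      (hamField M (Y' s) t - hamField M (Y s) t -
        fderiv ℝ (fun y => hamField M y t) (Y s) (Z s η)) (Icc 0 1) s := by
    intro s hs
    have h1 := (hZ s hs).clm_apply (hasDerivWithinAt_const s (Icc (0 : ℝ) 1) η)
    simp only [map_zero, add_zero, projIcc_of_mem zero_le_one hs,
      ContinuousLinearMap.comp_apply] at h1
    exact ((hY' s hs).sub (hY s hs)).sub h1
  -- The defect starts at zero and satisfies the linearised equation with a Taylor remainder
  -- `O(|η|²)` as forcing.
  have h := norm_le_gronwallBound_of_norm_deriv_right_le (f := fun s => Y' s - Y s - Z s η)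
    (f' := fun s => hamField M (Y' s) t - hamField M (Y s) t -
        fderiv ℝ (fun y => hamField M y t) (Y s) (Z s η)) (δ := 0) (K := L)
    (ε := C₁ * C₂ ^ 2 * ‖η‖ ^ 2) (a := 0) (b := 1) (fun s hs => (hder s hs).continuousWithinAt)
    (fun s hs => hasDerivWithinAt_Ici_of_Icc hs (hder s (Ico_subset_Icc_self hs)))
    (by simp [hZ0, hη])
    (fun s hs => by
      have hs' := Ico_subset_Icc_self hs
      have g1 := htay (Y s) (Y' s) t (hb s hs') (hb' s hs') ht (htR.trans hRR')
      have g2 := hl t t ht htR ht htR Y' Y hY' hY h0' h0 s hs'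
      rw [sub_self, abs_zero, add_zero, ← hη] at g2
      have g3 : C₁ * ‖Y' s - Y s‖ ^ 2 ≤ C₁ * C₂ ^ 2 * ‖η‖ ^ 2 := by
        rw [mul_assoc, ← mul_pow]
        gcongr
      have g4 := (hlip (Y s) (Y s) t t (hb s hs') (hb s hs') ht (htR.trans hRR') ht
        (htR.trans hRR')).1
      have g5 := (fderiv ℝ (fun y => hamField M y t) (Y s)).le_of_opNorm_le g4
        (Y' s - Y s - Z s η)
      have e : hamField M (Y' s) t - hamField M (Y s) t -
          fderiv ℝ (fun y => hamField M y t) (Y s) (Z s η) =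
          (hamField M (Y' s) t - hamField M (Y s) t -
            fderiv ℝ (fun y => hamField M y t) (Y s) (Y' s - Y s)) +
          fderiv ℝ (fun y => hamField M y t) (Y s) (Y' s - Y s - Z s η) := by
        rw [map_sub _ (Y' s - Y s) (Z s η)]; abel
      rw [e]
      refine (norm_add_le _ _).trans ?_
      linarith) 1 ⟨zero_le_one, le_rfl⟩
  refine h.trans ?_
  rw [gronwallBound_of_K_ne_0 hL.ne', sub_zero]
  simp only [mul_one, zero_mul, zero_add]
  have : 0 ≤ C₁ * C₂ ^ 2 / L * ‖η‖ ^ 2 := by positivity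
  rw [mul_div_right_comm]
  nlinarith

theorem exists_expMap_taylor (hM : IsUniformlyBoundedMetric M α₁ α₂) (R : ℝ) :
    ∃ C, 0 < C ∧ ∀ t, 0 ≤ t → t ≤ R → ∀ b p : Vec n, ‖b‖ ≤ R → ‖p‖ ≤ R →
      ∃ J : Vec n →L[ℝ] Vec n, ∀ p' : Vec n, ‖p'‖ ≤ R →
        ‖expMap M t b p' - expMap M t b p - J (p' - p)‖ ≤ C * ‖p' - p‖ ^ 2 := by
  obtain ⟨C, hC, h⟩ := IsCogeodesic.exists_linearization hM R
  refine ⟨C, hC, fun t ht htR b p hb hp => ?_⟩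
  obtain ⟨Z, hZ⟩ := h t ht htR _ (isCogeodesic_cogeod hM ht b p) (by
    rw [cogeod_zero hM ht, Prod.norm_def]; exact max_le hb hp)
  refine ⟨(ContinuousLinearMap.fst ℝ _ _) ∘L Z ∘L (ContinuousLinearMap.inr ℝ _ _),
    fun p' hp' => ?_⟩
  have h1 := hZ _ (isCogeodesic_cogeod hM ht b p') (by
    rw [cogeod_zero hM ht, Prod.norm_def]; exact max_le hb hp')
  rw [cogeod_zero hM ht, cogeod_zero hM ht] at h1
  have e : ((b, p') - (b, p) : Vec n × Vec n) = (0, p' - p) := by simp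
  rw [e] at h1
  have e2 : ‖((0, p' - p) : Vec n × Vec n)‖ = ‖p' - p‖ := by simp [Prod.norm_def]
  rw [e2] at h1
  exact (norm_fst_le_norm _).trans h1

theorem hasFDerivAt_of_quadratic {E G : Type*} [NormedAddCommGroup E] [NormedSpace ℝ E]
    [NormedAddCommGroup G] [NormedSpace ℝ G] {f : E → G} {J : E →L[ℝ] G} {x : E} {C : ℝ}
    (h : ∀ᶠ y in 𝓝 x, ‖f y - f x - J (y - x)‖ ≤ C * ‖y - x‖ ^ 2) : HasFDerivAt f J x := by
  rw [hasFDerivAt_iff_isLittleO]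
  refine (Asymptotics.IsBigO.of_bound C (g := fun y => ‖y - x‖ ^ 2) ?_).trans_isLittleO ?_
  · filter_upwards [h] with y hy
    rwa [Real.norm_of_nonneg (sq_nonneg _)]
  · have h1 : Tendsto (fun y => ‖y - x‖) (𝓝 x) (𝓝 0) := by
      have : Tendsto (fun y => ‖y - x‖) (𝓝 x) (𝓝 ‖x - x‖) :=
        (by fun_prop : Continuous fun y : E => ‖y - x‖).tendsto x
      simpa using this
    exact ((Asymptotics.isLittleO_pow_id one_lt_two).comp_tendsto h1).of_norm_right

theorem differentiableAt_expMap (hM : IsUniformlyBoundedMetric M α₁ α₂) {t : ℝ} (ht : 0 ≤ t)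
    (b p : Vec n) : DifferentiableAt ℝ (expMap M t b) p := by
  obtain ⟨C, hC, h⟩ := exists_expMap_taylor hM (max t (max ‖b‖ (‖p‖ + 1)))
  obtain ⟨J, hJ⟩ := h t ht (le_max_left _ _) b p (by simp) (by simp)
  refine (hasFDerivAt_of_quadratic (J := J) (C := C) ?_).differentiableAt
  filter_upwards [Metric.ball_mem_nhds p one_pos] with p' hp'
  refine hJ p' (le_max_of_le_right (le_max_of_le_right ?_))
  have := norm_add_le (p' - p) p
  rw [sub_add_cancel] at this
  have := mem_ball_iff_norm.1 hp'
  linarith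

theorem expMap_taylor (hM : IsUniformlyBoundedMetric M α₁ α₂) (R : ℝ) :
    ∃ C, 0 < C ∧ ∀ t, 0 ≤ t → t ≤ R → ∀ b p p' : Vec n, ‖b‖ ≤ R → ‖p‖ ≤ R → ‖p'‖ ≤ R →
      ‖expMap M t b p' - expMap M t b p - fderiv ℝ (expMap M t b) p (p' - p)‖ ≤
        C * ‖p' - p‖ ^ 2 := by
  obtain ⟨C, hC, h⟩ := exists_expMap_taylor hM (R + 1)
  refine ⟨C, hC, fun t ht htR b p p' hb hp hp' => ?_⟩
  obtain ⟨J, hJ⟩ := h t ht (by linarith) b p (by linarith) (by linarith)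
  have hd : HasFDerivAt (expMap M t b) J p := by
    refine hasFDerivAt_of_quadratic (C := C) ?_
    filter_upwards [Metric.ball_mem_nhds p one_pos] with q hq
    refine hJ q ?_
    have := norm_add_le (q - p) p
    rw [sub_add_cancel] at this
    have := mem_ball_iff_norm.1 hq
    linarith
  rw [hd.fderiv]
  exact hJ p' (by linarith)

/-- The curve `s ↦ exp(sp)` is the geodesic itself, with initial velocity `M⁻¹p`. Hence the zero
covector is never conjugate, which makes the target state regular. -/
theorem fderiv_expMap_zero (hM : IsUniformlyBoundedMetric M α₁ α₂) {t : ℝ} (ht : 0 ≤ t)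
    (b p : Vec n) : fderiv ℝ (expMap M t b) 0 p = dualMetric M b t p := by
  have hline : HasDerivWithinAt (fun s : ℝ => s • p) p (Icc 0 1) 0 := by
    simpa using ((hasDerivAt_id (0 : ℝ)).smul_const p).hasDerivWithinAt (s := Icc (0 : ℝ) 1)
  have h1 : HasDerivWithinAt (fun s : ℝ => expMap M t b (s • p)) (fderiv ℝ (expMap M t b) 0 p)
      (Icc 0 1) 0 := by
    refine HasFDerivAt.comp_hasDerivWithinAt (0 : ℝ) (f := fun s : ℝ => s • p)
      (l := expMap M t b) ?_ hline
    simpa using (differentiableAt_expMap hM ht b 0).hasFDerivAt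
  have h2 := hasDerivWithinAt_fst
    (isCogeodesic_cogeod hM ht b p 0 ⟨le_rfl, zero_le_one⟩)
  rw [cogeod_zero hM ht] at h2
  have h3 : HasDerivWithinAt (fun s : ℝ => expMap M t b (s • p)) (dualMetric M b t p)
      (Icc 0 1) 0 :=
    h2.congr (fun s hs => expMap_smul hM ht b p hs)
      (expMap_smul hM ht b p ⟨le_rfl, zero_le_one⟩)
  exact (uniqueDiffOn_Icc (zero_lt_one' ℝ) 0 ⟨le_rfl, zero_le_one⟩).eq_deriv _ h1 h3

/-- The derivative of the exponential map depends continuously on all its arguments. -/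
theorem fderiv_expMap_near (hM : IsUniformlyBoundedMetric M α₁ α₂) (R : ℝ) :
    ∃ C, 0 < C ∧ ∀ t t', 0 ≤ t → t ≤ R → 0 ≤ t' → t' ≤ R → ∀ b b' p p' : Vec n,
      ‖b‖ ≤ R → ‖b'‖ ≤ R → ‖p‖ ≤ R → ‖p'‖ ≤ R → ∀ h, 0 < h → h ≤ 1 →
      ‖b - b'‖ + ‖p - p'‖ + |t - t'| ≤ h ^ 2 →
      ∀ ξ, ‖fderiv ℝ (expMap M t b) p ξ - fderiv ℝ (expMap M t' b') p' ξ‖ ≤ C * h * ‖ξ‖ := by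
  obtain ⟨C₁, hC₁, htay⟩ := expMap_taylor hM (R + 1)
  obtain ⟨C₂, hC₂, hlip⟩ := expMap_lipschitz hM (R + 1)
  refine ⟨2 * C₁ + 2 * C₂, by positivity,
    fun t t' ht htR ht' htR' b b' p p' hb hb' hp hp' h h0 h1 hd ξ => ?_⟩
  rcases eq_or_ne ξ 0 with rfl | hξ
  · simp
  have hξ' : 0 < ‖ξ‖ := norm_pos_iff.2 hξ
  -- Both derivatives are tested on a vector of length `h`. The Taylor remainders and the change of
  -- the arguments are each `O(h²)`, so the derivatives differ by `O(h)`, without any second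
  -- derivative of the flow.
  set ζ := (h / ‖ξ‖) • ξ with hζ
  have hζn : ‖ζ‖ = h := by
    rw [hζ, norm_smul, Real.norm_of_nonneg (by positivity), div_mul_cancel₀ _ hξ'.ne']
  have hpζ : ∀ p : Vec n, ‖p‖ ≤ R → ‖p + ζ‖ ≤ R + 1 := fun p hp =>
    (norm_add_le _ _).trans (by rw [hζn]; linarith)
  have a1 := htay t ht (by linarith) b p (p + ζ) (by linarith) (by linarith) (hpζ p hp)
  have a2 := htay t' ht' (by linarith) b' p' (p' + ζ) (by linarith) (by linarith) (hpζ p' hp')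
  have a3 := hlip t t' ht (by linarith) ht' (by linarith) b b' p p' (by linarith) (by linarith)
    (by linarith) (by linarith)
  have a4 := hlip t t' ht (by linarith) ht' (by linarith) b b' (p + ζ) (p' + ζ) (by linarith)
    (by linarith) (hpζ p hp) (hpζ p' hp')
  rw [add_sub_cancel_left, hζn] at a1 a2
  rw [add_sub_add_right_eq_sub] at a4
  have key : ‖fderiv ℝ (expMap M t b) p ζ - fderiv ℝ (expMap M t' b') p' ζ‖ ≤
      (2 * C₁ + 2 * C₂) * h ^ 2 := by
    have e : fderiv ℝ (expMap M t b) p ζ - fderiv ℝ (expMap M t' b') p' ζ =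
        (expMap M t' b' (p' + ζ) - expMap M t' b' p' - fderiv ℝ (expMap M t' b') p' ζ) -
        (expMap M t b (p + ζ) - expMap M t b p - fderiv ℝ (expMap M t b) p ζ) +
        ((expMap M t b (p + ζ) - expMap M t' b' (p' + ζ)) -
          (expMap M t b p - expMap M t' b' p')) := by abel
    rw [e]
    have n1 := norm_add_le
      ((expMap M t' b' (p' + ζ) - expMap M t' b' p' - fderiv ℝ (expMap M t' b') p' ζ) -
        (expMap M t b (p + ζ) - expMap M t b p - fderiv ℝ (expMap M t b) p ζ))
      ((expMap M t b (p + ζ) - expMap M t' b' (p' + ζ)) -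
          (expMap M t b p - expMap M t' b' p'))
    have n2 := norm_sub_le
      (expMap M t' b' (p' + ζ) - expMap M t' b' p' - fderiv ℝ (expMap M t' b') p' ζ)
      (expMap M t b (p + ζ) - expMap M t b p - fderiv ℝ (expMap M t b) p ζ)
    have n3 := norm_sub_le (expMap M t b (p + ζ) - expMap M t' b' (p' + ζ))
      (expMap M t b p - expMap M t' b' p')
    have n4 := mul_le_mul_of_nonneg_left hd hC₂.le
    linarith
  rw [hζ, map_smul, map_smul, ← smul_sub, norm_smul, Real.norm_of_nonneg (by positivity),
    div_mul_eq_mul_div, div_le_iff₀ hξ'] at key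
  have : h * ‖fderiv ℝ (expMap M t b) p ξ - fderiv ℝ (expMap M t' b') p' ξ‖ ≤
      h * ((2 * C₁ + 2 * C₂) * h * ‖ξ‖) := by nlinarith
  exact le_of_mul_le_mul_left this h0

/-! ### Regular points -/

/-- `(x, t)` is regular with respect to the base point `b`: there is exactly one minimal covector
`p`, and it is not conjugate. -/
def IsRegularPoint (M : Vec n → ℝ → Vec n →L[ℝ] Vec n) (t : ℝ) (b x : Vec n) : Prop :=
  ∃ p, IsMinCovector M t b x p ∧ (∀ q, IsMinCovector M t b x q → q = p) ∧
    ∃ c > 0, ∀ ξ, c * ‖ξ‖ ≤ ‖fderiv ℝ (expMap M t b) p ξ‖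

theorem isRegularPoint_self (hM : IsUniformlyBoundedMetric M α₁ α₂) {t : ℝ} (ht : 0 ≤ t)
    (b : Vec n) : IsRegularPoint M t b b := by
  have hα₂ := hM.pos_upper
  have h0 : ∀ q, IsMinCovector M t b b q → q = 0 := fun q hq => by
    have := hq.norm_le hM ht
    rw [sub_self, norm_zero, mul_zero] at this
    exact norm_le_zero_iff.1 this
  obtain ⟨p, hp⟩ := exists_isMinCovector hM ht b b
  have hp0 := h0 p hp
  subst hp0
  refine ⟨0, hp, h0, 1 / α₂, by positivity, fun ξ => ?_⟩
  rw [fderiv_expMap_zero hM ht]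
  have := norm_metric_le hM b ht (dualMetric M b t ξ)
  rw [metric_dualMetric hM b ht] at this
  rw [one_div, inv_mul_le_iff₀ hα₂]
  exact this

/-- The squared distance is locally Lipschitz, so by Rademacher it is differentiable almost
everywhere, which forces a unique minimal covector. The critical values of the exponential map form
a null set, which excludes conjugate covectors. -/
theorem volume_not_isRegularPoint (hM : IsUniformlyBoundedMetric M α₁ α₂) {t : ℝ} (ht : 0 ≤ t)
    (b : Vec n) : volume {x : Vec n | ¬ IsRegularPoint M t b x} = 0 := by
  have hdiff : ∀ᵐ x : Vec n, DifferentiableAt ℝ (sqDist M t b) x := by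
    have : ∀ N : ℕ, ∀ᵐ x : Vec n, x ∈ Metric.ball (0 : Vec n) N →
        DifferentiableAt ℝ (sqDist M t b) x := by
      intro N
      obtain ⟨C, hC, h⟩ := sqDist_lipschitz hM (max t (max ‖b‖ N))
      have hlip : LipschitzOnWith C.toNNReal (sqDist M t b) (Metric.ball 0 N) := by
        refine LipschitzOnWith.of_dist_le_mul fun x hx y hy => ?_
        rw [mem_ball_zero_iff] at hx hy
        have hx' : ‖x‖ ≤ max t (max ‖b‖ N) := by simp [hx.le]
        have hy' : ‖y‖ ≤ max t (max ‖b‖ N) := by simp [hy.le]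
        have h4 := h t t ht (le_max_left _ _) ht (le_max_left _ _) b b x y (by simp) (by simp)
          hx' hy'
        have h5 := h t t ht (le_max_left _ _) ht (le_max_left _ _) b b y x (by simp) (by simp)
          hy' hx'
        rw [norm_sub_rev y x] at h4
        simp only [sub_self, norm_zero, abs_zero, zero_add, add_zero] at h4 h5
        rw [Real.coe_toNNReal _ hC.le, Real.dist_eq, dist_eq_norm, abs_le]
        constructor <;> linarith
      filter_upwards [hlip.ae_differentiableWithinAt_of_mem (μ := volume)] with x hx hxN
      exact (hx hxN).differentiableAt (Metric.isOpen_ball.mem_nhds hxN)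
    filter_upwards [ae_all_iff.2 this] with x hx
    obtain ⟨N, hN⟩ := exists_nat_gt ‖x‖
    exact hx N (by simpa using hN)
  have hsard : volume (expMap M t b '' {p | (fderiv ℝ (expMap M t b) p).det = 0}) = 0 :=
    addHaar_image_eq_zero_of_det_fderivWithin_eq_zero volume
      (f' := fun p => fderiv ℝ (expMap M t b) p)
      (fun p _ => (differentiableAt_expMap hM ht b p).hasFDerivAt.hasFDerivWithinAt)
      (fun p hp => hp)
  rw [measure_eq_zero_iff_ae_notMem] at hsard
  rw [measure_eq_zero_iff_ae_notMem]
  filter_upwards [hdiff, hsard] with x hx hs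
  rw [not_not]
  obtain ⟨p, hp⟩ := exists_isMinCovector hM ht b x
  refine ⟨p, hp, fun q hq => hq.eq_of_differentiableAt hM ht hx hp, ?_⟩
  have hdet : (fderiv ℝ (expMap M t b) p).det ≠ 0 := fun h => hs ⟨p, h, hp.1⟩
  set J := fderiv ℝ (expMap M t b) p
  set e := J.toContinuousLinearEquivOfDetNeZero hdet
  refine ⟨1 / (‖(e.symm : Vec n →L[ℝ] Vec n)‖ + 1), by positivity, fun ξ => ?_⟩
  have h1 : ξ = (e.symm : Vec n →L[ℝ] Vec n) (J ξ) := by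
    change ξ = e.symm (J ξ)
    rw [← ContinuousLinearMap.toContinuousLinearEquivOfDetNeZero_apply J hdet,
      ContinuousLinearEquiv.symm_apply_apply]
  have h2 := (e.symm : Vec n →L[ℝ] Vec n).le_opNorm (J ξ)
  rw [← h1] at h2
  rw [one_div, inv_mul_le_iff₀ (by positivity)]
  nlinarith [norm_nonneg (J ξ)]

/-- Minimal covectors over bounded data are bounded, and limits of them are minimal. If some stayed
at distance `ε` from `p₀`, an ultrafilter limit would be a second minimal covector at the limit
point. -/
theorem IsMinCovector.eventually_near (hM : IsUniformlyBoundedMetric M α₁ α₂) {ι : Type*}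
    {l : Filter ι} {t : ι → ℝ} {b x : ι → Vec n} {t₀ : ℝ} {b₀ x₀ p₀ : Vec n}
    (ht₀ : 0 ≤ t₀) (ht : ∀ᶠ i in l, 0 ≤ t i) (htl : Tendsto t l (𝓝 t₀))
    (hb : Tendsto b l (𝓝 b₀)) (hx : Tendsto x l (𝓝 x₀))
    (huniq : ∀ q, IsMinCovector M t₀ b₀ x₀ q → q = p₀) {ε : ℝ} (hε : 0 < ε) :
    ∀ᶠ i in l, ∀ p, IsMinCovector M (t i) (b i) (x i) p → ‖p - p₀‖ < ε := by
  by_contra hcon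
  rw [not_eventually] at hcon
  simp only [not_forall, not_lt] at hcon
  set l' := l ⊓ 𝓟 {i | ∃ p, ∃ (_ : IsMinCovector M (t i) (b i) (x i) p), ε ≤ ‖p - p₀‖} with hl'
  have : l'.NeBot := frequently_iff_neBot.1 hcon
  set U := Ultrafilter.of l' with hU
  have hUl : (U : Filter ι) ≤ l := (Ultrafilter.of_le l').trans inf_le_left
  have hmem : ∀ᶠ i in (U : Filter ι), ∃ p, IsMinCovector M (t i) (b i) (x i) p ∧ ε ≤ ‖p - p₀‖ := by
    have h1 : {i | ∃ p, ∃ (_ : IsMinCovector M (t i) (b i) (x i) p), ε ≤ ‖p - p₀‖} ∈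
        (U : Filter ι) := (Ultrafilter.of_le l').trans inf_le_right (mem_principal_self _)
    filter_upwards [h1] with i hi
    obtain ⟨p, hp, h⟩ := hi
    exact ⟨p, hp, h⟩
  have hex : ∀ i, ∃ p, (∃ q, IsMinCovector M (t i) (b i) (x i) q ∧ ε ≤ ‖q - p₀‖) →
      IsMinCovector M (t i) (b i) (x i) p ∧ ε ≤ ‖p - p₀‖ := by
    intro i
    by_cases h : ∃ q, IsMinCovector M (t i) (b i) (x i) q ∧ ε ≤ ‖q - p₀‖
    · obtain ⟨q, hq⟩ := h; exact ⟨q, fun _ => hq⟩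
    · exact ⟨0, fun h' => absurd h' h⟩
  choose p hp using hex
  have hα₂ := hM.pos_upper
  have hbd : ∀ᶠ i in (U : Filter ι), p i ∈ Metric.closedBall (0 : Vec n) (α₂ * (‖x₀ - b₀‖ + 1)) := by
    have h1 : ∀ᶠ i in (U : Filter ι), ‖x i - b i‖ ≤ ‖x₀ - b₀‖ + 1 :=
      ((hx.sub hb).mono_left hUl).norm.eventually (eventually_le_nhds (lt_add_one _))
    filter_upwards [h1, hmem, hUl ht] with i g1 g2 g3
    rw [mem_closedBall_zero_iff]
    exact ((hp i g2).1.norm_le hM g3).trans (by gcongr)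
  obtain ⟨q, -, hq⟩ := (isCompact_closedBall (0 : Vec n) (α₂ * (‖x₀ - b₀‖ + 1))).ultrafilter_le_nhds
    (U.map p) (by rw [le_principal_iff]; exact hbd)
  have hq' : Tendsto p (U : Filter ι) (𝓝 q) := hq
  have hqmin := IsMinCovector.of_tendsto hM ht₀ (hUl ht) (htl.mono_left hUl) (hb.mono_left hUl)
    (hx.mono_left hUl) hq' (hmem.mono fun i hi => (hp i hi).1)
  have h2 : ε ≤ ‖q - p₀‖ := ge_of_tendsto (hq'.sub_const p₀).norm (hmem.mono fun i hi => (hp i hi).2)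
  rw [huniq q hqmin, sub_self, norm_zero] at h2
  linarith

/-- Nearby minimal covectors lie close to `p₀`, where the derivative of the exponential map is still
bounded below by `c/2`. Two of them with the same end point satisfy `c/2 ≤ C₁|q - p|`, which fails
when they are close enough. -/
theorem IsRegularPoint.eventually (hM : IsUniformlyBoundedMetric M α₁ α₂) {ι : Type*}
    {l : Filter ι} {t : ι → ℝ} {b x : ι → Vec n} {t₀ : ℝ} {b₀ x₀ : Vec n}
    (ht₀ : 0 ≤ t₀) (ht : ∀ᶠ i in l, 0 ≤ t i) (htl : Tendsto t l (𝓝 t₀))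
    (hb : Tendsto b l (𝓝 b₀)) (hx : Tendsto x l (𝓝 x₀)) (hreg : IsRegularPoint M t₀ b₀ x₀) :
    ∀ᶠ i in l, IsRegularPoint M (t i) (b i) (x i) := by
  obtain ⟨p₀, hp₀, huniq, c, hc, hJ⟩ := hreg
  set R := max t₀ (max ‖b₀‖ ‖p₀‖) + 1 with hR
  obtain ⟨C₁, hC₁, htay⟩ := expMap_taylor hM R
  obtain ⟨C₂, hC₂, hnear⟩ := fderiv_expMap_near hM R
  set h := min 1 (c / (2 * C₂)) with hh
  have hh0 : 0 < h := by positivity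
  have hh1 : h ≤ 1 := min_le_left _ _
  have hh2 : C₂ * h ≤ c / 2 := by
    have : C₂ * h ≤ C₂ * (c / (2 * C₂)) := by gcongr; exact min_le_right _ _
    refine this.trans (le_of_eq (by field_simp))
  -- The first entry is the covector's third of the closeness budget `h²`, shared with time and base
  -- point. The second forces two nearby minimal covectors to be less than `c/(4C₁)` apart.
  set ε := min (h ^ 2 / 3) (c / (8 * C₁)) with hε
  have hε0 : 0 < ε := by positivity
  have e1 := IsMinCovector.eventually_near hM ht₀ ht htl hb hx huniq hε0
  have e2 : ∀ᶠ i in l, |t i - t₀| < h ^ 2 / 3 := by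
    have := htl.eventually (Metric.ball_mem_nhds t₀ (show 0 < h ^ 2 / 3 by positivity))
    filter_upwards [this] with i hi
    rwa [← Real.dist_eq]
  have e3 : ∀ᶠ i in l, ‖b i - b₀‖ < h ^ 2 / 3 := by
    have := hb.eventually (Metric.ball_mem_nhds b₀ (show 0 < h ^ 2 / 3 by positivity))
    filter_upwards [this] with i hi
    rwa [← dist_eq_norm]
  filter_upwards [ht, e1, e2, e3] with i g0 g1 g2 g3
  have hh3 : h ^ 2 ≤ 1 := pow_le_one₀ hh0.le hh1
  have ht₀R : t₀ + 1 ≤ R := by simp only [hR]; gcongr; exact le_max_left _ _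
  have hb₀R : ‖b₀‖ + 1 ≤ R := by
    simp only [hR]; gcongr; exact le_max_of_le_right (le_max_left _ _)
  have hp₀R : ‖p₀‖ + 1 ≤ R := by
    simp only [hR]; gcongr; exact le_max_of_le_right (le_max_right _ _)
  have htR : t i ≤ R := by have := (abs_lt.1 g2).2; linarith
  have hbR : ‖b i‖ ≤ R := by
    have := norm_add_le (b i - b₀) b₀
    rw [sub_add_cancel] at this
    linarith
  have hpR : ∀ p, IsMinCovector M (t i) (b i) (x i) p → ‖p‖ ≤ R ∧ ‖p - p₀‖ < h ^ 2 / 3 ∧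
      ‖p - p₀‖ < c / (8 * C₁) := by
    intro p hp
    have h1 := g1 p hp
    have h2 : ‖p - p₀‖ < h ^ 2 / 3 := h1.trans_le (min_le_left _ _)
    have := norm_add_le (p - p₀) p₀
    rw [sub_add_cancel] at this
    exact ⟨by linarith, h2, h1.trans_le (min_le_right _ _)⟩
  have hJp : ∀ p, IsMinCovector M (t i) (b i) (x i) p → ∀ ξ,
      c / 2 * ‖ξ‖ ≤ ‖fderiv ℝ (expMap M (t i) (b i)) p ξ‖ := by
    intro p hp ξ
    obtain ⟨k1, k2, k3⟩ := hpR p hp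
    have h1 := hnear (t i) t₀ g0 htR ht₀ (by linarith) (b i) b₀ p p₀ hbR (by linarith) k1
      (by linarith) h hh0 hh1 (by linarith) ξ
    have h2 := hJ ξ
    have h3 := norm_sub_norm_le (fderiv ℝ (expMap M t₀ b₀) p₀ ξ)
      (fderiv ℝ (expMap M (t i) (b i)) p ξ)
    rw [norm_sub_rev] at h3
    have h4 := mul_le_mul_of_nonneg_right hh2 (norm_nonneg ξ)
    linarith
  obtain ⟨p, hp⟩ := exists_isMinCovector hM g0 (b i) (x i)
  refine ⟨p, hp, fun q hq => ?_, c / 2, by positivity, hJp p hp⟩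
  by_contra hne
  have hpos : 0 < ‖q - p‖ := norm_pos_iff.2 (sub_ne_zero.2 hne)
  obtain ⟨k1, k2, k3⟩ := hpR p hp
  obtain ⟨m1, m2, m3⟩ := hpR q hq
  have h1 := htay (t i) g0 htR (b i) p q hbR k1 m1
  rw [hq.1, hp.1, sub_self, zero_sub, norm_neg] at h1
  have h2 := hJp p hp (q - p)
  have h3 : c / 2 ≤ C₁ * ‖q - p‖ := by
    refine le_of_mul_le_mul_right ?_ hpos
    nlinarith
  have h4 : ‖q - p‖ < c / (8 * C₁) + c / (8 * C₁) := by
    have := norm_sub_le (q - p₀) (p - p₀)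
    rw [sub_sub_sub_cancel_right] at this
    linarith
  have h5 : C₁ * ‖q - p‖ < C₁ * (c / (8 * C₁) + c / (8 * C₁)) := by gcongr
  have h6 : C₁ * (c / (8 * C₁) + c / (8 * C₁)) = c / 4 := by field_simp; norm_num
  linarith

end

end CCM

namespace CCM

noncomputable section

variable {n m : ℕ} {f : Vec n → ℝ → Vec n} {B : Vec n → ℝ → Vec m →L[ℝ] Vec n}

/-! ### Carathéodory solutions of the control system -/

/-- `x` solves `ẋ = f(x, t) + B(x, t) u(t)` on `[a, b]`. -/
structure SolOn (f : Vec n → ℝ → Vec n) (B : Vec n → ℝ → Vec m →L[ℝ] Vec n)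
    (x : ℝ → Vec n) (u : ℝ → Vec m) (a b : ℝ) : Prop where
  continuousOn : ContinuousOn x (Icc a b)
  integrable : IntegrableOn u (Icc a b)
  eq_integral : ∀ t ∈ Icc a b, x t = x a + ∫ s in a..t, (f (x s) s + B (x s) s (u s))

theorem isTrajectoryOn_iff {x : ℝ → Vec n} {u : ℝ → Vec m} {T : ℝ} :
    IsTrajectoryOn f B x u T ↔ SolOn f B x u 0 T :=
  ⟨fun h => ⟨h.1, h.2, h.3⟩, fun h => ⟨h.1, h.2, h.3⟩⟩

theorem integrableOn_rhs (hf : Smooth f) (hB : Smooth B) {x : ℝ → Vec n} {u : ℝ → Vec m}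
    {a b : ℝ} (ha : 0 ≤ a) (hx : ContinuousOn x (Icc a b)) (hu : IntegrableOn u (Icc a b)) :
    IntegrableOn (fun s => f (x s) s + B (x s) s (u s)) (Icc a b) := by
  have h0 : ∀ t ∈ Icc a b, 0 ≤ t := fun t ht => ha.trans ht.1
  have h1 : ContinuousOn (fun s => f (x s) s) (Icc a b) :=
    SmoothHalf.continuousOn_comp (F := f) hf hx h0
  have h2 : ContinuousOn (fun s => B (x s) s) (Icc a b) :=
    SmoothHalf.continuousOn_comp (F := B) hB hx h0
  obtain ⟨C, hC⟩ := isCompact_Icc.exists_bound_of_continuousOn h2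
  refine h1.integrableOn_Icc.add (Integrable.mono' (hu.norm.const_mul C) ?_ ?_)
  · exact (ContinuousLinearMap.id ℝ (Vec m →L[ℝ] Vec n)).aestronglyMeasurable_comp₂
      (h2.aestronglyMeasurable measurableSet_Icc) hu.aestronglyMeasurable
  · filter_upwards [ae_restrict_mem measurableSet_Icc] with s hs
    exact (B (x s) s).le_of_opNorm_le (hC s hs) (u s)

section

variable {x y : ℝ → Vec n} {u v : ℝ → Vec m} {a b c d : ℝ}

theorem SolOn.intervalIntegrable (hf : Smooth f) (hB : Smooth B) (ha : 0 ≤ a)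
    (h : SolOn f B x u a b) (hc : c ∈ Icc a b) (hd : d ∈ Icc a b) :
    IntervalIntegrable (fun s => f (x s) s + B (x s) s (u s)) volume c d := by
  rw [intervalIntegrable_iff]
  exact (integrableOn_rhs hf hB ha h.1 h.2).mono_set
    (uIoc_subset_uIcc.trans (uIcc_subset_Icc hc hd))

theorem SolOn.sub_eq (hf : Smooth f) (hB : Smooth B) (ha : 0 ≤ a)
    (h : SolOn f B x u a b) (hc : c ∈ Icc a b) (hd : d ∈ Icc a b) :
    x d - x c = ∫ s in c..d, (f (x s) s + B (x s) s (u s)) := by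
  have ha' : a ∈ Icc a b := ⟨le_rfl, hc.1.trans hc.2⟩
  rw [h.3 d hd, h.3 c hc, add_sub_add_left_eq_sub,
    intervalIntegral.integral_interval_sub_left (h.intervalIntegrable hf hB ha ha' hd)
      (h.intervalIntegrable hf hB ha ha' hc)]

theorem SolOn.restrict (hf : Smooth f) (hB : Smooth B) (ha : 0 ≤ a)
    (h : SolOn f B x u a b) (hac : a ≤ c) (hdb : d ≤ b) :
    SolOn f B x u c d := by
  refine ⟨h.1.mono (Icc_subset_Icc hac hdb), h.2.mono_set (Icc_subset_Icc hac hdb),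
    fun t ht => ?_⟩
  rw [← h.sub_eq hf hB ha ⟨hac, ht.1.trans (ht.2.trans hdb)⟩ ⟨hac.trans ht.1, ht.2.trans hdb⟩,
    add_sub_cancel]

theorem SolOn.append (hf : Smooth f) (hB : Smooth B) (ha : 0 ≤ a) (hab : a ≤ b) (hbc : b ≤ c)
    (h₁ : SolOn f B x u a b) (h₂ : SolOn f B x u b c) : SolOn f B x u a c := by
  have e : Icc a c = Icc a b ∪ Icc b c := (Icc_union_Icc_eq_Icc hab hbc).symm
  refine ⟨?_, ?_, fun t ht => ?_⟩
  · rw [e]; exact h₁.1.union_of_isClosed h₂.1 isClosed_Icc isClosed_Icc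
  · rw [e]; exact h₁.2.union h₂.2
  · rcases le_total t b with h | h
    · exact h₁.3 t ⟨ht.1, h⟩
    · have hb : b ∈ Icc a b := ⟨hab, le_rfl⟩
      have ha' : a ∈ Icc a b := ⟨le_rfl, hab⟩
      rw [h₂.3 t ⟨h, ht.2⟩, h₁.3 b hb, add_assoc, intervalIntegral.integral_add_adjacent_intervals
        (h₁.intervalIntegrable hf hB ha ha' hb) (h₂.intervalIntegrable hf hB (ha.trans hab)
          ⟨le_rfl, hbc⟩ ⟨h, ht.2⟩)]

theorem SolOn.congr (h : SolOn f B x u a b) (hab : a ≤ b) (hxy : EqOn x y (Icc a b))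
    (huv : ∀ᵐ s, s ∈ Icc a b → u s = v s) : SolOn f B y v a b := by
  refine ⟨h.1.congr fun s hs => (hxy hs).symm,
    h.2.congr ((ae_restrict_iff' measurableSet_Icc).2 huv), fun t ht => ?_⟩
  rw [← hxy ht, ← hxy ⟨le_rfl, hab⟩, h.3 t ht]
  congr 1
  refine intervalIntegral.integral_congr_ae ?_
  filter_upwards [huv] with s hs hst
  rw [uIoc_of_le ht.1] at hst
  have hs' : s ∈ Icc a b := ⟨hst.1.le, hst.2.trans ht.2⟩
  rw [hxy hs', hs hs']

theorem SolOn.refl (x : ℝ → Vec n) (u : ℝ → Vec m) (a : ℝ) : SolOn f B x u a a := by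
  refine ⟨?_, ?_, fun t ht => ?_⟩
  · rw [Icc_self]; exact continuousOn_singleton _ _
  · rw [Icc_self]; simp
  · rw [Icc_self, mem_singleton_iff] at ht
    rw [ht]; simp

theorem SolOn.ae_hasDerivAt (hf : Smooth f) (hB : Smooth B) (ha : 0 ≤ a)
    (h : SolOn f B x u a b) : ∀ᵐ t, t ∈ Ioo a b → HasDerivAt x (f (x t) t + B (x t) t (u t)) t := by
  rcases lt_or_ge b a with hab | hab
  · exact Eventually.of_forall fun t ht => absurd (ht.1.trans ht.2) (not_lt.2 hab.le)
  have hint := h.intervalIntegrable hf hB ha (c := a) (d := b) ⟨le_rfl, hab⟩ ⟨hab, le_rfl⟩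
  filter_upwards [hint.ae_hasDerivAt_integral] with t ht htI
  have h1 := ht (by rw [uIcc_of_le hab]; exact Ioo_subset_Icc_self htI) a left_mem_uIcc
  refine (h1.const_add (x a)).congr_of_eventuallyEq ?_
  filter_upwards [Icc_mem_nhds htI.1 htI.2] with s hs
  exact h.3 s hs

theorem exists_rhs_bound (hf : Smooth f) (hB : Smooth B) (R U : ℝ) : ∃ K, 0 < K ∧
    ∀ t, 0 ≤ t → t ≤ R → ∀ (x y : Vec n) (u v : Vec m), ‖x‖ ≤ R → ‖y‖ ≤ R → ‖u‖ ≤ U →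
      ‖f x t + B x t u‖ ≤ K ∧
      ‖(f x t + B x t u) - (f y t + B y t v)‖ ≤ K * (‖x - y‖ + ‖u - v‖) := by
  obtain ⟨C₁, hC₁, h₁⟩ := SmoothHalf.bounded_lipschitz (F := f) hf R
  obtain ⟨C₂, hC₂, h₂⟩ := SmoothHalf.bounded_lipschitz (F := B) hB R
  refine ⟨C₁ + C₂ * (|U| + 1), by positivity, fun t ht htR x y u v hx hy hu => ?_⟩
  obtain ⟨a1, a2⟩ := h₁ x y t t hx hy ht htR ht htR
  obtain ⟨b1, b2⟩ := h₂ x y t t hx hy ht htR ht htR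
  obtain ⟨b3, -⟩ := h₂ y x t t hy hx ht htR ht htR
  rw [sub_self, abs_zero, add_zero] at a2 b2
  have hu' : ‖u‖ ≤ |U| := hu.trans (le_abs_self U)
  have c1 := (B x t).le_of_opNorm_le b1 u
  have c2 := (B x t - B y t).le_of_opNorm_le b2 u
  have c3 := (B y t).le_of_opNorm_le b3 (u - v)
  have c4 : C₂ * ‖u‖ ≤ C₂ * |U| := by gcongr
  have c5 : C₂ * ‖x - y‖ * ‖u‖ ≤ C₂ * ‖x - y‖ * |U| := by gcongr
  refine ⟨(norm_add_le _ _).trans (by linarith), ?_⟩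
  have e : (f x t + B x t u) - (f y t + B y t v) =
      (f x t - f y t) + (B x t - B y t) u + B y t (u - v) := by
    rw [_root_.sub_apply, map_sub]; abel
  rw [e]
  have d1 := norm_add_le ((f x t - f y t) + (B x t - B y t) u) (B y t (u - v))
  have d2 := norm_add_le (f x t - f y t) ((B x t - B y t) u)
  have d3 : 0 ≤ C₁ * ‖u - v‖ := by positivity
  have d4 : 0 ≤ C₂ * |U| * ‖u - v‖ := by positivity
  have d5 : 0 ≤ C₂ * ‖x - y‖ := by positivity
  nlinarith

/-- A solution is Lipschitz as long as it and its input are bounded. -/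
theorem SolOn.norm_sub_le_of_bound (hf : Smooth f) (hB : Smooth B) (R U : ℝ) : ∃ K, 0 < K ∧
    ∀ (x : ℝ → Vec n) (u : ℝ → Vec m) (a b : ℝ), 0 ≤ a → b ≤ R → SolOn f B x u a b →
      (∀ t ∈ Icc a b, ‖x t‖ ≤ R) → (∀ᵐ t, t ∈ Icc a b → ‖u t‖ ≤ U) →
      ∀ s ∈ Icc a b, ∀ t ∈ Icc a b, ‖x t - x s‖ ≤ K * |t - s| := by
  obtain ⟨K, hK, h⟩ := exists_rhs_bound hf hB R U
  refine ⟨K, hK, fun x u a b ha hbR hx hxR huU s hs t ht => ?_⟩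
  rw [hx.sub_eq hf hB ha hs ht]
  refine intervalIntegral.norm_integral_le_of_norm_le_const_ae ?_
  filter_upwards [huU] with r hr hrI
  have hr' : r ∈ Icc a b := uIcc_subset_Icc hs ht (uIoc_subset_uIcc hrI)
  exact (h r (ha.trans hr'.1) (hr'.2.trans hbR) (x r) (x r) (u r) (u r) (hxR r hr') (hxR r hr')
    (hr hr')).1

/-- Continuous dependence of solutions on the initial value and on the input. -/
theorem SolOn.norm_sub_le (hf : Smooth f) (hB : Smooth B) (R U : ℝ) : ∃ K, 0 < K ∧
    ∀ (x y : ℝ → Vec n) (u v : ℝ → Vec m) (a b w : ℝ), 0 ≤ a → b ≤ R → SolOn f B x u a b →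
      SolOn f B y v a b → (∀ t ∈ Icc a b, ‖x t‖ ≤ R) → (∀ t ∈ Icc a b, ‖y t‖ ≤ R) →
      (∀ᵐ t, t ∈ Icc a b → ‖u t‖ ≤ U) → 0 ≤ w → (∀ᵐ t, t ∈ Icc a b → ‖u t - v t‖ ≤ w) →
      ∀ t ∈ Icc a b, ‖x t - y t‖ ≤ (‖x a - y a‖ + K * w * (t - a)) * Real.exp (K * (t - a)) := by
  obtain ⟨K, hK, h⟩ := exists_rhs_bound hf hB R U
  refine ⟨K, hK, fun x y u v a b w ha hbR hx hy hxR hyR huU hw huv t ht => ?_⟩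
  have hx' := hx.restrict hf hB ha le_rfl ht.2
  have hy' := hy.restrict hf hB ha le_rfl ht.2
  refine gronwall_integral (φ := fun t => ‖x t - y t‖) (b := t) hK.le (hx'.1.sub hy'.1).norm
    (fun s hs => ?_) t ⟨ht.1, le_rfl⟩
  have ha' : a ∈ Icc a t := ⟨le_rfl, ht.1⟩
  have e : x s - y s = (x a - y a) + ∫ r in a..s, ((f (x r) r + B (x r) r (u r)) -
      (f (y r) r + B (y r) r (v r))) := by
    rw [intervalIntegral.integral_sub (hx'.intervalIntegrable hf hB ha ha' hs)
      (hy'.intervalIntegrable hf hB ha ha' hs), ← hx'.sub_eq hf hB ha ha' hs,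
      ← hy'.sub_eq hf hB ha ha' hs]
    abel
  have hci : IntervalIntegrable (fun r => ‖x r - y r‖) volume a s :=
    ((hx'.1.sub hy'.1).norm.mono (by rw [uIcc_of_le hs.1]; exact Icc_subset_Icc_right hs.2)
      ).intervalIntegrable
  have h1 : ‖∫ r in a..s, ((f (x r) r + B (x r) r (u r)) - (f (y r) r + B (y r) r (v r)))‖ ≤
      ∫ r in a..s, (K * ‖x r - y r‖ + K * w) := by
    refine intervalIntegral.norm_integral_le_of_norm_le hs.1 ?_
      ((hci.const_mul K).add intervalIntegrable_const)
    filter_upwards [huU, huv] with r hr1 hr2 hr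
    have hr' : r ∈ Icc a b := ⟨hr.1.le, hr.2.trans (hs.2.trans ht.2)⟩
    refine (h r (ha.trans hr'.1) (hr'.2.trans hbR) (x r) (y r) (u r) (v r) (hxR r hr') (hyR r hr')
      (hr1 hr')).2.trans ?_
    have := mul_le_mul_of_nonneg_left (hr2 hr') hK.le
    linarith
  have h2 : ∫ r in a..s, (K * ‖x r - y r‖ + K * w) =
      K * (∫ r in a..s, ‖x r - y r‖) + K * w * (s - a) := by
    rw [intervalIntegral.integral_add (hci.const_mul K) intervalIntegrable_const,
      intervalIntegral.integral_const_mul, intervalIntegral.integral_const, smul_eq_mul]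
    ring
  have h3 : K * w * (s - a) ≤ K * w * (t - a) := by
    have : s - a ≤ t - a := by linarith [hs.2]
    gcongr
  rw [e]
  refine (norm_add_le _ _).trans ?_
  linarith

theorem SolOn.exists_bound (h : SolOn f B x u a b) : ∃ R, ∀ t ∈ Icc a b, ‖x t‖ ≤ R :=
  isCompact_Icc.exists_bound_of_continuousOn h.1

theorem SolOn.eqOn (hf : Smooth f) (hB : Smooth B) (ha : 0 ≤ a) (hx : SolOn f B x u a b)
    (hy : SolOn f B y u a b) (h0 : x a = y a) {U : ℝ} (hu : ∀ᵐ t, t ∈ Icc a b → ‖u t‖ ≤ U) :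
    EqOn x y (Icc a b) := by
  obtain ⟨R₁, h₁⟩ := hx.exists_bound
  obtain ⟨R₂, h₂⟩ := hy.exists_bound
  obtain ⟨K, hK, h⟩ := SolOn.norm_sub_le hf hB (max b (max R₁ R₂)) U
  intro t ht
  have := h x y u u a b 0 ha (le_max_left _ _) hx hy (fun t ht => (h₁ t ht).trans (by simp))
    (fun t ht => (h₂ t ht).trans (by simp)) hu le_rfl (by simp) t ht
  rw [h0, sub_self, norm_zero, mul_zero, zero_mul, add_zero, zero_mul] at this
  exact sub_eq_zero.1 (norm_le_zero_iff.1 this)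

/-- Local existence, with a uniform lifespan on bounded sets. -/
theorem exists_solOn (hf : Smooth f) (hB : Smooth B) (R U : ℝ) : ∃ h, 0 < h ∧ h ≤ 1 ∧
    ∀ (a b : ℝ) (x₀ : Vec n) (u : ℝ → Vec m), 0 ≤ a → a ≤ R → a ≤ b → b ≤ a + h → ‖x₀‖ ≤ R →
      IntegrableOn u (Icc a b) → (∀ t ∈ Icc a b, ‖u t‖ ≤ U) →
      ∃ x, x a = x₀ ∧ SolOn f B x u a b ∧ ∀ t ∈ Icc a b, ‖x t‖ ≤ R + 1 := by
  obtain ⟨K, hK, hb⟩ := exists_rhs_bound hf hB (R + 2) U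
  -- The cut-off field is bounded by `K`, so in time `1/K` the solution moves by at most 1 and stays
  -- where the cutoff equals 1.
  refine ⟨min 1 (1 / K), by positivity, min_le_left _ _,
    fun a b x₀ u ha haR hab hbh hx₀ hu huU => ?_⟩
  have hbh1 : b ≤ a + 1 := hbh.trans (by gcongr; exact min_le_left _ _)
  have hbK : K * (b - a) ≤ 1 := by
    have h1 : b - a ≤ 1 / K := by
      have := min_le_right 1 (1 / K)
      linarith
    rwa [le_div_iff₀ hK, mul_comm] at h1
  have hcutb : ∀ t ∈ Icc a b, ∀ x : Vec n, ‖cutoff (R + 1) x • (f x t + B x t (u t))‖ ≤ K := by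
    intro t ht x
    rcases le_total ‖x‖ (R + 2) with h | h
    · rw [norm_smul, Real.norm_of_nonneg (cutoff_nonneg _ _)]
      exact (mul_le_of_le_one_left (norm_nonneg _) (cutoff_le_one _ _)).trans
        (hb t (ha.trans ht.1) (by linarith [ht.2]) x x (u t) (u t) h h (huU t ht)).1
    · rw [cutoff_eq_zero (by linarith), zero_smul, norm_zero]; exact hK.le
  obtain ⟨x, hxc, hx⟩ := caratheodory_exists
    (fun s x => cutoff (R + 1) x • (f x s + B x s (u s))) hab (L := 2 * K) (by positivity)
    (fun s hs x y => cutoff_smul_lipschitz (F := fun x => f x s + B x s (u s)) (fun x y hx hy => by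
      have h0 := hb s (ha.trans hs.1) (by linarith [hs.2]) x y (u s) (u s) (by linarith)
        (by linarith) (huU s hs)
      rw [sub_self, norm_zero, add_zero] at h0
      exact h0) hK.le x y)
    (fun y hy => by
      have h1 := integrableOn_rhs hf hB ha hy.continuousOn hu
      refine Integrable.mono h1 ?_ ?_
      · exact ((continuous_cutoff _).comp hy).aestronglyMeasurable.smul h1.aestronglyMeasurable
      · refine Eventually.of_forall fun s => ?_
        rw [norm_smul, Real.norm_of_nonneg (cutoff_nonneg _ _)]
        exact mul_le_of_le_one_left (norm_nonneg _) (cutoff_le_one _ _)) x₀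
  have hxa : x a = x₀ := by simpa using hx a ⟨le_rfl, hab⟩
  have hxR : ∀ t ∈ Icc a b, ‖x t‖ ≤ R + 1 := by
    intro t ht
    have h1 : ‖∫ s in a..t, cutoff (R + 1) (x s) • (f (x s) s + B (x s) s (u s))‖ ≤ K * |t - a| :=
      intervalIntegral.norm_integral_le_of_norm_le_const fun s hs => by
        rw [uIoc_of_le ht.1] at hs
        exact hcutb s ⟨hs.1.le, hs.2.trans ht.2⟩ _
    rw [abs_of_nonneg (by linarith [ht.1])] at h1
    have h2 : K * (t - a) ≤ K * (b - a) := by gcongr; exact ht.2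
    rw [hx t ht]
    exact (norm_add_le _ _).trans (by linarith)
  refine ⟨x, hxa, ⟨hxc.continuousOn, hu, fun t ht => ?_⟩, hxR⟩
  rw [hx t ht, hxa]
  congr 1
  refine intervalIntegral.integral_congr fun s hs => ?_
  rw [uIcc_of_le ht.1] at hs
  rw [cutoff_eq_one (hxR s ⟨hs.1, hs.2.trans ht.2⟩), one_smul]

end

end

end CCM

namespace CCM

noncomputable section

variable {n m : ℕ} {f : Vec n → ℝ → Vec n} {B : Vec n → ℝ → Vec m →L[ℝ] Vec n}
  {M : Vec n → ℝ → Vec n →L[ℝ] Vec n} {α₁ α₂ lam : ℝ}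

/-! ### Uniform contraction estimates -/

/-- Otherwise the choices `ρ = N`, `ε = 1/(N + 1)` all fail at points accumulating somewhere in `K`.
At such a limit `q` vanishes because `a` is bounded along the subsequence, yet `a ≥ 0`, contrary to
the hypothesis. -/
theorem exists_uniform_finsler {X : Type*} [PseudoMetricSpace X] {K : Set X} (hK : IsCompact K)
    {a q : X → ℝ} (ha : ContinuousOn a K) (hq : ContinuousOn q K) (hq0 : ∀ z ∈ K, 0 ≤ q z)
    (h : ∀ z ∈ K, q z = 0 → a z < 0) :
    ∃ ρ, 0 ≤ ρ ∧ ∃ ε, 0 < ε ∧ ∀ z ∈ K, a z ≤ ρ * q z - ε := by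
  by_contra hcon
  push Not at hcon
  have key : ∀ N : ℕ, ∃ z ∈ K, (N : ℝ) * q z - 1 / (N + 1) < a z := fun N =>
    hcon N (Nat.cast_nonneg N) (1 / (N + 1)) (by positivity)
  choose z hzK hz using key
  obtain ⟨z₀, hz₀, φ, hφ, hlim⟩ := hK.tendsto_subseq hzK
  have hw : Tendsto (z ∘ φ) atTop (𝓝[K] z₀) :=
    tendsto_nhdsWithin_iff.2 ⟨hlim, Eventually.of_forall fun k => hzK _⟩
  have ha' : Tendsto (fun k => a (z (φ k))) atTop (𝓝 (a z₀)) := (ha z₀ hz₀).tendsto.comp hw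
  have hq' : Tendsto (fun k => q (z (φ k))) atTop (𝓝 (q z₀)) := (hq z₀ hz₀).tendsto.comp hw
  have hinv : Tendsto (fun k : ℕ => 1 / ((φ k : ℝ) + 1)) atTop (𝓝 0) :=
    tendsto_one_div_add_atTop_nhds_zero_nat.comp hφ.tendsto_atTop
  have h1 : q z₀ = 0 := by
    refine le_antisymm ?_ (hq0 z₀ hz₀)
    have h2 : Tendsto (fun k : ℕ => (a (z (φ k)) + q (z (φ k)) + 1) * (1 / ((φ k : ℝ) + 1))) atTop
        (𝓝 ((a z₀ + q z₀ + 1) * 0)) := ((ha'.add hq').add_const 1).mul hinv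
    rw [mul_zero] at h2
    refine le_of_tendsto_of_tendsto' hq' h2 fun k => ?_
    have h3 := hz (φ k)
    have h4 : 1 / ((φ k : ℝ) + 1) ≤ 1 := by
      rw [div_le_one (by positivity)]
      linarith [Nat.cast_nonneg (α := ℝ) (φ k)]
    rw [mul_one_div, le_div_iff₀ (by positivity)]
    linarith
  have h5 := h z₀ hz₀ h1
  have h6 : 0 ≤ a z₀ := by
    have h7 : Tendsto (fun k : ℕ => -(1 / ((φ k : ℝ) + 1))) atTop (𝓝 (-0)) := hinv.neg
    rw [neg_zero] at h7
    refine le_of_tendsto_of_tendsto' h7 ha' fun k => ?_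
    have := hz (φ k)
    have := mul_nonneg (Nat.cast_nonneg (α := ℝ) (φ k)) (hq0 _ (hzK (φ k)))
    linarith
  linarith

/-- The quadratic form `δ'(Ṁ + A'M + MA + 2λM)δ`. -/
def contractionForm (f : Vec n → ℝ → Vec n) (B : Vec n → ℝ → Vec m →L[ℝ] Vec n)
    (M : Vec n → ℝ → Vec n →L[ℝ] Vec n) (lam : ℝ) (x : Vec n) (u : Vec m) (t : ℝ) (δ : Vec n) : ℝ :=
  ⟪δ, metricDot f B M x u t δ⟫_ℝ +
    2 * ⟪M x t δ, fderiv ℝ (fun y => f y t) x δ + fderiv ℝ (fun y => B y t) x δ u⟫_ℝ +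
    2 * lam * ⟪δ, M x t δ⟫_ℝ

theorem fderiv_col (hB : Smooth B) (i : Fin m) (x δ : Vec n) {t : ℝ} (ht : 0 ≤ t) :
    fderiv ℝ (fun y => col B i y t) x δ =
      fderiv ℝ (fun y => B y t) x δ (EuclideanSpace.single i 1) := by
  have h := (SmoothHalf.hasFDerivAt (F := B) hB x ht).clm_apply
    (hasFDerivAt_const (EuclideanSpace.single i (1 : ℝ)) x)
  simp only [col]
  rw [h.fderiv]
  simp

theorem sum_single_smul (u : Vec m) : u = ∑ i, u i • EuclideanSpace.single i (1 : ℝ) := by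
  simpa using ((EuclideanSpace.basisFun (Fin m) ℝ).sum_repr u).symm

theorem jac_apply (hB : Smooth B) (x δ : Vec n) (u : Vec m) {t : ℝ} (ht : 0 ≤ t) :
    jac f B x u t δ = fderiv ℝ (fun y => f y t) x δ + fderiv ℝ (fun y => B y t) x δ u := by
  conv_rhs => rw [sum_single_smul u]
  simp only [jac, _root_.add_apply, _root_.sum_apply, _root_.smul_apply, fderiv_col hB _ _ _ ht,
    map_sum, map_smul]

theorem contractionForm_eq (hB : Smooth B) (hM : IsUniformlyBoundedMetric M α₁ α₂) (x δ : Vec n)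
    (u : Vec m) {t : ℝ} (ht : 0 ≤ t) : contractionForm f B M lam x u t δ =
    ⟪δ, (metricDot f B M x u t + (jac f B x u t).adjoint ∘L M x t + M x t ∘L jac f B x u t
      + (2 * lam) • M x t) δ⟫_ℝ := by
  simp only [contractionForm, _root_.add_apply, ContinuousLinearMap.comp_apply, _root_.smul_apply,
    inner_add_right, inner_smul_right, ContinuousLinearMap.adjoint_inner_right]
  rw [← hM.symm x t ht δ (jac f B x u t δ), real_inner_comm (M x t δ) (jac f B x u t δ),
    jac_apply hB x δ u ht, inner_add_right]
  ring

/-- This isolates the effect of the input: it enters only through the forms of the `H_i`, which the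
growth condition bounds by `Q`. -/
theorem contractionForm_affine (hB : Smooth B) (hM : IsUniformlyBoundedMetric M α₁ α₂)
    (x δ : Vec n) (u : Vec m) {t : ℝ} (ht : 0 ≤ t) : contractionForm f B M lam x u t δ =
    contractionForm f B M lam x 0 t δ + ∑ i, u i * ⟪δ, hMat B M i x t δ⟫_ℝ := by
  have h1 : ∀ i, ⟪δ, hMat B M i x t δ⟫_ℝ = ⟪δ, fderiv ℝ (fun y => M y t) x (col B i x t) δ⟫_ℝ +
      2 * ⟪M x t δ, fderiv ℝ (fun y => B y t) x δ (EuclideanSpace.single i 1)⟫_ℝ := by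
    intro i
    simp only [hMat, _root_.add_apply, ContinuousLinearMap.comp_apply, inner_add_right,
      ContinuousLinearMap.adjoint_inner_right]
    rw [← hM.symm x t ht δ, real_inner_comm (M x t δ), fderiv_col hB _ _ _ ht]
    ring
  have h2 : ∑ i, u i * ⟪δ, fderiv ℝ (fun y => M y t) x (col B i x t) δ⟫_ℝ =
      ⟪δ, fderiv ℝ (fun y => M y t) x (B x t u) δ⟫_ℝ := by
    conv_rhs => rw [sum_single_smul u]
    simp only [map_sum, map_smul, _root_.sum_apply, _root_.smul_apply, inner_sum,
      inner_smul_right, col]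
  have h3 : ∑ i, u i * ⟪M x t δ, fderiv ℝ (fun y => B y t) x δ (EuclideanSpace.single i 1)⟫_ℝ =
      ⟪M x t δ, fderiv ℝ (fun y => B y t) x δ u⟫_ℝ := by
    conv_rhs => rw [sum_single_smul u]
    simp only [map_sum, map_smul, inner_sum, inner_smul_right]
  simp only [h1, mul_add, Finset.sum_add_distrib, h2]
  have h4 : ∑ i, u i * (2 * ⟪M x t δ, fderiv ℝ (fun y => B y t) x δ
      (EuclideanSpace.single i 1)⟫_ℝ) = 2 * ⟪M x t δ, fderiv ℝ (fun y => B y t) x δ u⟫_ℝ := by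
    rw [← h3, Finset.mul_sum]
    exact Finset.sum_congr rfl fun i _ => by ring
  rw [h4]
  simp only [contractionForm, metricDot, map_add, map_zero, add_zero, _root_.add_apply,
    inner_add_right]
  ring

theorem contractionForm_smul (x δ : Vec n) (u : Vec m) (t c : ℝ) :
    contractionForm f B M lam x u t (c • δ) = c ^ 2 * contractionForm f B M lam x u t δ := by
  simp only [contractionForm, map_smul, _root_.smul_apply, ← smul_add, inner_smul_left,
    inner_smul_right, conj_trivial]
  ring

theorem inner_qMat (hM : IsUniformlyBoundedMetric M α₁ α₂) (x δ : Vec n) {t : ℝ} (ht : 0 ≤ t) :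
    ⟪δ, qMat B M x t δ⟫_ℝ = ‖(B x t).adjoint (M x t δ)‖ ^ 2 := by
  simp only [qMat, ContinuousLinearMap.comp_apply]
  rw [← hM.symm x t ht, ← ContinuousLinearMap.adjoint_inner_left, real_inner_self_eq_norm_sq]

theorem continuousOn_contractionForm (hf : Smooth f) (hM : IsUniformlyBoundedMetric M α₁ α₂) :
    ContinuousOn (fun z : Vec n × Vec n × ℝ => contractionForm f B M lam z.1 0 z.2.2 z.2.1)
      (univ ×ˢ univ ×ˢ Ici 0) := by
  have hmap : ContinuousOn (fun z : Vec n × Vec n × ℝ => (z.1, z.2.2)) (univ ×ˢ univ ×ˢ Ici 0) := by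
    fun_prop
  have hmaps : MapsTo (fun z : Vec n × Vec n × ℝ => (z.1, z.2.2)) (univ ×ˢ univ ×ˢ Ici 0)
      (univ ×ˢ Ici 0) := fun z hz => ⟨mem_univ _, hz.2.2⟩
  have hδ : ContinuousOn (fun z : Vec n × Vec n × ℝ => z.2.1) (univ ×ˢ univ ×ˢ Ici 0) := by
    fun_prop
  have c1 := (SmoothHalf.derivWithin (F := M) hM.smooth).continuousOn.comp hmap hmaps
  have c2 := (SmoothHalf.fderiv (F := M) hM.smooth).continuousOn.comp hmap hmaps
  have c3 := (SmoothHalf.continuousOn (F := f) hf).comp hmap hmaps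
  have c4 := (SmoothHalf.fderiv (F := f) hf).continuousOn.comp hmap hmaps
  have c5 := (SmoothHalf.continuousOn (F := M) hM.smooth).comp hmap hmaps
  simp only [contractionForm, metricDot, map_zero, add_zero]
  refine ContinuousOn.add (ContinuousOn.add ?_ ?_) ?_
  · exact hδ.inner ((c1.add (c2.clm_apply c3)).clm_apply hδ)
  · exact continuousOn_const.mul ((c5.clm_apply hδ).inner (c4.clm_apply hδ))
  · exact continuousOn_const.mul (hδ.inner (c5.clm_apply hδ))

/-- A quantitative form of the contraction condition on bounded sets. -/
theorem contractionForm_le (hf : Smooth f) (hB : Smooth B) (hM : IsUniformlyBoundedMetric M α₁ α₂)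
    (hccm : ContractionCondition f B M lam) (hgrowth : InputGrowthCondition B M) (R : ℝ) :
    ∃ ρ₀, 0 ≤ ρ₀ ∧ ∃ k, 0 ≤ k ∧ ∃ ε, 0 < ε ∧ ∀ t, 0 ≤ t → t ≤ R → ∀ (x δ : Vec n) (u : Vec m),
      ‖x‖ ≤ R → contractionForm f B M lam x u t δ ≤
        (ρ₀ + k * ‖u‖) * ‖(B x t).adjoint (M x t δ)‖ ^ 2 - ε * ‖δ‖ ^ 2 := by
  -- All the forms are homogeneous of degree two in `δ`, so unit vectors suffice. On this compact
  -- set `ψ` is bounded.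
  set K : Set (Vec n × Vec n × ℝ) :=
    Metric.closedBall 0 R ×ˢ Metric.sphere 0 1 ×ˢ Icc 0 R with hKdef
  have hK : IsCompact K :=
    (isCompact_closedBall _ _).prod ((isCompact_sphere _ _).prod isCompact_Icc)
  have hKsub : K ⊆ univ ×ˢ univ ×ˢ Ici 0 := fun z hz => ⟨mem_univ _, mem_univ _, hz.2.2.1⟩
  have hQ : ContinuousOn (fun z : Vec n × Vec n × ℝ =>
      ‖(B z.1 z.2.2).adjoint (M z.1 z.2.2 z.2.1)‖ ^ 2) (univ ×ˢ univ ×ˢ Ici 0) := by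
    have hmap : ContinuousOn (fun z : Vec n × Vec n × ℝ => (z.1, z.2.2))
      (univ ×ˢ univ ×ˢ Ici 0) := by fun_prop
    have hmaps : MapsTo (fun z : Vec n × Vec n × ℝ => (z.1, z.2.2)) (univ ×ˢ univ ×ˢ Ici 0)
        (univ ×ˢ Ici 0) := fun z hz => ⟨mem_univ _, hz.2.2⟩
    have hδ : ContinuousOn (fun z : Vec n × Vec n × ℝ => z.2.1) (univ ×ˢ univ ×ˢ Ici 0) := by
      fun_prop
    have c5 := (SmoothHalf.continuousOn (F := M) hM.smooth).comp hmap hmaps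
    have c6 := (SmoothHalf.continuousOn (F := B) hB).comp hmap hmaps
    have c7 := (ContinuousLinearMap.adjoint (𝕜 := ℝ) (E := Vec m) (F := Vec n)).continuous.comp_continuousOn c6
    exact ((c7.clm_apply (c5.clm_apply hδ)).norm).pow 2
  -- Finsler's lemma is applied at zero input only, since the inputs do not range over a compact
  -- set. The input is restored by affinity, at the cost of the term `k|u|`.
  obtain ⟨ρ₀, hρ₀, ε, hε, h1⟩ := exists_uniform_finsler hK
    ((continuousOn_contractionForm (B := B) (lam := lam) hf hM).mono hKsub) (hQ.mono hKsub)
    (fun z _ => sq_nonneg _) (fun z hz h0 => by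
      have hz0 : 0 ≤ z.2.2 := hz.2.2.1
      rw [contractionForm_eq hB hM _ _ _ hz0]
      refine hccm z.2.2 hz0 z.1 0 z.2.1 ?_ fun v => ?_
      · intro h
        have := hz.2.1
        rw [h] at this
        simp at this
      · have h2 : (B z.1 z.2.2).adjoint (M z.1 z.2.2 z.2.1) = 0 := by
          rwa [sq_eq_zero_iff, norm_eq_zero] at h0
        rw [← hM.symm _ _ hz0, ← ContinuousLinearMap.adjoint_inner_left, h2, inner_zero_left])
  obtain ⟨ψ, hψc, hψ0, hψ⟩ := hgrowth
  obtain ⟨k₁, hk₁⟩ := hK.exists_bound_of_continuousOn (hψc.mono hKsub)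
  refine ⟨ρ₀, hρ₀, m * |k₁|, by positivity, ε, hε, fun t ht htR x δ u hx => ?_⟩
  rcases eq_or_ne δ 0 with rfl | hδ
  · simp [contractionForm]
  have hδ' : 0 < ‖δ‖ := norm_pos_iff.2 hδ
  set e := ‖δ‖⁻¹ • δ with he
  have hen : ‖e‖ = 1 := by
    rw [he, norm_smul, norm_inv, norm_norm, inv_mul_cancel₀ hδ'.ne']
  have hδe : δ = ‖δ‖ • e := by rw [he, smul_smul, mul_inv_cancel₀ hδ'.ne', one_smul]
  have hz : (x, e, t) ∈ K := ⟨by simpa using hx, by simpa using hen, ht, htR⟩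
  have a1 := h1 _ hz
  simp only at a1
  set q := ‖(B x t).adjoint (M x t e)‖ ^ 2 with hq
  have hq0 : 0 ≤ q := sq_nonneg _
  have a2 : ∀ i, |⟪e, hMat B M i x t e⟫_ℝ| ≤ |k₁| * q := by
    intro i
    refine (hψ i x e t ht).trans ?_
    rw [inner_qMat hM x e ht]
    have := hk₁ _ hz
    rw [Real.norm_eq_abs] at this
    gcongr
    exact (le_abs_self _).trans (this.trans (le_abs_self _))
  have a3 : ∑ i, u i * ⟪e, hMat B M i x t e⟫_ℝ ≤ m * |k₁| * ‖u‖ * q := by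
    have : ∀ i ∈ Finset.univ, u i * ⟪e, hMat B M i x t e⟫_ℝ ≤ ‖u‖ * (|k₁| * q) := by
      intro i _
      refine (le_abs_self _).trans ?_
      rw [abs_mul]
      have h3 : |u i| ≤ ‖u‖ := by
        have := PiLp.norm_apply_le u i
        rwa [Real.norm_eq_abs] at this
      exact mul_le_mul h3 (a2 i) (abs_nonneg _) (norm_nonneg _)
    refine (Finset.sum_le_sum this).trans (le_of_eq ?_)
    simp only [Finset.sum_const, Finset.card_univ, Fintype.card_fin, nsmul_eq_mul]
    ring
  have a4 : contractionForm f B M lam x u t e ≤ (ρ₀ + m * |k₁| * ‖u‖) * q - ε := by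
    rw [contractionForm_affine hB hM x e u ht]
    linarith
  have a5 : ‖(B x t).adjoint (M x t δ)‖ ^ 2 = ‖δ‖ ^ 2 * q := by
    conv_lhs => rw [hδe]
    rw [map_smul, map_smul, norm_smul, norm_norm, mul_pow, hq]
  have a6 := mul_le_mul_of_nonneg_left a4 (sq_nonneg ‖δ‖)
  rw [a5]
  conv_lhs => rw [hδe]
  rw [contractionForm_smul]
  linarith

/-- The squared Riemannian length of a short segment between two states. -/
def pairForm (M : Vec n → ℝ → Vec n →L[ℝ] Vec n) (Y : Vec n × Vec n) (t : ℝ) : ℝ :=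
  ⟪Y.2 - Y.1, M Y.1 t (Y.2 - Y.1)⟫_ℝ

theorem smoothHalf_pairForm (hM : IsUniformlyBoundedMetric M α₁ α₂) : SmoothHalf (pairForm M) := by
  have h1 := SmoothHalf.comp_fst (F := M) hM.smooth
  have h2 : ContDiffOn ℝ ∞ (fun p : (Vec n × Vec n) × ℝ => p.1.2 - p.1.1) (univ ×ˢ Ici 0) := by
    fun_prop
  exact h2.inner ℝ (ContDiffOn.clm_apply h1 h2)

theorem hasDerivAt_pairForm (hM : IsUniformlyBoundedMetric M α₁ α₂) {y z : ℝ → Vec n}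
    {y' z' : Vec n} {t : ℝ} (ht : 0 < t) (hy : HasDerivAt y y' t) (hz : HasDerivAt z z' t) :
    HasDerivAt (fun s => pairForm M (y s, z s) s)
      (⟪z t - y t, (derivWithin (fun s => M (y t) s) (Ici 0) t +
        fderiv ℝ (fun x => M x t) (y t) y') (z t - y t)⟫_ℝ +
        2 * ⟪M (y t) t (z t - y t), z' - y'⟫_ℝ) t := by
  have h1 := SmoothHalf.hasDerivAt_comp (F := M) hM.smooth ht hy
  have h2 := hz.sub hy
  have h3 := h2.inner ℝ (h1.clm_apply h2)
  refine h3.congr_deriv ?_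
  simp only [Pi.sub_apply, inner_add_right, _root_.add_apply]
  rw [← hM.symm _ _ ht.le (z t - y t) (z' - y'), real_inner_comm (M (y t) t (z t - y t)) (z' - y')]
  ring

set_option maxHeartbeats 800000 in
/-- The infinitesimal contraction estimate for two nearby states with nearby inputs. -/
theorem pairForm_deriv_le (hf : Smooth f) (hB : Smooth B) (hM : IsUniformlyBoundedMetric M α₁ α₂)
    (hccm : ContractionCondition f B M lam) (hgrowth : InputGrowthCondition B M) (R : ℝ) :
    ∃ ρ₀, 0 ≤ ρ₀ ∧ ∃ k, 0 ≤ k ∧ ∃ ε, 0 < ε ∧ ∀ U, ∃ C, 0 < C ∧ ∀ t, 0 ≤ t → t ≤ R →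
      ∀ (y z : Vec n) (u w : Vec m) (ρ : ℝ), ‖y‖ ≤ R → ‖z‖ ≤ R → ‖u‖ ≤ U → ρ₀ + k * ‖u‖ ≤ ρ →
      ⟪z - y, (derivWithin (fun s => M y s) (Ici 0) t +
        fderiv ℝ (fun x => M x t) y (f y t + B y t u)) (z - y)⟫_ℝ +
        2 * ⟪M y t (z - y), (f z t + B z t (u + w)) - (f y t + B y t u)⟫_ℝ ≤
      -(2 * lam) * pairForm M (y, z) t - ε * ‖z - y‖ ^ 2 +
        C * ‖z - y‖ * ‖w + (ρ / 2) • (B y t).adjoint (M y t (z - y))‖ +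
        C * ‖z - y‖ ^ 2 * (‖z - y‖ + ‖w‖) := by
  obtain ⟨ρ₀, hρ₀, k, hk, ε, hε, hW⟩ := contractionForm_le hf hB hM hccm hgrowth R
  refine ⟨ρ₀, hρ₀, k, hk, ε, hε, fun U => ?_⟩
  obtain ⟨C₁, hC₁, hft⟩ := SmoothHalf.taylor (F := f) hf R
  obtain ⟨C₂, hC₂, hBt⟩ := SmoothHalf.taylor (F := B) hB R
  obtain ⟨C₃, hC₃, hBl⟩ := SmoothHalf.bounded_lipschitz (F := B) hB R
  have hα₂ := hM.pos_upper
  refine ⟨2 * α₂ * (C₁ + C₂ * |U| + C₃), by positivity,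
    fun t ht htR y z u w ρ hy hz hu hρ => ?_⟩
  have hu' : ‖u‖ ≤ |U| := hu.trans (le_abs_self _)
  set d := z - y with hd
  set q := (B y t).adjoint (M y t d) with hq
  set e := w + (ρ / 2) • q with he
  have a1 := hW t ht htR y d u hy
  have a2 := hft y z t hy hz ht htR
  have a3 := hBt y z t hy hz ht htR
  obtain ⟨a4, a5⟩ := hBl z y t t hz hy ht htR ht htR
  obtain ⟨a6, -⟩ := hBl y y t t hy hy ht htR ht htR
  rw [sub_self, abs_zero, add_zero] at a5
  rw [← hd] at a2 a3 a5
  set r₁ := f z t - f y t - fderiv ℝ (fun x => f x t) y d with hr₁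
  set r₂ := (B z t - B y t - fderiv ℝ (fun x => B x t) y d) u with hr₂
  set r₃ := (B z t - B y t) w with hr₃
  -- The linear part yields the contraction form. The input difference contributes `2⟨q, w⟩ = 2⟨q,
  -- e⟩ - ρ|q|²`, whose negative term absorbs `(ρ₀ + k|u|)|q|²`. The rest is the mismatch `e` and
  -- remainders of higher order.
  have e1 : (f z t + B z t (u + w)) - (f y t + B y t u) =
      (fderiv ℝ (fun x => f x t) y d + fderiv ℝ (fun x => B x t) y d u) + B y t w +
        (r₁ + r₂ + r₃) := by
    simp only [hr₁, hr₂, hr₃, _root_.sub_apply, map_add]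
    abel
  have hMd : ‖M y t d‖ ≤ α₂ * ‖d‖ := norm_metric_le hM y ht d
  have hr : ‖r₁ + r₂ + r₃‖ ≤ (C₁ + C₂ * |U| + C₃) * (‖d‖ * (‖d‖ + ‖w‖)) := by
    have b1 := (B z t - B y t - fderiv ℝ (fun x => B x t) y d).le_of_opNorm_le a3 u
    have b2 := (B z t - B y t).le_of_opNorm_le a5 w
    have b3 := norm_add_le (r₁ + r₂) r₃
    have b4 := norm_add_le r₁ r₂
    have b5 : C₂ * ‖d‖ ^ 2 * ‖u‖ ≤ C₂ * ‖d‖ ^ 2 * |U| := by gcongr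
    have b6 : 0 ≤ (C₁ + C₂ * |U|) * (‖d‖ * ‖w‖) := by positivity
    have b7 : 0 ≤ C₃ * ‖d‖ ^ 2 := by positivity
    linarith
  have e2 : ⟪M y t d, B y t w⟫_ℝ = ⟪q, e⟫_ℝ - ρ / 2 * ‖q‖ ^ 2 := by
    rw [← ContinuousLinearMap.adjoint_inner_left, ← hq, he, inner_add_right, inner_smul_right,
      real_inner_self_eq_norm_sq]
    ring
  have hqn : ‖q‖ ≤ C₃ * (α₂ * ‖d‖) := by
    have := (B y t).adjoint.le_opNorm (M y t d)
    rw [LinearIsometryEquiv.norm_map] at this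
    exact this.trans (mul_le_mul a6 hMd (norm_nonneg _) hC₃.le)
  have g1 := real_inner_le_norm q e
  have g2 := real_inner_le_norm (M y t d) (r₁ + r₂ + r₃)
  have g3 : ‖q‖ * ‖e‖ ≤ C₃ * (α₂ * ‖d‖) * ‖e‖ := by gcongr
  have g4 : ‖M y t d‖ * ‖r₁ + r₂ + r₃‖ ≤
      α₂ * ‖d‖ * ((C₁ + C₂ * |U| + C₃) * (‖d‖ * (‖d‖ + ‖w‖))) := by gcongr
  have g5 : (ρ₀ + k * ‖u‖) * ‖q‖ ^ 2 ≤ ρ * ‖q‖ ^ 2 := by gcongr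
  have g6 : 0 ≤ 2 * α₂ * (C₁ + C₂ * |U|) * ‖d‖ * ‖e‖ := by positivity
  simp only [contractionForm, metricDot] at a1
  have e3 : pairForm M (y, z) t = ⟪d, M y t d⟫_ℝ := rfl
  rw [e1, inner_add_right, inner_add_right, e2, e3]
  linarith

end

end CCM

namespace CCM

noncomputable section

variable {n m : ℕ} {f : Vec n → ℝ → Vec n} {B : Vec n → ℝ → Vec m →L[ℝ] Vec n}
  {M : Vec n → ℝ → Vec n →L[ℝ] Vec n} {α₁ α₂ lam : ℝ}

/-! ### Contraction of pairs of neighbouring trajectories -/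

theorem lipschitzOnWith_pairForm (hf : Smooth f) (hB : Smooth B)
    (hM : IsUniformlyBoundedMetric M α₁ α₂) {y z : ℝ → Vec n} {u v : ℝ → Vec m} {a b R U : ℝ}
    (ha : 0 ≤ a) (hbR : b ≤ R) (hy : SolOn f B y u a b) (hz : SolOn f B z v a b)
    (hyR : ∀ t ∈ Icc a b, ‖y t‖ ≤ R) (hzR : ∀ t ∈ Icc a b, ‖z t‖ ≤ R)
    (hu : ∀ᵐ t, t ∈ Icc a b → ‖u t‖ ≤ U) (hv : ∀ᵐ t, t ∈ Icc a b → ‖v t‖ ≤ U) :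
    ∃ K, LipschitzOnWith K (fun t => pairForm M (y t, z t) t) (Icc a b) := by
  obtain ⟨K, hK, hlip⟩ := SolOn.norm_sub_le_of_bound hf hB R U
  obtain ⟨C, hC, hp⟩ := (smoothHalf_pairForm hM).bounded_lipschitz R
  refine ⟨(C * (K + 1)).toNNReal, LipschitzOnWith.of_dist_le_mul fun s hs t ht => ?_⟩
  rw [Real.coe_toNNReal _ (by positivity), Real.dist_eq, Real.dist_eq]
  have h1 := hlip y u a b ha hbR hy hyR hu t ht s hs
  have h2 := hlip z v a b ha hbR hz hzR hv t ht s hs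
  have hn : ∀ r ∈ Icc a b, ‖(y r, z r)‖ ≤ R := fun r hr => by
    rw [Prod.norm_def]; exact max_le (hyR r hr) (hzR r hr)
  have h3 := (hp (y s, z s) (y t, z t) s t (hn s hs) (hn t ht) (ha.trans hs.1) (hs.2.trans hbR)
    (ha.trans ht.1) (ht.2.trans hbR)).2
  have h4 : ‖((y s, z s) - (y t, z t) : Vec n × Vec n)‖ ≤ K * |s - t| := by
    rw [Prod.norm_def]; exact max_le h1 h2
  rw [Real.norm_eq_abs] at h3
  refine h3.trans ?_
  rw [mul_assoc]
  gcongr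
  linarith

/-- The input difference may miss the matching feedback in two ways: a part proportional to the
separation, absorbed by the margin `ε`, and a remainder `σ`, which acts as a source. The exact rate
survives up to that source and a cubic term. -/
theorem pairForm_decay (hf : Smooth f) (hB : Smooth B) (hM : IsUniformlyBoundedMetric M α₁ α₂)
    (hlam : 0 < lam) (hccm : ContractionCondition f B M lam) (hgrowth : InputGrowthCondition B M)
    (R : ℝ) :
    ∃ ρ₀, 0 ≤ ρ₀ ∧ ∃ k, 0 ≤ k ∧ ∃ ε, 0 < ε ∧ ∀ U, ∃ C, 0 < C ∧
      ∀ (y z : ℝ → Vec n) (u : ℝ → Vec m) (w : Vec m) (ρ a b D η σ : ℝ), 0 ≤ a → b ≤ R →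
      SolOn f B y u a b → SolOn f B z (fun s => u s + w) a b →
      (∀ t ∈ Icc a b, ‖y t‖ ≤ R) → (∀ t ∈ Icc a b, ‖z t‖ ≤ R) → (∀ t ∈ Icc a b, ‖u t‖ ≤ U) →
      (∀ t ∈ Icc a b, ρ₀ + k * ‖u t‖ ≤ ρ) → (∀ t ∈ Icc a b, ‖z t - y t‖ ≤ D) → ‖w‖ ≤ D →
      (∀ t ∈ Icc a b, ‖w + (ρ / 2) • (B (y t) t).adjoint (M (y t) t (z t - y t))‖ ≤
        η * ‖z t - y t‖ + σ) → C * η ≤ ε → 0 ≤ σ →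
      ∀ t ∈ Icc a b, pairForm M (y t, z t) t ≤
        Real.exp (-(2 * lam) * (t - a)) * pairForm M (y a, z a) a + C / lam * (D * σ + D ^ 3) := by
  obtain ⟨ρ₀, hρ₀, k, hk, ε, hε, hW⟩ := pairForm_deriv_le hf hB hM hccm hgrowth R
  refine ⟨ρ₀, hρ₀, k, hk, ε, hε, fun U => ?_⟩
  obtain ⟨C, hC, hd⟩ := hW U
  refine ⟨C, hC, fun y z u w ρ a b D η σ ha hbR hy hz hyR hzR hu hρ hD hw he hη hσ τ hτ => ?_⟩
  have hD0 : 0 ≤ D := (norm_nonneg w).trans hw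
  -- A level chosen so that its restoring term `2λS` dominates the source terms; what exceeds it
  -- decays exponentially.
  set S := C / lam * (D * σ + D ^ 3) with hS
  have hS0 : 0 ≤ S := by positivity
  have hsub : Icc a τ ⊆ Icc a b := Icc_subset_Icc_right hτ.2
  obtain ⟨K, hK⟩ := lipschitzOnWith_pairForm hf hB hM (U := U + ‖w‖) ha hbR hy hz hyR hzR
    (Eventually.of_forall fun t ht => (hu t ht).trans (by linarith [norm_nonneg w]))
    (Eventually.of_forall fun t ht => (norm_add_le _ _).trans (by linarith [hu t ht]))
  have hdec := exp_decay_of_ae_deriv (g := fun t => pairForm M (y t, z t) t - S) (a := a) (b := τ)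
    (c := 2 * lam) (K := K) hτ.1 (by
      refine LipschitzOnWith.of_dist_le_mul fun s hs t ht => ?_
      rw [dist_sub_right]
      exact hK.dist_le_mul s (hsub hs) t (hsub ht)) (by
      filter_upwards [hy.ae_hasDerivAt hf hB ha, hz.ae_hasDerivAt hf hB ha] with t h1 h2 ht d hdd
      have ht' : t ∈ Ioo a b := ⟨ht.1, ht.2.trans_le hτ.2⟩
      have htI : t ∈ Icc a b := Ioo_subset_Icc_self ht'
      have ht0 : 0 < t := ha.trans_lt ht.1
      have h3 := (hasDerivAt_pairForm hM ht0 (h1 ht') (h2 ht')).sub_const S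
      rw [hdd.unique h3]
      refine (hd t ht0.le (ht'.2.le.trans hbR) (y t) (z t) (u t) w ρ (hyR t htI) (hzR t htI)
        (hu t htI) (hρ t htI)).trans ?_
      set δ := ‖z t - y t‖ with hδ
      have hδ0 : 0 ≤ δ := norm_nonneg _
      have hδD : δ ≤ D := hD t htI
      have g1 : C * δ * ‖w + (ρ / 2) • (B (y t) t).adjoint (M (y t) t (z t - y t))‖ ≤
          C * δ * (η * δ + σ) := by
        have := he t htI
        gcongr
      have g2 : C * η * δ ^ 2 ≤ ε * δ ^ 2 := by gcongr
      have g3 : C * δ * σ ≤ C * D * σ := by gcongr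
      have g4 : C * δ ^ 2 * (δ + ‖w‖) ≤ C * D ^ 2 * (D + D) := by gcongr
      have e1 : -(2 * lam) * (pairForm M (y t, z t) t - S) =
          -(2 * lam) * pairForm M (y t, z t) t + 2 * C * (D * σ + D ^ 3) := by
        rw [hS]; field_simp; ring
      have g5 : 0 ≤ C * D * σ := by positivity
      rw [e1]
      linarith)
  have hexp : Real.exp (-(2 * lam) * (τ - a)) ≤ 1 :=
    Real.exp_le_one_iff.2 (by nlinarith [hτ.1])
  have := Real.exp_pos (-(2 * lam) * (τ - a))
  have h5 := mul_nonneg this.le hS0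
  rw [mul_sub] at hdec
  linarith

theorem SolOn.norm_increment_sub_le (hf : Smooth f) (hB : Smooth B) (R U : ℝ) : ∃ K, 0 < K ∧
    ∀ (x y : ℝ → Vec n) (u v : ℝ → Vec m) (a b w D : ℝ), 0 ≤ a → b ≤ R → SolOn f B x u a b →
      SolOn f B y v a b → (∀ t ∈ Icc a b, ‖x t‖ ≤ R) → (∀ t ∈ Icc a b, ‖y t‖ ≤ R) →
      (∀ t ∈ Icc a b, ‖u t‖ ≤ U) → (∀ t ∈ Icc a b, ‖u t - v t‖ ≤ w) →
      (∀ t ∈ Icc a b, ‖x t - y t‖ ≤ D) →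
      ∀ t ∈ Icc a b, ‖(x t - y t) - (x a - y a)‖ ≤ K * (D + w) * (t - a) := by
  obtain ⟨K, hK, h⟩ := exists_rhs_bound hf hB R U
  refine ⟨K, hK, fun x y u v a b w D ha hbR hx hy hxR hyR hu huv hD t ht => ?_⟩
  have ha' : a ∈ Icc a b := ⟨le_rfl, ht.1.trans ht.2⟩
  have e : (x t - y t) - (x a - y a) = ∫ r in a..t, ((f (x r) r + B (x r) r (u r)) -
      (f (y r) r + B (y r) r (v r))) := by
    rw [intervalIntegral.integral_sub (hx.intervalIntegrable hf hB ha ha' ht)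
      (hy.intervalIntegrable hf hB ha ha' ht), ← hx.sub_eq hf hB ha ha' ht,
      ← hy.sub_eq hf hB ha ha' ht]
    abel
  rw [e]
  refine (intervalIntegral.norm_integral_le_of_norm_le_const (C := K * (D + w))
    fun r hr => ?_).trans (le_of_eq ?_)
  · rw [uIoc_of_le ht.1] at hr
    have hr' : r ∈ Icc a b := ⟨hr.1.le, hr.2.trans ht.2⟩
    refine (h r (ha.trans hr'.1) (hr'.2.trans hbR) (x r) (y r) (u r) (v r) (hxR r hr')
      (hyR r hr') (hu r hr')).2.trans ?_
    have := hD r hr'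
    have := huv r hr'
    gcongr
  · rw [abs_of_nonneg (by linarith [ht.1])]

theorem smoothHalf_adjoint (hB : Smooth B) : SmoothHalf (fun x t => (B x t).adjoint) := by
  let L : (Vec m →L[ℝ] Vec n) →ₗ[ℝ] (Vec n →L[ℝ] Vec m) :=
    { toFun := fun A => A.adjoint
      map_add' := map_add _
      map_smul' := fun c A => by simp }
  have h1 : ContDiff ℝ ∞ (fun A : Vec m →L[ℝ] Vec n => A.adjoint) :=
    L.toContinuousLinearMap.contDiff
  exact h1.comp_contDiffOn hB

theorem smoothHalf_adjoint_comp (hB : Smooth B) (hM : IsUniformlyBoundedMetric M α₁ α₂) :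
    SmoothHalf (fun x t => (B x t).adjoint ∘L M x t) :=
  (smoothHalf_adjoint hB).clm_comp hM.smooth

end

end CCM

/-! ### Neighbouring trajectories under a held matching feedback. -/

namespace CCM

noncomputable section

variable {n m : ℕ} {f : Vec n → ℝ → Vec n} {B : Vec n → ℝ → Vec m →L[ℝ] Vec n}
  {M : Vec n → ℝ → Vec n →L[ℝ] Vec n} {α₁ α₂ lam : ℝ}

set_option maxHeartbeats 1600000 in
/-- Two trajectories that start a distance `O(δ)` apart, and whose inputs differ by the matching
feedback held constant, contract at rate `lam` for a short uniform time, up to `O(δ³)`. -/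
theorem pairForm_hold (hf : Smooth f) (hB : Smooth B) (hM : IsUniformlyBoundedMetric M α₁ α₂)
    (hlam : 0 < lam) (hccm : ContractionCondition f B M lam) (hgrowth : InputGrowthCondition B M)
    (R : ℝ) :
    ∃ ρ₀, 0 ≤ ρ₀ ∧ ∃ k, 0 ≤ k ∧ ∀ U P A, 0 ≤ P → 0 ≤ A → ∃ h, 0 < h ∧ ∃ C, 0 < C ∧
      ∀ (y z : ℝ → Vec n) (u : ℝ → Vec m) (w : Vec m) (v : Vec n) (ρ a b δ : ℝ),
      0 ≤ a → b ≤ R → b ≤ a + h → 0 ≤ δ → δ ≤ 1 → 0 ≤ ρ → ρ ≤ P → ‖v‖ ≤ A →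
      SolOn f B y u a b → SolOn f B z (fun s => u s + w) a b →
      (∀ t ∈ Icc a b, ‖y t‖ ≤ R) → (∀ t ∈ Icc a b, ‖z t‖ ≤ R) → (∀ t ∈ Icc a b, ‖u t‖ ≤ U) →
      (∀ t ∈ Icc a b, ρ₀ + k * ‖u t‖ ≤ ρ) → ‖z a - y a - δ • v‖ ≤ A * δ ^ 2 →
      ‖w + (δ * ρ / 2) • (B (y a) a).adjoint (M (y a) a v)‖ ≤ A * δ ^ 2 →
      ∀ t ∈ Icc a b, pairForm M (y t, z t) t ≤
        Real.exp (-(2 * lam) * (t - a)) * pairForm M (y a, z a) a + C * δ ^ 3 := by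
  obtain ⟨ρ₀, hρ₀, k, hk, ε, hε, hdecay⟩ := pairForm_decay hf hB hM hlam hccm hgrowth R
  refine ⟨ρ₀, hρ₀, k, hk, fun U P A hP hA => ?_⟩
  obtain ⟨C, hC, hdec⟩ := hdecay U
  obtain ⟨K, hK, hdep⟩ := SolOn.norm_sub_le hf hB R U
  obtain ⟨K', hK', hinc⟩ := SolOn.norm_increment_sub_le hf hB R U
  obtain ⟨K₂, hK₂, hspeed⟩ := SolOn.norm_sub_le_of_bound hf hB R U
  obtain ⟨CL, hCL, hL⟩ := (smoothHalf_adjoint_comp hB hM).bounded_lipschitz R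
  obtain ⟨Ca, hCa⟩ : ∃ c, c = P * CL / 2 + A + 1 := ⟨_, rfl⟩
  have hCa0 : 0 < Ca := by rw [hCa]; positivity
  obtain ⟨Cb, hCb⟩ : ∃ c, c = ((1 + A) + K * Ca) * Real.exp K := ⟨_, rfl⟩
  have hCb0 : 0 < Cb := by rw [hCb]; positivity
  obtain ⟨Cc, hCc⟩ : ∃ c, c = K' * (Cb + Ca) := ⟨_, rfl⟩
  have hCc0 : 0 < Cc := by rw [hCc]; positivity
  obtain ⟨Cd, hCd⟩ : ∃ c, c = CL * ((K₂ + 1) * Cb + Cc) := ⟨_, rfl⟩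
  have hCd0 : 0 < Cd := by rw [hCd]; positivity
  obtain ⟨D₀, hD₀⟩ : ∃ c, c = (Cb + Ca) * (A + 1) := ⟨_, rfl⟩
  have hD₀0 : 0 < D₀ := by rw [hD₀]; positivity
  obtain ⟨σ₀, hσ₀⟩ : ∃ c, c = A + P / 2 * (Cd * (2 * A + 2) + CL * A) := ⟨_, rfl⟩
  have hσ₀0 : 0 ≤ σ₀ := by rw [hσ₀]; positivity
  -- The second bound lets the separation change by at most half of its scale `X`. The third keeps
  -- the drift `P·Cd·h` of the frozen feedback within the margin `ε`.
  set h := min 1 (min (1 / (2 * Cc)) (ε / (C * (P * Cd + 1)))) with hh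
  have hh0 : 0 < h := by positivity
  have hh1 : h ≤ 1 := min_le_left _ _
  have hhc : Cc * h ≤ 1 / 2 := by
    have h1 : h ≤ 1 / (2 * Cc) := (min_le_right _ _).trans (min_le_left _ _)
    calc Cc * h ≤ Cc * (1 / (2 * Cc)) := by gcongr
      _ = 1 / 2 := by field_simp
  have hhe : C * (P * Cd * h) ≤ ε := by
    have h1 : h ≤ ε / (C * (P * Cd + 1)) := (min_le_right _ _).trans (min_le_right _ _)
    rw [le_div_iff₀ (by positivity)] at h1
    have : 0 ≤ h * C := by positivity
    have e : h * (C * (P * Cd + 1)) = C * (P * Cd * h) + h * C := by ring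
    linarith
  refine ⟨h, hh0, C / lam * (D₀ * σ₀ + D₀ ^ 3) + 1, by positivity,
    fun y z u w v ρ a b δ ha hbR hbh hδ0 hδ1 hρ0 hρP hv hy hz hyR hzR hu hρu hzy hwv => ?_⟩
  intro t₁ ht₁
  have hab : a ≤ b := ht₁.1.trans ht₁.2
  have ha' : a ∈ Icc a b := ⟨le_rfl, hab⟩
  set V := ‖v‖ with hV
  have hV0 : 0 ≤ V := norm_nonneg v
  -- The common scale of the separation and of the input difference. The part `δ|v|` is kept apart
  -- from `δ²` because the error must be bounded relative to the separation itself, which may be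
  -- much smaller than `δ`.
  obtain ⟨X, hX⟩ : ∃ c, c = δ * V + δ ^ 2 := ⟨_, rfl⟩
  have hX0 : 0 ≤ X := by rw [hX]; positivity
  have hXδ : X ≤ (A + 1) * δ := by
    have h1 : δ * V ≤ δ * A := by gcongr
    have h2 : δ ^ 2 ≤ δ := pow_le_of_le_one hδ0 hδ1 two_ne_zero
    linarith
  have hLa : ‖(B (y a) a).adjoint ∘L M (y a) a‖ ≤ CL :=
    (hL (y a) (y a) a a (hyR a ha') (hyR a ha') ha (hab.trans hbR) ha (hab.trans hbR)).1
  have hLv := ((B (y a) a).adjoint ∘L M (y a) a).le_of_opNorm_le hLa v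
  rw [ContinuousLinearMap.comp_apply] at hLv
  have hδ2X : δ ^ 2 ≤ X := by linarith [mul_nonneg hδ0 hV0]
  have hδVX : δ * V ≤ X := by linarith [sq_nonneg δ]
  have hwX : ‖w‖ ≤ Ca * X := by
    have h1 := norm_sub_le (w + (δ * ρ / 2) • (B (y a) a).adjoint (M (y a) a v))
      ((δ * ρ / 2) • (B (y a) a).adjoint (M (y a) a v))
    rw [add_sub_cancel_right] at h1
    have h2 : ‖(δ * ρ / 2) • (B (y a) a).adjoint (M (y a) a v)‖ ≤ P * CL / 2 * (δ * V) := by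
      rw [norm_smul, Real.norm_of_nonneg (by positivity)]
      calc δ * ρ / 2 * ‖(B (y a) a).adjoint (M (y a) a v)‖ ≤ δ * P / 2 * (CL * V) := by gcongr
        _ = _ := by ring
    have h3 : P * CL / 2 * (δ * V) ≤ P * CL / 2 * X := by gcongr
    have h4 : A * δ ^ 2 ≤ A * X := by gcongr
    rw [hCa]; linarith
  have hΔa : ‖z a - y a‖ ≤ (1 + A) * X := by
    have h1 := norm_add_le (z a - y a - δ • v) (δ • v)
    rw [sub_add_cancel, norm_smul, Real.norm_of_nonneg hδ0] at h1
    have h4 : A * δ ^ 2 ≤ A * X := by gcongr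
    linarith
  have hwuv : ∀ t ∈ Icc a b, ‖u t - (u t + w)‖ ≤ ‖w‖ := fun t _ => by
    rw [sub_add_cancel_left, norm_neg]
  have hta : ∀ t ∈ Icc a b, t - a ≤ h := fun t ht => by linarith [ht.2]
  have hΔ : ∀ t ∈ Icc a b, ‖z t - y t‖ ≤ Cb * X := by
    intro t ht
    have h1 := hdep y z u (fun s => u s + w) a b ‖w‖ ha hbR hy hz hyR hzR
      (Eventually.of_forall hu) (norm_nonneg w) (Eventually.of_forall hwuv) t ht
    rw [norm_sub_rev, norm_sub_rev (y a)] at h1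
    have hta0 : 0 ≤ t - a := by linarith [ht.1]
    have hta1 : t - a ≤ 1 := (hta t ht).trans hh1
    have h2 : K * ‖w‖ * (t - a) ≤ K * (Ca * X) * 1 := by gcongr
    have h3 : Real.exp (K * (t - a)) ≤ Real.exp K :=
      Real.exp_le_exp.2 (mul_le_of_le_one_right hK.le hta1)
    refine h1.trans ?_
    have h4 : (‖z a - y a‖ + K * ‖w‖ * (t - a)) * Real.exp (K * (t - a)) ≤
        ((1 + A) * X + K * (Ca * X) * 1) * Real.exp K := by gcongr
    refine h4.trans (le_of_eq ?_)
    rw [hCb]; ring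
  have hΔinc : ∀ t ∈ Icc a b, ‖(z t - y t) - (z a - y a)‖ ≤ Cc * h * X := by
    intro t ht
    have h1 := hinc y z u (fun s => u s + w) a b ‖w‖ (Cb * X) ha hbR hy hz hyR hzR hu hwuv
      (fun t ht => by rw [norm_sub_rev]; exact hΔ t ht) t ht
    have e : ‖(z t - y t) - (z a - y a)‖ = ‖y t - z t - (y a - z a)‖ := by
      rw [← norm_neg]; congr 1; abel
    rw [e]
    have hta0 : 0 ≤ t - a := by linarith [ht.1]
    have hta1 := hta t ht
    calc ‖y t - z t - (y a - z a)‖ ≤ K' * (Cb * X + ‖w‖) * (t - a) := h1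
      _ ≤ K' * (Cb * X + Ca * X) * h := by gcongr
      _ = _ := by rw [hCc]; ring
  -- Conversely, the scale is recovered from the current separation up to `O(δ²)`. An error `O(hX)`
  -- thus becomes `O(h)` times the separation, to be absorbed, plus `O(δ²)`, which later contributes
  -- `O(δ³)`.
  have hXup : ∀ t ∈ Icc a b, X ≤ 2 * ‖z t - y t‖ + (2 * A + 2) * δ ^ 2 := by
    intro t ht
    have h1 := hΔinc t ht
    have e : δ • v = (z t - y t) - ((z t - y t) - (z a - y a)) - (z a - y a - δ • v) := by abel
    have h2 : δ * V ≤ ‖z t - y t‖ + Cc * h * X + A * δ ^ 2 := by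
      have h3 : ‖δ • v‖ = δ * V := by rw [norm_smul, Real.norm_of_nonneg hδ0]
      rw [← h3, e]
      have n1 := norm_sub_le ((z t - y t) - ((z t - y t) - (z a - y a))) (z a - y a - δ • v)
      have n2 := norm_sub_le (z t - y t) ((z t - y t) - (z a - y a))
      linarith
    have h4 : Cc * h * X ≤ 1 / 2 * X := by gcongr
    linarith
  have herr : ∀ t ∈ Icc a b, ‖w + (ρ / 2) • (B (y t) t).adjoint (M (y t) t (z t - y t))‖ ≤
      P * Cd * h * ‖z t - y t‖ + σ₀ * δ ^ 2 := by
    intro t ht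
    have ht0 : 0 ≤ t := ha.trans ht.1
    have htR : t ≤ R := ht.2.trans hbR
    set Lt := (B (y t) t).adjoint ∘L M (y t) t with hLt
    set La := (B (y a) a).adjoint ∘L M (y a) a with hLa'
    have l1 := (hL (y t) (y a) t a (hyR t ht) (hyR a ha') ht0 htR ha (hab.trans hbR)).2
    have l2 := hspeed y u a b ha hbR hy hyR (Eventually.of_forall hu) a ha' t ht
    have hta0 : 0 ≤ t - a := by linarith [ht.1]
    rw [abs_of_nonneg hta0] at l1 l2
    have hta1 := hta t ht
    have l3 : ‖Lt - La‖ ≤ CL * ((K₂ + 1) * h) := by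
      refine l1.trans ?_
      gcongr
      have : K₂ * (t - a) ≤ K₂ * h := by gcongr
      linarith
    have e : w + (ρ / 2) • (B (y t) t).adjoint (M (y t) t (z t - y t)) =
        (w + (δ * ρ / 2) • (B (y a) a).adjoint (M (y a) a v)) +
        (ρ / 2) • ((Lt - La) (z t - y t) + La ((z t - y t) - (z a - y a)) +
          La (z a - y a - δ • v)) := by
      have e1 : (Lt - La) (z t - y t) + La ((z t - y t) - (z a - y a)) + La (z a - y a - δ • v) =
          Lt (z t - y t) - δ • La v := by
        rw [_root_.sub_apply, map_sub La (z t - y t), map_sub La (z a - y a), map_smul]; abel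
      rw [e1, smul_sub, smul_smul]
      simp only [hLt, hLa', ContinuousLinearMap.comp_apply]
      rw [show ρ / 2 * δ = δ * ρ / 2 by ring]
      abel
    have n1 := (Lt - La).le_of_opNorm_le l3 (z t - y t)
    have n2 := La.le_of_opNorm_le hLa ((z t - y t) - (z a - y a))
    have n3 := La.le_of_opNorm_le hLa (z a - y a - δ • v)
    have n4 : CL * ((K₂ + 1) * h) * ‖z t - y t‖ ≤ CL * ((K₂ + 1) * h) * (Cb * X) := by
      have := hΔ t ht
      gcongr
    have n5 : CL * ‖(z t - y t) - (z a - y a)‖ ≤ CL * (Cc * h * X) := by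
      have := hΔinc t ht
      gcongr
    have n6 : CL * ‖z a - y a - δ • v‖ ≤ CL * (A * δ ^ 2) := by gcongr
    have n7 : ‖(Lt - La) (z t - y t) + La ((z t - y t) - (z a - y a)) + La (z a - y a - δ • v)‖ ≤
        Cd * h * X + CL * A * δ ^ 2 := by
      have m1 := norm_add_le ((Lt - La) (z t - y t) + La ((z t - y t) - (z a - y a)))
        (La (z a - y a - δ • v))
      have m2 := norm_add_le ((Lt - La) (z t - y t)) (La ((z t - y t) - (z a - y a)))
      have m3 : Cd * h * X = CL * ((K₂ + 1) * h) * (Cb * X) + CL * (Cc * h * X) := by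
        rw [hCd]; ring
      linarith
    rw [e]
    refine (norm_add_le _ _).trans ?_
    rw [norm_smul, Real.norm_of_nonneg (show 0 ≤ ρ / 2 by positivity)]
    have n8 : ρ / 2 * ‖(Lt - La) (z t - y t) + La ((z t - y t) - (z a - y a)) +
        La (z a - y a - δ • v)‖ ≤ P / 2 * (Cd * h * X + CL * A * δ ^ 2) := by gcongr
    have n9 : Cd * h * X ≤ Cd * h * (2 * ‖z t - y t‖ + (2 * A + 2) * δ ^ 2) := by
      have := hXup t ht
      gcongr
    have n10 : Cd * h * ((2 * A + 2) * δ ^ 2) ≤ Cd * ((2 * A + 2) * δ ^ 2) := by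
      have : Cd * h ≤ Cd := mul_le_of_le_one_right hCd0.le hh1
      gcongr
    have n11 : P / 2 * (Cd * h * X + CL * A * δ ^ 2) ≤
        P / 2 * (Cd * h * (2 * ‖z t - y t‖) + Cd * ((2 * A + 2) * δ ^ 2) + CL * A * δ ^ 2) := by
      gcongr
      linarith
    have e2 : P * Cd * h * ‖z t - y t‖ + σ₀ * δ ^ 2 = A * δ ^ 2 +
        P / 2 * (Cd * h * (2 * ‖z t - y t‖) + Cd * ((2 * A + 2) * δ ^ 2) + CL * A * δ ^ 2) := by
      rw [hσ₀]; ring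
    rw [e2]
    linarith
  have hDD : ∀ c, c ≤ Cb + Ca → c * X ≤ D₀ * δ := by
    intro c hc
    calc c * X ≤ (Cb + Ca) * X := by gcongr
      _ ≤ (Cb + Ca) * ((A + 1) * δ) := by gcongr
      _ = D₀ * δ := by rw [hD₀]; ring
  have hfin := hdec y z u w ρ a b (D₀ * δ) (P * Cd * h) (σ₀ * δ ^ 2) ha hbR hy hz hyR hzR hu hρu
    (fun t ht => (hΔ t ht).trans (hDD Cb (by linarith))) (hwX.trans (hDD Ca (by linarith))) herr
    hhe (by positivity) t₁ ht₁
  refine hfin.trans ?_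
  have e3 : C / lam * (D₀ * δ * (σ₀ * δ ^ 2) + (D₀ * δ) ^ 3) =
    C / lam * (D₀ * σ₀ + D₀ ^ 3) * δ ^ 3 := by ring
  rw [e3]
  have : 0 ≤ δ ^ 3 := by positivity
  linarith

end

end CCM

namespace CCM

noncomputable section

variable {n m : ℕ} {f : Vec n → ℝ → Vec n} {B : Vec n → ℝ → Vec m →L[ℝ] Vec n}
  {M : Vec n → ℝ → Vec n →L[ℝ] Vec n} {α₁ α₂ lam : ℝ}

/-! ### The input offset accumulated along a geodesic -/

/-- The rate `-½ θ e^{θ r} B' p` of the feedback along the cogeodesic `Y = (x, p)`. -/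
def gainRate (B : Vec n → ℝ → Vec m →L[ℝ] Vec n) (θ t : ℝ) (Y : ℝ → Vec n × Vec n) (r : ℝ) :
    Vec m :=
  -((θ * Real.exp (θ * r) / 2) • (B (Y r).1 t).adjoint (Y r).2)

/-- The input offset accumulated up to the parameter `σ` of the cogeodesic `Y`. -/
def gain (B : Vec n → ℝ → Vec m →L[ℝ] Vec n) (θ t : ℝ) (Y : ℝ → Vec n × Vec n) (σ : ℝ) : Vec m :=
  ∫ r in (0 : ℝ)..σ, gainRate B θ t Y r

theorem gain_zero (θ t : ℝ) (Y : ℝ → Vec n × Vec n) : gain B θ t Y 0 = 0 :=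
  intervalIntegral.integral_same

theorem continuousOn_gainRate (hB : Smooth B) {θ t : ℝ} (ht : 0 ≤ t) {Y : ℝ → Vec n × Vec n}
    (hY : ContinuousOn Y (Icc 0 1)) : ContinuousOn (gainRate B θ t Y) (Icc 0 1) := by
  have h1 : ContinuousOn (fun r => (B (Y r).1 t).adjoint) (Icc 0 1) :=
    ((smoothHalf_adjoint hB).continuous_slice ht).comp_continuousOn hY.fst
  have h2 : ContinuousOn (fun r => θ * Real.exp (θ * r) / 2) (Icc 0 1) :=
    Continuous.continuousOn (by fun_prop)
  exact (h2.smul (h1.clm_apply hY.snd)).neg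

theorem exp_sub_exp_le {a b c : ℝ} (hab : a ≤ b) (hbc : b ≤ c) :
    Real.exp b - Real.exp a ≤ Real.exp c * (b - a) := by
  have h1 := Real.add_one_le_exp (a - b)
  have h2 : Real.exp a = Real.exp b * Real.exp (a - b) := by rw [← Real.exp_add]; congr 1; ring
  have h3 := Real.exp_le_exp.2 hbc
  have h4 := mul_le_mul_of_nonneg_left h1 (Real.exp_pos b).le
  have h5 := mul_le_mul_of_nonneg_right h3 (sub_nonneg.2 hab)
  rw [h2]
  linarith

theorem exists_gainRate_bound (hB : Smooth B) (hM : IsUniformlyBoundedMetric M α₁ α₂) (R P : ℝ) :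
    ∃ C, 0 < C ∧ ∀ t, 0 ≤ t → t ≤ R → ∀ Y, IsCogeodesic M t Y → ‖Y 0‖ ≤ R → ∀ θ, 0 ≤ θ → θ ≤ P →
      ∀ s δ, 0 ≤ s → 0 ≤ δ → s + δ ≤ 1 → ‖gainRate B θ t Y s‖ ≤ C ∧
        ‖gainRate B θ t Y (s + δ) - gainRate B θ t Y s‖ ≤ C * δ := by
  obtain ⟨C₁, hC₁, hstep⟩ := IsCogeodesic.exists_step hM R
  obtain ⟨C₂, hC₂, hL⟩ := (smoothHalf_adjoint hB).bounded_lipschitz (max C₁ R)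
  set E := Real.exp P with hE
  have hE0 : 0 < E := Real.exp_pos P
  refine ⟨|P| * E * (C₂ * C₁) + |P| * E * (C₂ * C₁ * C₁ + C₂ * C₁) + |P| * (E * |P|) * (C₂ * C₁) + 1,
    by positivity, fun t ht htR Y hY hY0 θ hθ hθP s δ hs hδ hsδ => ?_⟩
  have hP : 0 ≤ P := hθ.trans hθP
  rw [abs_of_nonneg hP]
  have hst := hstep t ht htR Y hY hY0 s δ hs hδ hsδ
  have hst' := (hstep t ht htR Y hY hY0 (s + δ) 0 (by linarith) le_rfl (by linarith)).1
  have n1 := (norm_fst_le (Y s)).trans (hst.1.trans (le_max_left C₁ R))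
  have n2 := (norm_fst_le (Y (s + δ))).trans (hst'.trans (le_max_left C₁ R))
  have hb := hL (Y (s + δ)).1 (Y s).1 t t n2 n1 ht (htR.trans (le_max_right _ _)) ht
    (htR.trans (le_max_right _ _))
  have hb' := (hL (Y s).1 (Y s).1 t t n1 n1 ht (htR.trans (le_max_right _ _)) ht
    (htR.trans (le_max_right _ _))).1
  have q1 : ‖(B (Y s).1 t).adjoint (Y s).2‖ ≤ C₂ * C₁ := by
    refine ((B (Y s).1 t).adjoint.le_of_opNorm_le hb' _).trans ?_
    have := (norm_snd_le (Y s)).trans hst.1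
    gcongr
  have q2 : ‖(B (Y (s + δ)).1 t).adjoint (Y (s + δ)).2 - (B (Y s).1 t).adjoint (Y s).2‖ ≤
      (C₂ * C₁ * C₁ + C₂ * C₁) * δ := by
    have e : (B (Y (s + δ)).1 t).adjoint (Y (s + δ)).2 - (B (Y s).1 t).adjoint (Y s).2 =
        ((B (Y (s + δ)).1 t).adjoint - (B (Y s).1 t).adjoint) (Y (s + δ)).2 +
        (B (Y s).1 t).adjoint ((Y (s + δ)).2 - (Y s).2) := by
      rw [_root_.sub_apply, map_sub]; abel
    have h1 := ((B (Y (s + δ)).1 t).adjoint - (B (Y s).1 t).adjoint).le_of_opNorm_le hb.2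
      (Y (s + δ)).2
    have h2 := (B (Y s).1 t).adjoint.le_of_opNorm_le hb' ((Y (s + δ)).2 - (Y s).2)
    have h3 := (norm_fst_le (Y (s + δ) - Y s)).trans hst.2.2.1
    have h4 := (norm_snd_le (Y (s + δ) - Y s)).trans hst.2.2.1
    have h5 := (norm_snd_le (Y (s + δ))).trans hst'
    rw [Prod.fst_sub] at h3
    rw [Prod.snd_sub] at h4
    rw [sub_self, abs_zero, add_zero] at h1
    have h6 : C₂ * ‖(Y (s + δ)).1 - (Y s).1‖ * ‖(Y (s + δ)).2‖ ≤ C₂ * (C₁ * δ) * C₁ := by gcongr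
    have h7 : C₂ * ‖(Y (s + δ)).2 - (Y s).2‖ ≤ C₂ * (C₁ * δ) := by gcongr
    rw [e]
    refine (norm_add_le _ _).trans ?_
    linarith
  have e1 : ∀ r, r ≤ 1 → θ * Real.exp (θ * r) / 2 ≤ P * E := fun r hr => by
    have h1 : Real.exp (θ * r) ≤ E :=
      Real.exp_le_exp.2 ((mul_le_of_le_one_right hθ hr).trans hθP)
    have h2 : θ * Real.exp (θ * r) ≤ P * E := by gcongr
    have h3 : 0 ≤ θ * Real.exp (θ * r) := by positivity
    linarith
  have e2 : |θ * Real.exp (θ * (s + δ)) / 2 - θ * Real.exp (θ * s) / 2| ≤ P * (E * P) * δ := by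
    have h1 : θ * s ≤ θ * (s + δ) := by gcongr; linarith
    have h2 := exp_sub_exp_le h1 ((mul_le_of_le_one_right hθ hsδ).trans hθP)
    have h3 := sub_nonneg.2 (Real.exp_le_exp.2 h1)
    rw [show θ * Real.exp (θ * (s + δ)) / 2 - θ * Real.exp (θ * s) / 2 =
      θ / 2 * (Real.exp (θ * (s + δ)) - Real.exp (θ * s)) by ring, abs_of_nonneg (by positivity)]
    have h4 : θ / 2 * (Real.exp (θ * (s + δ)) - Real.exp (θ * s)) ≤ P * (E * (θ * δ)) := by
      have : θ / 2 ≤ P := by linarith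
      have h5 : Real.exp (θ * (s + δ)) - Real.exp (θ * s) ≤ E * (θ * δ) := by
        refine h2.trans (le_of_eq ?_); rw [hE]; ring
      gcongr
    have h6 : P * (E * (θ * δ)) ≤ P * (E * (P * δ)) := by gcongr
    linarith
  constructor
  · rw [gainRate, norm_neg, norm_smul, Real.norm_of_nonneg (by positivity)]
    have h1 := e1 s (by linarith)
    have h2 : θ * Real.exp (θ * s) / 2 * ‖(B (Y s).1 t).adjoint (Y s).2‖ ≤ P * E * (C₂ * C₁) := by
      gcongr
    have h3 : 0 ≤ P * E * (C₂ * C₁ * C₁ + C₂ * C₁) := by positivity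
    have h4 : 0 ≤ P * (E * P) * (C₂ * C₁) := by positivity
    linarith
  · have e : gainRate B θ t Y (s + δ) - gainRate B θ t Y s =
        -((θ * Real.exp (θ * (s + δ)) / 2) • ((B (Y (s + δ)).1 t).adjoint (Y (s + δ)).2 -
          (B (Y s).1 t).adjoint (Y s).2) + (θ * Real.exp (θ * (s + δ)) / 2 -
          θ * Real.exp (θ * s) / 2) • (B (Y s).1 t).adjoint (Y s).2) := by
      simp only [gainRate, smul_sub, sub_smul]; abel
    rw [e, norm_neg]
    refine (norm_add_le _ _).trans ?_
    rw [norm_smul, norm_smul, Real.norm_of_nonneg (by positivity), Real.norm_eq_abs]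
    have h1 := e1 (s + δ) hsδ
    have h2 : θ * Real.exp (θ * (s + δ)) / 2 * ‖(B (Y (s + δ)).1 t).adjoint (Y (s + δ)).2 -
        (B (Y s).1 t).adjoint (Y s).2‖ ≤ P * E * ((C₂ * C₁ * C₁ + C₂ * C₁) * δ) := by gcongr
    have h3 : |θ * Real.exp (θ * (s + δ)) / 2 - θ * Real.exp (θ * s) / 2| *
        ‖(B (Y s).1 t).adjoint (Y s).2‖ ≤ P * (E * P) * δ * (C₂ * C₁) := by gcongr
    have h4 : 0 ≤ P * E * (C₂ * C₁) * δ := by positivity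
    linarith

/-- The weight `θe^{θr}/2` integrates exactly, so the offset grows no faster than the gain `θe^{θσ}`
itself. -/
theorem norm_gain_le {θ t β σ : ℝ} {Y : ℝ → Vec n × Vec n} (hθ : 0 ≤ θ) (hσ : σ ∈ Icc (0 : ℝ) 1)
    (hβ : ∀ r ∈ Icc (0 : ℝ) 1, ‖(B (Y r).1 t).adjoint (Y r).2‖ ≤ β) :
    ‖gain B θ t Y σ‖ ≤ β / 2 * (Real.exp (θ * σ) - 1) := by
  have h1 : ∀ r ∈ uIcc 0 σ, HasDerivAt (fun r => β / 2 * Real.exp (θ * r))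
      (β / 2 * (Real.exp (θ * r) * θ)) r := fun r _ => by
    simpa using (((hasDerivAt_id r).const_mul θ).exp).const_mul (β / 2)
  have h2 := intervalIntegral.integral_eq_sub_of_hasDerivAt h1
    (Continuous.intervalIntegrable (by fun_prop) _ _)
  refine (intervalIntegral.norm_integral_le_of_norm_le hσ.1 (Eventually.of_forall fun r hr => ?_)
    (Continuous.intervalIntegrable (u := fun r => β / 2 * (Real.exp (θ * r) * θ))
      (by fun_prop) _ _)).trans (le_of_eq ?_)
  · rw [gainRate, norm_neg, norm_smul, Real.norm_of_nonneg (by positivity)]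
    have := hβ r ⟨hr.1.le, hr.2.trans hσ.2⟩
    calc θ * Real.exp (θ * r) / 2 * ‖(B (Y r).1 t).adjoint (Y r).2‖ ≤
        θ * Real.exp (θ * r) / 2 * β := by gcongr
      _ = _ := by ring
  · rw [h2]; simp; ring

theorem norm_gain_sub_le (hB : Smooth B) {θ t C s δ : ℝ} (ht : 0 ≤ t) {Y : ℝ → Vec n × Vec n}
    (hY : ContinuousOn Y (Icc 0 1)) (hs : 0 ≤ s) (hδ : 0 ≤ δ) (hsδ : s + δ ≤ 1) (hC : 0 ≤ C)
    (hlip : ∀ η, 0 ≤ η → s + η ≤ 1 → ‖gainRate B θ t Y (s + η) - gainRate B θ t Y s‖ ≤ C * η) :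
    ‖gain B θ t Y (s + δ) - gain B θ t Y s - δ • gainRate B θ t Y s‖ ≤ C * δ ^ 2 := by
  have hint : ∀ a ∈ Icc (0 : ℝ) 1, ∀ b ∈ Icc (0 : ℝ) 1,
      IntervalIntegrable (gainRate B θ t Y) volume a b := fun a ha b hb =>
    ((continuousOn_gainRate hB ht hY).mono (uIcc_subset_Icc ha hb)).intervalIntegrable
  have z0 : (0 : ℝ) ∈ Icc (0 : ℝ) 1 := ⟨le_rfl, zero_le_one⟩
  have zs : s ∈ Icc (0 : ℝ) 1 := ⟨hs, by linarith⟩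
  have zd : s + δ ∈ Icc (0 : ℝ) 1 := ⟨by linarith, hsδ⟩
  have e : gain B θ t Y (s + δ) - gain B θ t Y s - δ • gainRate B θ t Y s =
      ∫ r in s..s + δ, (gainRate B θ t Y r - gainRate B θ t Y s) := by
    rw [intervalIntegral.integral_sub (hint s zs _ zd) intervalIntegrable_const,
      intervalIntegral.integral_const, add_sub_cancel_left, gain, gain,
      intervalIntegral.integral_interval_sub_left (hint 0 z0 _ zd) (hint 0 z0 _ zs)]
  rw [e]
  refine (intervalIntegral.norm_integral_le_of_norm_le_const (C := C * δ) fun r hr => ?_).trans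
    (le_of_eq ?_)
  · rw [uIoc_of_le (by linarith)] at hr
    have h1 := hlip (r - s) (by linarith [hr.1]) (by linarith [hr.2])
    rw [add_sub_cancel] at h1
    refine h1.trans ?_
    gcongr
    linarith [hr.2]
  · rw [add_sub_cancel_left, abs_of_nonneg hδ]; ring

theorem continuousOn_cogeod (hM : IsUniformlyBoundedMetric M α₁ α₂) {r : ℝ}
    (hr : r ∈ Icc (0 : ℝ) 1) : ContinuousOn
      (fun z : ℝ × Vec n × Vec n => cogeod M z.1 z.2.1 z.2.2 r) (Ici 0 ×ˢ univ) := by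
  rintro z₀ ⟨hz₀, -⟩
  obtain ⟨C, hC, hlip⟩ := IsCogeodesic.exists_lipschitz hM (‖z₀‖ + 1)
  have hb : ∀ z : ℝ × Vec n × Vec n, ‖z‖ ≤ ‖z₀‖ + 1 → z.1 ≤ ‖z₀‖ + 1 ∧ ‖z.2‖ ≤ ‖z₀‖ + 1 :=
    fun z hz => ⟨(le_abs_self _).trans ((norm_fst_le z).trans hz), (norm_snd_le z).trans hz⟩
  have h1 : ∀ᶠ z in 𝓝[Ici 0 ×ˢ univ] z₀, ‖cogeod M z.1 z.2.1 z.2.2 r -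
      cogeod M z₀.1 z₀.2.1 z₀.2.2 r‖ ≤ C * (‖z.2 - z₀.2‖ + |z.1 - z₀.1|) := by
    filter_upwards [self_mem_nhdsWithin, mem_nhdsWithin_of_mem_nhds (Metric.ball_mem_nhds z₀ one_pos)]
      with z hz hzb
    have hz1 : ‖z‖ ≤ ‖z₀‖ + 1 := by
      have := norm_add_le (z - z₀) z₀
      rw [sub_add_cancel] at this
      have := mem_ball_iff_norm.1 hzb
      linarith
    have g := hlip z.1 z₀.1 hz.1 (hb z hz1).1 hz₀ (hb z₀ (by linarith)).1 _ _
      (isCogeodesic_cogeod hM hz.1 z.2.1 z.2.2) (isCogeodesic_cogeod hM hz₀ z₀.2.1 z₀.2.2)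
      (by rw [cogeod_zero hM hz.1]; exact (hb z hz1).2)
      (by rw [cogeod_zero hM hz₀]; exact (hb z₀ (by linarith)).2) r hr
    rw [cogeod_zero hM hz.1, cogeod_zero hM hz₀] at g
    exact g
  have h2 : Tendsto (fun z : ℝ × Vec n × Vec n => C * (‖z.2 - z₀.2‖ + |z.1 - z₀.1|))
      (𝓝[Ici 0 ×ˢ univ] z₀) (𝓝 0) := by
    have : Continuous (fun z : ℝ × Vec n × Vec n => C * (‖z.2 - z₀.2‖ + |z.1 - z₀.1|)) :=
      continuous_const.mul ((continuous_snd.sub continuous_const).norm.add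
        (continuous_fst.sub continuous_const).abs)
    simpa using (this.tendsto z₀).mono_left nhdsWithin_le_nhds
  exact tendsto_iff_norm_sub_tendsto_zero.2 (squeeze_zero' (Eventually.of_forall fun _ =>
    norm_nonneg _) h1 h2)

/-- Dominated convergence: the integrand depends continuously on time, base point and covector for
each parameter and is locally uniformly bounded. -/
theorem continuousOn_gain (hB : Smooth B) (hM : IsUniformlyBoundedMetric M α₁ α₂) {Θ : ℝ → ℝ}
    (hΘ : Continuous Θ) (hΘ0 : ∀ r, 0 ≤ Θ r) : ContinuousOn (fun z : ℝ × Vec n × Vec n =>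
      gain B (Θ (z.1 + ‖z.2.2‖)) z.1 (cogeod M z.1 z.2.1 z.2.2) 1) (Ici 0 ×ˢ univ) := by
  rintro z₀ ⟨hz₀, -⟩
  obtain ⟨C, hC, hbd⟩ := exists_gainRate_bound hB hM (‖z₀‖ + 1) (Θ (z₀.1 + ‖z₀.2.2‖) + 1)
  have hΘc : Continuous (fun z : ℝ × Vec n × Vec n => Θ (z.1 + ‖z.2.2‖)) :=
    hΘ.comp (continuous_fst.add continuous_snd.snd.norm)
  have hev : ∀ᶠ z in 𝓝[Ici 0 ×ˢ univ] z₀, Θ (z.1 + ‖z.2.2‖) < Θ (z₀.1 + ‖z₀.2.2‖) + 1 :=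
    mem_nhdsWithin_of_mem_nhds ((hΘc.tendsto z₀).eventually (gt_mem_nhds (lt_add_one _)))
  refine intervalIntegral.tendsto_integral_filter_of_dominated_convergence (fun _ => C) ?_ ?_
    intervalIntegrable_const ?_
  · filter_upwards [self_mem_nhdsWithin] with z hz
    rw [uIoc_of_le zero_le_one]
    exact ((continuousOn_gainRate hB hz.1 (isCogeodesic_cogeod hM hz.1 _ _).continuousOn).mono
      Ioc_subset_Icc_self).aestronglyMeasurable measurableSet_Ioc
  · filter_upwards [self_mem_nhdsWithin, hev,
      mem_nhdsWithin_of_mem_nhds (Metric.ball_mem_nhds z₀ one_pos)] with z hz hzΘ hzb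
    refine Eventually.of_forall fun r hr => ?_
    rw [uIoc_of_le zero_le_one] at hr
    have hz1 : ‖z‖ ≤ ‖z₀‖ + 1 := by
      have := norm_add_le (z - z₀) z₀
      rw [sub_add_cancel] at this
      have := mem_ball_iff_norm.1 hzb
      linarith
    exact (hbd z.1 hz.1 ((le_abs_self _).trans ((norm_fst_le z).trans hz1)) _
      (isCogeodesic_cogeod hM hz.1 _ _)
      (by rw [cogeod_zero hM hz.1]; exact (norm_snd_le z).trans hz1) _ (hΘ0 _) hzΘ.le r 0 hr.1.le
      le_rfl (by linarith [hr.2])).1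
  · refine Eventually.of_forall fun r hr => ?_
    rw [uIoc_of_le zero_le_one] at hr
    have h1 := continuousOn_cogeod hM (Ioc_subset_Icc_self hr) z₀ ⟨hz₀, mem_univ _⟩
    have h2 : Tendsto (fun z : ℝ × Vec n × Vec n =>
        (B (cogeod M z.1 z.2.1 z.2.2 r).1 z.1).adjoint) (𝓝[Ici 0 ×ˢ univ] z₀)
        (𝓝 (B (cogeod M z₀.1 z₀.2.1 z₀.2.2 r).1 z₀.1).adjoint) :=
      (smoothHalf_adjoint hB).tendsto_comp ((continuous_fst.tendsto _).comp h1) hz₀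
        ((continuous_fst.tendsto z₀).mono_left nhdsWithin_le_nhds)
        (eventually_mem_nhdsWithin.mono fun z hz => hz.1)
    have h3 : Continuous (fun z : ℝ × Vec n × Vec n =>
        Θ (z.1 + ‖z.2.2‖) * Real.exp (Θ (z.1 + ‖z.2.2‖) * r) / 2) :=
      ((hΘc.mul (Real.continuous_exp.comp (hΘc.mul continuous_const))).div_const 2)
    exact (((h3.tendsto z₀).mono_left nhdsWithin_le_nhds).smul
      (Filter.Tendsto.comp (g := fun q : (Vec n →L[ℝ] Vec m) × Vec n => q.1 q.2)
      (isBoundedBilinearMap_apply.continuous.tendsto (_, _))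
      (h2.prodMk_nhds ((continuous_snd.tendsto _).comp h1)))).neg

end

end CCM

/-! ### Contraction of whole geodesics under a held input. -/

namespace CCM

noncomputable section

variable {n m : ℕ} {f : Vec n → ℝ → Vec n} {B : Vec n → ℝ → Vec m →L[ℝ] Vec n}
  {M : Vec n → ℝ → Vec n →L[ℝ] Vec n} {α₁ α₂ lam : ℝ}

/-! ### Holding the offset input -/

/-- A global solution whose input is bounded on bounded intervals. -/
structure IsBoundedTarget (f : Vec n → ℝ → Vec n) (B : Vec n → ℝ → Vec m →L[ℝ] Vec n)
    (xs : ℝ → Vec n) (us : ℝ → Vec m) : Prop where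
  sol : ∀ T, SolOn f B xs us 0 T
  bound : ∀ T, ∃ U, ∀ t ∈ Icc 0 T, ‖us t‖ ≤ U

/-- The reason for the exponential weight, with `e = e^{θr}`: required and available gain are both
affine in `e`, so a single comparison of constants settles all parameters of the geodesic. -/
theorem le_exp_mul_of_affine_le {ρ₀ k U β e u θ : ℝ} (hρ₀ : 0 ≤ ρ₀) (hk : 0 ≤ k) (hU : 0 ≤ U)
    (hβ : 0 ≤ β) (he : 1 ≤ e) (hu : u ≤ U + β / 2 * (e - 1)) (hθ : ρ₀ + k * (U + β / 2) ≤ θ) :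
    ρ₀ + k * u ≤ θ * e := by
  have h1 : k * u ≤ k * (U + β / 2 * (e - 1)) := by gcongr
  have h2 : (ρ₀ + k * (U + β / 2)) * e ≤ θ * e := by gcongr
  have h3 : 0 ≤ (ρ₀ + k * U) * (e - 1) := mul_nonneg (by positivity) (by linarith)
  have h4 : 0 ≤ k * (β / 2) := by positivity
  linarith

/-- A cubic error per link is just small enough: `N` links and the factor `N` in the chain energy
leave `C/N`. -/
theorem chainEnergy_le_of_pairForm_le {t τ e C : ℝ} {N : ℕ} (hN : 0 < N) {y z : ℕ → Vec n}
    (h : ∀ i < N, pairForm M (y i, y (i + 1)) τ ≤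
      e * pairForm M (z i, z (i + 1)) t + C * (1 / (N : ℝ)) ^ 3) :
    chainEnergy M τ N y ≤ e * chainEnergy M t N z + C / N := by
  have hN' : (0 : ℝ) < N := Nat.cast_pos.2 hN
  have h1 : ∑ i ∈ Finset.range N, pairForm M (y i, y (i + 1)) τ ≤
      ∑ i ∈ Finset.range N, (e * pairForm M (z i, z (i + 1)) t + C * (1 / (N : ℝ)) ^ 3) :=
    Finset.sum_le_sum fun i hi => h i (Finset.mem_range.1 hi)
  rw [Finset.sum_add_distrib, ← Finset.mul_sum, Finset.sum_const, Finset.card_range,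
    nsmul_eq_mul] at h1
  have h2 := mul_le_mul_of_nonneg_left h1 hN'.le
  have e1 : (N : ℝ) * (e * ∑ i ∈ Finset.range N, pairForm M (z i, z (i + 1)) t +
      N * (C * (1 / (N : ℝ)) ^ 3)) = e * (N * ∑ i ∈ Finset.range N, pairForm M (z i, z (i + 1)) t) +
        C / N := by
    field_simp
  rw [e1] at h2
  exact h2

set_option maxHeartbeats 1600000 in
/-- The distance to the target decays at rate `lam` while the offset input is held constant. -/
theorem exists_hold (hf : Smooth f) (hB : Smooth B) (hM : IsUniformlyBoundedMetric M α₁ α₂)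
    (hlam : 0 < lam) (hccm : ContractionCondition f B M lam) (hgrowth : InputGrowthCondition B M)
    {xs : ℝ → Vec n} {us : ℝ → Vec m} (htar : IsBoundedTarget f B xs us) (r : ℝ) :
    ∃ θ₀, 0 ≤ θ₀ ∧ ∀ P, ∃ h, 0 < h ∧ ∀ t p θ, 0 ≤ t → t ≤ r → ‖p‖ ≤ r → θ₀ ≤ θ → θ ≤ P →
      ∀ b, t ≤ b → b ≤ t + h →
      (∃ x, x t = expMap M t (xs t) p ∧
        SolOn f B x (fun s => us s + gain B θ t (cogeod M t (xs t) p) 1) t b) ∧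
      ∀ x, x t = expMap M t (xs t) p →
      SolOn f B x (fun s => us s + gain B θ t (cogeod M t (xs t) p) 1) t b →
      ∀ τ ∈ Icc t b, sqDist M τ (xs τ) (x τ) ≤
        Real.exp (-(2 * lam) * (τ - t)) * energy M (xs t, p) t := by
  obtain ⟨X, hX⟩ := (htar.sol (r + 1)).exists_bound
  obtain ⟨U, hU⟩ := htar.bound (r + 1)
  obtain ⟨R₁, hR₁⟩ : ∃ c, c = max r X := ⟨_, rfl⟩
  obtain ⟨C₀, hC₀, hstep⟩ := IsCogeodesic.exists_step hM R₁
  obtain ⟨C₁, hC₁, hL⟩ := (smoothHalf_adjoint hB).bounded_lipschitz (max C₀ R₁)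
  obtain ⟨C₂, hC₂, hchain⟩ := chainEnergy_cogeod_le hM R₁
  obtain ⟨β, hβ⟩ : ∃ c, c = C₁ * C₀ := ⟨_, rfl⟩
  have hβ0 : 0 ≤ β := by rw [hβ]; positivity
  obtain ⟨R₂, hR₂⟩ : ∃ c, c = max C₀ R₁ := ⟨_, rfl⟩
  have hrR : r ≤ R₂ := (le_max_left r X).trans (hR₁ ▸ hR₂ ▸ le_max_right _ _)
  have hC₀R : C₀ ≤ R₂ := hR₂ ▸ le_max_left _ _
  obtain ⟨ρ₀, hρ₀, k, hk, hpair⟩ := pairForm_hold hf hB hM hlam hccm hgrowth (R₂ + 1)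
  -- The bound `β` for `B'p` depends only on the geodesics and not on the gain, so the choice of
  -- `θ₀` is not circular. Only the hold time may depend on the upper bound `P` for `θ`.
  refine ⟨ρ₀ + k * (|U| + β / 2), by positivity, fun P => ?_⟩
  obtain ⟨Cg, hCg, hgr⟩ := exists_gainRate_bound hB hM R₁ P
  obtain ⟨A, hA⟩ : ∃ c, c = C₀ + Cg := ⟨_, rfl⟩
  obtain ⟨U₁, hU₁⟩ : ∃ c, c = |U| + β / 2 * (Real.exp |P| - 1) := ⟨_, rfl⟩
  obtain ⟨h₁, hh₁, hh₁1, hex⟩ := exists_solOn hf hB R₂ U₁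
  obtain ⟨h₂, hh₂, C, hC, hdec⟩ := hpair U₁ (|P| * Real.exp |P|) A (by positivity)
    (by rw [hA]; positivity)
  refine ⟨min h₁ h₂, lt_min hh₁ hh₂,
    fun t p θ ht htr hp hθ₀ hθP b htb hbh => ?_⟩
  have hθ : 0 ≤ θ := le_trans (by positivity) hθ₀
  have hbh₁ : b ≤ t + h₁ := hbh.trans (by gcongr; exact min_le_left _ _)
  have hbh₂ : b ≤ t + h₂ := hbh.trans (by gcongr; exact min_le_right _ _)
  have htR : t ≤ R₁ := htr.trans (hR₁ ▸ le_max_left _ _)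
  have hIcc : ∀ s ∈ Icc t b, s ∈ Icc 0 (r + 1) := fun s hs =>
    ⟨ht.trans hs.1, by linarith [hs.2]⟩
  have hus : ∀ s ∈ Icc t b, ‖us s‖ ≤ |U| := fun s hs => (hU s (hIcc s hs)).trans (le_abs_self U)
  obtain ⟨Y, hYd⟩ : ∃ Y, Y = cogeod M t (xs t) p := ⟨_, rfl⟩
  have hY0 : Y 0 = (xs t, p) := by rw [hYd, cogeod_zero hM ht]
  have hY1 : (Y 1).1 = expMap M t (xs t) p := by rw [hYd]; rfl
  rw [← hYd]
  have hY : IsCogeodesic M t Y := by rw [hYd]; exact isCogeodesic_cogeod hM ht _ _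
  have hYn : ‖Y 0‖ ≤ R₁ := by
    rw [hY0, Prod.norm_def, hR₁]
    exact max_le ((hX t (hIcc t ⟨le_rfl, htb⟩)).trans (le_max_right _ _))
      (hp.trans (le_max_left _ _))
  have hYC : ∀ s ∈ Icc (0 : ℝ) 1, ‖Y s‖ ≤ C₀ := fun s hs =>
    (hstep t ht htR Y hY hYn s 0 hs.1 le_rfl (by linarith [hs.2])).1
  have hq : ∀ s ∈ Icc (0 : ℝ) 1, ‖(B (Y s).1 t).adjoint (Y s).2‖ ≤ β := fun s hs => by
    have h1 := (norm_fst_le (Y s)).trans ((hYC s hs).trans (le_max_left C₀ R₁))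
    have h2 := (hL (Y s).1 (Y s).1 t t h1 h1 ht (htR.trans (le_max_right _ _)) ht
      (htR.trans (le_max_right _ _))).1
    have h3 := (norm_snd_le (Y s)).trans (hYC s hs)
    refine ((B (Y s).1 t).adjoint.le_of_opNorm_le h2 _).trans ?_
    rw [hβ]; gcongr
  have hun : ∀ σ ∈ Icc (0 : ℝ) 1, ∀ s ∈ Icc t b, ‖us s + gain B θ t Y σ‖ ≤
      |U| + β / 2 * (Real.exp (θ * σ) - 1) := fun σ hσ s hs =>
    (norm_add_le _ _).trans (add_le_add (hus s hs) (norm_gain_le hθ hσ hq))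
  have hexpP : ∀ σ ∈ Icc (0 : ℝ) 1, Real.exp (θ * σ) ≤ Real.exp |P| := fun σ hσ =>
    Real.exp_le_exp.2 (((mul_le_of_le_one_right hθ hσ.2).trans hθP).trans (le_abs_self P))
  have hunU : ∀ σ ∈ Icc (0 : ℝ) 1, ∀ s ∈ Icc t b, ‖us s + gain B θ t Y σ‖ ≤ U₁ :=
    fun σ hσ s hs => (hun σ hσ s hs).trans <| by
      have := hexpP σ hσ
      have h1 : β / 2 * (Real.exp (θ * σ) - 1) ≤ β / 2 * (Real.exp |P| - 1) :=
        mul_le_mul_of_nonneg_left (by linarith) (by positivity)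
      rw [hU₁]; linarith
  have hxs : SolOn f B xs us t b := (htar.sol b).restrict hf hB le_rfl ht le_rfl
  -- Each point of the geodesic is moved by the system with its own held input. The parameter `0`
  -- has no offset and follows the target; the parameter `1` follows the controlled state.
  have hsol : ∀ σ ∈ Icc (0 : ℝ) 1, ∃ y, y t = (Y σ).1 ∧
      SolOn f B y (fun s => us s + gain B θ t Y σ) t b ∧ ∀ s ∈ Icc t b, ‖y s‖ ≤ R₂ + 1 :=
    fun σ hσ => hex t b (Y σ).1 _ ht (htr.trans hrR) htb hbh₁
      ((norm_fst_le (Y σ)).trans ((hYC σ hσ).trans hC₀R))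
      (hxs.integrable.add (integrableOn_const (by simp))) (hunU σ hσ)
  choose! y hyt hysol hyR using hsol
  have z0 : (0 : ℝ) ∈ Icc (0 : ℝ) 1 := ⟨le_rfl, zero_le_one⟩
  have z1 : (1 : ℝ) ∈ Icc (0 : ℝ) 1 := ⟨zero_le_one, le_rfl⟩
  refine ⟨⟨y 1, (hyt 1 z1).trans hY1, hysol 1 z1⟩, fun x hxt hx τ hτ => ?_⟩
  have hy0 : EqOn (y 0) xs (Icc t b) := by
    refine (hysol 0 z0).eqOn hf hB ht ?_ ((hyt 0 z0).trans (by rw [hY0]))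
      (Eventually.of_forall (hunU 0 z0))
    simpa only [gain_zero, add_zero] using hxs
  have hy1 : EqOn (y 1) x (Icc t b) :=
    (hysol 1 z1).eqOn hf hB ht hx ((hyt 1 z1).trans (hY1.trans hxt.symm))
      (Eventually.of_forall (hunU 1 z1))
  have hτ0 : 0 ≤ τ := ht.trans hτ.1
  -- The transported geodesic need not be a geodesic at time `τ`, but its samples form a chain
  -- between the two states, which is enough for an upper bound.
  refine sqDist_le_of_chains (C := C₂ + C) hM hτ0 fun N hN =>
    ⟨fun i => y (i / N) τ, ?_, ?_, ?_⟩
  · simpa using hy0 hτ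
  · change y ((N : ℝ) / N) τ = x τ
    rw [div_self (Nat.cast_ne_zero.2 hN.ne')]; exact hy1 hτ
  have hN' : (0 : ℝ) < N := Nat.cast_pos.2 hN
  have hexp1 : Real.exp (-(2 * lam) * (τ - t)) ≤ 1 :=
    Real.exp_le_one_iff.2 (mul_nonpos_of_nonpos_of_nonneg (by linarith) (by linarith [hτ.1]))
  have hmain : ∀ i < N, pairForm M (y (i / N) τ, y ((i + 1 : ℕ) / N) τ) τ ≤
      Real.exp (-(2 * lam) * (τ - t)) * pairForm M ((Y (i / N)).1, (Y ((i + 1 : ℕ) / N)).1) t +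
        C * (1 / (N : ℝ)) ^ 3 := by
    intro i hi
    obtain ⟨s, hs⟩ : ∃ s : ℝ, s = i / N := ⟨_, rfl⟩
    obtain ⟨δ, hδ⟩ : ∃ δ : ℝ, δ = 1 / N := ⟨_, rfl⟩
    have hs0 : 0 ≤ s := by rw [hs]; positivity
    have hδ0 : 0 ≤ δ := by rw [hδ]; positivity
    have esδ : ((i + 1 : ℕ) : ℝ) / N = s + δ := by rw [hs, hδ]; push_cast; ring
    have hsδ : s + δ ≤ 1 := by
      rw [← esδ, div_le_one hN']; exact_mod_cast hi
    have zs : s ∈ Icc (0 : ℝ) 1 := ⟨hs0, by linarith⟩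
    have zd : s + δ ∈ Icc (0 : ℝ) 1 := ⟨by linarith, hsδ⟩
    rw [esδ, ← hs, ← hδ]
    have hst := hstep t ht htR Y hY hYn s δ hs0 hδ0 hsδ
    have hv : (hamField M (Y s) t).1 = dualMetric M (Y s).1 t (Y s).2 := rfl
    have hgs := norm_gain_sub_le (B := B) (θ := θ) (C := Cg) hB ht hY.continuousOn hs0 hδ0 hsδ hCg.le
      fun η hη hsη => (hgr t ht htR Y hY hYn θ hθ hθP s η hs0 hη hsη).2
    have hE1 : 1 ≤ Real.exp (θ * s) := Real.one_le_exp (by positivity)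
    -- Adjacent samples contract with `ρ = θe^{θs}`, large enough for the accumulated input at `s`.
    -- Their inputs differ by the gain increment, which is the matching feedback up to `O(δ²)`.
    have key := hdec (y s) (y (s + δ)) (fun σ => us σ + gain B θ t Y s)
      (gain B θ t Y (s + δ) - gain B θ t Y s) (hamField M (Y s) t).1 (θ * Real.exp (θ * s)) t b δ
      ht (by linarith) hbh₂ hδ0 (by linarith) (by positivity)
      (mul_le_mul (hθP.trans (le_abs_self P)) (hexpP s zs) (Real.exp_pos _).le (abs_nonneg P))
      (((norm_fst_le _).trans hst.2.1).trans (by linarith)) (hysol s zs)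
      (by simpa only [add_assoc, add_sub_cancel] using hysol (s + δ) zd) (hyR s zs) (hyR _ zd)
      (hunU s zs)
      (fun σ hσ => le_exp_mul_of_affine_le hρ₀ hk (abs_nonneg U) hβ0 hE1 (hun s zs σ hσ) hθ₀)
      (by
        rw [hyt s zs, hyt _ zd, ← Prod.fst_sub, ← Prod.smul_fst, ← Prod.fst_sub]
        refine ((norm_fst_le _).trans hst.2.2.2).trans ?_
        rw [hA]; gcongr; linarith)
      (by
        rw [hyt s zs, hv, metric_dualMetric hM _ ht]
        have e : gain B θ t Y (s + δ) - gain B θ t Y s +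
            (δ * (θ * Real.exp (θ * s)) / 2) • (B (Y s).1 t).adjoint (Y s).2 =
            gain B θ t Y (s + δ) - gain B θ t Y s - δ • gainRate B θ t Y s := by
          rw [gainRate, smul_neg, smul_smul, sub_neg_eq_add]
          congr 2; ring
        rw [e]
        refine hgs.trans ?_
        rw [hA]; gcongr; linarith) τ hτ
    rwa [hyt s zs, hyt _ zd] at key
  have h3 := chainEnergy_le_of_pairForm_le hN hmain
  have h4 := hchain t ht htR Y hY hYn N hN
  rw [hY0] at h4
  refine h3.trans ?_
  have h5 := mul_le_mul_of_nonneg_left h4 (Real.exp_pos (-(2 * lam) * (τ - t))).le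
  have h6 : Real.exp (-(2 * lam) * (τ - t)) * (C₂ / N) ≤ C₂ / N :=
    mul_le_of_le_one_left (by positivity) hexp1
  rw [add_div]
  linarith

end

end CCM

/-! ### Continuous offset laws and the gluing of solutions. -/

namespace CCM

noncomputable section

variable {n m : ℕ} {f : Vec n → ℝ → Vec n} {B : Vec n → ℝ → Vec m →L[ℝ] Vec n}
  {M : Vec n → ℝ → Vec n →L[ℝ] Vec n} {α₁ α₂ lam : ℝ}

/-- An offset law `w` such that the input `u* + w(s, x*(s), p)`, held on `[s, s + η]`, contracts the
distance to the target at rate `lam` when started at the endpoint of the geodesic with covector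
`p`. -/
structure IsHoldLaw (f : Vec n → ℝ → Vec n) (B : Vec n → ℝ → Vec m →L[ℝ] Vec n)
    (M : Vec n → ℝ → Vec n →L[ℝ] Vec n) (lam : ℝ) (xs : ℝ → Vec n) (us : ℝ → Vec m)
    (w : ℝ → Vec n → Vec n → Vec m) (η : ℝ → ℝ) : Prop where
  continuousOn : ContinuousOn (fun z : ℝ × Vec n × Vec n => w z.1 z.2.1 z.2.2) (Ici 0 ×ˢ univ)
  continuous_step : Continuous η
  step_pos : ∀ r, 0 < η r
  exists_sol : ∀ r t p, 0 ≤ t → t + ‖p‖ ≤ r → ∀ b, t ≤ b → b ≤ t + η r →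
    ∃ x, x t = expMap M t (xs t) p ∧ SolOn f B x (fun s => us s + w t (xs t) p) t b
  decay : ∀ r t p, 0 ≤ t → t + ‖p‖ ≤ r → ∀ b, t ≤ b → b ≤ t + η r →
    ∀ x, x t = expMap M t (xs t) p → SolOn f B x (fun s => us s + w t (xs t) p) t b →
    ∀ τ ∈ Icc t b, sqDist M τ (xs τ) (x τ) ≤
      Real.exp (-(2 * lam) * (τ - t)) * energy M (xs t, p) t

theorem eventually_ceil_le (r : ℝ) : ∀ᶠ y in 𝓝 r, ⌈y⌉₊ ≤ ⌈r + 1⌉₊ := by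
  filter_upwards [eventually_le_nhds (lt_add_one r)] with y hy using Nat.ceil_mono hy

/-- A partition of unity glues local constants, because the admissible values form convex sets. A
continuous gain keeps the offset law continuous. -/
theorem exists_continuous_ge (a : ℕ → ℝ) (ha : Monotone a) :
    ∃ Θ : ℝ → ℝ, Continuous Θ ∧ ∀ r, a ⌈r⌉₊ ≤ Θ r := by
  obtain ⟨Θ, hΘ⟩ := exists_continuous_forall_mem_convex_of_local_const
    (t := fun r : ℝ => Ici (a ⌈r⌉₊)) (fun r => convex_Ici _) fun r =>
      ⟨a ⌈r + 1⌉₊, (eventually_ceil_le r).mono fun y hy => ha hy⟩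
  exact ⟨Θ, Θ.continuous, hΘ⟩

theorem exists_continuous_pos {S : ℝ → Set ℝ} (hpos : ∀ r, ∀ h ∈ S r, 0 < h)
    (hle : ∀ r, ∀ h ∈ S r, ∀ h', 0 < h' → h' ≤ h → h' ∈ S r)
    (hanti : ∀ r r', r ≤ r' → S r' ⊆ S r) (hne : ∀ r, (S r).Nonempty) :
    ∃ η : ℝ → ℝ, Continuous η ∧ ∀ r, η r ∈ S r := by
  obtain ⟨η, hη⟩ := exists_continuous_forall_mem_convex_of_local_const (t := S)
    (fun r => (ordConnected_of_Ioo fun x hx y hy _ z hz =>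
      hle r y hy z ((hpos r x hx).trans hz.1) hz.2.le).convex) fun r => by
      obtain ⟨c, hc⟩ := hne (r + 1)
      exact ⟨c, (eventually_le_nhds (lt_add_one r)).mono fun y hy => hanti y (r + 1) hy hc⟩
  exact ⟨η, η.continuous, hη⟩

/-- The constants of `exists_hold` are given separately for each integer bound on time and covector.
Here gain and hold time become continuous functions of such bounds, the gain being evaluated at `t +
|p|`. -/
theorem exists_holdLaw (hf : Smooth f) (hB : Smooth B) (hM : IsUniformlyBoundedMetric M α₁ α₂)
    (hlam : 0 < lam) (hccm : ContractionCondition f B M lam) (hgrowth : InputGrowthCondition B M)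
    {xs : ℝ → Vec n} {us : ℝ → Vec m} (htar : IsBoundedTarget f B xs us) :
    ∃ w η, IsHoldLaw f B M lam xs us w η := by
  have hhold := fun j : ℕ => exists_hold hf hB hM hlam hccm hgrowth htar j
  choose θ₀ hθ₀ hhold using hhold
  obtain ⟨Θ, hΘ, hΘa⟩ := exists_continuous_ge (fun j => ∑ i ∈ Finset.range (j + 1), θ₀ i)
    (fun i j hij => Finset.sum_le_sum_of_subset_of_nonneg
      (Finset.range_mono (Nat.succ_le_succ hij)) fun k _ _ => hθ₀ k)
  have hΘ0 : ∀ r, 0 ≤ Θ r := fun r => (Finset.sum_nonneg fun i _ => hθ₀ i).trans (hΘa r)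
  have hΘθ : ∀ r, θ₀ ⌈r⌉₊ ≤ Θ r := fun r =>
    (Finset.single_le_sum (f := θ₀) (fun i _ => hθ₀ i)
      (Finset.mem_range.2 (Nat.lt_succ_self _))).trans (hΘa r)
  set w : ℝ → Vec n → Vec n → Vec m := fun t b p =>
    gain B (Θ (t + ‖p‖)) t (cogeod M t b p) 1 with hw
  obtain ⟨η, hη, hηS⟩ := exists_continuous_pos (S := fun r => {h | 0 < h ∧ ∀ t p, 0 ≤ t →
      t + ‖p‖ ≤ r → ∀ b, t ≤ b → b ≤ t + h →
      (∃ x, x t = expMap M t (xs t) p ∧ SolOn f B x (fun s => us s + w t (xs t) p) t b) ∧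
      ∀ x, x t = expMap M t (xs t) p → SolOn f B x (fun s => us s + w t (xs t) p) t b →
      ∀ τ ∈ Icc t b, sqDist M τ (xs τ) (x τ) ≤
        Real.exp (-(2 * lam) * (τ - t)) * energy M (xs t, p) t})
    (fun r h hh => hh.1)
    (fun r h hh h' h0 hle => ⟨h0, fun t p ht htp b htb hb => hh.2 t p ht htp b htb (by linarith)⟩)
    (fun r r' hr h hh => ⟨hh.1, fun t p ht htp b htb hb => hh.2 t p ht (htp.trans hr) b htb hb⟩)
    -- The gain at `t + |p|` is only known to exceed the threshold of its own integer level, so the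
    -- estimate is used at that level. Below `r` there are finitely many levels, and the smallest of
    -- their hold times works for all.
    (fun r => by
      obtain ⟨P, hP⟩ := (isCompact_Icc (a := 0) (b := r)).exists_bound_of_continuousOn hΘ.continuousOn
      choose h hh0 hh using fun j => hhold j P
      obtain ⟨j₀, -, hj₀⟩ := (Finset.range (⌈r⌉₊ + 1)).exists_min_image h
        ⟨0, Finset.mem_range.2 (Nat.succ_pos _)⟩
      refine ⟨h j₀, hh0 j₀, fun t p ht htp b htb hb => ?_⟩
      have hj : ⌈t + ‖p‖⌉₊ ∈ Finset.range (⌈r⌉₊ + 1) :=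
        Finset.mem_range.2 (Nat.lt_succ_of_le (Nat.ceil_mono htp))
      have hle := Nat.le_ceil (t + ‖p‖)
      have hp0 := norm_nonneg p
      exact hh ⌈t + ‖p‖⌉₊ t p (Θ (t + ‖p‖)) ht (by linarith) (by linarith) (hΘθ _)
        ((le_abs_self _).trans (hP _ ⟨by positivity, htp⟩)) b htb
        (hb.trans (by linarith [hj₀ _ hj])))
  exact ⟨w, η, continuousOn_gain hB hM hΘ hΘ0, hη, fun r => (hηS r).1,
    fun r t p ht htp b htb hb => ((hηS r).2 t p ht htp b htb hb).1,
    fun r t p ht htp b htb hb => ((hηS r).2 t p ht htp b htb hb).2⟩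

/-! ### Gluing solutions -/

/-- The index of the interval `[τ k, τ (k + 1))` that contains `t`. -/
def stepIndex (τ : ℕ → ℝ) (t : ℝ) : ℕ := sInf {k | t < τ (k + 1)}

theorem stepIndex_eq {τ : ℕ → ℝ} (hτ : Monotone τ) {k : ℕ} {t : ℝ}
    (ht : t ∈ Ico (τ k) (τ (k + 1))) : stepIndex τ t = k := by
  refine le_antisymm (Nat.sInf_le ht.2) ?_
  by_contra hlt
  have h1 : t < τ (stepIndex τ t + 1) := Nat.sInf_mem (s := {k | t < τ (k + 1)}) ⟨k, ht.2⟩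
  have h2 : τ (stepIndex τ t + 1) ≤ τ k := hτ (not_le.1 hlt)
  linarith [ht.1]

theorem exists_mem_Ico {τ : ℕ → ℝ} (hlim : Tendsto τ atTop atTop) {t : ℝ} (ht : τ 0 ≤ t) :
    ∃ k, t ∈ Ico (τ k) (τ (k + 1)) := by
  obtain ⟨N, hN⟩ := (hlim.eventually_gt_atTop t).exists
  have hex : ∃ k, t < τ k := ⟨N, hN⟩
  classical
  have h0 : Nat.find hex ≠ 0 := fun h => by
    have := Nat.find_spec hex
    rw [h] at this
    linarith
  obtain ⟨k, hk⟩ := Nat.exists_eq_succ_of_ne_zero h0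
  refine ⟨k, not_lt.1 (Nat.find_min hex (by omega)), ?_⟩
  have := Nat.find_spec hex
  rwa [hk] at this

/-- At a breakpoint `stepIndex` selects the later piece. The states agree there, and on each closed
interval the input is altered at its right end point only, a null set. -/
theorem SolOn.glue (hf : Smooth f) (hB : Smooth B) {τ : ℕ → ℝ} (hτ : StrictMono τ)
    (h0 : 0 ≤ τ 0) (hlim : Tendsto τ atTop atTop) {X : ℕ → ℝ → Vec n} {u : ℕ → ℝ → Vec m}
    (hX : ∀ k, SolOn f B (X k) (u k) (τ k) (τ (k + 1)))
    (hXX : ∀ k, X (k + 1) (τ (k + 1)) = X k (τ (k + 1))) :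
    ∃ x, (∀ k, EqOn x (X k) (Icc (τ k) (τ (k + 1)))) ∧
      ∀ T, SolOn f B x (fun t => u (stepIndex τ t) t) (τ 0) T := by
  have heq : ∀ k, EqOn (fun t => X (stepIndex τ t) t) (X k) (Icc (τ k) (τ (k + 1))) := by
    intro k t ht
    rcases ht.2.eq_or_lt with h | h
    · change X (stepIndex τ t) t = X k t
      rw [stepIndex_eq hτ.monotone (k := k + 1) ⟨h.ge, h ▸ hτ (Nat.lt_succ_self _)⟩, h, hXX]
    · change X (stepIndex τ t) t = X k t
      rw [stepIndex_eq hτ.monotone ⟨ht.1, h⟩]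
  refine ⟨_, heq, fun T => ?_⟩
  have hk : ∀ k, SolOn f B (fun t => X (stepIndex τ t) t) (fun t => u (stepIndex τ t) t)
      (τ 0) (τ k) := by
    intro k
    induction k with
    | zero => exact SolOn.refl _ _ _
    | succ k ih =>
      refine ih.append hf hB h0 (hτ.monotone (Nat.zero_le k)) (hτ (Nat.lt_succ_self k)).le ?_
      refine (hX k).congr (hτ (Nat.lt_succ_self k)).le (fun t ht => (heq k ht).symm) ?_
      filter_upwards [compl_mem_ae_iff.2 (measure_singleton (μ := volume) (τ (k + 1)))] with t ht htI
      rw [stepIndex_eq hτ.monotone ⟨htI.1, lt_of_le_of_ne htI.2 ht⟩]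
  obtain ⟨N, hN⟩ := (hlim.eventually_ge_atTop T).exists
  exact (hk N).restrict hf hB h0 le_rfl hN

/-! ### Piecewise continuous inputs -/

/-- One-sided limits and the value at the point give a bound near each time; compactness of the
interval makes it uniform. -/
theorem PiecewiseContinuousFrom.exists_bound {a : ℝ} {u : ℝ → Vec m}
    (hu : PiecewiseContinuousFrom a u) (T : ℝ) : ∃ U, ∀ t ∈ Icc a T, ‖u t‖ ≤ U := by
  have hlim : ∀ {l : Filter ℝ} {y : Vec m}, Tendsto u l (𝓝 y) → ∀ᶠ s in l, ‖u s‖ ≤ ‖y‖ + 1 :=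
    fun h => (h.norm.eventually (eventually_le_nhds (lt_add_one _)))
  refine isCompact_Icc.induction_on (p := fun s => ∃ U, ∀ t ∈ s, ‖u t‖ ≤ U) ⟨0, by simp⟩
    (fun s t hst ⟨U, hU⟩ => ⟨U, fun r hr => hU r (hst hr)⟩)
    (fun s t ⟨U, hU⟩ ⟨V, hV⟩ => ⟨max U V, fun r hr => hr.elim
      (fun h => (hU r h).trans (le_max_left _ _)) fun h => (hV r h).trans (le_max_right _ _)⟩)
    fun t ht => ?_
  obtain ⟨l, hl⟩ := hu.2.1 t ht.1
  obtain ⟨l', hl'⟩ : ∃ U, ∀ᶠ s in 𝓝[<] t, s ∈ Icc a T → ‖u s‖ ≤ U := by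
    rcases ht.1.eq_or_lt with h | h
    · refine ⟨0, eventually_mem_nhdsWithin.mono fun s hs hsI => ?_⟩
      exact absurd hsI.1 (not_le.2 (h ▸ hs))
    · obtain ⟨l', hl'⟩ := hu.2.2 t h
      exact ⟨_, (hlim hl').mono fun s hs _ => hs⟩
  have hev : ∀ᶠ s in 𝓝 t, s ∈ Icc a T → ‖u s‖ ≤ max (max l' (‖l‖ + 1)) ‖u t‖ := by
    rw [← nhdsLT_sup_nhdsGE, ← Ioi_insert, nhdsWithin_insert, eventually_sup, eventually_sup]
    refine ⟨hl'.mono fun s hs hI => (hs hI).trans (by simp), ?_, (hlim hl).mono fun s hs _ =>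
      hs.trans (by simp)⟩
    exact eventually_pure.2 fun _ => le_max_right _ _
  exact ⟨_, mem_nhdsWithin_iff_eventually.2 (hev.mono fun s hs => hs), _, fun s hs => hs⟩

end

end CCM

/-! ### Global sampled solutions. -/

namespace CCM

noncomputable section

variable {n m : ℕ} {f : Vec n → ℝ → Vec n} {B : Vec n → ℝ → Vec m →L[ℝ] Vec n}
  {M : Vec n → ℝ → Vec n →L[ℝ] Vec n} {α₁ α₂ lam : ℝ}

/-- The times cannot accumulate: at a finite limit `l`, continuity would give `l = l + η(l)`. -/
theorem exists_steps {η : ℝ → ℝ} (hη : Continuous η) (hpos : ∀ r, 0 < η r) (s : ℝ) :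
    ∃ τ : ℕ → ℝ, τ 0 = s ∧ StrictMono τ ∧ Tendsto τ atTop atTop ∧
      ∀ k, τ (k + 1) = τ k + η (τ k) := by
  obtain ⟨τ, hτ0, hτ⟩ : ∃ τ : ℕ → ℝ, τ 0 = s ∧ ∀ k, τ (k + 1) = τ k + η (τ k) :=
    ⟨fun k => Nat.rec s (fun _ t => t + η t) k, rfl, fun k => rfl⟩
  have hmono : StrictMono τ := strictMono_nat_of_lt_succ fun k => by
    rw [hτ]; linarith [hpos (τ k)]
  refine ⟨τ, hτ0, hmono, ?_, hτ⟩
  rcases tendsto_atTop_of_monotone hmono.monotone with h | ⟨l, hl⟩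
  · exact h
  · have h1 : Tendsto (fun k => τ k + η (τ k)) atTop (𝓝 (l + η l)) :=
      hl.add ((hη.tendsto l).comp hl)
    have h2 : Tendsto (fun k => τ (k + 1)) atTop (𝓝 l) := hl.comp (tendsto_add_atTop_nat 1)
    simp only [hτ] at h2
    linarith [tendsto_nhds_unique h1 h2, hpos l]

theorem PiecewiseContinuousFrom.add_step {a : ℝ} {u : ℝ → Vec m}
    (hu : PiecewiseContinuousFrom a u) {τ : ℕ → ℝ} (hτ : StrictMono τ) (ha : a ≤ τ 0)
    (hlim : Tendsto τ atTop atTop) (c : ℕ → Vec m) :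
    PiecewiseContinuousFrom (τ 0) (fun t => u t + c (stepIndex τ t)) := by
  have hright : ∀ t, τ 0 ≤ t → ∃ k, ∀ᶠ s in 𝓝[≥] t, c (stepIndex τ s) = c k := fun t ht => by
    obtain ⟨k, hk⟩ := exists_mem_Ico hlim ht
    refine ⟨k, ?_⟩
    filter_upwards [self_mem_nhdsWithin, mem_nhdsWithin_of_mem_nhds (Iio_mem_nhds hk.2)] with s h1 h2
    rw [stepIndex_eq hτ.monotone ⟨hk.1.trans h1, h2⟩]
  have hleft : ∀ t, τ 0 < t → ∃ k, (t ∉ range τ → t ∈ Ioo (τ k) (τ (k + 1))) ∧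
      ∀ᶠ s in 𝓝[<] t, c (stepIndex τ s) = c k := fun t ht => by
    obtain ⟨k, hk⟩ := exists_mem_Ico hlim ht.le
    rcases hk.1.eq_or_lt with h | h
    · obtain ⟨j, rfl⟩ : ∃ j, k = j + 1 :=
        ⟨k - 1, by have : k ≠ 0 := fun h0 => by rw [← h, h0] at ht; exact lt_irrefl _ ht
                   omega⟩
      refine ⟨j, fun hr => absurd ⟨_, h⟩ hr, ?_⟩
      filter_upwards [self_mem_nhdsWithin, mem_nhdsWithin_of_mem_nhds
        (Ioi_mem_nhds (h ▸ hτ (Nat.lt_succ_self j) : τ j < t))] with s h1 h2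
      rw [stepIndex_eq hτ.monotone ⟨le_of_lt h2, h.symm ▸ h1⟩]
    · refine ⟨k, fun _ => ⟨h, hk.2⟩, ?_⟩
      filter_upwards [self_mem_nhdsWithin, mem_nhdsWithin_of_mem_nhds (Ioi_mem_nhds h)] with s h1 h2
      rw [stepIndex_eq hτ.monotone ⟨le_of_lt h2, lt_trans h1 hk.2⟩]
  obtain ⟨⟨S, hS, hSc⟩, hr, hl⟩ := hu
  refine ⟨⟨S ∪ range τ, fun T => ?_, fun t ht htS => ?_⟩, fun t ht => ?_, fun t ht => ?_⟩
  · rw [union_inter_distrib_right]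
    refine ((hS T).subset (inter_subset_inter_right _ (Icc_subset_Icc_left ha))).union ?_
    obtain ⟨N, hN⟩ := (hlim.eventually_gt_atTop T).exists
    refine ((Finset.range N).finite_toSet.image τ).subset ?_
    rintro _ ⟨⟨k, rfl⟩, hk⟩
    exact ⟨k, Finset.mem_coe.2 (Finset.mem_range.2 (hτ.lt_iff_lt.1 (hk.2.trans_lt hN))), rfl⟩
  · rw [mem_union, not_or] at htS
    have hne : τ 0 < t := lt_of_le_of_ne ht fun h => htS.2 ⟨0, h⟩
    obtain ⟨k, hk, -⟩ := hleft t hne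
    have hk := hk htS.2
    have h1 : ContinuousWithinAt u (Ici (τ 0)) t :=
      (hSc t (ha.trans ht) htS.1).mono (Ici_subset_Ici.2 ha)
    refine (h1.add (continuousWithinAt_const (b := c k))).congr_of_eventuallyEq ?_ ?_
    · filter_upwards [mem_nhdsWithin_of_mem_nhds (Ioo_mem_nhds hk.1 hk.2)] with s hs
      rw [stepIndex_eq hτ.monotone (Ioo_subset_Ico_self hs)]
      rfl
    · rw [stepIndex_eq hτ.monotone (Ioo_subset_Ico_self hk)]
      rfl
  · obtain ⟨l, hl⟩ := hr t (ha.trans ht)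
    obtain ⟨k, hk⟩ := hright t ht
    refine ⟨l + c k, (hl.add_const (c k)).congr' ?_⟩
    filter_upwards [nhdsWithin_mono t Ioi_subset_Ici_self hk] with s hs
    rw [hs]
  · obtain ⟨l, hl⟩ := hl t (ha.trans_lt ht)
    obtain ⟨k, -, hk⟩ := hleft t ht
    refine ⟨l + c k, (hl.add_const (c k)).congr' ?_⟩
    filter_upwards [hk] with s hs
    rw [hs]

set_option maxHeartbeats 800000 in
/-- Solutions under the offset law, sampled at mesh at most `ε`. -/
theorem IsHoldLaw.exists_solution (hf : Smooth f) (hB : Smooth B)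
    (hM : IsUniformlyBoundedMetric M α₁ α₂) (hlam : 0 < lam) {xs : ℝ → Vec n} {us : ℝ → Vec m}
    {w : ℝ → Vec n → Vec n → Vec m} {η : ℝ → ℝ} (hw : IsHoldLaw f B M lam xs us w η)
    (hus : PiecewiseContinuousFrom 0 us) {s : ℝ} (hs : 0 ≤ s) (ξ : Vec n) {ε : ℝ} (hε : 0 < ε) :
    ∃ (v : ℝ → Vec m) (z : ℝ → Vec n), PiecewiseContinuousFrom s (fun t => us t + v t) ∧ z s = ξ ∧
      (∀ T, SolOn f B z (fun t => us t + v t) s T) ∧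
      (∀ t, s ≤ t → sqDist M t (xs t) (z t) ≤
        Real.exp (-(2 * lam) * (t - s)) * sqDist M s (xs s) ξ) ∧
      ∀ t, s ≤ t → ∃ t' ∈ Icc s t, t ≤ t' + ε ∧
        ∃ p, IsMinCovector M t' (xs t') (z t') p ∧ v t = w t' (xs t') p := by
  obtain ⟨V₀, hV₀⟩ : ∃ c, c = sqDist M s (xs s) ξ := ⟨_, rfl⟩
  have hV₀0 : 0 ≤ V₀ := hV₀ ▸ sqDist_nonneg hM hs _ _
  -- The squared distance never exceeds its initial value, so this bounds every minimal covector
  -- that occurs. The step lengths then depend on time alone and can be fixed before the solution is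
  -- constructed.
  obtain ⟨P, hP⟩ : ∃ c, c = √(α₂ * V₀) := ⟨_, rfl⟩
  have hα₂ := hM.pos_upper
  have hpP : ∀ t ζ p, 0 ≤ t → sqDist M t (xs t) ζ ≤ V₀ → IsMinCovector M t (xs t) ζ p →
      ‖p‖ ≤ P := fun t ζ p ht hV hp => by
    have h1 := le_energy hM (xs t, p) ht
    rw [hp.2, div_le_iff₀ hα₂] at h1
    rw [hP]
    refine Real.le_sqrt_of_sq_le (h1.trans ?_)
    rw [mul_comm]; gcongr
  obtain ⟨τ, hτ0, hτ, hlim, hτs⟩ := exists_steps (η := fun t => min ε (η (t + P)))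
    (continuous_const.min (hw.continuous_step.comp (continuous_id.add continuous_const)))
    (fun r => lt_min hε (hw.step_pos _)) s
  have hτ0' : ∀ k, 0 ≤ τ k := fun k => hs.trans (hτ0 ▸ hτ.monotone (Nat.zero_le k))
  -- The properties are stated conditionally so that a choice is available for every state. The
  -- recursion then shows that only states with squared distance at most `V₀` are met.
  have hstep : ∀ k ζ, ∃ p x, IsMinCovector M (τ k) (xs (τ k)) ζ p ∧
      (sqDist M (τ k) (xs (τ k)) ζ ≤ V₀ → x (τ k) = ζ ∧
        SolOn f B x (fun r => us r + w (τ k) (xs (τ k)) p) (τ k) (τ (k + 1)) ∧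
        ∀ t ∈ Icc (τ k) (τ (k + 1)), sqDist M t (xs t) (x t) ≤
          Real.exp (-(2 * lam) * (t - τ k)) * sqDist M (τ k) (xs (τ k)) ζ) := by
    intro k ζ
    obtain ⟨p, hp⟩ := exists_isMinCovector hM (hτ0' k) (xs (τ k)) ζ
    by_cases hV : sqDist M (τ k) (xs (τ k)) ζ ≤ V₀
    · have hle : τ (k + 1) ≤ τ k + η (τ k + P) := by rw [hτs]; gcongr; exact min_le_right _ _
      have hpn : τ k + ‖p‖ ≤ τ k + P := by gcongr; exact hpP _ _ _ (hτ0' k) hV hp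
      obtain ⟨x, hx0, hx⟩ := hw.exists_sol _ _ p (hτ0' k) hpn _ (hτ (Nat.lt_succ_self k)).le hle
      refine ⟨p, x, hp, fun _ => ⟨hx0.trans hp.1, hx, fun t ht => ?_⟩⟩
      have := hw.decay _ _ p (hτ0' k) hpn _ (hτ (Nat.lt_succ_self k)).le hle x hx0 hx t ht
      rwa [hp.2] at this
    · exact ⟨p, fun _ => 0, hp, fun h => absurd h hV⟩
  choose p x hp hx using hstep
  obtain ⟨ζ, hζ0, hζ⟩ : ∃ ζ : ℕ → Vec n, ζ 0 = ξ ∧ ∀ k, ζ (k + 1) = x k (ζ k) (τ (k + 1)) :=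
    ⟨fun k => Nat.rec ξ (fun k y => x k y (τ (k + 1))) k, rfl, fun k => rfl⟩
  have hexp1 : ∀ t, s ≤ t → Real.exp (-(2 * lam) * (t - s)) * V₀ ≤ V₀ := fun t ht =>
    mul_le_of_le_one_left hV₀0 (Real.exp_le_one_iff.2
      (mul_nonpos_of_nonpos_of_nonneg (by linarith) (by linarith)))
  have hsτ : ∀ k, s ≤ τ k := fun k => hτ0 ▸ hτ.monotone (Nat.zero_le k)
  have hcomb : ∀ k t y, sqDist M (τ k) (xs (τ k)) (ζ k) ≤
      Real.exp (-(2 * lam) * (τ k - s)) * V₀ → sqDist M t (xs t) y ≤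
      Real.exp (-(2 * lam) * (t - τ k)) * sqDist M (τ k) (xs (τ k)) (ζ k) →
      sqDist M t (xs t) y ≤ Real.exp (-(2 * lam) * (t - s)) * V₀ := fun k t y h1 h2 => by
    refine h2.trans ((mul_le_mul_of_nonneg_left h1 (Real.exp_pos _).le).trans (le_of_eq ?_))
    rw [← mul_assoc, ← Real.exp_add]
    congr 2; ring
  have hV : ∀ k, sqDist M (τ k) (xs (τ k)) (ζ k) ≤ Real.exp (-(2 * lam) * (τ k - s)) * V₀ := by
    intro k
    induction k with
    | zero => rw [hτ0, hζ0, sub_self, mul_zero, Real.exp_zero, one_mul, hV₀]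
    | succ k ih =>
      rw [hζ]
      exact hcomb k _ _ ih (((hx k (ζ k) (ih.trans (hexp1 _ (hsτ k)))).2.2 _
        ⟨(hτ (Nat.lt_succ_self k)).le, le_rfl⟩))
  have hx' := fun k => hx k (ζ k) ((hV k).trans (hexp1 _ (hsτ k)))
  obtain ⟨z, hz, hzsol⟩ := SolOn.glue hf hB hτ (hτ0' 0) hlim (X := fun k => x k (ζ k))
    (u := fun k r => us r + w (τ k) (xs (τ k)) (p k (ζ k))) (fun k => (hx' k).2.1)
    (fun k => ((hx' (k + 1)).1).trans (hζ k))
  have hzτ : ∀ k, z (τ k) = ζ k := fun k =>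
    (hz k ⟨le_rfl, (hτ (Nat.lt_succ_self k)).le⟩).trans (hx' k).1
  have hpc := hus.add_step hτ (hτ0' 0) hlim (fun k => w (τ k) (xs (τ k)) (p k (ζ k)))
  rw [hτ0] at hpc hzsol
  refine ⟨_, z, hpc, by rw [← hτ0, hzτ, hζ0], hzsol, fun t ht => ?_, fun t ht => ?_⟩
  · obtain ⟨k, hk⟩ := exists_mem_Ico hlim (hτ0.le.trans ht)
    rw [hz k (Ico_subset_Icc_self hk), ← hV₀]
    exact hcomb k t _ (hV k) ((hx' k).2.2 t (Ico_subset_Icc_self hk))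
  · obtain ⟨k, hk⟩ := exists_mem_Ico hlim (hτ0.le.trans ht)
    refine ⟨τ k, ⟨hsτ k, hk.1⟩, ?_, p k (ζ k), ?_, ?_⟩
    · have := hτs k
      have := min_le_left ε (η (τ k + P))
      linarith [hk.2]
    · rw [hzτ]; exact hp k (ζ k)
    · rw [stepIndex_eq hτ.monotone hk]

end

end CCM

namespace CCM

noncomputable section

variable {n m : ℕ} {f : Vec n → ℝ → Vec n} {B : Vec n → ℝ → Vec m →L[ℝ] Vec n}
  {M : Vec n → ℝ → Vec n →L[ℝ] Vec n} {α₁ α₂ lam : ℝ}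

/-! ### Open-loop controllability and sampled-data feedback -/

theorem IsTarget.isBoundedTarget (hf : Smooth f) (hB : Smooth B) {xs : ℝ → Vec n}
    {us : ℝ → Vec m} (h : IsTarget f B xs us) : IsBoundedTarget f B xs us :=
  ⟨fun T => (isTrajectoryOn_iff.1 (h.2 (max T 0) (le_max_right _ _))).restrict hf hB le_rfl le_rfl
    (le_max_left _ _), h.1.exists_bound⟩

/-- The uniform bounds on the metric are used at time `t` from below and at time zero from above;
their ratio is the square of the overshoot. -/
theorem expBoundOn_of_sqDist_le (hM : IsUniformlyBoundedMetric M α₁ α₂) {xs x : ℝ → Vec n}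
    {I : Set ℝ} (hI : ∀ t ∈ I, 0 ≤ t)
    (h : ∀ t ∈ I, sqDist M t (xs t) (x t) ≤
      Real.exp (-(2 * lam) * t) * sqDist M 0 (xs 0) (x 0)) :
    ExpBoundOn lam (√(α₂ / α₁)) xs x I := by
  have hα₁ := hM.pos_lower
  have hα₂ := hM.pos_upper
  intro t ht
  have h1 := le_sqDist hM (hI t ht) (xs t) (x t)
  have h2 := mul_le_mul_of_nonneg_left (sqDist_le hM le_rfl (xs 0) (x 0))
    (Real.exp_pos (-(2 * lam) * t)).le
  refine abs_le_of_sq_le_sq' ?_ (by positivity) |>.2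
  have e : (√(α₂ / α₁) * Real.exp (-lam * t) * ‖x 0 - xs 0‖) ^ 2 =
      Real.exp (-(2 * lam) * t) * (α₂ * ‖x 0 - xs 0‖ ^ 2) / α₁ := by
    rw [mul_pow, mul_pow, Real.sq_sqrt (by positivity), ← Real.exp_nat_mul]
    rw [show ((2 : ℕ) : ℝ) * (-lam * t) = -(2 * lam) * t by push_cast; ring]
    ring
  rw [e, le_div_iff₀ hα₁]
  have := h t ht
  linarith

theorem univExpOpenLoopControllable (hf : Smooth f) (hB : Smooth B)
    (hM : IsUniformlyBoundedMetric M α₁ α₂) (hlam : 0 < lam)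
    (hccm : ContractionCondition f B M lam) (hgrowth : InputGrowthCondition B M) :
    UnivExpOpenLoopControllable f B lam (√(α₂ / α₁)) := by
  intro xs us htar x₀
  obtain ⟨w, η, hw⟩ := exists_holdLaw hf hB hM hlam hccm hgrowth (htar.isBoundedTarget hf hB)
  obtain ⟨v, z, hv, hz0, hz, hV, -⟩ := hw.exists_solution hf hB hM hlam htar.1 le_rfl x₀ one_pos
  refine ⟨_, z, hv, fun T _ => isTrajectoryOn_iff.2 (hz T), hz0,
    expBoundOn_of_sqDist_le hM (fun t ht => ht) fun t ht => ?_⟩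
  have := hV t ht
  rwa [sub_zero, ← hz0] at this

/-- The law at `(s, ξ)` is the complete open-loop input from that state on, so no sampling interval
is too long. By uniqueness any closed-loop solution follows the constructed one between samples, and
the decay factors multiply. -/
theorem univExpStabSampledData (hf : Smooth f) (hB : Smooth B)
    (hM : IsUniformlyBoundedMetric M α₁ α₂) (hlam : 0 < lam)
    (hccm : ContractionCondition f B M lam) (hgrowth : InputGrowthCondition B M) :
    UnivExpStabSampledData f B lam (√(α₂ / α₁)) := by
  intro xs us htar
  obtain ⟨w, η, hw⟩ := exists_holdLaw hf hB hM hlam hccm hgrowth (htar.isBoundedTarget hf hB)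
  have hsol := fun s (hs : 0 ≤ s) ξ => hw.exists_solution hf hB hM hlam htar.1 hs ξ one_pos
  choose! v z hv hz0 hz hV _ using hsol
  refine ⟨fun s ξ t => us t + v s ξ t, fun s hs ξ => hv s hs ξ, fun τ hτ x₀ => ⟨?_, ?_⟩⟩
  · obtain ⟨hτ0, hτm, hlim⟩ := hτ
    have hτn : ∀ k, 0 ≤ τ k := fun k => hτ0 ▸ hτm.monotone (Nat.zero_le k)
    obtain ⟨ζ, hζ0, hζ⟩ : ∃ ζ : ℕ → Vec n, ζ 0 = x₀ ∧
        ∀ k, ζ (k + 1) = z (τ k) (ζ k) (τ (k + 1)) :=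
      ⟨fun k => Nat.rec x₀ (fun k y => z (τ k) y (τ (k + 1))) k, rfl, fun k => rfl⟩
    obtain ⟨x, hx, hxsol⟩ := SolOn.glue hf hB hτm (hτn 0) hlim (X := fun k => z (τ k) (ζ k))
      (u := fun k r => us r + v (τ k) (ζ k) r) (fun k => hz _ (hτn k) _ _)
      (fun k => (hz0 _ (hτn _) _).trans (hζ k))
    have hxτ : ∀ k, x (τ k) = ζ k := fun k =>
      (hx k ⟨le_rfl, (hτm (Nat.lt_succ_self k)).le⟩).trans (hz0 _ (hτn k) _)
    rw [hτ0] at hxsol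
    refine ⟨x, ⟨_, fun T _ => isTrajectoryOn_iff.2 (hxsol T), fun i t ht => ?_⟩, ?_⟩
    · simp only [stepIndex_eq hτm.monotone ht, hxτ]
    · rw [← hτ0, hxτ, hζ0]
  · rintro x ⟨u, hx, hu⟩ rfl
    obtain ⟨hτ0, hτm, hlim⟩ := hτ
    have hτn : ∀ k, 0 ≤ τ k := fun k => hτ0 ▸ hτm.monotone (Nat.zero_le k)
    have heq : ∀ k, EqOn x (z (τ k) (x (τ k))) (Icc (τ k) (τ (k + 1))) := fun k => by
      obtain ⟨U, hU⟩ := (hv (τ k) (hτn k) (x (τ k))).exists_bound (τ (k + 1))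
      have h1 := (isTrajectoryOn_iff.1 (hx (τ (k + 1)) (hτn _))).restrict hf hB le_rfl (hτn k) le_rfl
      have hle := (hτm (Nat.lt_succ_self k)).le
      refine ((h1.congr hle (fun _ _ => rfl) ?_).eqOn hf hB (hτn k)
        (hz (τ k) (hτn k) (x (τ k)) (τ (k + 1))) (hz0 _ (hτn k) _).symm (Eventually.of_forall hU))
      filter_upwards [compl_mem_ae_iff.2 (measure_singleton (μ := volume) (τ (k + 1)))] with t ht htI
      exact hu k t ⟨htI.1, lt_of_le_of_ne htI.2 ht⟩
    have hdec : ∀ k, sqDist M (τ k) (xs (τ k)) (x (τ k)) ≤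
        Real.exp (-(2 * lam) * τ k) * sqDist M 0 (xs 0) (x 0) → ∀ t ∈ Icc (τ k) (τ (k + 1)),
        sqDist M t (xs t) (x t) ≤ Real.exp (-(2 * lam) * t) * sqDist M 0 (xs 0) (x 0) := by
      intro k hk t ht
      rw [heq k ht]
      refine (hV (τ k) (hτn k) (x (τ k)) t ht.1).trans
        ((mul_le_mul_of_nonneg_left hk (Real.exp_pos _).le).trans (le_of_eq ?_))
      rw [← mul_assoc, ← Real.exp_add]
      congr 2; ring
    have hk : ∀ k, sqDist M (τ k) (xs (τ k)) (x (τ k)) ≤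
        Real.exp (-(2 * lam) * τ k) * sqDist M 0 (xs 0) (x 0) := by
      intro k
      induction k with
      | zero => rw [hτ0, mul_zero, Real.exp_zero, one_mul]
      | succ k ih => exact hdec k ih _ ⟨(hτm (Nat.lt_succ_self k)).le, le_rfl⟩
    refine expBoundOn_of_sqDist_le hM (fun t ht => ht) fun t ht => ?_
    obtain ⟨k, hkt⟩ := exists_mem_Ico hlim (hτ0.le.trans ht)
    exact hdec k (hk k) t (Ico_subset_Icc_self hkt)

end

end CCM

namespace CCM

noncomputable section

variable {n m : ℕ} {f : Vec n → ℝ → Vec n} {B : Vec n → ℝ → Vec m →L[ℝ] Vec n}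
  {M : Vec n → ℝ → Vec n →L[ℝ] Vec n} {α₁ α₂ lam : ℝ} {xs : ℝ → Vec n} {us : ℝ → Vec m}
  {w : ℝ → Vec n → Vec n → Vec m} {η : ℝ → ℝ}

/-! ### Continuous feedback on the set of regular points -/

theorem IsBoundedTarget.continuousOn (h : IsBoundedTarget f B xs us) :
    ContinuousOn xs (Ici 0) := by
  intro t ht
  refine ((h.sol (t + 1)).continuousOn t ⟨ht, by linarith⟩).mono_of_mem_nhdsWithin ?_
  filter_upwards [self_mem_nhdsWithin,
    mem_nhdsWithin_of_mem_nhds (Iio_mem_nhds (lt_add_one t))] with s h1 h2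
  exact ⟨h1, le_of_lt h2⟩

theorem IsBoundedTarget.tendsto (h : IsBoundedTarget f B xs us) {ι : Type*} {l : Filter ι}
    {t : ι → ℝ} {t₀ : ℝ} (ht₀ : 0 ≤ t₀) (htl : Tendsto t l (𝓝 t₀)) (ht : ∀ᶠ i in l, 0 ≤ t i) :
    Tendsto (fun i => xs (t i)) l (𝓝 (xs t₀)) :=
  (h.continuousOn t₀ ht₀).tendsto.comp (tendsto_nhdsWithin_iff.2 ⟨htl, ht⟩)

theorem IsHoldLaw.tendsto (hw : IsHoldLaw f B M lam xs us w η) (htar : IsBoundedTarget f B xs us)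
    {ι : Type*} {l : Filter ι} {t : ι → ℝ} {t₀ : ℝ} {p : ι → Vec n} {p₀ : Vec n} (ht₀ : 0 ≤ t₀)
    (htl : Tendsto t l (𝓝 t₀)) (ht : ∀ᶠ i in l, 0 ≤ t i) (hp : Tendsto p l (𝓝 p₀)) :
    Tendsto (fun i => w (t i) (xs (t i)) (p i)) l (𝓝 (w t₀ (xs t₀) p₀)) :=
  Filter.Tendsto.comp (g := fun z : ℝ × Vec n × Vec n => w z.1 z.2.1 z.2.2)
    (hw.continuousOn (t₀, xs t₀, p₀) ⟨ht₀, mem_univ _⟩)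
    (tendsto_nhdsWithin_iff.2 ⟨htl.prodMk_nhds ((htar.tendsto ht₀ htl ht).prodMk_nhds hp),
      ht.mono fun _ hi => ⟨hi, mem_univ _⟩⟩)

theorem IsHoldLaw.exists_bound (hw : IsHoldLaw f B M lam xs us w η)
    (htar : IsBoundedTarget f B xs us) (R : ℝ) :
    ∃ C, 0 ≤ C ∧ ∀ t p, 0 ≤ t → t ≤ R → ‖p‖ ≤ R → ‖w t (xs t) p‖ ≤ C := by
  have hc : ContinuousOn (fun z : ℝ × Vec n => w z.1 (xs z.1) z.2)
      (Icc 0 R ×ˢ Metric.closedBall 0 R) := fun z hz =>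
    hw.tendsto htar hz.1.1 ((continuous_fst.tendsto z).mono_left nhdsWithin_le_nhds)
      (eventually_mem_nhdsWithin.mono fun y hy => hy.1.1)
      ((continuous_snd.tendsto z).mono_left nhdsWithin_le_nhds)
  obtain ⟨C, hC⟩ := (isCompact_Icc.prod (isCompact_closedBall _ _)).exists_bound_of_continuousOn hc
  exact ⟨|C|, abs_nonneg C, fun t p ht htR hp =>
    (hC (t, p) ⟨⟨ht, htR⟩, mem_closedBall_zero_iff.2 hp⟩).trans (le_abs_self C)⟩

/-- The initial covector of some minimal geodesic from `b` to `x`. -/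
def minCovector (M : Vec n → ℝ → Vec n →L[ℝ] Vec n) (t : ℝ) (b x : Vec n) : Vec n :=
  Classical.epsilon fun p => IsMinCovector M t b x p

theorem isMinCovector_minCovector (hM : IsUniformlyBoundedMetric M α₁ α₂) {t : ℝ} (ht : 0 ≤ t)
    (b x : Vec n) : IsMinCovector M t b x (minCovector M t b x) :=
  Classical.epsilon_spec (exists_isMinCovector hM ht b x)

/-- The set of regular points of the distance to the target. -/
def regularDomain (M : Vec n → ℝ → Vec n →L[ℝ] Vec n) (xs : ℝ → Vec n) : Set (Vec n × ℝ) :=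
  {q | 0 ≤ q.2 ∧ IsRegularPoint M q.2 (xs q.2) q.1}

/-- The feedback law `u* + w(t, x*(t), p)`, with `p` the covector of the minimal geodesic to `x`. -/
def geodesicFeedback (M : Vec n → ℝ → Vec n →L[ℝ] Vec n) (xs : ℝ → Vec n)
    (w : ℝ → Vec n → Vec n → Vec m) (x : Vec n) (t : ℝ) (u : Vec m) : Vec m :=
  u + w t (xs t) (minCovector M t (xs t) x)

theorem exists_isOpen_regularDomain (hM : IsUniformlyBoundedMetric M α₁ α₂)
    (htar : IsBoundedTarget f B xs us) :
    ∃ O : Set (Vec n × ℝ), IsOpen O ∧ regularDomain M xs = O ∩ (univ ×ˢ Ici 0) := by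
  refine ⟨interior (regularDomain M xs ∪ (univ ×ˢ Ici 0)ᶜ), isOpen_interior, ?_⟩
  ext q
  constructor
  · intro hq
    refine ⟨mem_interior_iff_mem_nhds.2 ?_, mem_univ _, hq.1⟩
    have hmem : ∀ᶠ y in 𝓝[univ ×ˢ Ici 0] q, (0 : ℝ) ≤ (y : Vec n × ℝ).2 :=
      eventually_mem_nhdsWithin.mono fun y hy => hy.2
    have htl : Tendsto (fun y : Vec n × ℝ => y.2) (𝓝[univ ×ˢ Ici 0] q) (𝓝 q.2) :=
      (continuous_snd.tendsto q).mono_left nhdsWithin_le_nhds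
    have h1 := IsRegularPoint.eventually hM hq.1 hmem htl (htar.tendsto hq.1 htl hmem)
      ((continuous_fst.tendsto q).mono_left nhdsWithin_le_nhds) hq.2
    have h2 := mem_nhdsWithin_iff_eventually.1 h1
    filter_upwards [h2] with y hy
    by_cases h : y ∈ (univ ×ˢ Ici 0 : Set (Vec n × ℝ))
    · exact Or.inl ⟨h.2, hy h⟩
    · exact Or.inr h
  · rintro ⟨h1, h2⟩
    exact (interior_subset h1).resolve_right fun h => h h2

theorem continuousOn_geodesicFeedback (hM : IsUniformlyBoundedMetric M α₁ α₂)
    (htar : IsBoundedTarget f B xs us) (hw : IsHoldLaw f B M lam xs us w η) :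
    ContinuousOn (fun q : (Vec n × ℝ) × Vec m => geodesicFeedback M xs w q.1.1 q.1.2 q.2)
      (regularDomain M xs ×ˢ univ) := by
  rintro ⟨⟨x, t⟩, u⟩ ⟨⟨ht, hreg⟩, -⟩
  simp only at ht hreg
  have hc : Tendsto (fun q : (Vec n × ℝ) × Vec m => q)
      (𝓝[regularDomain M xs ×ˢ univ] ((x, t), u)) (𝓝 ((x, t), u)) :=
    tendsto_id.mono_left nhdsWithin_le_nhds
  have hmem : ∀ᶠ q in 𝓝[regularDomain M xs ×ˢ univ] ((x, t), u),
      (0 : ℝ) ≤ (q : (Vec n × ℝ) × Vec m).1.2 :=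
    eventually_mem_nhdsWithin.mono fun y hy => hy.1.1
  have htl : Tendsto (fun q : (Vec n × ℝ) × Vec m => q.1.2)
      (𝓝[regularDomain M xs ×ˢ univ] ((x, t), u)) (𝓝 t) := hc.fst_nhds.snd_nhds
  have hp : Tendsto (fun q : (Vec n × ℝ) × Vec m => minCovector M q.1.2 (xs q.1.2) q.1.1)
      (𝓝[regularDomain M xs ×ˢ univ] ((x, t), u)) (𝓝 (minCovector M t (xs t) x)) := by
    obtain ⟨p₀, hp₀, huniq, -⟩ := hreg
    rw [huniq _ (isMinCovector_minCovector hM ht (xs t) x), Metric.tendsto_nhds]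
    intro ε hε
    have h1 := IsMinCovector.eventually_near hM ht hmem htl (htar.tendsto ht htl hmem)
      hc.fst_nhds.fst_nhds huniq hε
    filter_upwards [h1, hmem] with q hq hq0
    rw [dist_eq_norm]
    exact hq _ (isMinCovector_minCovector hM hq0 _ _)
  exact hc.snd_nhds.add (hw.tendsto htar ht htl hmem hp)

/-- The minimal covectors at the approximating points are bounded. A subsequence converges to a
minimal covector at `x`, and continuity of the offset law identifies the limit value. -/
theorem exists_of_mem_limitValues (hM : IsUniformlyBoundedMetric M α₁ α₂)
    (htar : IsBoundedTarget f B xs us) (hw : IsHoldLaw f B M lam xs us w η) {t : ℝ} (ht : 0 ≤ t)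
    {x : Vec n} {u : Vec m} (hu : u ∈ limitValues (regularDomain M xs)
      (fun y s => geodesicFeedback M xs w y s (us s)) x t) :
    ∃ p, IsMinCovector M t (xs t) x p ∧ u = us t + w t (xs t) p := by
  have hα₂ := hM.pos_upper
  have h1 : ∀ k : ℕ, ∃ y ∈ Metric.ball x (1 / ((k : ℝ) + 1)),
      dist u (geodesicFeedback M xs w y t (us t)) < 1 / ((k : ℝ) + 1) := by
    intro k
    have hk : (0 : ℝ) < 1 / ((k : ℝ) + 1) := by positivity
    have h2 := mem_iInter₂.1 hu (1 / ((k : ℝ) + 1)) hk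
    obtain ⟨_, ⟨y, ⟨hy, -⟩, rfl⟩, hd⟩ := Metric.mem_closure_iff.1 h2 _ hk
    exact ⟨y, hy, hd⟩
  choose y hy hd using h1
  have hlim := tendsto_one_div_add_atTop_nhds_zero_nat (𝕜 := ℝ)
  have hyx : Tendsto y atTop (𝓝 x) := tendsto_iff_dist_tendsto_zero.2
    (squeeze_zero (fun _ => dist_nonneg) (fun k => (Metric.mem_ball.1 (hy k)).le) hlim)
  have hyu : Tendsto (fun k => geodesicFeedback M xs w (y k) t (us t)) atTop (𝓝 u) :=
    tendsto_iff_dist_tendsto_zero.2 (squeeze_zero (fun _ => dist_nonneg)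
      (fun k => by rw [dist_comm]; exact (hd k).le) hlim)
  have hmem : ∀ k, minCovector M t (xs t) (y k) ∈
      Metric.closedBall (0 : Vec n) (α₂ * (1 + ‖x - xs t‖)) := fun k => by
    rw [mem_closedBall_zero_iff]
    refine ((isMinCovector_minCovector hM ht (xs t) (y k)).norm_le hM ht).trans ?_
    have h2 : ‖y k - x‖ ≤ 1 := by
      rw [← dist_eq_norm]
      refine (Metric.mem_ball.1 (hy k)).le.trans ?_
      rw [div_le_one (by positivity)]
      linarith [Nat.cast_nonneg (α := ℝ) k]
    have h3 := norm_add_le (y k - x) (x - xs t)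
    rw [sub_add_sub_cancel] at h3
    gcongr
    linarith
  obtain ⟨p, -, φ, hφ, hp⟩ := (isCompact_closedBall _ _).tendsto_subseq hmem
  have ht' : ∀ᶠ k in (atTop : Filter ℕ), 0 ≤ (fun _ : ℕ => t) k := Eventually.of_forall fun _ => ht
  refine ⟨p, IsMinCovector.of_tendsto hM (l := atTop) (t := fun _ => t) (b := fun _ => xs t) ht ht'
    tendsto_const_nhds tendsto_const_nhds (hyx.comp hφ.tendsto_atTop) hp
    (Eventually.of_forall fun k => isMinCovector_minCovector hM ht _ _), ?_⟩
  refine tendsto_nhds_unique (hyu.comp hφ.tendsto_atTop) ?_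
  exact tendsto_const_nhds.add (hw.tendsto htar (t := fun _ => t) ht tendsto_const_nhds ht' hp)

theorem SolOn.hasDerivWithinAt_left (hf : Smooth f) (hB : Smooth B) {x : ℝ → Vec n} {u : ℝ → Vec m}
    {a b : ℝ} (ha : 0 ≤ a) (hab : a < b) (h : SolOn f B x u a b)
    (hu : ContinuousWithinAt u (Ici a) a) :
    HasDerivWithinAt x (f (x a) a + B (x a) a (u a)) (Ici a) a := by
  have ha' : a ∈ Icc a b := ⟨le_rfl, hab.le⟩
  have hmem : Icc a b ∈ 𝓝[≥] a := Icc_mem_nhdsGE hab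
  have hx : ContinuousWithinAt x (Ici a) a := (h.continuousOn a ha').mono_of_mem_nhdsWithin hmem
  have h0 : ∀ t ∈ Icc a b, 0 ≤ t := fun t ht => ha.trans ht.1
  have c1 : ContinuousWithinAt (fun s => f (x s) s) (Ici a) a :=
    (SmoothHalf.continuousOn_comp (F := f) hf h.continuousOn h0 a ha').mono_of_mem_nhdsWithin hmem
  have c2 : ContinuousWithinAt (fun s => B (x s) s) (Ici a) a :=
    (SmoothHalf.continuousOn_comp (F := B) hB h.continuousOn h0 a ha').mono_of_mem_nhdsWithin hmem
  have hint := integrableOn_rhs hf hB ha h.continuousOn h.integrable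
  have h1 := intervalIntegral.integral_hasDerivWithinAt_right (s := Ici a) (t := Ioi a)
    (f := fun s => f (x s) s + B (x s) s (u s)) (a := a) (b := a) (by simp)
    ⟨Icc a b, Icc_mem_nhdsGT hab, hint.aestronglyMeasurable⟩
    ((c1.add (c2.clm_apply hu)).mono Ioi_subset_Ici_self)
  refine (h1.const_add (x a)).congr_of_eventuallyEq ?_ (by simp)
  filter_upwards [hmem] with s hs using h.eq_integral s hs

theorem HasDerivAt.le_of_eventually_le {g φ : ℝ → ℝ} {t d e : ℝ} (hg : HasDerivAt g d t)
    (hφ : HasDerivWithinAt φ e (Ici t) t) (heq : g t = φ t)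
    (hle : ∀ᶠ s in 𝓝[>] t, g s ≤ φ s) : d ≤ e := by
  have h1 := (hasDerivWithinAt_iff_tendsto_slope' (by simp)).1 (hg.hasDerivWithinAt (s := Ioi t))
  have h2 := (hasDerivWithinAt_iff_tendsto_slope' (by simp)).1 (hφ.mono Ioi_subset_Ici_self)
  refine le_of_tendsto_of_tendsto h1 h2 ?_
  filter_upwards [hle, self_mem_nhdsWithin] with s hs hst
  have : 0 < s - t := sub_pos.2 hst
  rw [slope_def_field, slope_def_field, heq]
  gcongr

theorem PiecewiseContinuousFrom.ae_continuousWithinAt {u : ℝ → Vec m}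
    (hu : PiecewiseContinuousFrom 0 u) :
    ∀ᵐ t, 0 ≤ t → ContinuousWithinAt u (Ici 0) t := by
  obtain ⟨⟨S, hS, hc⟩, -⟩ := hu
  have h1 : ∀ N : ℕ, ∀ᵐ t : ℝ, t ∉ S ∩ Icc 0 (N : ℝ) := fun N =>
    compl_mem_ae_iff.2 ((hS N).measure_zero volume)
  filter_upwards [ae_all_iff.2 h1] with t ht ht0
  obtain ⟨N, hN⟩ := exists_nat_ge t
  exact hc t ht0 fun h => ht N ⟨h, ht0, hN⟩

theorem lipschitzOnWith_sqDist (hM : IsUniformlyBoundedMetric M α₁ α₂) {x y : ℝ → Vec n} {T K R : ℝ}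
    (hTR : T ≤ R) (hK : 0 ≤ K) (hx : ∀ t ∈ Icc 0 T, ‖x t‖ ≤ R) (hy : ∀ t ∈ Icc 0 T, ‖y t‖ ≤ R)
    (hxK : ∀ s ∈ Icc 0 T, ∀ t ∈ Icc 0 T, ‖x t - x s‖ ≤ K * |t - s|)
    (hyK : ∀ s ∈ Icc 0 T, ∀ t ∈ Icc 0 T, ‖y t - y s‖ ≤ K * |t - s|) :
    ∃ L, LipschitzOnWith L (fun t => sqDist M t (y t) (x t)) (Icc 0 T) := by
  obtain ⟨C, hC, h⟩ := sqDist_lipschitz hM R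
  refine ⟨(C * (K + K + 1)).toNNReal, LipschitzOnWith.of_dist_le_mul fun s hs t ht => ?_⟩
  have key : ∀ s ∈ Icc 0 T, ∀ t ∈ Icc 0 T, sqDist M s (y s) (x s) - sqDist M t (y t) (x t) ≤
      C * (K + K + 1) * |s - t| := fun s hs t ht => by
    have h1 := h t s ht.1 (ht.2.trans hTR) hs.1 (hs.2.trans hTR) (y t) (y s) (x t) (x s)
      (hy t ht) (hy s hs) (hx t ht) (hx s hs)
    have h2 := hxK t ht s hs
    have h3 := hyK t ht s hs
    have h4 : C * (‖y s - y t‖ + ‖x s - x t‖ + |s - t|) ≤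
        C * (K * |s - t| + K * |s - t| + |s - t|) := by gcongr
    linarith
  rw [Real.coe_toNNReal _ (by positivity), Real.dist_eq, Real.dist_eq, abs_le]
  have h1 := key s hs t ht
  have h2 := key t ht s hs
  rw [abs_sub_comm] at h2
  exact ⟨by linarith, h1⟩

set_option maxHeartbeats 800000 in
/-- Every solution whose input is at almost every time given by some minimal geodesic contracts. -/
theorem IsHoldLaw.sqDist_le (hf : Smooth f) (hB : Smooth B)
    (hM : IsUniformlyBoundedMetric M α₁ α₂) (htar : IsBoundedTarget f B xs us)
    (hw : IsHoldLaw f B M lam xs us w η) (hus : PiecewiseContinuousFrom 0 us) {T : ℝ}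
    {x : ℝ → Vec n} {u : ℝ → Vec m} (hx : SolOn f B x u 0 T)
    (hu : ∀ᵐ t, t ∈ Icc 0 T → ∃ p, IsMinCovector M t (xs t) (x t) p ∧ u t = us t + w t (xs t) p) :
    ∀ t ∈ Icc 0 T, sqDist M t (xs t) (x t) ≤
      Real.exp (-(2 * lam) * t) * sqDist M 0 (xs 0) (x 0) := by
  have hα₂ := hM.pos_upper
  obtain ⟨R₁, hR₁⟩ := hx.exists_bound
  obtain ⟨R₂, hR₂⟩ := (htar.sol T).exists_bound
  obtain ⟨U, hU⟩ := htar.bound T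
  obtain ⟨R, hR⟩ : ∃ R, R = max T (max R₁ R₂) := ⟨_, rfl⟩
  have hTR : T ≤ R := hR ▸ le_max_left _ _
  have hxR : ∀ t ∈ Icc 0 T, ‖x t‖ ≤ R := fun t ht => (hR₁ t ht).trans (hR ▸ by simp)
  have hxsR : ∀ t ∈ Icc 0 T, ‖xs t‖ ≤ R := fun t ht => (hR₂ t ht).trans (hR ▸ by simp)
  obtain ⟨C, hC, hwC⟩ := hw.exists_bound htar (max R (α₂ * (R + R)))
  have huU : ∀ᵐ t, t ∈ Icc 0 T → ‖u t‖ ≤ |U| + C := by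
    filter_upwards [hu] with t ht htI
    obtain ⟨p, hp, hup⟩ := ht htI
    rw [hup]
    refine (norm_add_le _ _).trans (add_le_add ((hU t htI).trans (le_abs_self U))
      (hwC t p htI.1 ((htI.2.trans hTR).trans (le_max_left _ _)) (le_trans ?_ (le_max_right _ _))))
    refine (hp.norm_le hM htI.1).trans ?_
    gcongr
    exact (norm_sub_le _ _).trans (add_le_add (hxR t htI) (hxsR t htI))
  obtain ⟨K, hK, hlip⟩ := SolOn.norm_sub_le_of_bound hf hB R (|U| + C)
  have hxK := hlip x u 0 T le_rfl hTR hx hxR huU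
  have hxsK := hlip xs us 0 T le_rfl hTR (htar.sol T) hxsR (Eventually.of_forall fun t ht =>
    (hU t ht).trans ((le_abs_self U).trans (by linarith)))
  obtain ⟨L, hL⟩ := lipschitzOnWith_sqDist hM hTR hK.le hxR hxsR hxK hxsK
  intro τ hτ
  have hmain := exp_decay_of_ae_deriv (g := fun t => sqDist M t (xs t) (x t)) (c := 2 * lam) hτ.1
    (hL.mono (Icc_subset_Icc_right hτ.2)) ?_
  · rwa [sub_zero] at hmain
  filter_upwards [hx.ae_hasDerivAt hf hB le_rfl, hu, hus.ae_continuousWithinAt] with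
    t hxt hut hct ht d hd
  have htT : t ∈ Ioo 0 T := ⟨ht.1, ht.2.trans_le hτ.2⟩
  have ht0 : 0 ≤ t := ht.1.le
  obtain ⟨p, hp, hup⟩ := hut (Ioo_subset_Icc_self htT)
  have hpos := hw.step_pos (t + ‖p‖)
  have htb : t ≤ t + η (t + ‖p‖) := by linarith
  -- The solution held from time `t` has the same state and right velocity as `x`, so `|x - y| = o(s
  -- - t)`. By Lipschitz continuity of the squared distance, the decay of `y` bounds the derivative
  -- along `x` at this time.
  obtain ⟨y, hy0, hy⟩ := hw.exists_sol _ t p ht0 le_rfl _ htb le_rfl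
  have hdec := hw.decay _ t p ht0 le_rfl _ htb le_rfl y hy0 hy
  rw [hp.2] at hdec
  have hyx : y t = x t := hy0.trans hp.1
  have hyd := hy.hasDerivWithinAt_left hf hB ht0 (by linarith)
    (((hct ht0).mono (Ici_subset_Ici.2 ht0)).add continuousWithinAt_const)
  rw [hyx, ← hup] at hyd
  have hxy := ((hxt htT).hasDerivWithinAt (s := Ici t)).sub hyd
  rw [sub_self] at hxy
  have hn : HasDerivWithinAt (fun s => ‖x s - y s‖) 0 (Ici t) t := by
    rw [hasDerivWithinAt_iff_isLittleO] at hxy ⊢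
    simp only [Pi.sub_apply, hyx, sub_self, sub_zero, smul_zero, norm_zero] at hxy ⊢
    exact hxy.norm_left
  obtain ⟨C₁, hC₁, hsq⟩ := sqDist_lipschitz hM (R + 1)
  have hexp : HasDerivWithinAt (fun s => Real.exp (-(2 * lam) * (s - t)) *
      sqDist M t (xs t) (x t) + C₁ * ‖x s - y s‖)
      (-(2 * lam) * sqDist M t (xs t) (x t)) (Ici t) t := by
    have e1 : HasDerivAt (fun s => Real.exp (-(2 * lam) * (s - t))) (-(2 * lam)) t := by
      simpa using (((hasDerivAt_id t).sub_const t).const_mul (-(2 * lam))).exp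
    have e2 := (e1.hasDerivWithinAt (s := Ici t)).mul_const (sqDist M t (xs t) (x t))
    have e3 := e2.add (hn.const_mul C₁)
    rw [mul_zero, add_zero] at e3
    exact e3
  refine HasDerivAt.le_of_eventually_le hd hexp (by simp [hyx]) ?_
  have hyc : ∀ᶠ s in 𝓝[>] t, ‖y s‖ ≤ R + 1 := by
    have h1 : Tendsto y (𝓝[>] t) (𝓝 (y t)) :=
      (hyd.continuousWithinAt.mono Ioi_subset_Ici_self)
    refine h1.norm.eventually (eventually_le_nhds ?_)
    rw [hyx]
    linarith [hxR t (Ioo_subset_Icc_self htT)]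
  filter_upwards [hyc, Ioo_mem_nhdsGT (show t < t + η (t + ‖p‖) by linarith),
    Ioo_mem_nhdsGT htT.2] with s hs1 hs2 hs3
  have hsT : s ∈ Icc 0 T := ⟨ht0.trans hs3.1.le, hs3.2.le⟩
  have h1 := hsq s s hsT.1 (by linarith [hsT.2]) hsT.1 (by linarith [hsT.2]) (xs s) (xs s) (y s)
    (x s) (by linarith [hxsR s hsT]) (by linarith [hxsR s hsT]) hs1 (by linarith [hxR s hsT])
  rw [sub_self, sub_self, norm_zero, abs_zero, zero_add, add_zero] at h1
  linarith [hdec s (Ioo_subset_Icc_self hs2)]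

end

end CCM

namespace CCM

noncomputable section

variable {n m : ℕ} {f : Vec n → ℝ → Vec n} {B : Vec n → ℝ → Vec m →L[ℝ] Vec n}
  {M : Vec n → ℝ → Vec n →L[ℝ] Vec n} {α₁ α₂ lam : ℝ} {xs : ℝ → Vec n} {us : ℝ → Vec m}
  {w : ℝ → Vec n → Vec n → Vec m} {η : ℝ → ℝ}

/-! ### Limits of sampled solutions -/

/-- Each minimal geodesic gives a limit value of the feedback law. -/
theorem IsHoldLaw.mem_limitValues (hM : IsUniformlyBoundedMetric M α₁ α₂)
    (htar : IsBoundedTarget f B xs us) (hw : IsHoldLaw f B M lam xs us w η) {t : ℝ} (ht : 0 ≤ t)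
    {x p : Vec n} (hp : IsMinCovector M t (xs t) x p) :
    us t + w t (xs t) p ∈ limitValues (regularDomain M xs)
      (fun y s => geodesicFeedback M xs w y s (us s)) x t := by
  refine mem_iInter₂.2 fun ε hε => ?_
  -- The end point may have several minimal covectors, but an interior point of the geodesic has
  -- only `s • p`, and the law is close to its value there at all nearby points. Among these are
  -- regular ones, since a set of full measure is dense; then `s` tends to 1.
  have hIoo : ∀ᶠ s in 𝓝[<] (1 : ℝ), s ∈ Ioo (0 : ℝ) 1 := Ioo_mem_nhdsLT zero_lt_one
  have hsp : Tendsto (fun s : ℝ => s • p) (𝓝[<] 1) (𝓝 p) := by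
    have : Continuous fun s : ℝ => s • p := by fun_prop
    simpa using (this.tendsto 1).mono_left nhdsWithin_le_nhds
  have hwt : Tendsto (fun s : ℝ => us t + w t (xs t) (s • p)) (𝓝[<] 1)
      (𝓝 (us t + w t (xs t) p)) :=
    tendsto_const_nhds.add (hw.tendsto htar (t := fun _ => t) ht tendsto_const_nhds
      (Eventually.of_forall fun _ => ht) hsp)
  have hγ : Tendsto (fun s => (cogeod M t (xs t) p s).1) (𝓝[<] 1) (𝓝 x) := by
    have h1 := (isCogeodesic_cogeod hM ht (xs t) p).continuousOn.fst 1 ⟨zero_le_one, le_rfl⟩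
    have h2 : (cogeod M t (xs t) p 1).1 = x := hp.1
    rw [ContinuousWithinAt, h2] at h1
    refine h1.mono_left (nhdsWithin_le_iff.2 ?_)
    filter_upwards [hIoo] with s hs using Ioo_subset_Icc_self hs
  refine isClosed_closure.mem_of_tendsto hwt ?_
  filter_upwards [hIoo, hγ.eventually (Metric.ball_mem_nhds x hε)] with s hs hsε
  have huniq : ∀ q, IsMinCovector M t (xs t) (cogeod M t (xs t) p s).1 q → q = s • p :=
    fun q hq => hp.eq_smul hM ht hs hq
  have hmin : Tendsto (fun y => minCovector M t (xs t) y) (𝓝 (cogeod M t (xs t) p s).1)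
      (𝓝 (s • p)) := by
    rw [Metric.tendsto_nhds]
    intro e he
    have h1 := IsMinCovector.eventually_near hM (l := 𝓝 (cogeod M t (xs t) p s).1)
      (t := fun _ => t) (b := fun _ => xs t) (x := id) ht (Eventually.of_forall fun _ => ht)
      tendsto_const_nhds tendsto_const_nhds tendsto_id huniq he
    filter_upwards [h1] with y hy
    rw [dist_eq_norm]
    exact hy _ (isMinCovector_minCovector hM ht _ _)
  have hK : Tendsto (fun y => geodesicFeedback M xs w y t (us t))
      (𝓝 (cogeod M t (xs t) p s).1) (𝓝 (us t + w t (xs t) (s • p))) :=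
    tendsto_const_nhds.add (hw.tendsto htar (t := fun _ => t) ht tendsto_const_nhds
      (Eventually.of_forall fun _ => ht) hmin)
  have hdense : Dense {y : Vec n | IsRegularPoint M t (xs t) y} := by
    refine Measure.dense_of_ae (μ := volume) ?_
    have := volume_not_isRegularPoint hM ht (xs t)
    exact measure_eq_zero_iff_ae_notMem.1 this |>.mono fun y hy => not_not.1 hy
  refine mem_closure_iff_nhds.2 fun N hN => ?_
  obtain ⟨y, hy, hyN, hyε⟩ := hdense.inter_nhds_nonempty
    (inter_mem (hK hN) (Metric.isOpen_ball.mem_nhds hsε))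
  exact ⟨_, hyN, y, ⟨hyε, ht, hy⟩, rfl⟩

/-- Inputs of the law near `(x, t)` are close to values given by minimal geodesics to `x`. -/
theorem IsHoldLaw.exists_near (hM : IsUniformlyBoundedMetric M α₁ α₂)
    (htar : IsBoundedTarget f B xs us) (hw : IsHoldLaw f B M lam xs us w η) {t : ℝ} (ht : 0 ≤ t)
    (x : Vec n) {δ : ℝ} (hδ : 0 < δ) :
    ∃ ρ, 0 < ρ ∧ ∀ s y p, 0 ≤ s → |s - t| < ρ → ‖y - x‖ < ρ → IsMinCovector M s (xs s) y p →
      ∃ q, IsMinCovector M t (xs t) x q ∧ ‖w s (xs s) p - w t (xs t) q‖ < δ := by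
  by_contra hcon
  push Not at hcon
  have hα₂ := hM.pos_upper
  choose s y p hs hst hyx hp hq using fun k : ℕ => hcon (1 / ((k : ℝ) + 1)) (by positivity)
  have hlim := tendsto_one_div_add_atTop_nhds_zero_nat (𝕜 := ℝ)
  have hst' : Tendsto s atTop (𝓝 t) := tendsto_iff_dist_tendsto_zero.2
    (squeeze_zero (fun _ => dist_nonneg) (fun k => (hst k).le) hlim)
  have hyx' : Tendsto y atTop (𝓝 x) := tendsto_iff_norm_sub_tendsto_zero.2
    (squeeze_zero (fun _ => norm_nonneg _) (fun k => (hyx k).le) hlim)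
  have hs' : ∀ᶠ k in atTop, 0 ≤ s k := Eventually.of_forall hs
  have hb := htar.tendsto ht hst' hs'
  obtain ⟨R, hR⟩ := (((hyx'.sub hb).norm.const_mul α₂).bddAbove_range)
  have hpR : ∀ k, p k ∈ Metric.closedBall (0 : Vec n) R := fun k => by
    rw [mem_closedBall_zero_iff]
    exact ((hp k).norm_le hM (hs k)).trans (hR ⟨k, rfl⟩)
  obtain ⟨q, -, φ, hφ, hpq⟩ := (isCompact_closedBall _ _).tendsto_subseq hpR
  have hφt := hφ.tendsto_atTop
  have hmin : IsMinCovector M t (xs t) x q := IsMinCovector.of_tendsto hM ht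
    (hφt.eventually hs') (hst'.comp hφt) (hb.comp hφt) (hyx'.comp hφt) hpq
    (Eventually.of_forall fun k => hp (φ k))
  have hwt := hw.tendsto htar ht (hst'.comp hφt) (hφt.eventually hs') hpq
  have h1 := (hwt.sub_const (w t (xs t) q)).norm
  rw [sub_self, norm_zero] at h1
  exact absurd (ge_of_tendsto h1 (Eventually.of_forall fun k => hq (φ k) q hmin)) (not_le.2 hδ)

theorem exists_tendsto_of_norm_le {k : ℕ} {U : Ultrafilter ℕ} {u : ℕ → Vec k} {R : ℝ}
    (h : ∀ i, ‖u i‖ ≤ R) : ∃ y, Tendsto u U (𝓝 y) := by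
  obtain ⟨y, -, hy⟩ := (isCompact_closedBall (0 : Vec k) R).ultrafilter_le_nhds (U.map u)
    (tendsto_principal.2 (Eventually.of_forall fun i => mem_closedBall_zero_iff.2 (h i)))
  exact ⟨y, hy⟩

theorem smul_integral_mem {k : ℕ} {C : Set (Vec k)} (hC : Convex ℝ C) (hcl : IsClosed C) {a b : ℝ}
    (hab : a < b) {v : ℝ → Vec k} (hv : IntegrableOn v (Icc a b)) (h : ∀ s ∈ Icc a b, v s ∈ C) :
    (b - a)⁻¹ • ∫ s in a..b, v s ∈ C := by
  have h1 := hC.set_average_mem hcl (μ := volume) (t := Ioc a b) (f := v)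
    (by rw [Real.volume_Ioc]; simpa using hab) (by rw [Real.volume_Ioc]; simp)
    ((ae_restrict_iff' measurableSet_Ioc).2 (Eventually.of_forall fun s hs =>
      h s (Ioc_subset_Icc_self hs))) (hv.mono_set Ioc_subset_Icc_self)
  rwa [← uIoc_of_le hab.le, interval_average_eq] at h1

/-- A Lipschitz curve whose right derivative is almost everywhere `0` is constant. -/
theorem eq_of_ae_hasDerivWithinAt_zero {x : ℝ → Vec n} {a b K : ℝ} (hab : a ≤ b) (hK : 0 ≤ K)
    (hx : ∀ s ∈ Icc a b, ∀ t ∈ Icc a b, ‖x t - x s‖ ≤ K * |t - s|)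
    (hd : ∀ᵐ t, t ∈ Ioo a b → HasDerivWithinAt x 0 (Ici t) t) : x b = x a := by
  have key : ∀ e : Vec n, ⟪e, x b⟫_ℝ ≤ ⟪e, x a⟫_ℝ := by
    intro e
    have := exp_decay_of_ae_deriv (g := fun t => ⟪e, x t⟫_ℝ) (c := 0)
      (K := (‖e‖ * K).toNNReal) hab ?_ ?_
    · simpa using this
    · refine LipschitzOnWith.of_dist_le_mul fun s hs t ht => ?_
      rw [Real.coe_toNNReal _ (by positivity), Real.dist_eq, Real.dist_eq, ← inner_sub_right]
      refine (abs_real_inner_le_norm _ _).trans ?_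
      rw [mul_assoc]
      gcongr
      exact hx t ht s hs
    · filter_upwards [hd] with t ht htI d hgd
      have h1 : HasDerivWithinAt (fun t => ⟪e, x t⟫_ℝ) 0 (Ici t) t := by
        simpa using (hasDerivWithinAt_const t (Ici t) e).inner ℝ (ht htI)
      have h2 := (uniqueDiffOn_Ici t t self_mem_Ici).eq_deriv _ (hgd.hasDerivWithinAt (s := Ici t)) h1
      rw [h2]; simp
  have h := key (x b - x a)
  rw [← sub_nonpos, ← inner_sub_right, real_inner_self_eq_norm_sq] at h
  exact sub_eq_zero.1 (norm_eq_zero.1 (pow_eq_zero_iff two_ne_zero |>.1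
    (le_antisymm h (sq_nonneg _))))

end

end CCM

/-! ### Sampled sequences and the velocity of their limits. -/

namespace CCM

noncomputable section

variable {n m : ℕ} {f : Vec n → ℝ → Vec n} {B : Vec n → ℝ → Vec m →L[ℝ] Vec n}
  {M : Vec n → ℝ → Vec n →L[ℝ] Vec n} {α₁ α₂ lam : ℝ} {xs : ℝ → Vec n} {us : ℝ → Vec m}
  {w : ℝ → Vec n → Vec n → Vec m} {η : ℝ → ℝ}

/-- First-order expansion of solutions with frozen coefficients. -/
theorem SolOn.exists_expansion (hf : Smooth f) (hB : Smooth B) (R U K : ℝ) (hK : 0 ≤ K) :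
    ∃ C, 0 < C ∧ ∀ (z : ℝ → Vec n) (u v : ℝ → Vec m) (y : Vec n) (t τ : ℝ), 0 ≤ t → t ≤ τ → τ ≤ R →
      SolOn f B z (fun s => u s + v s) t τ → IntegrableOn u (Icc t τ) → IntegrableOn v (Icc t τ) →
      (∀ s ∈ Icc t τ, ‖z s‖ ≤ R) → ‖y‖ ≤ R → (∀ s ∈ Icc t τ, ‖u s + v s‖ ≤ U) →
      (∀ s ∈ Icc t τ, ‖z s - z t‖ ≤ K * |s - t|) →
      ‖z τ - z t - ((τ - t) • f y t + B y t (∫ s in t..τ, u s) + B y t (∫ s in t..τ, v s))‖ ≤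
        C * (‖z t - y‖ + (τ - t)) * (τ - t) := by
  obtain ⟨C₁, hC₁, h₁⟩ := SmoothHalf.bounded_lipschitz (F := f) hf R
  obtain ⟨C₂, hC₂, h₂⟩ := SmoothHalf.bounded_lipschitz (F := B) hB R
  refine ⟨(C₁ + C₂ * |U|) * (K + 1), by positivity,
    fun z u v y t τ ht htτ hτR hz hu hv hzR hyR huU hzK => ?_⟩
  have ht' : t ∈ Icc t τ := ⟨le_rfl, htτ⟩
  have hτ' : τ ∈ Icc t τ := ⟨htτ, le_rfl⟩
  have iu : IntervalIntegrable u volume t τ :=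
    (intervalIntegrable_iff_integrableOn_Icc_of_le htτ).2 hu
  have iv : IntervalIntegrable v volume t τ :=
    (intervalIntegrable_iff_integrableOn_Icc_of_le htτ).2 hv
  have iBu := (B y t).integrable_comp hu
  have iBv := (B y t).integrable_comp hv
  have iBu' : IntervalIntegrable (fun s => B y t (u s)) volume t τ :=
    (intervalIntegrable_iff_integrableOn_Icc_of_le htτ).2 iBu
  have iBv' : IntervalIntegrable (fun s => B y t (v s)) volume t τ :=
    (intervalIntegrable_iff_integrableOn_Icc_of_le htτ).2 iBv
  have e : z τ - z t - ((τ - t) • f y t + B y t (∫ s in t..τ, u s) + B y t (∫ s in t..τ, v s)) =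
      ∫ s in t..τ, ((f (z s) s + B (z s) s (u s + v s)) -
        (f y t + B y t (u s) + B y t (v s))) := by
    rw [intervalIntegral.integral_sub (hz.intervalIntegrable hf hB ht ht' hτ')
      ((intervalIntegrable_const.add iBu').add iBv'),
      intervalIntegral.integral_add (intervalIntegrable_const.add iBu') iBv',
      intervalIntegral.integral_add intervalIntegrable_const iBu', intervalIntegral.integral_const,
      ← hz.sub_eq hf hB ht ht' hτ', (B y t).intervalIntegral_comp_comm iu,
      (B y t).intervalIntegral_comp_comm iv]
  rw [e]
  refine (intervalIntegral.norm_integral_le_of_norm_le_const (C := (C₁ + C₂ * |U|) * (K + 1) *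
    (‖z t - y‖ + (τ - t))) fun s hs => ?_).trans (le_of_eq ?_)
  · rw [uIoc_of_le htτ] at hs
    have hs' : s ∈ Icc t τ := Ioc_subset_Icc_self hs
    have hs0 : 0 ≤ s := ht.trans hs.1.le
    have g1 := (h₁ (z s) y s t (hzR s hs') hyR hs0 (hs.2.trans hτR) ht (htτ.trans hτR)).2
    have g2 := (h₂ (z s) y s t (hzR s hs') hyR hs0 (hs.2.trans hτR) ht (htτ.trans hτR)).2
    have hst : |s - t| ≤ τ - t := by
      rw [abs_of_nonneg (by linarith [hs.1])]; linarith [hs.2]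
    have g3 : ‖z s - y‖ + |s - t| ≤ (K + 1) * (‖z t - y‖ + (τ - t)) := by
      have a1 := norm_add_le (z s - z t) (z t - y)
      rw [sub_add_sub_cancel] at a1
      have a2 := hzK s hs'
      have a3 : K * |s - t| ≤ K * (τ - t) := by gcongr
      have a4 : 0 ≤ K * ‖z t - y‖ := by positivity
      linarith
    have e2 : (f (z s) s + B (z s) s (u s + v s)) - (f y t + B y t (u s) + B y t (v s)) =
        (f (z s) s - f y t) + (B (z s) s - B y t) (u s + v s) := by
      rw [_root_.sub_apply, map_add (B y t)]; abel
    rw [e2]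
    refine (norm_add_le _ _).trans ?_
    have g4 := ((B (z s) s - B y t).le_opNorm (u s + v s)).trans
      (mul_le_mul g2 ((huU s hs').trans (le_abs_self U)) (norm_nonneg _) (by positivity))
    calc _ ≤ C₁ * (‖z s - y‖ + |s - t|) + C₂ * (‖z s - y‖ + |s - t|) * |U| := add_le_add g1 g4
      _ = (C₁ + C₂ * |U|) * (‖z s - y‖ + |s - t|) := by ring
      _ ≤ (C₁ + C₂ * |U|) * ((K + 1) * (‖z t - y‖ + (τ - t))) := by gcongr
      _ = _ := by ring
  · rw [abs_of_nonneg (sub_nonneg.2 htτ)]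

/-- Solutions sampled at mesh tending to zero. -/
structure IsSampledSequence (f : Vec n → ℝ → Vec n) (B : Vec n → ℝ → Vec m →L[ℝ] Vec n)
    (M : Vec n → ℝ → Vec n →L[ℝ] Vec n) (xs : ℝ → Vec n) (us : ℝ → Vec m)
    (w : ℝ → Vec n → Vec n → Vec m) (z : ℕ → ℝ → Vec n) (v : ℕ → ℝ → Vec m) : Prop where
  sol : ∀ (k : ℕ) (T : ℝ), SolOn f B (z k) (fun t => us t + v k t) 0 T
  bounded : ∀ T, ∃ R, ∀ k, ∀ t ∈ Icc (0 : ℝ) T, ‖z k t‖ ≤ R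
  sampled : ∀ (k : ℕ) (t : ℝ), 0 ≤ t → ∃ s ∈ Icc 0 t, t ≤ s + 1 / ((k : ℝ) + 1) ∧
    ∃ p, IsMinCovector M s (xs s) (z k s) p ∧ v k t = w s (xs s) p

variable {z : ℕ → ℝ → Vec n} {v : ℕ → ℝ → Vec m}

theorem IsSampledSequence.integrableOn (h : IsSampledSequence f B M xs us w z v)
    (htar : IsBoundedTarget f B xs us) (k : ℕ) (T : ℝ) : IntegrableOn (v k) (Icc 0 T) := by
  have := (h.sol k T).integrable.sub (htar.sol T).integrable
  exact this.congr (Eventually.of_forall fun t => by simp)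

theorem IsSampledSequence.exists_bounds (hf : Smooth f) (hB : Smooth B)
    (hM : IsUniformlyBoundedMetric M α₁ α₂) (htar : IsBoundedTarget f B xs us)
    (hw : IsHoldLaw f B M lam xs us w η) (h : IsSampledSequence f B M xs us w z v) (T : ℝ) :
    ∃ R U K, 0 ≤ U ∧ 0 ≤ K ∧ T ≤ R ∧ ∀ k, (∀ t ∈ Icc 0 T, ‖z k t‖ ≤ R) ∧
      (∀ t ∈ Icc 0 T, ‖v k t‖ ≤ U) ∧ (∀ t ∈ Icc 0 T, ‖us t + v k t‖ ≤ U) ∧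
      ∀ s ∈ Icc 0 T, ∀ t ∈ Icc 0 T, ‖z k t - z k s‖ ≤ K * |t - s| := by
  have hα₂ := hM.pos_upper
  obtain ⟨R₁, hR₁⟩ := h.bounded T
  obtain ⟨R₂, hR₂⟩ := (htar.sol T).exists_bound
  obtain ⟨U, hU⟩ := htar.bound T
  obtain ⟨R, hR⟩ : ∃ R, R = max T (max R₁ R₂) := ⟨_, rfl⟩
  have hTR : T ≤ R := hR ▸ le_max_left _ _
  have hzR : ∀ k, ∀ t ∈ Icc 0 T, ‖z k t‖ ≤ R := fun k t ht => (hR₁ k t ht).trans (hR ▸ by simp)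
  have hxsR : ∀ t ∈ Icc 0 T, ‖xs t‖ ≤ R := fun t ht => (hR₂ t ht).trans (hR ▸ by simp)
  obtain ⟨C, hC, hwC⟩ := hw.exists_bound htar (max R (α₂ * (R + R)))
  have hvC : ∀ k, ∀ t ∈ Icc 0 T, ‖v k t‖ ≤ C := fun k t ht => by
    obtain ⟨s, hs, -, p, hp, hvp⟩ := h.sampled k t ht.1
    have hsT : s ∈ Icc 0 T := ⟨hs.1, hs.2.trans ht.2⟩
    rw [hvp]
    refine hwC s p hs.1 ((hsT.2.trans hTR).trans (le_max_left _ _)) (le_trans ?_ (le_max_right _ _))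
    refine (hp.norm_le hM hs.1).trans ?_
    gcongr
    exact (norm_sub_le _ _).trans (add_le_add (hzR k s hsT) (hxsR s hsT))
  have huC : ∀ k, ∀ t ∈ Icc 0 T, ‖us t + v k t‖ ≤ |U| + C := fun k t ht =>
    (norm_add_le _ _).trans (add_le_add ((hU t ht).trans (le_abs_self U)) (hvC k t ht))
  obtain ⟨K, hK, hlip⟩ := SolOn.norm_sub_le_of_bound hf hB R (|U| + C)
  exact ⟨R, |U| + C, K, by positivity, hK.le, hTR, fun k => ⟨hzR k,
    fun t ht => (hvC k t ht).trans (by linarith [abs_nonneg U]), huC k,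
    hlip _ _ 0 T le_rfl hTR (h.sol k T) (hzR k) (Eventually.of_forall (huC k))⟩⟩

/-- Limits of states and of accumulated offsets of a sampled sequence. -/
structure IsSampledLimit (𝒰 : Ultrafilter ℕ) (z : ℕ → ℝ → Vec n) (v : ℕ → ℝ → Vec m)
    (x : ℝ → Vec n) (W : ℝ → Vec m) : Prop where
  le_atTop : (𝒰 : Filter ℕ) ≤ atTop
  state : ∀ t, 0 ≤ t → Tendsto (fun k => z k t) 𝒰 (𝓝 (x t))
  offset : ∀ t, 0 ≤ t → Tendsto (fun k => ∫ s in (0 : ℝ)..t, v k s) 𝒰 (𝓝 (W t))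

variable {𝒰 : Ultrafilter ℕ} {x : ℝ → Vec n} {W : ℝ → Vec m}

/-- A single nonprincipal ultrafilter provides limits of states and accumulated offsets at all times
at once, without a diagonal argument. -/
theorem IsSampledSequence.exists_limit (hf : Smooth f) (hB : Smooth B)
    (hM : IsUniformlyBoundedMetric M α₁ α₂) (htar : IsBoundedTarget f B xs us)
    (hw : IsHoldLaw f B M lam xs us w η) (h : IsSampledSequence f B M xs us w z v) :
    ∃ 𝒰 x W, IsSampledLimit 𝒰 z v x W := by
  have key : ∀ t, 0 ≤ t → ∃ y Y, Tendsto (fun k => z k t) (hyperfilter ℕ) (𝓝 y) ∧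
      Tendsto (fun k => ∫ s in (0 : ℝ)..t, v k s) (hyperfilter ℕ) (𝓝 Y) := by
    intro t ht
    obtain ⟨R, U, K, hU, -, -, hb⟩ := h.exists_bounds hf hB hM htar hw t
    obtain ⟨y, hy⟩ := exists_tendsto_of_norm_le (U := hyperfilter ℕ)
      fun k => (hb k).1 t ⟨ht, le_rfl⟩
    obtain ⟨Y, hY⟩ := exists_tendsto_of_norm_le (U := hyperfilter ℕ) (R := U * |t - 0|)
      fun k => intervalIntegral.norm_integral_le_of_norm_le_const (a := 0) (b := t) (f := v k)
        fun s hs => (hb k).2.1 s (by rw [uIoc_of_le ht] at hs; exact Ioc_subset_Icc_self hs)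
    exact ⟨y, Y, hy, hY⟩
  choose! x W hx hW using key
  exact ⟨hyperfilter ℕ, x, W, Nat.hyperfilter_le_atTop, hx, hW⟩

theorem IsSampledLimit.tendsto_integral (hl : IsSampledLimit 𝒰 z v x W)
    (h : IsSampledSequence f B M xs us w z v) (htar : IsBoundedTarget f B xs us) {t τ : ℝ}
    (ht : 0 ≤ t) (htτ : t ≤ τ) : Tendsto (fun k => ∫ s in t..τ, v k s) 𝒰 (𝓝 (W τ - W t)) := by
  refine ((hl.offset τ (ht.trans htτ)).sub (hl.offset t ht)).congr fun k => ?_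
  have hi : ∀ r, 0 ≤ r → r ≤ τ → IntervalIntegrable (v k) volume 0 r := fun r hr hrτ =>
    (intervalIntegrable_iff_integrableOn_Icc_of_le hr).2 (h.integrableOn htar k r)
  exact intervalIntegral.integral_interval_sub_left (hi τ (ht.trans htτ) le_rfl) (hi t ht htτ)

theorem IsSampledLimit.lipschitz (hf : Smooth f) (hB : Smooth B)
    (hM : IsUniformlyBoundedMetric M α₁ α₂) (htar : IsBoundedTarget f B xs us)
    (hw : IsHoldLaw f B M lam xs us w η) (h : IsSampledSequence f B M xs us w z v)
    (hl : IsSampledLimit 𝒰 z v x W) (T : ℝ) : ∃ R K, 0 ≤ K ∧ T ≤ R ∧ (∀ t ∈ Icc 0 T, ‖x t‖ ≤ R) ∧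
      (∀ s ∈ Icc 0 T, ∀ t ∈ Icc 0 T, ‖x t - x s‖ ≤ K * |t - s|) ∧
      ∀ s ∈ Icc 0 T, ∀ t ∈ Icc 0 T, ‖W t - W s‖ ≤ K * |t - s| := by
  obtain ⟨R, U, K, hU, hK, hTR, hb⟩ := h.exists_bounds hf hB hM htar hw T
  refine ⟨R, max U K, hK.trans (le_max_right _ _), hTR, fun t ht => ?_, fun s hs t ht => ?_, ?_⟩
  · exact le_of_tendsto (hl.state t ht.1).norm (Eventually.of_forall fun k => (hb k).1 t ht)
  · refine (le_of_tendsto ((hl.state t ht.1).sub (hl.state s hs.1)).norm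
      (Eventually.of_forall fun k => (hb k).2.2.2 s hs t ht)).trans ?_
    gcongr
    exact le_max_right _ _
  · have key : ∀ s ∈ Icc 0 T, ∀ t ∈ Icc 0 T, s ≤ t → ‖W t - W s‖ ≤ max U K * |t - s| := by
      intro s hs t ht hst
      refine le_of_tendsto (hl.tendsto_integral h htar hs.1 hst).norm
        (Eventually.of_forall fun k => ?_)
      refine (intervalIntegral.norm_integral_le_of_norm_le_const (C := U) fun r hr => ?_).trans ?_
      · rw [uIoc_of_le hst] at hr
        exact (hb k).2.1 r ⟨hs.1.trans hr.1.le, hr.2.trans ht.2⟩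
      · gcongr
        exact le_max_left _ _
    intro s hs t ht
    rcases le_total s t with hst | hst
    · exact key s hs t ht hst
    · rw [norm_sub_rev, abs_sub_comm]; exact key t ht s hs hst

/-- The limit solves the system at each time where its offset is differentiable. -/
theorem IsSampledLimit.hasDerivWithinAt (hf : Smooth f) (hB : Smooth B)
    (hM : IsUniformlyBoundedMetric M α₁ α₂) (htar : IsBoundedTarget f B xs us)
    (hw : IsHoldLaw f B M lam xs us w η) (h : IsSampledSequence f B M xs us w z v)
    (hl : IsSampledLimit 𝒰 z v x W) {t : ℝ} (ht : 0 ≤ t) {d : Vec m}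
    (hW : HasDerivWithinAt W d (Ici t) t) (hus : ContinuousWithinAt us (Ici t) t) :
    HasDerivWithinAt x (f (x t) t + B (x t) t (us t + d)) (Ici t) t := by
  obtain ⟨R, U, K, hU, hK, hTR, hb⟩ := h.exists_bounds hf hB hM htar hw (t + 1)
  obtain ⟨C, hC, hexp⟩ := SolOn.exists_expansion hf hB R U K hK
  have htT : t ∈ Icc 0 (t + 1) := ⟨ht, by linarith⟩
  have hxR : ‖x t‖ ≤ R :=
    le_of_tendsto (hl.state t ht).norm (Eventually.of_forall fun k => (hb k).1 t htT)
  -- With coefficients frozen at `(x t, t)` the offsets enter only through their integrals. The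
  -- expansion therefore passes to the limit although the offsets themselves need not converge, with
  -- error `O((τ - t)²)`.
  obtain ⟨φ, hφ⟩ : ∃ φ : ℝ → Vec n, φ = fun τ => (τ - t) • f (x t) t +
      B (x t) t (∫ s in t..τ, us s) + B (x t) t (W τ - W t) := ⟨_, rfl⟩
  have hest : ∀ τ ∈ Icc t (t + 1), ‖x τ - x t - φ τ‖ ≤ C * (τ - t) * (τ - t) := by
    intro τ hτ
    have hsub : Icc t τ ⊆ Icc 0 (t + 1) := Icc_subset_Icc ht hτ.2
    have h1 : ∀ k, ‖z k τ - z k t - ((τ - t) • f (x t) t + B (x t) t (∫ s in t..τ, us s) +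
        B (x t) t (∫ s in t..τ, v k s))‖ ≤ C * (‖z k t - x t‖ + (τ - t)) * (τ - t) := fun k =>
      hexp (z k) us (v k) (x t) t τ ht hτ.1 (hτ.2.trans hTR)
        ((h.sol k (t + 1)).restrict hf hB le_rfl ht hτ.2)
        ((htar.sol (t + 1)).integrable.mono_set hsub)
        ((h.integrableOn htar k (t + 1)).mono_set hsub) (fun s hs => (hb k).1 s (hsub hs)) hxR
        (fun s hs => (hb k).2.2.1 s (hsub hs))
        (fun s hs => (hb k).2.2.2 t htT s (hsub hs))
    have h2 := hl.state τ (ht.trans hτ.1)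
    have h3 := hl.state t ht
    have h4 := ((B (x t) t).continuous.tendsto _).comp (hl.tendsto_integral h htar ht hτ.1)
    have h5 := ((h2.sub h3).sub (h4.const_add ((τ - t) • f (x t) t +
      B (x t) t (∫ s in t..τ, us s)))).norm
    have h6 : Tendsto (fun k => C * (‖z k t - x t‖ + (τ - t)) * (τ - t)) 𝒰
        (𝓝 (C * (‖x t - x t‖ + (τ - t)) * (τ - t))) :=
      (((h3.sub_const (x t)).norm.add_const (τ - t)).const_mul C).mul_const (τ - t)
    rw [sub_self, norm_zero, zero_add] at h6
    rw [hφ]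
    exact le_of_tendsto_of_tendsto' h5 h6 h1
  have hφd : HasDerivWithinAt φ (f (x t) t + B (x t) t (us t) + B (x t) t d) (Ici t) t := by
    have hint := (htar.sol (t + 1)).integrable.mono_set (Icc_subset_Icc_left ht)
    have g1 := intervalIntegral.integral_hasDerivWithinAt_right (s := Ici t) (t := Ioi t)
      (f := us) (a := t) (b := t) (by simp)
      ⟨Icc t (t + 1), Icc_mem_nhdsGT (by linarith), hint.aestronglyMeasurable⟩
      (hus.mono Ioi_subset_Ici_self)
    have g2 : HasDerivWithinAt (fun τ => (τ - t) • f (x t) t) (f (x t) t) (Ici t) t := by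
      simpa using (((hasDerivWithinAt_id t (Ici t)).sub_const t).smul_const (f (x t) t))
    rw [hφ]
    exact (g2.add ((B (x t) t).hasFDerivAt.comp_hasDerivWithinAt t g1)).add
      ((B (x t) t).hasFDerivAt.comp_hasDerivWithinAt t (hW.sub_const (W t)))
  have hφ0 : φ t = 0 := by rw [hφ]; simp
  have hdiff : HasDerivWithinAt (fun τ => x τ - x t - φ τ) 0 (Ici t) t := by
    rw [hasDerivWithinAt_iff_isLittleO]
    simp only [sub_self, hφ0, sub_zero, smul_zero]
    refine Asymptotics.IsLittleO.of_bound fun c hc => ?_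
    have hpos : t < t + min 1 (c / C) := by
      have : 0 < min 1 (c / C) := by positivity
      linarith
    filter_upwards [self_mem_nhdsWithin, mem_nhdsWithin_of_mem_nhds (Iio_mem_nhds hpos)]
      with τ h1 h2
    have h0 : 0 ≤ τ - t := sub_nonneg.2 h1
    have h2' : τ < t + min 1 (c / C) := h2
    have h3 := min_le_left 1 (c / C)
    have h4 := min_le_right 1 (c / C)
    have h5 : τ - t ≤ c / C := by linarith
    rw [le_div_iff₀ hC] at h5
    refine (hest τ ⟨h1, by linarith⟩).trans ?_
    rw [Real.norm_of_nonneg h0]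
    gcongr
    linarith
  have := (hdiff.add hφd).const_add (x t)
  rw [zero_add, add_assoc, ← map_add] at this
  refine this.congr_of_eventuallyEq (Eventually.of_forall fun τ => ?_) ?_ <;> simp

end

end CCM

/-! ### The limit as a Filippov solution. -/

namespace CCM

noncomputable section

variable {n m : ℕ} {f : Vec n → ℝ → Vec n} {B : Vec n → ℝ → Vec m →L[ℝ] Vec n}
  {M : Vec n → ℝ → Vec n →L[ℝ] Vec n} {α₁ α₂ lam : ℝ} {xs : ℝ → Vec n} {us : ℝ → Vec m}
  {w : ℝ → Vec n → Vec n → Vec m} {η : ℝ → ℝ} {z : ℕ → ℝ → Vec n} {v : ℕ → ℝ → Vec m}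
  {𝒰 : Ultrafilter ℕ} {x : ℝ → Vec n} {W : ℝ → Vec m}

theorem IsSampledLimit.ae_differentiableAt (hf : Smooth f) (hB : Smooth B)
    (hM : IsUniformlyBoundedMetric M α₁ α₂) (htar : IsBoundedTarget f B xs us)
    (hw : IsHoldLaw f B M lam xs us w η) (h : IsSampledSequence f B M xs us w z v)
    (hl : IsSampledLimit 𝒰 z v x W) : ∀ᵐ t, 0 < t → DifferentiableAt ℝ W t := by
  have h1 : ∀ N : ℕ, ∀ᵐ t : ℝ, t ∈ Icc (0 : ℝ) N → DifferentiableWithinAt ℝ W (Icc (0 : ℝ) N) t := by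
    intro N
    obtain ⟨R, K, hK, -, -, -, hWK⟩ := hl.lipschitz hf hB hM htar hw h N
    have : LipschitzOnWith K.toNNReal W (Icc (0 : ℝ) N) :=
      LipschitzOnWith.of_dist_le_mul fun s hs t ht => by
        rw [Real.coe_toNNReal _ hK, dist_eq_norm, Real.dist_eq]
        exact hWK t ht s hs
    exact this.ae_differentiableWithinAt_of_mem
  filter_upwards [ae_all_iff.2 h1] with t ht ht0
  obtain ⟨N, hN⟩ := exists_nat_gt t
  exact (ht N ⟨ht0.le, hN.le⟩).differentiableAt (Icc_mem_nhds ht0 hN)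

/-- The difference between `x` and the integral of the right-hand side is Lipschitz with vanishing
right derivative almost everywhere, hence constant. -/
theorem IsSampledLimit.solOn (hf : Smooth f) (hB : Smooth B)
    (hM : IsUniformlyBoundedMetric M α₁ α₂) (htar : IsBoundedTarget f B xs us)
    (hw : IsHoldLaw f B M lam xs us w η) (hus : PiecewiseContinuousFrom 0 us)
    (h : IsSampledSequence f B M xs us w z v) (hl : IsSampledLimit 𝒰 z v x W) (T : ℝ) :
    SolOn f B x (fun t => us t + deriv W t) 0 T := by
  obtain ⟨R, K, hK, hTR, hxR, hxK, hWK⟩ := hl.lipschitz hf hB hM htar hw h T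
  obtain ⟨U, hU⟩ := htar.bound T
  have hdW : ∀ t ∈ Ioo 0 T, ‖deriv W t‖ ≤ K := fun t ht => by
    have : LipschitzOnWith K.toNNReal W (Icc 0 T) :=
      LipschitzOnWith.of_dist_le_mul fun s hs t ht => by
        rw [Real.coe_toNNReal _ hK, dist_eq_norm, Real.dist_eq]
        exact hWK t ht s hs
    have := norm_deriv_le_of_lipschitzOn (Icc_mem_nhds ht.1 ht.2) this
    rwa [Real.coe_toNNReal _ hK] at this
  have hIoo : ∀ᵐ t : ℝ, t ∈ Icc 0 T → t ∈ Ioo 0 T := by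
    filter_upwards [compl_mem_ae_iff.2 (measure_singleton (μ := volume) (0 : ℝ)),
      compl_mem_ae_iff.2 (measure_singleton (μ := volume) T)] with t h1 h2 h3
    exact ⟨lt_of_le_of_ne h3.1 (Ne.symm h1), lt_of_le_of_ne h3.2 h2⟩
  have hint : IntegrableOn (fun t => us t + deriv W t) (Icc 0 T) := by
    refine (htar.sol T).integrable.add (Integrable.mono' (integrableOn_const (C := K) (by simp))
      (measurable_deriv W).aestronglyMeasurable ?_)
    rw [ae_restrict_iff' measurableSet_Icc]
    filter_upwards [hIoo] with t h1 h2 using hdW t (h1 h2)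
  have hxc : ContinuousOn x (Icc 0 T) := by
    refine LipschitzOnWith.continuousOn (K := K.toNNReal)
      (LipschitzOnWith.of_dist_le_mul fun s hs t ht => ?_)
    rw [Real.coe_toNNReal _ hK, dist_eq_norm, Real.dist_eq]
    exact hxK t ht s hs
  have hrhs := integrableOn_rhs hf hB le_rfl hxc hint
  obtain ⟨C, hC, hb⟩ := exists_rhs_bound hf hB R (|U| + K)
  have hrhsC : ∀ᵐ t, t ∈ Icc 0 T → ‖f (x t) t + B (x t) t (us t + deriv W t)‖ ≤ C := by
    filter_upwards [hIoo] with t h1 h2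
    exact (hb t h2.1 (h2.2.trans hTR) (x t) (x t) _ 0 (hxR t h2) (hxR t h2)
      ((norm_add_le _ _).trans (add_le_add ((hU t h2).trans (le_abs_self U)) (hdW t (h1 h2))))).1
  refine ⟨hxc, hint, fun τ hτ => ?_⟩
  obtain ⟨g, hg⟩ : ∃ g : ℝ → Vec n, g = fun s => f (x s) s + B (x s) s (us s + deriv W s) :=
    ⟨_, rfl⟩
  rw [← hg] at hrhs
  have hgC : ∀ᵐ t, t ∈ Icc 0 T → ‖g t‖ ≤ C := by rw [hg]; exact hrhsC
  have hi : ∀ s ∈ Icc 0 T, ∀ t ∈ Icc 0 T, IntervalIntegrable g volume s t := fun s hs t ht => by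
    rw [intervalIntegrable_iff]
    exact hrhs.mono_set (uIoc_subset_uIcc.trans (uIcc_subset_Icc hs ht))
  have h0 : (0 : ℝ) ∈ Icc 0 T := ⟨le_rfl, hτ.1.trans hτ.2⟩
  have hsub : ∀ s ∈ Icc 0 τ, s ∈ Icc 0 T := fun s hs => ⟨hs.1, hs.2.trans hτ.2⟩
  have key := eq_of_ae_hasDerivWithinAt_zero (x := fun t => x t - ∫ s in (0 : ℝ)..t, g s)
    (K := K + C) hτ.1 (by positivity) ?_ ?_
  · simp only [intervalIntegral.integral_same, sub_zero] at key
    rw [← key, hg, sub_add_cancel]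
  · intro s hs t ht
    have e : (x t - ∫ r in (0 : ℝ)..t, g r) - (x s - ∫ r in (0 : ℝ)..s, g r) =
        (x t - x s) - ∫ r in s..t, g r := by
      rw [← intervalIntegral.integral_interval_sub_left (hi 0 h0 t (hsub t ht))
        (hi 0 h0 s (hsub s hs))]
      abel
    have h1 : ‖∫ r in s..t, g r‖ ≤ C * |t - s| := by
      refine intervalIntegral.norm_integral_le_of_norm_le_const_ae ?_
      filter_upwards [hgC] with r hr hrI
      exact hr ((uIoc_subset_uIcc.trans (uIcc_subset_Icc (hsub s hs) (hsub t ht))) hrI)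
    rw [e, add_mul]
    exact (norm_sub_le _ _).trans (add_le_add (hxK s (hsub s hs) t (hsub t ht)) h1)
  · filter_upwards [(hi 0 h0 T ⟨h0.2, le_rfl⟩).ae_hasDerivAt_integral, hus.ae_continuousWithinAt,
      hl.ae_differentiableAt hf hB hM htar hw h] with t h1 h2 h3 ht
    have ht0 : 0 ≤ t := ht.1.le
    have h4 := h1 (by rw [uIcc_of_le h0.2]; exact hsub t (Ioo_subset_Icc_self ht)) 0 left_mem_uIcc
    have h5 := hl.hasDerivWithinAt hf hB hM htar hw h ht0 (h3 ht.1).hasDerivAt.hasDerivWithinAt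
      ((h2 ht0).mono (Ici_subset_Ici.2 ht0))
    have h6 := h5.sub (h4.hasDerivWithinAt (s := Ici t))
    have e : f (x t) t + B (x t) t (us t + deriv W t) - g t = 0 := by rw [hg]; exact sub_self _
    rw [e] at h6
    exact h6

/-- Slopes of `W` are limits of averages of the sampled offsets over short intervals. On such
intervals the offsets lie in a `δ`-thickening of `C`, which is closed and convex and so contains the
averages; then `δ` tends to zero. -/
theorem IsSampledLimit.deriv_mem (hf : Smooth f) (hB : Smooth B)
    (hM : IsUniformlyBoundedMetric M α₁ α₂) (htar : IsBoundedTarget f B xs us)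
    (hw : IsHoldLaw f B M lam xs us w η) (h : IsSampledSequence f B M xs us w z v)
    (hl : IsSampledLimit 𝒰 z v x W) {t : ℝ} (ht : 0 ≤ t) {d : Vec m}
    (hW : HasDerivWithinAt W d (Ici t) t) {C : Set (Vec m)} (hC : Convex ℝ C) (hcl : IsClosed C)
    (hmem : ∀ p, IsMinCovector M t (xs t) (x t) p → w t (xs t) p ∈ C) : d ∈ C := by
  rw [← hcl.closure_eq, Metric.closure_eq_iInter_cthickening]
  refine mem_iInter₂.2 fun δ hδ => ?_
  obtain ⟨ρ, hρ, hnear⟩ := hw.exists_near hM htar ht (x t) hδ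
  obtain ⟨R, U, K, hU, hK, hTR, hb⟩ := h.exists_bounds hf hB hM htar hw (t + 1)
  -- Within `r` of `t` the sampled states move by at most `ρ/2`; the other `ρ/2` is for their
  -- convergence at `t`. A mesh below `r` keeps sample times preceding `t` within `r` as well.
  obtain ⟨r, hr⟩ : ∃ r, r = min 1 (min ρ (ρ / (2 * (K + 1)))) := ⟨_, rfl⟩
  have hr0 : 0 < r := by rw [hr]; positivity
  have hr1 : r ≤ 1 := hr ▸ min_le_left _ _
  have hrρ : r ≤ ρ := hr ▸ (min_le_right _ _).trans (min_le_left _ _)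
  have hrK : K * r ≤ ρ / 2 := by
    have h1 : r ≤ ρ / (2 * (K + 1)) := hr ▸ (min_le_right _ _).trans (min_le_right _ _)
    rw [le_div_iff₀ (by positivity)] at h1
    linarith
  have hmesh : ∀ᶠ k : ℕ in (𝒰 : Filter ℕ), 1 / ((k : ℝ) + 1) < r :=
    hl.le_atTop (tendsto_one_div_add_atTop_nhds_zero_nat.eventually (gt_mem_nhds hr0))
  have hzt : ∀ᶠ k in (𝒰 : Filter ℕ), ‖z k t - x t‖ < ρ / 2 := by
    have h1 := ((hl.state t ht).sub_const (x t)).norm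
    rw [sub_self, norm_zero] at h1
    exact h1.eventually (gt_mem_nhds (by positivity))
  have hv : ∀ᶠ k in (𝒰 : Filter ℕ), ∀ s ∈ Ico t (t + r), v k s ∈ Metric.cthickening δ C := by
    filter_upwards [hmesh, hzt] with k hk1 hk2 s hs
    obtain ⟨s', hs', hss', p, hp, hvp⟩ := h.sampled k s (ht.trans hs.1)
    have habs : |s' - t| < r := abs_lt.2 ⟨by linarith [hs.1], by linarith [hs'.2, hs.2]⟩
    have hn := norm_add_le (z k s' - z k t) (z k t - x t)
    rw [sub_add_sub_cancel] at hn
    have hlip := (hb k).2.2.2 t ⟨ht, by linarith⟩ s' ⟨hs'.1, by linarith [hs'.2, hs.2]⟩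
    have hKr : K * |s' - t| ≤ K * r := by gcongr
    obtain ⟨q, hq, hqd⟩ := hnear s' (z k s') p hs'.1 (habs.trans_le hrρ) (by linarith) hp
    rw [hvp]
    refine Metric.mem_cthickening_of_dist_le _ _ _ _ (hmem q hq) ?_
    rw [dist_eq_norm]
    exact hqd.le
  have hslope : Tendsto (slope W t) (𝓝[>] t) (𝓝 d) :=
    (hasDerivWithinAt_iff_tendsto_slope' (by simp)).1 (hW.mono Ioi_subset_Ici_self)
  refine Metric.isClosed_cthickening.mem_of_tendsto hslope ?_
  filter_upwards [Ioo_mem_nhdsGT (show t < t + r by linarith)] with τ hτ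
  refine Metric.isClosed_cthickening.mem_of_tendsto
    ((hl.tendsto_integral h htar ht hτ.1.le).const_smul (τ - t)⁻¹) ?_
  filter_upwards [hv] with k hk
  exact smul_integral_mem (hC.cthickening δ) Metric.isClosed_cthickening hτ.1
    ((h.integrableOn htar k τ).mono_set (Icc_subset_Icc_left ht))
    fun s hs => hk s ⟨hs.1, hs.2.trans_lt hτ.2⟩

/-- Every set in the defining intersection is itself closed and convex and contains all limit
values, so the regularisation need not be identified with their closed convex hull. -/
theorem mem_filippovValues_of_forall {k : ℕ} {D : Set (Vec n × ℝ)} {κ : Vec n → ℝ → Vec k} {y : Vec n}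
    {t : ℝ} {u : Vec k} (h : ∀ C : Set (Vec k), Convex ℝ C → IsClosed C →
      limitValues D κ y t ⊆ C → u ∈ C) : u ∈ filippovValues D κ y t := by
  refine mem_iInter₂.2 fun ε hε => h _ (convex_convexHull ℝ _).closure isClosed_closure fun p hp => ?_
  exact closure_mono (subset_convexHull ℝ _) (mem_iInter₂.1 hp ε hε)

theorem univExpStabContinuousAE (hf : Smooth f) (hB : Smooth B)
    (hM : IsUniformlyBoundedMetric M α₁ α₂) (hlam : 0 < lam)
    (hccm : ContractionCondition f B M lam) (hgrowth : InputGrowthCondition B M) :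
    UnivExpStabContinuousAE f B lam (√(α₂ / α₁)) := by
  intro xs us hT
  have htar := hT.isBoundedTarget hf hB
  have hus := hT.1
  obtain ⟨w, η, hw⟩ := exists_holdLaw hf hB hM hlam hccm hgrowth htar
  refine ⟨regularDomain M xs, geodesicFeedback M xs w, exists_isOpen_regularDomain hM htar,
    fun t ht => ⟨ht, isRegularPoint_self hM ht _⟩, fun t ht => ?_,
    continuousOn_geodesicFeedback hM htar hw, fun x₀ => ?_, fun T x u hT0 hx hu => ?_⟩
  · have hsub : {x : Vec n | (x, t) ∉ regularDomain M xs} ⊆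
        {x | ¬ IsRegularPoint M t (xs t) x} := fun x hx hreg => hx ⟨ht, hreg⟩
    exact measure_mono_null hsub (volume_not_isRegularPoint hM ht (xs t))
  · have hsol := fun k : ℕ => hw.exists_solution hf hB hM hlam hus le_rfl x₀
      (ε := 1 / ((k : ℝ) + 1)) (by positivity)
    choose v z _ hz0 hz hV hsam using hsol
    have hbd : ∀ T, ∃ R, ∀ k, ∀ t ∈ Icc (0 : ℝ) T, ‖z k t‖ ≤ R := by
      intro T
      obtain ⟨R, hR⟩ := (htar.sol T).exists_bound
      refine ⟨R + √(sqDist M 0 (xs 0) x₀ / α₁), fun k t ht => ?_⟩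
      have hα₁ := hM.pos_lower
      have h1 := le_sqDist hM ht.1 (xs t) (z k t)
      have h2 : Real.exp (-(2 * lam) * (t - 0)) * sqDist M 0 (xs 0) x₀ ≤ sqDist M 0 (xs 0) x₀ :=
        mul_le_of_le_one_left (sqDist_nonneg hM le_rfl _ _) (Real.exp_le_one_iff.2
          (mul_nonpos_of_nonpos_of_nonneg (by linarith) (by linarith [ht.1])))
      have h3 : ‖z k t - xs t‖ ≤ √(sqDist M 0 (xs 0) x₀ / α₁) := by
        refine Real.le_sqrt_of_sq_le ?_
        rw [le_div_iff₀ hα₁]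
        linarith [hV k t ht.1]
      have h4 := norm_add_le (xs t) (z k t - xs t)
      rw [add_sub_cancel] at h4
      linarith [hR t ht]
    have hseq : IsSampledSequence f B M xs us w z v := ⟨hz, hbd, hsam⟩
    obtain ⟨𝒰, x, W, hl⟩ := hseq.exists_limit hf hB hM htar hw
    have hx0 : x 0 = x₀ := by
      refine tendsto_nhds_unique (hl.state 0 le_rfl) ?_
      simp only [hz0]
      exact tendsto_const_nhds
    refine ⟨x, fun t => us t + deriv W t,
      fun T _ => isTrajectoryOn_iff.2 (hl.solOn hf hB hM htar hw hus hseq T), hx0, ?_,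
      expBoundOn_of_sqDist_le hM (fun t ht => ht) fun t ht => ?_⟩
    · rw [ae_restrict_iff' measurableSet_Ici]
      filter_upwards [hl.ae_differentiableAt hf hB hM htar hw hseq,
        compl_mem_ae_iff.2 (measure_singleton (μ := volume) (0 : ℝ))] with t h1 h2 h3
      have ht : 0 < t := lt_of_le_of_ne h3 (Ne.symm h2)
      refine mem_filippovValues_of_forall fun C hC hcl hsub => ?_
      refine hl.deriv_mem hf hB hM htar hw hseq ht.le (h1 ht).hasDerivAt.hasDerivWithinAt
        (C := (fun y => us t + y) ⁻¹' C) (hC.translate_preimage_right _)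
        (hcl.preimage (by fun_prop)) fun p hp => ?_
      exact hsub (hw.mem_limitValues hM htar ht.le hp)
    · refine le_of_tendsto (((continuous_sqDist hM ht (xs t)).tendsto _).comp (hl.state t ht))
        (Eventually.of_forall fun k => ?_)
      have := hV k t ht
      rwa [sub_zero, ← hx0] at this
  · refine expBoundOn_of_sqDist_le hM (fun t ht => ht.1) (hw.sqDist_le hf hB hM htar hus
      (isTrajectoryOn_iff.1 hx) ?_)
    rw [ae_restrict_iff' measurableSet_Icc] at hu
    filter_upwards [hu] with t ht htI
    exact exists_of_mem_limitValues hM htar hw htI.1 (ht htI)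

end

end CCM

theorem theorem2 {n m : ℕ}
    (f : CCM.Vec n → ℝ → CCM.Vec n) (B : CCM.Vec n → ℝ → CCM.Vec m →L[ℝ] CCM.Vec n)
    (hf : CCM.Smooth f) (hB : CCM.Smooth B)
    (M : CCM.Vec n → ℝ → CCM.Vec n →L[ℝ] CCM.Vec n) (α₁ α₂ lam : ℝ)
    (hM : CCM.IsUniformlyBoundedMetric M α₁ α₂)
    (hlam : 0 < lam)
    (hccm : CCM.ContractionCondition f B M lam)
    (hgrowth : CCM.InputGrowthCondition B M) :
    CCM.UnivExpOpenLoopControllable f B lam (Real.sqrt (α₂ / α₁)) ∧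
    CCM.UnivExpStabSampledData f B lam (Real.sqrt (α₂ / α₁)) ∧
    CCM.UnivExpStabContinuousAE f B lam (Real.sqrt (α₂ / α₁)) :=
  ⟨CCM.univExpOpenLoopControllable hf hB hM hlam hccm hgrowth,
    CCM.univExpStabSampledData hf hB hM hlam hccm hgrowth,
    CCM.univExpStabContinuousAE hf hB hM hlam hccm hgrowth⟩
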